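/- Let $G$ be a finite group acting on a noetherian commutative ring $A$. For a commutative ring $B$ with an action of $G$ let $BG$ be the skew group ring and let $\mathcal{T}_{B,G}=D^b(BG)_{B\text{-perf}}$ be the full subcategory of the derived category $D(BG)$ of left $BG$-modules consisting of the objects that are isomorphic in $D(B)$ to a bounded complex of finitely generated projective $B$-modules. It is a tensor triangulated category under the tensor product over $B$ with diagonal $G$-action, computed on bounded above complexes of projective $BG$-modules (and it is equivalent to the category of perfect complexes on the stack $[\operatorname{Spec}(B)/G]$). Let $\operatorname{Spc}(\mathcal{T}_{B,G})$ be its Balmer spectrum, i.e. the space of prime thick tensor ideals $\mathcal{P}$, with the topology for which the supports $\{\mathcal{P}\mid X\notin\mathcal{P}\}$, $X\in\mathcal{T}_{B,G}$, form a basis of closed sets, and let $$\bar\rho_{B,G}\colon \operatorname{Spc}(\mathcal{T}_{B,G})\to\operatorname{Spec}(B^G),\qquad \bar\rho_{B,G}(\mathcal{P})=\{b\in B^G\mid \operatorname{cone}(b\colon B\to B)\notin\mathcal{P}\},$$ be the degree zero part of the comparison map $\operatorname{Spc}(\mathcal{T}_{B,G})\to\operatorname{Spec}^h(H^*(G,B))$.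 A $G$-equivariant ring homomorphism $f\colon A\to B$ induces a functor $f_*=B\otimes^L_A-\colon\mathcal{T}_{A,G}\to\mathcal{T}_{B,G}$ and hence a continuous base change map $$f^{\mathcal{T}}_{\mathrm{res}}\colon \operatorname{Spc}(\mathcal{T}_{B,G})\to\operatorname{Spc}(\mathcal{T}_{A,G})\times_{\operatorname{Spec}(A^G)}\operatorname{Spec}(B^G),\qquad \mathcal{P}\mapsto\bigl(f_*^{-1}(\mathcal{P}),\bar\rho_{B,G}(\mathcal{P})\bigr).$$ Let $\mathfrak{q}\in\operatorname{Spec}(A^G)$, let $A(\mathfrak{q})=(A\otimes_{A^G}k(\mathfrak{q}))_{\mathrm{red}}$ be the reduced fiber of $A$ over $\mathfrak{q}$ with the action of $G$ induced by the action on the first factor, and let $\psi_{\mathfrak{q}}\colon A\to A(\mathfrak{q})$, $a\mapsto a\otimes 1$, be the natural $G$-equivariant homomorphism. Then the base change map $(\psi_{\mathfrak{q}})^{\mathcal{T}}_{\mathrm{res}}$ is well defined, continuous and surjective. In other words, $\mathcal{P}\mapsto(\psi_{\mathfrak{q}})_*^{-1}(\mathcal{P})$ defines a surjective continuous map $$\operatorname{Spc}(\mathcal{T}_{A(\mathfrak{q}),G})\to\operatorname{Spc}(\mathcal{T}_{A,G})_{\mathfrak{q}}=\bar\rho_{A,G}^{-1}(\mathfrak{q})$$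 onto the fiber of $\operatorname{Spc}(\mathcal{T}_{A,G})$ over $\mathfrak{q}$. -/

import Mathlib

open CategoryTheory Limits
open scoped TensorProduct

universe u v

noncomputable section

namespace EquivPerf

/-! ### Modules over the skew group ring -/

section SkewGroupRing

variable (A : Type u) (G : Type v) [CommRing A] [Group G] [MulSemiringAction G A]

/-- The skew group ring `AG`: the free `A`-module on `G` with `(a g) (b h) = a g(b) g h`. -/
abbrev SkewGroupRing : Type max u v := SkewMonoidAlgebra A G

/-- The category of left `AG`-modules. -/
abbrev SkewMod : Type (max u v (u + 1)) := ModuleCat.{u} (SkewGroupRing A G)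

/-- The inclusion `A → AG`, `a ↦ a 1`. -/
def incl : A →+* SkewGroupRing A G where
  toFun a := SkewMonoidAlgebra.single 1 a
  map_one' := rfl
  map_zero' := SkewMonoidAlgebra.single_zero 1
  map_add' := SkewMonoidAlgebra.single_add 1
  map_mul' a b := by simp [SkewMonoidAlgebra.single_mul_single]

/-- The forgetful functor from `AG`-modules to `A`-modules. -/
abbrev toMod : SkewMod A G ⥤ ModuleCat.{u} A := ModuleCat.restrictScalars (incl A G)

variable {A G}

/-- The action of `g : G` on an `AG`-module, i.e. of the element `1 g` of `AG`. -/
def act (M : SkewMod A G) : G →* AddMonoid.End ((toMod A G).obj M) where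
  toFun g := DistribSMul.toAddMonoidHom (M := SkewGroupRing A G) M (SkewMonoidAlgebra.single g 1)
  map_one' := by
    ext x
    exact one_smul (SkewGroupRing A G) (x : M)
  map_mul' g h := by
    ext x
    have : (SkewMonoidAlgebra.single (g * h) 1 : SkewGroupRing A G) =
        SkewMonoidAlgebra.single g 1 * SkewMonoidAlgebra.single h 1 := by
      simp [SkewMonoidAlgebra.single_mul_single]
    change (SkewMonoidAlgebra.single (g * h) 1 : SkewGroupRing A G) • (x : M) = _
    rw [this, mul_smul]
    rfl

lemma act_smul (M : SkewMod A G) (g : G) (a : A) (x : (toMod A G).obj M) :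
    act M g (a • x) = (g • a) • act M g x := by
  change (SkewMonoidAlgebra.single g 1 : SkewGroupRing A G) •
      ((SkewMonoidAlgebra.single 1 a : SkewGroupRing A G) • (x : M)) =
    (SkewMonoidAlgebra.single 1 (g • a) : SkewGroupRing A G) •
      ((SkewMonoidAlgebra.single g 1 : SkewGroupRing A G) • (x : M))
  rw [← mul_smul, ← mul_smul]
  simp [SkewMonoidAlgebra.single_mul_single]

lemma map_act {M N : SkewMod A G} (φ : M ⟶ N) (g : G) (x : (toMod A G).obj M) :
    (toMod A G).map φ (act M g x) = act N g ((toMod A G).map φ x) :=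
  φ.hom.map_smul _ _

/-- The ring homomorphism `AG → End(X)` of a semilinear action `ρ` of `G` on an `A`-module. -/
def semilinearHom (X : ModuleCat.{u} A) (ρ : G →* AddMonoid.End X)
    (h : ∀ (g : G) (a : A) (x : X), ρ g (a • x) = (g • a) • ρ g x) :
    SkewGroupRing A G →+* AddMonoid.End X :=
  SkewMonoidAlgebra.liftNCRingHom (Module.toAddMonoidEnd A X) ρ (by
    intro a g
    ext x
    exact (h g a x).symm)

/-- An `A`-module with a semilinear action of `G`, as an `AG`-module:
`(a g) x = a (ρ g x)`. -/
def ofSemilinear (X : ModuleCat.{u} A) (ρ : G →* AddMonoid.End X)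
    (h : ∀ (g : G) (a : A) (x : X), ρ g (a • x) = (g • a) • ρ g x) : SkewMod A G :=
  letI : Module (SkewGroupRing A G) X := Module.compHom X (semilinearHom X ρ h)
  ModuleCat.of (SkewGroupRing A G) X

lemma ofSemilinear_single_smul (X : ModuleCat.{u} A) (ρ : G →* AddMonoid.End X)
    (h : ∀ (g : G) (a : A) (x : X), ρ g (a • x) = (g • a) • ρ g x) (g : G) (a : A) (x : X) :
    (SkewMonoidAlgebra.single g a : SkewGroupRing A G) • (show ofSemilinear X ρ h from x) =
      (show ofSemilinear X ρ h from a • ρ g x) := by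
  change semilinearHom X ρ h (SkewMonoidAlgebra.single g a) x = a • ρ g x
  simp only [semilinearHom, SkewMonoidAlgebra.liftNCRingHom, RingHom.coe_mk, MonoidHom.coe_mk,
    OneHom.coe_mk]
  exact DFunLike.congr_fun (SkewMonoidAlgebra.liftNC_single
    ((Module.toAddMonoidEnd A X : A →+* AddMonoid.End X) : A →+ AddMonoid.End X) ρ g a) x

lemma semilinearHom_map {X Y : ModuleCat.{u} A} {ρ : G →* AddMonoid.End X}
    {h : ∀ (g : G) (a : A) (x : X), ρ g (a • x) = (g • a) • ρ g x} {σ : G →* AddMonoid.End Y}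
    {h' : ∀ (g : G) (a : A) (y : Y), σ g (a • y) = (g • a) • σ g y}
    (φ : X ⟶ Y) (hφ : ∀ (g : G) (x : X), φ (ρ g x) = σ g (φ x)) (r : SkewGroupRing A G) (x : X) :
    φ.hom (semilinearHom X ρ h r x) = semilinearHom Y σ h' r (φ.hom x) := by
  induction r using SkewMonoidAlgebra.induction_on with
  | zero =>
    rw [map_zero, map_zero]
    exact φ.hom.map_zero
  | single g a =>
    refine (congrArg φ.hom (ofSemilinear_single_smul X ρ h g a x)).trans
      (Eq.trans ?_ (ofSemilinear_single_smul Y σ h' g a (φ.hom x)).symm)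
    exact (φ.hom.map_smul a (ρ g x)).trans (congrArg (fun y => a • y) (hφ g x))
  | add r s hr hs =>
    rw [map_add, map_add]
    exact (φ.hom.map_add _ _).trans (congrArg₂ (fun y z : Y => y + z) hr hs)

/-- A `G`-equivariant `A`-linear map, as a homomorphism of `AG`-modules. -/
def homOfSemilinear {X Y : ModuleCat.{u} A} {ρ : G →* AddMonoid.End X}
    {h : ∀ (g : G) (a : A) (x : X), ρ g (a • x) = (g • a) • ρ g x} {σ : G →* AddMonoid.End Y}
    {h' : ∀ (g : G) (a : A) (y : Y), σ g (a • y) = (g • a) • σ g y}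
    (φ : X ⟶ Y) (hφ : ∀ (g : G) (x : X), φ (ρ g x) = σ g (φ x)) :
    ofSemilinear X ρ h ⟶ ofSemilinear Y σ h' :=
  ModuleCat.ofHom (X := ofSemilinear X ρ h) (Y := ofSemilinear Y σ h')
    { toFun := fun x => φ.hom x
      map_add' := fun x y => φ.hom.map_add x y
      map_smul' := fun r x => semilinearHom_map (h := h) (h' := h') φ hφ r x }

/-! ### The tensor product over `A` with diagonal action -/

section Diagonal

variable {M N : Type u} [AddCommGroup M] [Module A M] [AddCommGroup N] [Module A N]
  (σ : G →* AddMonoid.End M) (hσ : ∀ (g : G) (a : A) (x : M), σ g (a • x) = (g • a) • σ g x)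
  (τ : G →* AddMonoid.End N) (hτ : ∀ (g : G) (a : A) (x : N), τ g (a • x) = (g • a) • τ g x)

/-- The additive endomorphism `m ⊗ n ↦ g m ⊗ g n`. -/
def diagEnd (g : G) : M ⊗[A] N →+ M ⊗[A] N :=
  TensorProduct.liftAddHom
    { toFun := fun m =>
        { toFun := fun n => σ g m ⊗ₜ[A] τ g n
          map_zero' := by rw [map_zero, TensorProduct.tmul_zero]
          map_add' := fun x y => by rw [map_add, TensorProduct.tmul_add] }
      map_zero' := by
        ext n
        exact (congrArg (· ⊗ₜ[A] τ g n) (map_zero (σ g))).trans (TensorProduct.zero_tmul _ _)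
      map_add' := fun x y => by
        ext n
        exact (congrArg (· ⊗ₜ[A] τ g n) (map_add (σ g) x y)).trans (TensorProduct.add_tmul _ _ _) }
    (fun a m n => by
      change σ g (a • m) ⊗ₜ[A] τ g n = σ g m ⊗ₜ[A] τ g (a • n)
      rw [hσ, hτ, TensorProduct.smul_tmul])

lemma diagEnd_tmul (g : G) (m : M) (n : N) :
    diagEnd σ hσ τ hτ g (m ⊗ₜ[A] n) = σ g m ⊗ₜ[A] τ g n :=
  rfl

/-- The diagonal action `g (m ⊗ n) = g m ⊗ g n` on the tensor product over `A` of two `A`-modules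
with semilinear actions. -/
def diagAct : G →* AddMonoid.End (M ⊗[A] N) where
  toFun g := diagEnd σ hσ τ hτ g
  map_one' := by
    have : ∀ z, diagEnd σ hσ τ hτ 1 z = z := fun z => by
      induction z using TensorProduct.induction_on with
      | zero => rw [map_zero]
      | tmul x y =>
        rw [diagEnd_tmul, map_one, map_one]
        rfl
      | add x y hx hy => rw [map_add, hx, hy]
    exact AddMonoidHom.ext this
  map_mul' g h := by
    have : ∀ z, diagEnd σ hσ τ hτ (g * h) z = diagEnd σ hσ τ hτ g (diagEnd σ hσ τ hτ h z) :=
      fun z => by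
        induction z using TensorProduct.induction_on with
        | zero => rw [map_zero, map_zero, map_zero]
        | tmul x y =>
          rw [diagEnd_tmul, diagEnd_tmul, diagEnd_tmul, map_mul, map_mul]
          rfl
        | add x y hx hy => rw [map_add, hx, hy, map_add, map_add]
    exact AddMonoidHom.ext this

lemma diagAct_tmul (g : G) (m : M) (n : N) :
    diagAct σ hσ τ hτ g (m ⊗ₜ[A] n) = σ g m ⊗ₜ[A] τ g n :=
  rfl

lemma diagAct_smul (g : G) (a : A) (z : M ⊗[A] N) :
    diagAct σ hσ τ hτ g (a • z) = (g • a) • diagAct σ hσ τ hτ g z := by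
  induction z using TensorProduct.induction_on with
  | zero => rw [smul_zero, map_zero, smul_zero]
  | tmul x y =>
    rw [TensorProduct.smul_tmul', diagAct_tmul, diagAct_tmul, hσ, TensorProduct.smul_tmul']
  | add x y hx hy => rw [smul_add, map_add, hx, hy, map_add, smul_add]

end Diagonal

/-- `M ⊗_A N` with the diagonal action of `G`. -/
def tensorMod (M N : SkewMod A G) : SkewMod A G :=
  ofSemilinear (ModuleCat.of A ((toMod A G).obj M ⊗[A] (toMod A G).obj N))
    (diagAct (act M) (act_smul M) (act N) (act_smul N))
    (diagAct_smul (act M) (act_smul M) (act N) (act_smul N))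

/-- The elementary tensor `m ⊗ n` in `tensorMod M N`. -/
def tmul {M N : SkewMod A G} (m : (toMod A G).obj M) (n : (toMod A G).obj N) : tensorMod M N :=
  m ⊗ₜ[A] n

/-- `φ ⊗ ψ` as a homomorphism of `AG`-modules. -/
def tensorMap {M M' N N' : SkewMod A G} (φ : M ⟶ M') (ψ : N ⟶ N') :
    tensorMod M N ⟶ tensorMod M' N' :=
  homOfSemilinear
    (ModuleCat.ofHom (TensorProduct.map ((toMod A G).map φ).hom ((toMod A G).map ψ).hom))
    (fun g z => by
      induction z using TensorProduct.induction_on with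
      | zero => simp only [map_zero]
      | tmul x y => exact congrArg₂ (fun a b => a ⊗ₜ[A] b) (map_act φ g x) (map_act ψ g y)
      | add x y hx hy => simp only [map_add, hx, hy])

lemma tensorMap_tmul {M M' N N' : SkewMod A G} (φ : M ⟶ M') (ψ : N ⟶ N')
    (m : (toMod A G).obj M) (n : (toMod A G).obj N) :
    tensorMap φ ψ (tmul m n) = tmul ((toMod A G).map φ m) ((toMod A G).map ψ n) :=
  rfl

lemma tensorMod_hom_ext {M N L : SkewMod A G} {φ ψ : tensorMod M N ⟶ L}
    (h : ∀ (m : (toMod A G).obj M) (n : (toMod A G).obj N), φ (tmul m n) = ψ (tmul m n)) :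
    φ = ψ := by
  have : ∀ w : (toMod A G).obj M ⊗[A] (toMod A G).obj N,
      φ.hom (show tensorMod M N from w) = ψ.hom (show tensorMod M N from w) := fun w => by
    induction w using TensorProduct.induction_on with
    | zero => exact (φ.hom.map_zero).trans (ψ.hom.map_zero).symm
    | tmul x y => exact h x y
    | add x y hx hy =>
      exact (φ.hom.map_add _ _).trans ((congrArg₂ (· + ·) hx hy).trans (ψ.hom.map_add _ _).symm)
  ext z
  exact this z

variable (A G) in
/-- The bifunctor `(M, N) ↦ M ⊗_A N` on `AG`-modules. -/
def tensorBifunctor : SkewMod A G ⥤ SkewMod A G ⥤ SkewMod A G where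
  obj M :=
    { obj := fun N => tensorMod M N
      map := fun ψ => tensorMap (𝟙 M) ψ
      map_id := fun N => tensorMod_hom_ext fun m n => rfl
      map_comp := fun ψ ψ' => tensorMod_hom_ext fun m n => rfl }
  map φ :=
    { app := fun N => tensorMap φ (𝟙 N)
      naturality := fun N N' ψ => tensorMod_hom_ext fun m n => rfl }
  map_id M := by
    ext N : 2
    exact tensorMod_hom_ext fun m n => rfl
  map_comp φ φ' := by
    ext N : 2
    exact tensorMod_hom_ext fun m n => rfl

instance : (tensorBifunctor A G).Additive where
  map_add {M M' φ ψ} := by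
    ext N : 2
    exact tensorMod_hom_ext fun m n => TensorProduct.add_tmul (R := A) _ _ _

instance (M : SkewMod A G) : ((tensorBifunctor A G).obj M).Additive where
  map_add := tensorMod_hom_ext fun _ _ => TensorProduct.tmul_add (R := A) _ _ _

/-- The total tensor product over `A` of two complexes of `AG`-modules, with diagonal action. -/
def tensorCplx (K L : CochainComplex (SkewMod A G) ℤ) : CochainComplex (SkewMod A G) ℤ :=
  HomologicalComplex.mapBifunctor K L (tensorBifunctor A G) (ComplexShape.up ℤ)

/-! ### Base change -/

section BaseChange

variable {B : Type u} [CommRing B] [MulSemiringAction G B] (f : A →+*[G] B)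

/-- `B` as an `A`-module via `f`. -/
abbrev restr : ModuleCat.{u} A := (ModuleCat.restrictScalars f.toRingHom).obj (ModuleCat.of B B)

/-- The given action of `G` on `B`, which is semilinear over `A`. -/
def restrAct : G →* AddMonoid.End (restr f) :=
  DistribMulAction.toAddMonoidEnd G B

lemma restrAct_smul (g : G) (a : A) (b : restr f) :
    restrAct f g (a • b) = (g • a) • restrAct f g b := by
  change g • (f a * (show B from b)) = f (g • a) * (g • (show B from b))
  rw [smul_mul', map_smul]

/-- The underlying `B`-module `B ⊗_A M` of the base change of an `AG`-module `M`. -/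
abbrev baseChangeUnder (M : SkewMod A G) : ModuleCat.{u} B :=
  (ModuleCat.extendScalars f.toRingHom).obj ((toMod A G).obj M)

/-- The diagonal action of `G` on `B ⊗_A M`. -/
def baseChangeAct (M : SkewMod A G) : G →* AddMonoid.End (baseChangeUnder f M) :=
  diagAct (M := restr f) (N := (toMod A G).obj M) (restrAct f) (restrAct_smul f) (act M) (act_smul M)

/-- The elementary tensor `b ⊗ m` in `B ⊗_A M`. -/
def baseChangeTmul (M : SkewMod A G) (b : B) (m : (toMod A G).obj M) : baseChangeUnder f M :=
  (show restr f from b) ⊗ₜ[A] m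

lemma baseChange_induction {M : SkewMod A G} {p : baseChangeUnder f M → Prop} (zero : p 0)
    (tmul : ∀ (b : B) (m : (toMod A G).obj M), p (baseChangeTmul f M b m))
    (add : ∀ x y, p x → p y → p (x + y)) (z : baseChangeUnder f M) : p z :=
  TensorProduct.induction_on (R := A) (M := restr f) (N := (toMod A G).obj M)
    (motive := p) z zero tmul add

lemma baseChangeAct_tmul (M : SkewMod A G) (g : G) (b : B) (m : (toMod A G).obj M) :
    baseChangeAct f M g (baseChangeTmul f M b m) = baseChangeTmul f M (g • b) (act M g m) :=
  rfl

lemma smul_baseChangeTmul (M : SkewMod A G) (b b' : B) (m : (toMod A G).obj M) :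
    b • baseChangeTmul f M b' m = baseChangeTmul f M (b * b') m :=
  rfl

lemma baseChangeAct_smul (M : SkewMod A G) (g : G) (b : B) (z : baseChangeUnder f M) :
    baseChangeAct f M g (b • z) = (g • b) • baseChangeAct f M g z := by
  induction z using baseChange_induction with
  | zero => rw [smul_zero, map_zero, smul_zero]
  | tmul x y =>
    rw [smul_baseChangeTmul, baseChangeAct_tmul, baseChangeAct_tmul, smul_baseChangeTmul, smul_mul']
  | add x y hx hy => rw [smul_add, map_add, hx, hy, map_add, smul_add]

/-- The `BG`-module `B ⊗_A M` with the diagonal action of `G`. -/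
def baseChangeMod (M : SkewMod A G) : SkewMod B G :=
  ofSemilinear (baseChangeUnder f M) (baseChangeAct f M) (baseChangeAct_smul f M)

/-- The functor `M ↦ B ⊗_A M` from `AG`-modules to `BG`-modules. -/
def baseChange : SkewMod A G ⥤ SkewMod B G where
  obj M := baseChangeMod f M
  map {M N} φ := homOfSemilinear ((ModuleCat.extendScalars f.toRingHom).map ((toMod A G).map φ))
    (fun g z => by
      induction z using baseChange_induction with
      | zero => simp only [map_zero]
      | tmul x y =>
        exact congrArg (fun w => (restrAct f g x : restr f) ⊗ₜ[A] w) (map_act φ g y)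
      | add x y hx hy => simp only [map_add, hx, hy])
  map_id M := by
    ext z
    exact congrArg (fun ψ : baseChangeUnder f M ⟶ baseChangeUnder f M => ψ.hom z)
      ((toMod A G ⋙ ModuleCat.extendScalars f.toRingHom).map_id M)
  map_comp {M N L} φ ψ := by
    ext z
    exact congrArg (fun ψ : baseChangeUnder f M ⟶ baseChangeUnder f L => ψ.hom z)
      ((toMod A G ⋙ ModuleCat.extendScalars f.toRingHom).map_comp φ ψ)

instance : (baseChange (G := G) f).Additive where
  map_add {M N φ ψ} := by
    ext z
    induction z using TensorProduct.induction_on with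
    | zero => exact (map_zero _).trans (map_zero _).symm
    | tmul x y =>
      exact TensorProduct.tmul_add (R := A) (M := restr f) (N := (toMod A G).obj N) x
        ((toMod A G).map φ y) ((toMod A G).map ψ y)
    | add x y hx hy => exact (map_add _ _ _).trans ((congrArg₂ (· + ·) hx hy).trans (map_add _ _ _).symm)

/-- The base change `B ⊗_A K` of a complex of `AG`-modules. -/
def baseChangeCplx (K : CochainComplex (SkewMod A G) ℤ) : CochainComplex (SkewMod B G) ℤ :=
  ((baseChange f).mapHomologicalComplex (ComplexShape.up ℤ)).obj K

end BaseChange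

/-! ### The tensor triangulated category `D^b(AG)_{A-perf}` -/

section Derived

attribute [local instance] HasDerivedCategory.standard

variable (A G)

/-- The derived category `D(AG)`. -/
abbrev DAG := DerivedCategory (SkewMod A G)

instance : PreservesFiniteLimits (toMod A G) :=
  ⟨fun _ _ _ => ⟨inferInstance⟩⟩

instance : PreservesFiniteColimits (toMod A G) :=
  ⟨fun _ _ _ => ⟨inferInstance⟩⟩

/-- The triangulated functor `D(AG) ⥤ D(A)` forgetting the action of `G`. -/
abbrev toDMod : DAG A G ⥤ DerivedCategory (ModuleCat.{u} A) := (toMod A G).mapDerivedCategory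

/-- The objects of `D^b(AG)_{A-perf}`: those complexes of `AG`-modules which are isomorphic in
`D(A)` to a bounded complex of finitely generated projective `A`-modules. -/
def perf : ObjectProperty (DAG A G) := fun X =>
  ∃ (L : CochainComplex (ModuleCat.{u} A) ℤ) (a b : ℤ),
    L.IsStrictlyGE a ∧ L.IsStrictlyLE b ∧
    (∀ i, Module.Finite A (L.X i) ∧ Module.Projective A (L.X i)) ∧
    Nonempty ((toDMod A G).obj X ≅ DerivedCategory.Q.obj L)

variable {A G}

/-- The objects of `K^-(AG-Proj)`: bounded above complexes of projective `AG`-modules. -/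
def IsBoundedAboveProj (P : CochainComplex (SkewMod A G) ℤ) : Prop :=
  (∃ b : ℤ, P.IsStrictlyLE b) ∧ ∀ i, Module.Projective (SkewGroupRing A G) (P.X i)

/-- `Z` is (isomorphic to) the tensor product of `X` and `Y` in `D^-(AG) ≃ K^-(AG-Proj)`, i.e.
`Z ≅ P ⊗_A P'` with diagonal action for bounded above complexes of projective `AG`-modules
`P ≅ X` and `P' ≅ Y`. -/
def IsTensor (X Y Z : DAG A G) : Prop :=
  ∃ P P' : CochainComplex (SkewMod A G) ℤ, IsBoundedAboveProj P ∧ IsBoundedAboveProj P' ∧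
    Nonempty (DerivedCategory.Q.obj P ≅ X) ∧ Nonempty (DerivedCategory.Q.obj P' ≅ Y) ∧
    Nonempty (DerivedCategory.Q.obj (tensorCplx P P') ≅ Z)

/-- `Y` is (isomorphic to) `f_* X` for the functor `f_* : D^-(AG) ⥤ D^-(BG)` which is `B ⊗_A -`
on `K^-(AG-Proj)`. -/
def IsBaseChange {B : Type u} [CommRing B] [MulSemiringAction G B] (f : A →+*[G] B)
    (X : DAG A G) (Y : DAG B G) : Prop :=
  ∃ P : CochainComplex (SkewMod A G) ℤ, IsBoundedAboveProj P ∧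
    Nonempty (DerivedCategory.Q.obj P ≅ X) ∧
    Nonempty (DerivedCategory.Q.obj (baseChangeCplx f P) ≅ Y)

/-! ### The Balmer spectrum -/

variable (A G)

/-- The Balmer spectrum of `D^b(AG)_{A-perf}`: its points are the prime thick tensor ideals. -/
structure Spc where
  /-- The objects of the prime ideal. -/
  carrier : ObjectProperty (DAG A G)
  le_perf : carrier ≤ perf A G
  isTriangulated : carrier.IsTriangulated
  thick : carrier.IsStableUnderRetracts
  ideal : ∀ X Y Z : DAG A G, carrier X → perf A G Y → IsTensor X Y Z → carrier Z
  proper : ∃ X : DAG A G, perf A G X ∧ ¬ carrier X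
  prime : ∀ X Y Z : DAG A G, perf A G X → perf A G Y → IsTensor X Y Z → carrier Z →
    carrier X ∨ carrier Y

/-- The topology in which the supports `supp X = {𝒫 | X ∉ 𝒫}` are a basis of closed sets. -/
instance : TopologicalSpace (Spc A G) :=
  TopologicalSpace.generateFrom {U | ∃ X : DAG A G, perf A G X ∧ U = {P | P.carrier X}}

/-- The ring `A^G` of invariants. -/
abbrev Inv : Subring A := FixedPoints.subring A G

/-- The unit object `A`, with its given action of `G`. -/
def unitMod : SkewMod A G :=
  ofSemilinear (ModuleCat.of A A) (DistribMulAction.toAddMonoidEnd G A)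
    (fun g a x => smul_mul' g a (show A from x))

variable {A G}

/-- Multiplication by `a ∈ A^G`, as an endomorphism of the unit object. -/
def mulUnit (a : Inv A G) : unitMod A G ⟶ unitMod A G :=
  homOfSemilinear (ModuleCat.ofHom (LinearMap.mulLeft A (a : A))) (fun g x => by
    change (a : A) * (g • (show A from x)) = g • ((a : A) * (show A from x))
    rw [smul_mul', a.2 g])

/-- The cone of `a ∈ A^G = End(A)`. -/
def coneInv (a : Inv A G) : DAG A G :=
  DerivedCategory.Q.obj (CochainComplex.mappingCone
    ((HomologicalComplex.single (SkewMod A G) (ComplexShape.up ℤ) 0).map (mulUnit a)))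

/-- The image of `𝒫` under `Spc(D^b(AG)_{A-perf}) → Spec(A^G)`, i.e. the degree zero part of the
comparison map `Spc → Spec^h(H^*(G, A))`: the prime ideal of all `a ∈ A^G` with `cone(a) ∉ 𝒫`. -/
def rhoBar (P : Spc A G) : Set (Inv A G) :=
  {a | ¬ P.carrier (coneInv a)}

section Map

variable {B : Type u} [CommRing B] [MulSemiringAction G B] (f : A →+*[G] B)

/-- The homomorphism `A^G → B^G` induced by `f`. -/
def invMap : Inv A G →+* Inv B G :=
  (f.toRingHom.comp (Inv A G).subtype).codRestrict (Inv B G) (fun a g => by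
    change g • f (a : A) = f (a : A)
    rw [← map_smul, a.2 g])

/-- `𝒬` is the inverse image of `𝒫` under `f_*`. -/
def IsPreimage (P : Spc B G) (Q : Spc A G) : Prop :=
  ∀ (X : DAG A G) (Y : DAG B G), perf A G X → IsBaseChange f X Y → (Q.carrier X ↔ P.carrier Y)

/-- The fiber product `Spc(D^b(AG)_{A-perf}) ×_{Spec(A^G)} Spec(B^G)`. -/
abbrev FiberProduct : Type _ :=
  {x : Spc A G × PrimeSpectrum (Inv B G) //
    rhoBar x.1 = ((PrimeSpectrum.comap (invMap f) x.2).asIdeal : Set (Inv A G))}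

/-- The base change map
`Spc(D^b(BG)_{B-perf}) → Spc(D^b(AG)_{A-perf}) ×_{Spec(A^G)} Spec(B^G)` associated to `f`,
`𝒫 ↦ (f_*⁻¹(𝒫), ρ̄(𝒫))`, is a well-defined continuous map which is surjective. -/
def SpcSurj : Prop :=
  ∃ φ : Spc B G → FiberProduct f, Continuous φ ∧
    (∀ P, IsPreimage f P (φ P).1.1 ∧ rhoBar P = ((φ P).1.2.asIdeal : Set (Inv B G))) ∧
    Function.Surjective φ

end Map

/-- The fiber of `Spc(D^b(AG)_{A-perf})` over `𝔮 ∈ Spec(A^G)`. -/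
abbrev SpcFiber (q : PrimeSpectrum (Inv A G)) : Type _ :=
  {Q : Spc A G // rhoBar Q = (q.asIdeal : Set (Inv A G))}

end Derived

/-! ### The reduced fiber of the coefficient ring -/

section ReducedFiber

variable (q : PrimeSpectrum (Inv A G))

/-- The fiber `A ⊗_{A^G} k(𝔮)`. -/
abbrev FiberRing : Type u := A ⊗[Inv A G] q.asIdeal.ResidueField

/-- The reduced fiber `A(𝔮) = (A ⊗_{A^G} k(𝔮))_red`. -/
def ReducedFiber : Type u := FiberRing q ⧸ nilradical (FiberRing q)

instance : CommRing (ReducedFiber q) :=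
  inferInstanceAs (CommRing (FiberRing q ⧸ nilradical (FiberRing q)))

/-- The action of `g` on `A ⊗_{A^G} k(𝔮)` via the first factor. -/
def fiberAct (g : G) : FiberRing q →+* FiberRing q :=
  (Algebra.TensorProduct.map (MulSemiringAction.toAlgHom (Inv A G) A g)
    (AlgHom.id (Inv A G) q.asIdeal.ResidueField)).toRingHom

lemma fiberAct_tmul (g : G) (a : A) (x : q.asIdeal.ResidueField) :
    fiberAct q g (a ⊗ₜ[Inv A G] x) = (g • a) ⊗ₜ[Inv A G] x :=
  rfl

lemma fiberAct_one (z : FiberRing q) : fiberAct q (1 : G) z = z := by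
  induction z using TensorProduct.induction_on with
  | zero => rw [map_zero]
  | tmul x y => rw [fiberAct_tmul, one_smul]
  | add x y hx hy => rw [map_add, hx, hy]

lemma fiberAct_mul (g h : G) (z : FiberRing q) :
    fiberAct q (g * h) z = fiberAct q g (fiberAct q h z) := by
  induction z using TensorProduct.induction_on with
  | zero => rw [map_zero, map_zero, map_zero]
  | tmul x y => rw [fiberAct_tmul, fiberAct_tmul, fiberAct_tmul, mul_smul]
  | add x y hx hy => rw [map_add, hx, hy, map_add, map_add]

/-- The induced action of `g` on `A(𝔮)`. -/
def redAct (g : G) : ReducedFiber q →+* ReducedFiber q :=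
  Ideal.quotientMap (nilradical (FiberRing q)) (fiberAct q g)
    (fun _ hz => IsNilpotent.map hz (fiberAct q g))

instance : MulSemiringAction G (ReducedFiber q) where
  smul g x := redAct q g x
  one_smul x := by
    obtain ⟨z, rfl⟩ := Ideal.Quotient.mk_surjective x
    exact congrArg (Ideal.Quotient.mk (nilradical (FiberRing q))) (fiberAct_one q z)
  mul_smul g h x := by
    obtain ⟨z, rfl⟩ := Ideal.Quotient.mk_surjective x
    exact congrArg (Ideal.Quotient.mk (nilradical (FiberRing q))) (fiberAct_mul q g h z)
  smul_zero g := map_zero (redAct q g)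
  smul_add g := map_add (redAct q g)
  smul_one g := map_one (redAct q g)
  smul_mul g := map_mul (redAct q g)

/-- The natural homomorphism `ψ_𝔮 : A → A(𝔮)`, `a ↦ a ⊗ 1`. -/
def psi : A →+*[G] ReducedFiber q where
  toFun a := Ideal.Quotient.mk (nilradical (FiberRing q)) (a ⊗ₜ[Inv A G] 1)
  map_smul' _ _ := rfl
  map_zero' := map_zero ((Ideal.Quotient.mk (nilradical (FiberRing q))).comp
    (Algebra.TensorProduct.includeLeftRingHom (R := Inv A G)))
  map_add' := map_add ((Ideal.Quotient.mk (nilradical (FiberRing q))).comp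
    (Algebra.TensorProduct.includeLeftRingHom (R := Inv A G)))
  map_one' := map_one ((Ideal.Quotient.mk (nilradical (FiberRing q))).comp
    (Algebra.TensorProduct.includeLeftRingHom (R := Inv A G)))
  map_mul' := map_mul ((Ideal.Quotient.mk (nilradical (FiberRing q))).comp
    (Algebra.TensorProduct.includeLeftRingHom (R := Inv A G)))

end ReducedFiber

end SkewGroupRing

end EquivPerf

end

noncomputable section

namespace EquivPerf

/-! ### Morphisms of modules over the skew group ring -/

section Monoidal

variable {A : Type u} {G : Type v} [CommRing A] [Group G] [MulSemiringAction G A]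

/-! Write `B` for the reduced fiber and `f = psi q`. Given a prime `𝒫` over `𝔮`, a prime over `B`
with inverse image `𝒫` is needed. It is enough to have a thick tensor ideal `𝒩` over `B` such that,
for perfect `L`, `f_* L ∈ 𝒩` exactly when `L ∈ 𝒫`. By Zorn's lemma there is then a thick ideal
containing `𝒩` that is maximal among those whose inverse image lies in `𝒫`, and maximality together
with primality of `𝒫` makes it prime (`Spc.exists_comap_eq`).

The ideal `𝒩` is made from the morphisms `ξ : W ⟶ 1` of perfect complexes with cone in `𝒫`. Such an
augmented complex annihilates `Z` if `W ⊗ Z ⟶ Z` vanishes in the derived category. Augmented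
complexes with cone in `𝒫` are closed under tensor products, so the objects annihilated by one of
them form a thick tensor ideal; the same holds for their base changes to `B`, and these define `𝒩`.
If `L ∈ 𝒫`, then the cocone of the coevaluation `1 ⟶ L ⊗ L^∨` annihilates `L` by a triangle identity
(`IsStrictPerf.exists_aug`), and base change preserves this.

The converse is `Spc.carrier_of_annihilated`. Suppose that `f_* L ∈ 𝒩`. The ring `B` is semisimple,
because `G` permutes transitively the primes of `A` over `𝔮`; hence every `B`-module is flat, and
the projection formula shows that `N ⊗ L` is annihilated for each `BG`-module `N` restricted to
`AG`. Now let `M` be an `AG`-module on which the invariants outside `𝔮` act invertibly. If a power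
of `ker f` kills `M`, the sequences `0 → K → M → B ⊗ M → 0` give by induction that `M ⊗ L` is
annihilated; this covers all such `M` killed by `𝔮`. Replacing `L` by its tensor product `L'` with a
Koszul complex on generators of `𝔮A` removes the condition that `𝔮` kills `M`, so `A_𝔮 ⊗ L'` is
annihilated. A null homotopy over the localization lifts, up to invariants outside `𝔮`, to one over
`A`. Those invariants have cones in `𝒫`, so a zero morphism into `L'` has its cone in `𝒫`, whence
`L' ∈ 𝒫`. The cones of elements of `𝔮` are not in `𝒫`, so primality gives `L ∈ 𝒫`.

Finally the invariants of `B` form a field (`isUnit_of_invariant`), so the second component of the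
base change map carries no information and the two forms of the theorem agree.

Most of the earlier part makes this calculus explicit. Perfect objects are represented by bounded
complexes of `AG`-modules that are finitely generated projective over `A` (`exists_isStrictPerf`),
and tensor products and base changes may be computed on these: a quasi-isomorphism of bounded above
complexes with `A`-projective terms is a homotopy equivalence over `A`, though perhaps not over
`AG`, and quasi-isomorphisms are detected over `A`. -/

lemma single_smul_eq (M : SkewMod A G) (g : G) (a : A) (x : (toMod A G).obj M) :
    (SkewMonoidAlgebra.single g a : SkewGroupRing A G) • (x : M) = (a • act M g x : (toMod A G).obj M) := by
  change _ = (SkewMonoidAlgebra.single 1 a : SkewGroupRing A G) •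
    ((SkewMonoidAlgebra.single g 1 : SkewGroupRing A G) • (x : M))
  rw [← mul_smul]
  simp [SkewMonoidAlgebra.single_mul_single]

/-- An equivariant `A`-linear map between `AG`-modules is a homomorphism of `AG`-modules. -/
def homOfEquivariant {M N : SkewMod A G} (f : (toMod A G).obj M →ₗ[A] (toMod A G).obj N)
    (hf : ∀ (g : G) (x : (toMod A G).obj M), f (act M g x) = act N g (f x)) : M ⟶ N :=
  ModuleCat.ofHom
    { toFun := fun x => f x
      map_add' := fun x y => f.map_add x y
      map_smul' := fun r x => by
        induction r using SkewMonoidAlgebra.induction_on with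
        | zero => rw [zero_smul]; exact (f.map_zero).trans (zero_smul _ _).symm
        | single g a =>
          refine (congrArg f (single_smul_eq M g a x)).trans ?_
          refine (f.map_smul a _).trans ((congrArg (fun y => a • y) (hf g x)).trans ?_)
          exact (single_smul_eq N g a (f x)).symm
        | add r s hr hs =>
          rw [add_smul]
          refine (f.map_add _ _).trans ((congrArg₂ (fun y z : N => y + z) hr hs).trans ?_)
          exact (add_smul r s (f x : N)).symm }

/-- An equivariant `A`-linear equivalence between `AG`-modules is an isomorphism. -/
def isoOfEquivariant {M N : SkewMod A G} (e : (toMod A G).obj M ≃ₗ[A] (toMod A G).obj N)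
    (he : ∀ (g : G) (x : (toMod A G).obj M), e (act M g x) = act N g (e x)) : M ≅ N where
  hom := homOfEquivariant e.toLinearMap he
  inv := homOfEquivariant e.symm.toLinearMap (fun g y => by
    apply e.injective
    refine (e.apply_symm_apply _).trans ?_
    refine (congrArg (act N g) (e.apply_symm_apply y).symm).trans (he g (e.symm y)).symm)
  hom_inv_id := by ext x; exact e.symm_apply_apply x
  inv_hom_id := by ext x; exact e.apply_symm_apply x

/-- The underlying `A`-module of `ofSemilinear X ρ h` is `X`. -/
def ofSemilinearEquiv (X : ModuleCat.{u} A) (ρ : G →* AddMonoid.End X)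
    (h : ∀ (g : G) (a : A) (x : X), ρ g (a • x) = (g • a) • ρ g x) :
    (toMod A G).obj (ofSemilinear X ρ h) ≃ₗ[A] X where
  toFun x := x
  invFun x := x
  left_inv _ := rfl
  right_inv _ := rfl
  map_add' _ _ := rfl
  map_smul' a x := by
    refine (ofSemilinear_single_smul X ρ h 1 a x).trans ?_
    rw [map_one]
    rfl

lemma act_ofSemilinear (X : ModuleCat.{u} A) (ρ : G →* AddMonoid.End X)
    (h : ∀ (g : G) (a : A) (x : X), ρ g (a • x) = (g • a) • ρ g x) (g : G)
    (x : (toMod A G).obj (ofSemilinear X ρ h)) :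
    ofSemilinearEquiv X ρ h (act (ofSemilinear X ρ h) g x) =
      ρ g (ofSemilinearEquiv X ρ h x) := by
  refine (ofSemilinear_single_smul X ρ h g 1 x).trans ?_
  exact one_smul A (ρ g x)

/-- The underlying `A`-module of `tensorMod M N`. -/
def tensorEquiv (M N : SkewMod A G) :
    (toMod A G).obj (tensorMod M N) ≃ₗ[A] (toMod A G).obj M ⊗[A] (toMod A G).obj N :=
  ofSemilinearEquiv (ModuleCat.of A ((toMod A G).obj M ⊗[A] (toMod A G).obj N)) _ _

/-- The elementary tensor `m ⊗ n`, as an element of the underlying `A`-module of `M ⊗ N`. -/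
def tens {M N : SkewMod A G} (m : (toMod A G).obj M) (n : (toMod A G).obj N) :
    (toMod A G).obj (tensorMod M N) :=
  (m ⊗ₜ[A] n : (toMod A G).obj M ⊗[A] (toMod A G).obj N)

lemma act_tens {M N : SkewMod A G} (g : G) (m : (toMod A G).obj M) (n : (toMod A G).obj N) :
    act (tensorMod M N) g (tens m n) = tens (act M g m) (act N g n) :=
  act_ofSemilinear _ _ _ g (tens m n)

lemma tensorMod_induction {M N : SkewMod A G} {p : (toMod A G).obj (tensorMod M N) → Prop}
    (zero : p 0) (tens : ∀ m n, p (tens m n)) (add : ∀ x y, p x → p y → p (x + y)) (z) : p z :=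
  TensorProduct.induction_on (R := A) (M := (toMod A G).obj M) (N := (toMod A G).obj N)
    (motive := p) z zero tens add

lemma tensorMod_linearMap_ext {M N : SkewMod A G} {X : Type*} [AddCommGroup X] [Module A X]
    {f g : (toMod A G).obj (tensorMod M N) →ₗ[A] X} (h : ∀ m n, f (tens m n) = g (tens m n)) :
    f = g :=
  LinearMap.ext fun z => by
    induction z using tensorMod_induction with
    | zero => rw [map_zero, map_zero]
    | tens m n => exact h m n
    | add x y hx hy => rw [map_add, map_add, hx, hy]

/-- The underlying `A`-linear map of the associativity isomorphism. -/
def assocEquiv (M N P : SkewMod A G) :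
    (toMod A G).obj (tensorMod (tensorMod M N) P) ≃ₗ[A]
      (toMod A G).obj (tensorMod M (tensorMod N P)) :=
  tensorEquiv _ _ ≪≫ₗ TensorProduct.congr (tensorEquiv M N) (LinearEquiv.refl A _) ≪≫ₗ
    TensorProduct.assoc A _ _ _ ≪≫ₗ
    TensorProduct.congr (LinearEquiv.refl A _) (tensorEquiv N P).symm ≪≫ₗ (tensorEquiv _ _).symm

lemma assocEquiv_tens {M N P : SkewMod A G} (m : (toMod A G).obj M) (n : (toMod A G).obj N)
    (p : (toMod A G).obj P) :
    assocEquiv M N P (tens (tens m n) p) =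
      tens m (tens n p) := rfl

lemma tens_add {M N : SkewMod A G} (m : (toMod A G).obj M) (n n' : (toMod A G).obj N) :
    tens m (n + n') = tens m n + tens m n' := TensorProduct.tmul_add _ _ _

lemma add_tens {M N : SkewMod A G} (m m' : (toMod A G).obj M) (n : (toMod A G).obj N) :
    tens (m + m') n = tens m n + tens m' n := TensorProduct.add_tmul _ _ _

lemma tens_zero {M N : SkewMod A G} (m : (toMod A G).obj M) :
    tens m (0 : (toMod A G).obj N) = 0 := TensorProduct.tmul_zero _ _

lemma zero_tens {M N : SkewMod A G} (n : (toMod A G).obj N) :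
    tens (0 : (toMod A G).obj M) n = 0 := TensorProduct.zero_tmul _ _

lemma smul_tens {M N : SkewMod A G} (a : A) (m : (toMod A G).obj M) (n : (toMod A G).obj N) :
    (tens (a • m) n) = tens m (a • n) := TensorProduct.smul_tmul _ _ _

/-- A property of `(M ⊗ N) ⊗ P` may be checked on elementary tensors. -/
lemma tensorMod_induction₃ {M N P : SkewMod A G}
    {p : (toMod A G).obj (tensorMod (tensorMod M N) P) → Prop}
    (zero : p 0) (tens : ∀ m n q, p (tens (tens m n) q))
    (add : ∀ x y, p x → p y → p (x + y)) (z) : p z := by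
  refine tensorMod_induction zero (fun w q => ?_) add z
  induction w using tensorMod_induction with
  | zero => rw [zero_tens]; exact zero
  | tens m n => exact tens m n q
  | add x y hx hy => rw [add_tens]; exact add _ _ hx hy

lemma tensorMod_hom_ext₃ {M N P L : SkewMod A G}
    {φ ψ : tensorMod (tensorMod M N) P ⟶ L}
    (h : ∀ m n p, φ (tens (tens m n) p) =
      ψ (tens (tens m n) p)) : φ = ψ := by
  ext z
  refine tensorMod_induction₃ (p := fun z => φ.hom z = ψ.hom z) ?_ h ?_ z
  · exact (φ.hom.map_zero).trans (ψ.hom.map_zero).symm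
  · intro x y hx hy
    exact (φ.hom.map_add _ _).trans ((congrArg₂ (· + ·) hx hy).trans (ψ.hom.map_add _ _).symm)

lemma tensorMod_hom_ext₄ {M N P R L : SkewMod A G}
    {φ ψ : tensorMod (tensorMod (tensorMod M N) P) R ⟶ L}
    (h : ∀ m n p r, φ (tens 
        (tens (tens m n) p) r) =
      ψ (tens 
        (tens (tens m n) p) r)) : φ = ψ := by
  refine tensorMod_hom_ext fun w r => ?_
  change φ (tens w r) = ψ (tens w r)
  induction w using tensorMod_induction₃ with
  | zero =>
    refine (congrArg φ (zero_tens r)).trans (Eq.trans ?_ (congrArg ψ (zero_tens r)).symm)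
    exact (φ.hom.map_zero).trans (ψ.hom.map_zero).symm
  | tens m n p => exact h m n p r
  | add x y hx hy =>
    refine (congrArg φ (add_tens x y r)).trans (Eq.trans ?_ (congrArg ψ (add_tens x y r)).symm)
    exact (φ.hom.map_add _ _).trans ((congrArg₂ (· + ·) hx hy).trans (ψ.hom.map_add _ _).symm)

/-- The associativity isomorphism `(M ⊗ N) ⊗ P ≅ M ⊗ (N ⊗ P)`. -/
def tensorAssoc (M N P : SkewMod A G) :
    tensorMod (tensorMod M N) P ≅ tensorMod M (tensorMod N P) :=
  isoOfEquivariant (assocEquiv M N P) (fun g z => by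
    induction z using tensorMod_induction₃ with
    | zero => simp only [map_zero]
    | tens m n p =>
      rw [act_tens, act_tens, assocEquiv_tens, assocEquiv_tens, act_tens, act_tens]
    | add x y hx hy => simp only [map_add, hx, hy])

/-- The underlying `A`-module of the unit object. -/
def unitEquiv : (toMod A G).obj (unitMod A G) ≃ₗ[A] A :=
  ofSemilinearEquiv (ModuleCat.of A A) _ _

lemma act_unit (g : G) (x : (toMod A G).obj (unitMod A G)) :
    unitEquiv (act (unitMod A G) g x) = g • unitEquiv x :=
  act_ofSemilinear _ _ _ g x

/-- The left unit isomorphism. -/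
def leftUnit (M : SkewMod A G) : tensorMod (unitMod A G) M ≅ M :=
  isoOfEquivariant
    (tensorEquiv _ _ ≪≫ₗ TensorProduct.congr unitEquiv (LinearEquiv.refl A _) ≪≫ₗ
      TensorProduct.lid A _) (fun g z => by
    induction z using tensorMod_induction with
    | zero => simp only [map_zero]
    | tens m n =>
      rw [act_tens]
      change unitEquiv (act (unitMod A G) g m) • act M g n = act M g (unitEquiv m • n)
      rw [act_smul, act_unit]
    | add x y hx hy => simp only [map_add, hx, hy])

/-- The right unit isomorphism. -/
def rightUnit (M : SkewMod A G) : tensorMod M (unitMod A G) ≅ M :=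
  isoOfEquivariant
    (tensorEquiv _ _ ≪≫ₗ TensorProduct.congr (LinearEquiv.refl A _) unitEquiv ≪≫ₗ
      TensorProduct.rid A _) (fun g z => by
    induction z using tensorMod_induction with
    | zero => simp only [map_zero]
    | tens m n =>
      rw [act_tens]
      change unitEquiv (act (unitMod A G) g n) • act M g m = act M g (unitEquiv n • m)
      rw [act_smul, act_unit]
    | add x y hx hy => simp only [map_add, hx, hy])

instance : MonoidalCategoryStruct (SkewMod A G) where
  tensorObj M N := tensorMod M N
  whiskerLeft M _ _ φ := tensorMap (𝟙 M) φ
  whiskerRight φ N := tensorMap φ (𝟙 N)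
  tensorHom φ ψ := tensorMap φ ψ
  tensorUnit := unitMod A G
  associator := tensorAssoc
  leftUnitor := leftUnit
  rightUnitor := rightUnit

/-- On elementary tensors both sides of each axiom agree definitionally, except where a unitor turns
a tensor factor into a scalar; there linearity over `A` is used. -/
instance : MonoidalCategory (SkewMod A G) where
  tensorHom_def _ _ := tensorMod_hom_ext fun _ _ => rfl
  id_tensorHom_id _ _ := tensorMod_hom_ext fun _ _ => rfl
  tensorHom_comp_tensorHom _ _ _ _ := tensorMod_hom_ext fun _ _ => rfl
  whiskerLeft_id _ _ := tensorMod_hom_ext fun _ _ => rfl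
  id_whiskerRight _ _ := tensorMod_hom_ext fun _ _ => rfl
  associator_naturality _ _ _ := tensorMod_hom_ext₃ fun _ _ _ => rfl
  leftUnitor_naturality φ := tensorMod_hom_ext fun a m =>
    (((toMod A G).map φ).hom.map_smul (unitEquiv a) m).symm
  rightUnitor_naturality φ := tensorMod_hom_ext fun m a =>
    (((toMod A G).map φ).hom.map_smul (unitEquiv a) m).symm
  pentagon _ _ _ _ := tensorMod_hom_ext₄ fun _ _ _ _ => rfl
  triangle _ _ := tensorMod_hom_ext₃ fun m a n => (smul_tens (unitEquiv a) m n).symm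

/-- The symmetry `M ⊗ N ≅ N ⊗ M`. -/
def tensorComm (M N : SkewMod A G) : tensorMod M N ≅ tensorMod N M :=
  isoOfEquivariant
    (tensorEquiv _ _ ≪≫ₗ TensorProduct.comm A _ _ ≪≫ₗ (tensorEquiv _ _).symm) (fun g z => by
    induction z using tensorMod_induction with
    | zero => simp only [map_zero]
    | tens m n =>
      rw [act_tens]
      change _ = act (tensorMod N M) g (tens n m)
      rw [act_tens]
      rfl
    | add x y hx hy => simp only [map_add, hx, hy])

variable (A G) in
/-- The symmetry as an isomorphism of bifunctors. -/
def tensorFlipIso : tensorBifunctor A G ≅ (tensorBifunctor A G).flip :=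
  NatIso.ofComponents
    (fun M => NatIso.ofComponents (fun N => tensorComm M N)
      (fun _ => tensorMod_hom_ext fun _ _ => rfl))
    (fun _ => by ext N : 2; exact tensorMod_hom_ext fun _ _ => rfl)

instance : (MonoidalCategory.curriedTensor (SkewMod A G)).Additive :=
  inferInstanceAs (tensorBifunctor A G).Additive

instance (M : SkewMod A G) : ((MonoidalCategory.curriedTensor (SkewMod A G)).obj M).Additive :=
  inferInstanceAs ((tensorBifunctor A G).obj M).Additive

variable (A G) in
/-- The tensor product commutes with forgetting the action. -/
def tensorToModIso (M : SkewMod A G) : (tensorBifunctor A G).obj M ⋙ toMod A G ≅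
    toMod A G ⋙ MonoidalCategory.tensorLeft ((toMod A G).obj M) :=
  NatIso.ofComponents (fun N => (tensorEquiv M N).toModuleIso) (fun _ =>
    ModuleCat.hom_ext (tensorMod_linearMap_ext fun _ _ => rfl))

/-- A conservative functor reflects the colimits that exist and that it preserves. -/
lemma preservesColimitsOfShape_of_comp_toMod {C : Type*} [Category C] (F : C ⥤ SkewMod A G)
    (J : Type*) [Category J] [PreservesColimitsOfShape J (F ⋙ toMod A G)]
    [PreservesColimitsOfShape J (toMod A G)] [HasColimitsOfShape J (SkewMod A G)] :
    PreservesColimitsOfShape J F :=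
  have : ReflectsColimitsOfShape J (toMod A G) :=
    reflectsColimitsOfShape_of_reflectsIsomorphisms
  preservesColimitsOfShape_of_reflects_of_preserves F (toMod A G)

/-- Both module categories forget to abelian groups compatibly, and the forgetful functor from
`A`-modules reflects these colimits. -/
instance toMod_preservesColimitsOfShape (J : Type) [Category.{0} J] :
    PreservesColimitsOfShape J (toMod A G) := by
  have : ReflectsColimitsOfShape J (forget₂ (ModuleCat.{u} A) AddCommGrpCat.{u}) :=
    reflectsColimitsOfShape_of_reflectsIsomorphisms
  have : PreservesColimitsOfShape J (toMod A G ⋙ forget₂ (ModuleCat.{u} A) AddCommGrpCat.{u}) :=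
    inferInstanceAs (PreservesColimitsOfShape J
      (forget₂ (ModuleCat.{u} (SkewGroupRing A G)) AddCommGrpCat.{u}))
  exact preservesColimitsOfShape_of_reflects_of_preserves (toMod A G)
    (forget₂ (ModuleCat.{u} A) AddCommGrpCat.{u})

/-- The terms of a total complex are infinite coproducts; the monoidal structure on complexes
requires that tensoring commutes with them. -/
instance (M : SkewMod A G) (J : Type) : PreservesColimitsOfShape (Discrete J)
    ((tensorBifunctor A G).obj M) := by
  have : PreservesColimitsOfShape (Discrete J) ((tensorBifunctor A G).obj M ⋙ toMod A G) :=
    preservesColimitsOfShape_of_natIso (tensorToModIso A G M).symm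
  exact preservesColimitsOfShape_of_comp_toMod _ _

instance (N : SkewMod A G) (J : Type) : PreservesColimitsOfShape (Discrete J)
    ((tensorBifunctor A G).flip.obj N) :=
  preservesColimitsOfShape_of_natIso ((tensorFlipIso A G).app N)

instance (M : SkewMod A G) (J : Type) : PreservesColimitsOfShape (Discrete J)
    ((MonoidalCategory.curriedTensor (SkewMod A G)).obj M) :=
  inferInstanceAs (PreservesColimitsOfShape (Discrete J) ((tensorBifunctor A G).obj M))

instance (N : SkewMod A G) (J : Type) : PreservesColimitsOfShape (Discrete J)
    ((MonoidalCategory.curriedTensor (SkewMod A G)).flip.obj N) :=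
  inferInstanceAs (PreservesColimitsOfShape (Discrete J) ((tensorBifunctor A G).flip.obj N))

instance complexMonoidal : MonoidalCategory (CochainComplex (SkewMod A G) ℤ) :=
  HomologicalComplex.monoidalCategory (SkewMod A G) (ComplexShape.up ℤ)

end Monoidal

/-! ### Total complexes of bifunctors under additive functors -/

section Comparison

open HomologicalComplex

/-- A natural isomorphism `F'(Φ₁ X, Φ₂ Y) ≅ Φ(F(X, Y))`. -/
structure BifunctorComparison {C₁ C₂ D C₁' C₂' D' : Type*} [Category C₁] [Category C₂]
    [Category D] [Category C₁'] [Category C₂'] [Category D'] (F : C₁ ⥤ C₂ ⥤ D)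
    (F' : C₁' ⥤ C₂' ⥤ D') (Φ₁ : C₁ ⥤ C₁') (Φ₂ : C₂ ⥤ C₂') (Φ : D ⥤ D') where
  /-- The isomorphisms. -/
  iso : ∀ X Y, (F'.obj (Φ₁.obj X)).obj (Φ₂.obj Y) ≅ Φ.obj ((F.obj X).obj Y)
  nat₁ : ∀ {X X' : C₁} (f : X ⟶ X') (Y : C₂),
    (F'.map (Φ₁.map f)).app (Φ₂.obj Y) ≫ (iso X' Y).hom =
      (iso X Y).hom ≫ Φ.map ((F.map f).app Y)
  nat₂ : ∀ (X : C₁) {Y Y' : C₂} (g : Y ⟶ Y'),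
    (F'.obj (Φ₁.obj X)).map (Φ₂.map g) ≫ (iso X Y').hom =
      (iso X Y).hom ≫ Φ.map ((F.obj X).map g)

variable {C₁ C₂ D C₁' C₂' D' : Type*} [Category C₁] [Category C₂] [Category D]
  [Category C₁'] [Category C₂'] [Category D']
  [Preadditive C₁] [Preadditive C₂] [Preadditive D]
  [Preadditive C₁'] [Preadditive C₂'] [Preadditive D']
  {F : C₁ ⥤ C₂ ⥤ D} [F.Additive] [∀ X, (F.obj X).Additive]
  {F' : C₁' ⥤ C₂' ⥤ D'} [F'.Additive] [∀ X, (F'.obj X).Additive]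
  {Φ₁ : C₁ ⥤ C₁'} {Φ₂ : C₂ ⥤ C₂'} {Φ : D ⥤ D'} [Φ₁.Additive] [Φ₂.Additive] [Φ.Additive]
  (e : BifunctorComparison F F' Φ₁ Φ₂ Φ)
  (K K' : CochainComplex C₁ ℤ) (L L' : CochainComplex C₂ ℤ)
  [HasMapBifunctor K L F (ComplexShape.up ℤ)]
  [HasMapBifunctor ((Φ₁.mapHomologicalComplex (ComplexShape.up ℤ)).obj K)
    ((Φ₂.mapHomologicalComplex (ComplexShape.up ℤ)).obj L) F' (ComplexShape.up ℤ)]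

lemma ιMapBifunctor_d {C₁ C₂ D : Type*} [Category C₁] [Category C₂] [Category D]
    [Preadditive C₁] [Preadditive C₂] [Preadditive D]
    (F : C₁ ⥤ C₂ ⥤ D) [F.Additive] [∀ X, (F.obj X).Additive]
    (K : CochainComplex C₁ ℤ) (L : CochainComplex C₂ ℤ)
    [HasMapBifunctor K L F (ComplexShape.up ℤ)] (i j n : ℤ) (h : i + j = n) :
    ιMapBifunctor K L F (ComplexShape.up ℤ) i j n h ≫
      (mapBifunctor K L F (ComplexShape.up ℤ)).d n (n + 1) =
    (F.map (K.d i (i + 1))).app (L.X j) ≫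
      ιMapBifunctor K L F (ComplexShape.up ℤ) (i + 1) j (n + 1) (by dsimp; omega) +
    i.negOnePow • ((F.obj (K.X i)).map (L.d j (j + 1)) ≫
      ιMapBifunctor K L F (ComplexShape.up ℤ) i (j + 1) (n + 1) (by dsimp; omega)) := by
  rw [mapBifunctor.d_eq, Preadditive.comp_add, mapBifunctor.ι_D₁, mapBifunctor.ι_D₂,
    mapBifunctor.d₁_eq K L F (ComplexShape.up ℤ) (show (ComplexShape.up ℤ).Rel i (i + 1) from rfl)
      j (n + 1) (by dsimp; omega),
    mapBifunctor.d₂_eq K L F (ComplexShape.up ℤ) i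
      (show (ComplexShape.up ℤ).Rel j (j + 1) from rfl) (n + 1) (by dsimp; omega)]
  congr 1
  -- The sign of the first partial differential is `1`; only the second one carries `(-1)^i`.
  exact one_smul _ _

variable (F' Φ₁ Φ₂) in
/-- The inclusion of a summand in the total complex of the images of two complexes. -/
def ιImage (i j n : ℤ) (h : i + j = n) : (F'.obj (Φ₁.obj (K.X i))).obj (Φ₂.obj (L.X j)) ⟶
    (mapBifunctor ((Φ₁.mapHomologicalComplex (ComplexShape.up ℤ)).obj K)
      ((Φ₂.mapHomologicalComplex (ComplexShape.up ℤ)).obj L) F' (ComplexShape.up ℤ)).X n :=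
  ιMapBifunctor ((Φ₁.mapHomologicalComplex (ComplexShape.up ℤ)).obj K)
      ((Φ₂.mapHomologicalComplex (ComplexShape.up ℤ)).obj L) F' (ComplexShape.up ℤ) i j n h

variable {K L} in
lemma image_hom_ext {n : ℤ} {Y : D'}
    {f g : (mapBifunctor ((Φ₁.mapHomologicalComplex (ComplexShape.up ℤ)).obj K)
      ((Φ₂.mapHomologicalComplex (ComplexShape.up ℤ)).obj L) F' (ComplexShape.up ℤ)).X n ⟶ Y}
    (h : ∀ i j (h : i + j = n), ιImage F' Φ₁ Φ₂ K L i j n h ≫ f =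
      ιImage F' Φ₁ Φ₂ K L i j n h ≫ g) : f = g :=
  mapBifunctor.hom_ext h

lemma ιImage_d (i j n : ℤ) (h : i + j = n) :
    ιImage F' Φ₁ Φ₂ K L i j n h ≫
      (mapBifunctor ((Φ₁.mapHomologicalComplex (ComplexShape.up ℤ)).obj K)
      ((Φ₂.mapHomologicalComplex (ComplexShape.up ℤ)).obj L) F' (ComplexShape.up ℤ)).d n (n + 1) =
    (F'.map (Φ₁.map (K.d i (i + 1)))).app (Φ₂.obj (L.X j)) ≫
      ιImage F' Φ₁ Φ₂ K L (i + 1) j (n + 1) (by omega) +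
    i.negOnePow • ((F'.obj (Φ₁.obj (K.X i))).map (Φ₂.map (L.d j (j + 1))) ≫
      ιImage F' Φ₁ Φ₂ K L i (j + 1) (n + 1) (by omega)) :=
  ιMapBifunctor_d F' _ _ i j n h

/-- The components of the comparison between the total complex of the image and the image of the
total complex. -/
def mapBifunctorComparisonX (n : ℤ) :
    (mapBifunctor ((Φ₁.mapHomologicalComplex (ComplexShape.up ℤ)).obj K)
      ((Φ₂.mapHomologicalComplex (ComplexShape.up ℤ)).obj L) F' (ComplexShape.up ℤ)).X n ⟶
    Φ.obj ((mapBifunctor K L F (ComplexShape.up ℤ)).X n) :=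
  mapBifunctorDesc (fun i j h => (e.iso (K.X i) (L.X j)).hom ≫
    Φ.map (ιMapBifunctor K L F (ComplexShape.up ℤ) i j n h))

omit [Φ.Additive] in
lemma ι_mapBifunctorComparisonX (n i j : ℤ) (h : i + j = n) :
    ιImage F' Φ₁ Φ₂ K L i j n h ≫ mapBifunctorComparisonX e K L n =
    (e.iso (K.X i) (L.X j)).hom ≫ Φ.map (ιMapBifunctor K L F (ComplexShape.up ℤ) i j n h) :=
  ι_mapBifunctorDesc _ i j h

lemma mapBifunctorComparisonX_comm (n : ℤ) :
    mapBifunctorComparisonX e K L n ≫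
      Φ.map ((mapBifunctor K L F (ComplexShape.up ℤ)).d n (n + 1)) =
    (mapBifunctor ((Φ₁.mapHomologicalComplex (ComplexShape.up ℤ)).obj K)
      ((Φ₂.mapHomologicalComplex (ComplexShape.up ℤ)).obj L) F' (ComplexShape.up ℤ)).d n (n + 1) ≫
    mapBifunctorComparisonX e K L (n + 1) := by
  refine image_hom_ext fun i j h => ?_
  rw [reassoc_of% (ιImage_d (F' := F') (Φ₁ := Φ₁) (Φ₂ := Φ₂) K L i j n h), reassoc_of% (ι_mapBifunctorComparisonX e K L n i j h), ← Φ.map_comp,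
    ιMapBifunctor_d F K L i j n h, Preadditive.add_comp, Category.assoc,
    ι_mapBifunctorComparisonX, Linear.units_smul_comp, Category.assoc,
    ι_mapBifunctorComparisonX, reassoc_of% e.nat₁, reassoc_of% e.nat₂, Φ.map_add,
    Functor.map_units_smul, Φ.map_comp, Φ.map_comp, Preadditive.comp_add,
    Linear.comp_units_smul]

/-- The comparison between the total complex of the image and the image of the total complex. -/
def mapBifunctorComparison :
    mapBifunctor ((Φ₁.mapHomologicalComplex (ComplexShape.up ℤ)).obj K)
      ((Φ₂.mapHomologicalComplex (ComplexShape.up ℤ)).obj L) F' (ComplexShape.up ℤ) ⟶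
    (Φ.mapHomologicalComplex (ComplexShape.up ℤ)).obj
      (mapBifunctor K L F (ComplexShape.up ℤ)) where
  f n := mapBifunctorComparisonX e K L n
  comm' n m hnm := by
    obtain rfl : n + 1 = m := hnm
    exact mapBifunctorComparisonX_comm e K L n

/-- The total complex in degree `n` is the coproduct of the terms of total degree `n`. -/
def mapBifunctorIsColimit (n : ℤ) :
    IsColimit (Cofan.mk (f := fun p : {p : ℤ × ℤ // p.1 + p.2 = n} =>
      (F.obj (K.X p.1.1)).obj (L.X p.1.2)) _
      (fun p => ιMapBifunctor K L F (ComplexShape.up ℤ) p.1.1 p.1.2 n p.2)) :=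
  (((F.mapBifunctorHomologicalComplex _ _).obj K).obj L).toGradedObject.isColimitCofanMapObj
      (ComplexShape.π (ComplexShape.up ℤ) (ComplexShape.up ℤ) (ComplexShape.up ℤ)) n

variable [∀ J : Type, PreservesColimitsOfShape (Discrete J) Φ]

/-- As `Φ` preserves the coproduct in degree `n`, an inverse can be prescribed on the summands by
the inverses of `e.iso`. -/
instance (n : ℤ) : IsIso (mapBifunctorComparisonX e K L n) := by
  have hc := isColimitCofanMkObjOfIsColimit Φ _ _ (mapBifunctorIsColimit K L (F := F) n)
  let g : Φ.obj ((mapBifunctor K L F (ComplexShape.up ℤ)).X n) ⟶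
      (mapBifunctor ((Φ₁.mapHomologicalComplex (ComplexShape.up ℤ)).obj K)
      ((Φ₂.mapHomologicalComplex (ComplexShape.up ℤ)).obj L) F' (ComplexShape.up ℤ)).X n :=
    Cofan.IsColimit.desc hc (fun p => (e.iso (K.X p.1.1) (L.X p.1.2)).inv ≫
      ιImage F' Φ₁ Φ₂ K L p.1.1 p.1.2 n p.2)
  have hg : ∀ (i j : ℤ) (h : i + j = n),
      Φ.map (ιMapBifunctor K L F (ComplexShape.up ℤ) i j n h) ≫ g =
      (e.iso (K.X i) (L.X j)).inv ≫ ιImage F' Φ₁ Φ₂ K L i j n h :=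
    fun i j h => Cofan.IsColimit.fac hc _ ⟨(i, j), h⟩
  refine ⟨g, ?_, ?_⟩
  · refine image_hom_ext fun i j h => ?_
    rw [reassoc_of% (ι_mapBifunctorComparisonX e K L n i j h), hg i j h, Iso.hom_inv_id_assoc, Category.comp_id]
  · refine Cofan.IsColimit.hom_ext hc _ _ fun p => ?_
    refine (Category.assoc _ _ _).symm.trans ((congrArg
      (fun t => t ≫ mapBifunctorComparisonX e K L n) (hg p.1.1 p.1.2 p.2)).trans ?_)
    rw [Category.assoc, ι_mapBifunctorComparisonX, Iso.inv_hom_id_assoc]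
    exact (Category.comp_id _).symm

instance : IsIso (mapBifunctorComparison e K L) :=
  have (n : ℤ) : IsIso ((mapBifunctorComparison e K L).f n) :=
    inferInstanceAs (IsIso (mapBifunctorComparisonX e K L n))
  Hom.isIso_of_components _

/-- The total complex of the image is the image of the total complex. -/
def mapBifunctorComparisonIso :
    mapBifunctor ((Φ₁.mapHomologicalComplex (ComplexShape.up ℤ)).obj K)
      ((Φ₂.mapHomologicalComplex (ComplexShape.up ℤ)).obj L) F' (ComplexShape.up ℤ) ≅
    (Φ.mapHomologicalComplex (ComplexShape.up ℤ)).obj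
      (mapBifunctor K L F (ComplexShape.up ℤ)) :=
  asIso (mapBifunctorComparison e K L)

omit [∀ J : Type, PreservesColimitsOfShape (Discrete J) Φ] in
variable {K K' L L'} in
lemma mapBifunctorComparison_naturality
    [HasMapBifunctor K' L' F (ComplexShape.up ℤ)]
    [HasMapBifunctor ((Φ₁.mapHomologicalComplex (ComplexShape.up ℤ)).obj K')
      ((Φ₂.mapHomologicalComplex (ComplexShape.up ℤ)).obj L') F' (ComplexShape.up ℤ)]
    (f : K ⟶ K') (g : L ⟶ L') :
    mapBifunctorMap ((Φ₁.mapHomologicalComplex (ComplexShape.up ℤ)).map f)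
      ((Φ₂.mapHomologicalComplex (ComplexShape.up ℤ)).map g) F' (ComplexShape.up ℤ) ≫
      mapBifunctorComparison e K' L' =
    mapBifunctorComparison e K L ≫ (Φ.mapHomologicalComplex (ComplexShape.up ℤ)).map
      (mapBifunctorMap f g F (ComplexShape.up ℤ)) := by
  ext n : 1
  refine image_hom_ext fun i j h => ?_
  have h₁ : ιImage F' Φ₁ Φ₂ K L i j n h ≫
      (mapBifunctorMap ((Φ₁.mapHomologicalComplex (ComplexShape.up ℤ)).map f)
      ((Φ₂.mapHomologicalComplex (ComplexShape.up ℤ)).map g) F' (ComplexShape.up ℤ)).f n =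
      (F'.map (Φ₁.map (f.f i))).app _ ≫ (F'.obj _).map (Φ₂.map (g.f j)) ≫
        ιImage F' Φ₁ Φ₂ K' L' i j n h :=
    ι_mapBifunctorMap _ _ F' _ i j n h
  have h₂ : ιImage F' Φ₁ Φ₂ K L i j n h ≫
      (mapBifunctorMap ((Φ₁.mapHomologicalComplex (ComplexShape.up ℤ)).map f)
      ((Φ₂.mapHomologicalComplex (ComplexShape.up ℤ)).map g) F' (ComplexShape.up ℤ)).f n ≫
        mapBifunctorComparisonX e K' L' n = ιImage F' Φ₁ Φ₂ K L i j n h ≫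
        mapBifunctorComparisonX e K L n ≫
          Φ.map ((mapBifunctorMap f g F (ComplexShape.up ℤ)).f n) := by
    rw [reassoc_of% h₁, ι_mapBifunctorComparisonX, reassoc_of% (ι_mapBifunctorComparisonX e K L n i j h), ← Φ.map_comp,
      ι_mapBifunctorMap, Φ.map_comp, Φ.map_comp, reassoc_of% e.nat₂, reassoc_of% e.nat₁]
  exact h₂

end Comparison

/-! ### Total complexes of bifunctors and mapping cones -/

section BifunctorCone

open HomologicalComplex CochainComplex.HomComplex CochainComplex.mappingCone

variable {C₁ C₂ D : Type*} [Category C₁] [Category C₂] [Category D]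
  [Preadditive C₁] [Preadditive C₂] [Preadditive D] [HasBinaryBiproducts C₁]
  [HasBinaryBiproducts D]
  (F : C₁ ⥤ C₂ ⥤ D) [F.Additive] [∀ X, (F.obj X).Additive]
  {K K' : CochainComplex C₁ ℤ} (φ : K ⟶ K') (L : CochainComplex C₂ ℤ)
  [HasMapBifunctor K L F (ComplexShape.up ℤ)] [HasMapBifunctor K' L F (ComplexShape.up ℤ)]
  [HasMapBifunctor (CochainComplex.mappingCone φ) L F (ComplexShape.up ℤ)]

omit [HasBinaryBiproducts C₁] [HasBinaryBiproducts D] in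
lemma ι_d (M : CochainComplex C₁ ℤ) [HasMapBifunctor M L F (ComplexShape.up ℤ)]
    (i j n m i' j' : ℤ) (h : i + j = n) (hm : n + 1 = m) (hi : i + 1 = i') (hj : j + 1 = j') :
    ιMapBifunctor M L F (ComplexShape.up ℤ) i j n h ≫
      (mapBifunctor M L F (ComplexShape.up ℤ)).d n m =
    (F.map (M.d i i')).app (L.X j) ≫ ιMapBifunctor M L F (ComplexShape.up ℤ) i' j m
      (by dsimp; omega) +
    i.negOnePow • ((F.obj (M.X i)).map (L.d j j') ≫
      ιMapBifunctor M L F (ComplexShape.up ℤ) i j' m (by dsimp; omega)) := by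
  subst hm hi hj
  exact ιMapBifunctor_d F M L i j n h

omit [HasBinaryBiproducts C₁] [HasBinaryBiproducts D] in
lemma ι_map {M M' : CochainComplex C₁ ℤ} [HasMapBifunctor M L F (ComplexShape.up ℤ)]
    [HasMapBifunctor M' L F (ComplexShape.up ℤ)] (f : M ⟶ M')
    (i j n : ℤ) (h : i + j = n) :
    ιMapBifunctor M L F (ComplexShape.up ℤ) i j n h ≫
      (mapBifunctorMap f (𝟙 L) F (ComplexShape.up ℤ)).f n =
    (F.map (f.f i)).app (L.X j) ≫ ιMapBifunctor M' L F (ComplexShape.up ℤ) i j n h := by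
  have := ι_mapBifunctorMap f (𝟙 L) F (ComplexShape.up ℤ) i j n h
  rw [HomologicalComplex.id_f, CategoryTheory.Functor.map_id, Category.id_comp] at this
  exact this

omit [HasBinaryBiproducts C₁] [HasBinaryBiproducts D] in
variable {F L} in
lemma tot_hom_ext {M : CochainComplex C₁ ℤ} [HasMapBifunctor M L F (ComplexShape.up ℤ)] {n : ℤ}
    {Y : D} {f g : (mapBifunctor M L F (ComplexShape.up ℤ)).X n ⟶ Y}
    (h : ∀ i j (h : i + j = n), ιMapBifunctor M L F (ComplexShape.up ℤ) i j n h ≫ f =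
      ιMapBifunctor M L F (ComplexShape.up ℤ) i j n h ≫ g) : f = g :=
  mapBifunctor.hom_ext h

/-- A morphism out of the total complex in degree `n`. -/
def totDesc (M : CochainComplex C₁ ℤ) [HasMapBifunctor M L F (ComplexShape.up ℤ)] {n : ℤ}
    {Y : D} (f : ∀ i j, i + j = n → ((F.obj (M.X i)).obj (L.X j) ⟶ Y)) :
    (mapBifunctor M L F (ComplexShape.up ℤ)).X n ⟶ Y :=
  mapBifunctorDesc f

omit [HasBinaryBiproducts C₁] [HasBinaryBiproducts D] in
lemma ι_totDesc (M : CochainComplex C₁ ℤ) [HasMapBifunctor M L F (ComplexShape.up ℤ)] {n : ℤ}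
    {Y : D} (f : ∀ i j, i + j = n → ((F.obj (M.X i)).obj (L.X j) ⟶ Y)) (i j : ℤ)
    (h : i + j = n) :
    ιMapBifunctor M L F (ComplexShape.up ℤ) i j n h ≫ totDesc F L M f = f i j h :=
  ι_mapBifunctorDesc (K₁ := M) (K₂ := L) (F := F) (c := ComplexShape.up ℤ) (j := n) f i j h

/-- The homotopy from the map induced by `φ` and `inr` to zero. -/
def bifunctorInl : Cochain (mapBifunctor K L F (ComplexShape.up ℤ))
    (mapBifunctor (CochainComplex.mappingCone φ) L F (ComplexShape.up ℤ)) (-1) :=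
  Cochain.mk fun n m hnm => totDesc F L K fun i j h =>
    (F.map ((inl φ).v i (i - 1) rfl)).app (L.X j) ≫
      ιMapBifunctor (CochainComplex.mappingCone φ) L F (ComplexShape.up ℤ) (i - 1) j m
        (by dsimp at h ⊢; omega)

omit [HasBinaryBiproducts D] [HasMapBifunctor K' L F (ComplexShape.up ℤ)] in
lemma ι_bifunctorInl (i j n m : ℤ) (h : i + j = n) (hnm : n + (-1) = m) (i' : ℤ)
    (hi : i + (-1) = i') :
    ιMapBifunctor K L F (ComplexShape.up ℤ) i j n h ≫ (bifunctorInl F φ L).v n m hnm =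
      (F.map ((inl φ).v i i' hi)).app (L.X j) ≫
        ιMapBifunctor (CochainComplex.mappingCone φ) L F (ComplexShape.up ℤ) i' j m
          (by dsimp; omega) := by
  obtain rfl : i' = i - 1 := by omega
  rw [bifunctorInl, Cochain.mk_v]
  exact ι_totDesc F L K _ i j h

-- The terms containing the differential of `L` cancel, since passing from `i` to `i - 1` flips the
-- sign `(-1)^i`. What remains is the boundary of `inl φ`, namely `φ` followed by `inr φ`.
omit [HasBinaryBiproducts D] in
lemma δ_bifunctorInl : δ (-1) 0 (bifunctorInl F φ L) =
    Cochain.ofHom (mapBifunctorMap φ (𝟙 L) F (ComplexShape.up ℤ) ≫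
      mapBifunctorMap (inr φ) (𝟙 L) F (ComplexShape.up ℤ)) := by
  refine Cochain.ext₀ _ _ fun n => ?_
  rw [δ_v (-1) 0 (by omega) _ n n (by omega) (n - 1) (n + 1) rfl rfl]
  refine tot_hom_ext (M := K) (F := F) (L := L) fun i j h => ?_
  have e₁ := ι_bifunctorInl F φ L i j n (n - 1) h (by omega) (i - 1) (by omega)
  have e₂ := ι_d F L K i j n (n + 1) (i + 1) (j + 1) h rfl rfl rfl
  have e₃ := ι_d F L (CochainComplex.mappingCone φ) (i - 1) j (n - 1) n i (j + 1) (by omega)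
    (by omega) (by omega) rfl
  have e₄ := inl_v_d φ i (i - 1) (i + 1) (by omega) (by omega)
  rw [Preadditive.comp_add, Linear.comp_units_smul, reassoc_of% e₁, reassoc_of% e₂,
    e₃, Preadditive.add_comp, Linear.units_smul_comp, Category.assoc, Category.assoc,
    ι_bifunctorInl F φ L (i + 1) j (n + 1) n (by omega) (by omega) i (by omega),
    ι_bifunctorInl F φ L i (j + 1) (n + 1) n (by omega) (by omega) (i - 1) (by omega),
    Cochain.ofHom_v, HomologicalComplex.comp_f, reassoc_of% (ι_map F L φ i j n h), ι_map,
    Preadditive.comp_add, ← NatTrans.comp_app_assoc, ← F.map_comp, e₄, F.map_sub, NatTrans.app_sub,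
    F.map_comp, F.map_comp, NatTrans.comp_app, NatTrans.comp_app, Preadditive.sub_comp,
    Category.assoc, Category.assoc, Linear.comp_units_smul, Int.negOnePow_sub, Int.negOnePow_one,
    Int.negOnePow_zero, one_smul, mul_neg, mul_one, Units.neg_smul,
    NatTrans.naturality_assoc]
  abel

/-- The comparison of the mapping cone of an induced map with the total complex of a mapping
cone. -/
def bifunctorCone : CochainComplex.mappingCone (mapBifunctorMap φ (𝟙 L) F (ComplexShape.up ℤ)) ⟶
    mapBifunctor (CochainComplex.mappingCone φ) L F (ComplexShape.up ℤ) :=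
  desc _ (bifunctorInl F φ L)
    (mapBifunctorMap (inr φ) (𝟙 L) F (ComplexShape.up ℤ)) (δ_bifunctorInl F φ L)

/-- The inverse of `bifunctorCone` in degree `n`. -/
def bifunctorConeInv (n : ℤ) :
    (mapBifunctor (CochainComplex.mappingCone φ) L F (ComplexShape.up ℤ)).X n ⟶
    (CochainComplex.mappingCone (mapBifunctorMap φ (𝟙 L) F (ComplexShape.up ℤ))).X n :=
  totDesc F L _ fun i j h =>
    (F.map ((fst φ).1.v i (i + 1) rfl)).app (L.X j) ≫
      ιMapBifunctor K L F (ComplexShape.up ℤ) (i + 1) j (n + 1) (by dsimp at h ⊢; omega) ≫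
      (inl _).v (n + 1) n (by omega) +
    (F.map ((snd φ).v i i (add_zero i))).app (L.X j) ≫
      ιMapBifunctor K' L F (ComplexShape.up ℤ) i j n h ≫ (inr _).f n

lemma ι_bifunctorConeInv (i j n i' n' : ℤ) (h : i + j = n) (hi : i + 1 = i') (hn : n + 1 = n') :
    ιMapBifunctor (CochainComplex.mappingCone φ) L F (ComplexShape.up ℤ) i j n h ≫
      bifunctorConeInv F φ L n =
    (F.map ((fst φ).1.v i i' hi)).app (L.X j) ≫
      ιMapBifunctor K L F (ComplexShape.up ℤ) i' j n' (by dsimp; omega) ≫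
      (inl _).v n' n (by omega) +
    (F.map ((snd φ).v i i (add_zero i))).app (L.X j) ≫
      ιMapBifunctor K' L F (ComplexShape.up ℤ) i j n h ≫ (inr _).f n := by
  subst hi hn
  rw [bifunctorConeInv]
  exact ι_totDesc F L (CochainComplex.mappingCone φ) _ i j h

lemma bifunctorCone_inv (n : ℤ) :
    (bifunctorCone F φ L).f n ≫ bifunctorConeInv F φ L n = 𝟙 _ := by
  refine (ext_from_iff _ (n + 1) n rfl _ _).2 ⟨?_, ?_⟩
  · refine (Category.assoc _ _ _).symm.trans ((congrArg (fun t => t ≫ bifunctorConeInv F φ L n)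
      (inl_v_desc_f _ _ _ _ _ _ _)).trans ?_)
    refine tot_hom_ext (M := K) (F := F) (L := L) fun i j h => ?_
    rw [reassoc_of% (ι_bifunctorInl F φ L i j (n + 1) n h (by omega) (i - 1) rfl),
      ι_bifunctorConeInv F φ L (i - 1) j n i (n + 1) (by omega) (by omega) rfl,
      Preadditive.comp_add, ← NatTrans.comp_app_assoc, ← NatTrans.comp_app_assoc, ← F.map_comp,
      ← F.map_comp, inl_v_fst_v, inl_v_snd_v, F.map_zero, NatTrans.app_zero, zero_comp, add_zero,
      F.map_id, NatTrans.id_app, Category.id_comp, Category.comp_id]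
  · refine (Category.assoc _ _ _).symm.trans ((congrArg (fun t => t ≫ bifunctorConeInv F φ L n)
      (inr_f_desc_f _ _ _ _ _)).trans ?_)
    refine tot_hom_ext (M := K') (F := F) (L := L) fun i j h => ?_
    rw [reassoc_of% (ι_map F L (inr φ) i j n h),
      ι_bifunctorConeInv F φ L i j n (i + 1) (n + 1) h rfl rfl,
      Preadditive.comp_add, ← NatTrans.comp_app_assoc, ← NatTrans.comp_app_assoc, ← F.map_comp,
      ← F.map_comp, inr_f_fst_v, inr_f_snd_v, F.map_zero, NatTrans.app_zero, zero_comp, zero_add,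
      F.map_id, NatTrans.id_app, Category.id_comp, Category.comp_id]

lemma inv_bifunctorCone (n : ℤ) :
    bifunctorConeInv F φ L n ≫ (bifunctorCone F φ L).f n = 𝟙 _ := by
  refine tot_hom_ext (M := CochainComplex.mappingCone φ) (F := F) (L := L) fun i j h => ?_
  rw [reassoc_of% (ι_bifunctorConeInv F φ L i j n (i + 1) (n + 1) h rfl rfl),
    Preadditive.add_comp, Category.assoc, Category.assoc, Category.assoc, Category.assoc,
    bifunctorCone, inl_v_desc_f, inr_f_desc_f,
    ι_bifunctorInl F φ L (i + 1) j (n + 1) n (by omega) (by omega) i (by omega), ι_map,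
    ← NatTrans.comp_app_assoc, ← NatTrans.comp_app_assoc, ← F.map_comp, ← F.map_comp,
    ← Preadditive.add_comp, ← NatTrans.app_add, ← F.map_add, id_X, F.map_id, NatTrans.id_app,
    Category.id_comp, Category.comp_id]

instance : IsIso (bifunctorCone F φ L) :=
  have (n : ℤ) : IsIso ((bifunctorCone F φ L).f n) :=
    ⟨bifunctorConeInv F φ L n, bifunctorCone_inv F φ L n, inv_bifunctorCone F φ L n⟩
  Hom.isIso_of_components _

/-- The mapping cone of an induced map is the total complex of the mapping cone. -/
def bifunctorConeIso :
    CochainComplex.mappingCone (mapBifunctorMap φ (𝟙 L) F (ComplexShape.up ℤ)) ≅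
    mapBifunctor (CochainComplex.mappingCone φ) L F (ComplexShape.up ℤ) :=
  asIso (bifunctorCone F φ L)

end BifunctorCone

/-! ### Complements on derived categories -/

section DerivedComplements

open DerivedCategory Pretriangulated ZeroObject

variable {C : Type*} [Category C] [Abelian C]

/-- A property of complexes which is stable under isomorphisms, shifts and mapping cones, and which
holds for objects of a class `𝓐` in degree zero, holds for bounded complexes with terms in `𝓐`. -/
lemma bounded_induction (P : ObjectProperty (CochainComplex C ℤ)) [P.IsClosedUnderIsomorphisms]
    (shift : ∀ K (n : ℤ), P K → P (K⟦n⟧))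
    (cone : ∀ {K L} (φ : K ⟶ L), P K → P L → P (CochainComplex.mappingCone φ))
    (zero : ∀ K, IsZero K → P K) (𝓐 : ObjectProperty C) [𝓐.IsClosedUnderIsomorphisms]
    (zero' : ∀ M, IsZero M → 𝓐 M)
    (single : ∀ M, 𝓐 M → P ((HomologicalComplex.single C (ComplexShape.up ℤ) 0).obj M))
    (K : CochainComplex C ℤ) (a b : ℤ) [K.IsStrictlyGE a] [K.IsStrictlyLE b]
    (hK : ∀ i, 𝓐 (K.X i)) : P K := by
  obtain ⟨n, hn⟩ : ∃ n : ℕ, b < a + n := ⟨(b - a + 1).toNat, by omega⟩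
  induction n generalizing K b with
  | zero =>
    refine zero _ ?_
    rw [IsZero.iff_id_eq_zero]
    ext i
    by_cases hi : i < a
    · exact (K.isZero_of_isStrictlyGE a i hi).eq_of_src _ _
    · exact (K.isZero_of_isStrictlyLE b i (by simp at hn; omega)).eq_of_src _ _
  | succ n ih =>
    -- The top term is a subcomplex, because the differential leaving degree `b` is zero. It is
    -- split off, and the quotient has one degree fewer.
    let ι : (HomologicalComplex.single C (ComplexShape.up ℤ) b).obj (K.X b) ⟶ K :=
      HomologicalComplex.mkHomFromSingle (𝟙 _) (fun k hk =>
        (K.isZero_of_isStrictlyLE b k (by have : b + 1 = k := hk; omega)).eq_of_tgt _ _)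
    have hι : IsIso (ι.f b) := by
      dsimp only [ι]
      rw [HomologicalComplex.mkHomFromSingle_f]
      infer_instance
    have hz : ∀ i, i ≠ b → IsZero (((HomologicalComplex.single C (ComplexShape.up ℤ) b).obj
        (K.X b)).X i) := fun i hi => HomologicalComplex.isZero_single_obj_X _ _ _ _ hi
    have : Mono ι := by
      have : ∀ i, Mono (ι.f i) := fun i => by
        by_cases hi : i = b
        · subst hi; infer_instance
        · exact ⟨fun _ _ _ => (hz i hi).eq_of_tgt _ _⟩
      exact HomologicalComplex.mono_of_mono_f ι this
    let S : ShortComplex (CochainComplex C ℤ) := ShortComplex.mk ι (cokernel.π ι) (by simp)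
    have hS : S.ShortExact := { exact := ShortComplex.exact_cokernel ι }
    have hS' := fun i => hS.map_of_exact (HomologicalComplex.eval C (ComplexShape.up ℤ) i)
    have hb : IsZero (S.X₃.X b) := by
      have : Epi (S.g.f b) := (hS' b).epi_g
      have h0 : S.g.f b = 0 := by
        rw [← cancel_epi (ι.f b), comp_zero]
        exact (HomologicalComplex.comp_f _ _ _).symm.trans (by
          rw [show ι ≫ S.g = 0 from S.zero]; rfl)
      exact IsZero.of_epi_eq_zero _ h0
    have hne : ∀ i, i ≠ b → IsIso (S.g.f i) := fun i hi => by
      have := (hS' i).exact.mono_g ((hz i hi).eq_of_src _ _)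
      have : Epi (S.g.f i) := (hS' i).epi_g
      have : Mono (S.g.f i) := ‹_›
      exact isIso_of_mono_of_epi _
    -- In each degree one of the two outer terms vanishes, so the sequence splits degreewise.
    let σ : ∀ i, (S.map (HomologicalComplex.eval C (ComplexShape.up ℤ) i)).Splitting := fun i =>
      if hi : i = b then .ofIsIsoOfIsZero _ (by subst hi; exact hι) (by subst hi; exact hb)
      else .ofIsZeroOfIsIso _ (hz i hi) (hne i hi)
    have h₃ : P S.X₃ := by
      have : S.X₃.IsStrictlyGE a := (CochainComplex.isStrictlyGE_iff _ _).2 fun i hi => by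
        by_cases h : i = b
        · subst h; exact hb
        · have := hne i h
          exact (K.isZero_of_isStrictlyGE a i hi).of_iso (asIso (S.g.f i)).symm
      have : S.X₃.IsStrictlyLE (b - 1) := (CochainComplex.isStrictlyLE_iff _ _).2 fun i hi => by
        by_cases h : i = b
        · subst h; exact hb
        · have := hne i h
          exact (K.isZero_of_isStrictlyLE b i (by omega)).of_iso (asIso (S.g.f i)).symm
      refine ih S.X₃ (b - 1) (fun i => ?_) (by push_cast at hn ⊢; omega)
      by_cases h : i = b
      · subst h; exact zero' _ hb
      · have := hne i h
        exact 𝓐.prop_of_iso (asIso (S.g.f i)) (hK i)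
    have h₁ : P S.X₁ := by
      refine P.prop_of_iso ?_ (shift _ (-b) (single _ (hK b)))
      exact ((CochainComplex.singleFunctors C).shiftIso (-b) b 0 (by omega)).app (K.X b)
    -- For a degreewise split sequence the shift `K⟦1⟧` is the cone of the connecting map from the
    -- quotient to the shifted subcomplex.
    have h₂ := cone (CochainComplex.homOfDegreewiseSplit S σ) h₃ (shift _ 1 h₁)
    have h₂' := shift _ (-1) (P.prop_of_iso
      (CochainComplex.mappingConeHomOfDegreewiseSplitIso S σ) h₂)
    exact P.prop_of_iso ((shiftEquiv (CochainComplex C ℤ) (1 : ℤ)).unitIso.app K).symm h₂'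

variable [HasDerivedCategory C]

/-- Acyclicity says that `K ⟶ 0` is a quasi-isomorphism, and these are the morphisms that `Q`
inverts. -/
lemma isZero_Q_iff (K : CochainComplex C ℤ) : IsZero (Q.obj K) ↔ K.Acyclic := by
  have h0 : (0 : CochainComplex C ℤ).Acyclic :=
    HomologicalComplex.acyclic_of_isZero _ (isZero_zero _)
  have hQ : IsZero (Q.obj (0 : CochainComplex C ℤ)) := Functor.map_isZero Q (isZero_zero _)
  have key : K.Acyclic ↔ QuasiIso (0 : K ⟶ 0) := by
    rw [quasiIso_iff]
    exact forall_congr' fun i => (quasiIsoAt_iff_exactAt' _ i (h0 i)).symm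
  rw [key, ← isIso_Q_map_iff_quasiIso]
  exact ⟨fun h => ⟨0, h.eq_of_src _ _, hQ.eq_of_src _ _⟩, fun h => hQ.of_iso (asIso (Q.map 0))⟩

lemma exists_cone_triangle {K L : CochainComplex C ℤ} (φ : K ⟶ L) :
    ∃ h, Triangle.mk (Q.map φ) (Q.map (CochainComplex.mappingCone.inr φ)) h ∈
      distTriang (DerivedCategory C) :=
  ⟨_, mappingCone_triangle_distinguished φ⟩

lemma trW_Q_map_iff (P : ObjectProperty (DerivedCategory C)) [P.IsClosedUnderIsomorphisms]
    {K L : CochainComplex C ℤ} (φ : K ⟶ L) :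
    P.trW (Q.map φ) ↔ P (Q.obj (CochainComplex.mappingCone φ)) :=
  P.trW_iff_of_distinguished _ (mappingCone_triangle_distinguished φ)

lemma acyclic_mappingCone_iff {K L : CochainComplex C ℤ} (φ : K ⟶ L) :
    (CochainComplex.mappingCone φ).Acyclic ↔ QuasiIso φ := by
  rw [← isZero_Q_iff, ← isIso_Q_map_iff_quasiIso]
  exact Triangle.isZero₃_iff_isIso₁ _ (mappingCone_triangle_distinguished φ)

/-- Out of a `K`-projective complex, morphisms in the derived category are homotopy classes, and
each class has a representative. This replaces the choice of derived functors below. -/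
lemma exists_Q_map_eq {K : CochainComplex C ℤ} [K.IsKProjective] {L : CochainComplex C ℤ}
    (f : Q.obj K ⟶ Q.obj L) : ∃ φ : K ⟶ L, Q.map φ = f := by
  obtain ⟨g, hg⟩ := (CochainComplex.IsKProjective.Qh_map_bijective K
    ((HomotopyCategory.quotient C _).obj L)).2
    ((quotientCompQhIso C).hom.app K ≫ f ≫ (quotientCompQhIso C).inv.app L)
  obtain ⟨φ, rfl⟩ := (HomotopyCategory.quotient C _).map_surjective g
  refine ⟨φ, ?_⟩
  rw [← cancel_epi ((quotientCompQhIso C).hom.app K), ← quotientCompQhIso_hom_naturality, hg]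
  simp

lemma homotopy_of_Q_map_eq {K : CochainComplex C ℤ} [K.IsKProjective] {L : CochainComplex C ℤ}
    {φ ψ : K ⟶ L} (h : Q.map φ = Q.map ψ) : Nonempty (Homotopy φ ψ) := by
  refine ⟨HomotopyCategory.homotopyOfEq _ _ ?_⟩
  apply (CochainComplex.IsKProjective.Qh_map_bijective K
    ((HomotopyCategory.quotient C _).obj L)).1
  rw [← cancel_mono ((quotientCompQhIso C).hom.app L), quotientCompQhIso_hom_naturality,
    quotientCompQhIso_hom_naturality, h]

/-- A triangulated subcategory is given by a class of objects stable under isomorphisms, shifts and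
extensions. -/
lemma isTriangulated_of {D : Type*} [Category D] [HasZeroObject D] [HasShift D ℤ] [Preadditive D]
    [∀ n : ℤ, (shiftFunctor D n).Additive] [Pretriangulated D] (P : ObjectProperty D)
    [P.IsClosedUnderIsomorphisms] (zero : ∀ X, IsZero X → P X)
    (shift : ∀ X (n : ℤ), P X → P (X⟦n⟧))
    (ext : ∀ T ∈ distTriang D, P T.obj₁ → P T.obj₃ → P T.obj₂) : P.IsTriangulated where
  exists_zero := ⟨0, isZero_zero _, zero _ (isZero_zero _)⟩
  isStableUnderShiftBy n := ⟨fun X hX => shift X n hX⟩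
  toIsTriangulatedClosed₂ := .mk' (fun T hT h₁ h₃ => ext T hT h₁ h₃)

end DerivedComplements

/-! ### Tensor products with complexes concentrated in degree zero -/

section SingleTensor

open HomologicalComplex

variable {C₁ C₂ D : Type*} [Category C₁] [Category C₂] [Category D]
  [Preadditive C₁] [Preadditive C₂] [Preadditive D] [HasZeroObject C₂]
  (F : C₁ ⥤ C₂ ⥤ D) [F.Additive] [∀ X, (F.obj X).Additive]
  (K : CochainComplex C₁ ℤ) (N : C₂)
  [HasMapBifunctor K ((single C₂ (ComplexShape.up ℤ) 0).obj N) F (ComplexShape.up ℤ)]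

instance (N : C₂) : (F.flip.obj N).Additive where

/-- The components of the comparison between a total complex with a complex concentrated in degree
zero and the functor applied termwise. -/
def singleTensorX (n : ℤ) :
    (F.obj (K.X n)).obj N ⟶ (mapBifunctor K ((single C₂ (ComplexShape.up ℤ) 0).obj N) F
      (ComplexShape.up ℤ)).X n :=
  (F.obj (K.X n)).map (singleObjXSelf (ComplexShape.up ℤ) 0 N).inv ≫
    ιMapBifunctor K ((single C₂ (ComplexShape.up ℤ) 0).obj N) F (ComplexShape.up ℤ) n 0 n
      (add_zero n)

/-- The inverse of `singleTensorX`. -/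
def singleTensorInvX (n : ℤ) : (mapBifunctor K ((single C₂ (ComplexShape.up ℤ) 0).obj N) F
      (ComplexShape.up ℤ)).X n ⟶ (F.obj (K.X n)).obj N :=
  totDesc F _ K fun i j h => if hj : j = 0 then
      (F.obj (K.X i)).map (singleObjXIsoOfEq (ComplexShape.up ℤ) 0 N j hj).hom ≫
        (F.map (K.XIsoOfEq (by omega)).hom).app N else 0

lemma ι_singleTensorInvX (n : ℤ) :
    ιMapBifunctor K ((single C₂ (ComplexShape.up ℤ) 0).obj N) F (ComplexShape.up ℤ) n 0 n
      (add_zero n) ≫ singleTensorInvX F K N n =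
    (F.obj (K.X n)).map (singleObjXSelf (ComplexShape.up ℤ) 0 N).hom := by
  rw [singleTensorInvX, ι_totDesc, dif_pos rfl, XIsoOfEq_rfl, Iso.refl_hom, F.map_id,
    NatTrans.id_app]
  exact Category.comp_id _

lemma singleTensorX_inv (n : ℤ) : singleTensorX F K N n ≫ singleTensorInvX F K N n = 𝟙 _ := by
  rw [singleTensorX, Category.assoc, ι_singleTensorInvX, ← Functor.map_comp, Iso.inv_hom_id,
    CategoryTheory.Functor.map_id]

lemma inv_singleTensorX (n : ℤ) : singleTensorInvX F K N n ≫ singleTensorX F K N n = 𝟙 _ := by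
  refine tot_hom_ext (M := K) (F := F) fun i j h => ?_
  by_cases hj : j = 0
  · obtain rfl : n = i := by omega
    subst hj
    rw [← Category.assoc, ι_singleTensorInvX, singleTensorX, ← Category.assoc, ← Functor.map_comp,
      Iso.hom_inv_id, CategoryTheory.Functor.map_id, Category.comp_id, Category.id_comp]
  · exact (Functor.map_isZero (F.obj (K.X i)) (isZero_single_obj_X (ComplexShape.up ℤ) 0 N j
      hj)).eq_of_src _ _

lemma singleTensorX_comm (n : ℤ) :
    singleTensorX F K N n ≫ (mapBifunctor K ((single C₂ (ComplexShape.up ℤ) 0).obj N) F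
      (ComplexShape.up ℤ)).d n (n + 1) =
    (F.map (K.d n (n + 1))).app N ≫ singleTensorX F K N (n + 1) := by
  rw [singleTensorX, Category.assoc, ι_d F _ K n 0 n (n + 1) (n + 1) (0 + 1) (add_zero n) rfl rfl
    rfl, single_obj_d, Functor.map_zero, zero_comp, smul_zero, add_zero, singleTensorX,
    NatTrans.naturality_assoc]

/-- The total complex of `K` and an object `N` in degree zero is obtained by applying the functor
`F(-, N)` to the terms of `K`. -/
def singleTensorIso : ((F.flip.obj N).mapHomologicalComplex (ComplexShape.up ℤ)).obj K ≅
    mapBifunctor K ((single C₂ (ComplexShape.up ℤ) 0).obj N) F (ComplexShape.up ℤ) :=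
  Hom.isoOfComponents
    (fun n => ⟨singleTensorX F K N n, singleTensorInvX F K N n, singleTensorX_inv F K N n,
      inv_singleTensorX F K N n⟩) (fun n m hnm => by
      obtain rfl : n + 1 = m := hnm
      exact singleTensorX_comm F K N n)

variable {K N} in
lemma singleTensorIso_naturality {K' : CochainComplex C₁ ℤ} {N' : C₂}
    [HasMapBifunctor K' ((single C₂ (ComplexShape.up ℤ) 0).obj N') F (ComplexShape.up ℤ)]
    (φ : K ⟶ K') (ψ : N ⟶ N') :
    (singleTensorIso F K N).hom ≫ mapBifunctorMap φ ((single C₂ (ComplexShape.up ℤ) 0).map ψ) F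
      (ComplexShape.up ℤ) =
    ((F.flip.obj N).mapHomologicalComplex (ComplexShape.up ℤ)).map φ ≫
      (NatTrans.mapHomologicalComplex (F.flip.map ψ) (ComplexShape.up ℤ)).app K' ≫
      (singleTensorIso F K' N').hom := by
  ext n : 1
  change singleTensorX F K N n ≫ (mapBifunctorMap φ ((single C₂ (ComplexShape.up ℤ) 0).map ψ) F
      (ComplexShape.up ℤ)).f n = (F.map (φ.f n)).app N ≫ (F.obj (K'.X n)).map ψ ≫
        singleTensorX F K' N' n
  rw [singleTensorX, singleTensorX, Category.assoc, ι_mapBifunctorMap, NatTrans.naturality_assoc,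
    single_map_f_self, ← Functor.map_comp_assoc, ← Functor.map_comp_assoc, Iso.inv_hom_id_assoc]

end SingleTensor

/-! ### The symmetry of the tensor product of complexes -/

section Symmetry

open HomologicalComplex MonoidalCategory

variable {A : Type u} {G : Type v} [CommRing A] [Group G] [MulSemiringAction G A]

/-- The tensor product of complexes of `AG`-modules. -/
local infixr:70 " ⊠ " => MonoidalCategoryStruct.tensorObj

lemma whiskerRight_eq {K K' : CochainComplex (SkewMod A G) ℤ} (φ : K ⟶ K')
    (L : CochainComplex (SkewMod A G) ℤ) :
    φ ▷ L = mapBifunctorMap φ (𝟙 L) (tensorBifunctor A G) (ComplexShape.up ℤ) := rfl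

instance : (tensorBifunctor A G).flip.Additive where
  map_add {M M' φ ψ} := by
    ext N : 2
    exact tensorMod_hom_ext fun _ _ => TensorProduct.tmul_add (R := A) _ _ _

variable (A G) in
/-- The symmetry, as a comparison of bifunctors. -/
def flipComparison : BifunctorComparison (tensorBifunctor A G).flip (tensorBifunctor A G)
    (𝟭 _) (𝟭 _) (𝟭 _) where
  iso X Y := tensorComm X Y
  nat₁ _ _ := tensorMod_hom_ext fun _ _ => rfl
  nat₂ _ _ _ _ := tensorMod_hom_ext fun _ _ => rfl

/-- The symmetry of the tensor product of complexes. -/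
def cplxComm (K L : CochainComplex (SkewMod A G) ℤ) : K ⊠ L ≅ L ⊠ K :=
  -- The first isomorphism swaps the modules term by term; the Koszul sign is carried by the second.
  mapBifunctorComparisonIso (flipComparison A G) K L ≪≫
    mapBifunctorFlipIso L K (tensorBifunctor A G) (ComplexShape.up ℤ)

lemma cplxComm_naturality {K K' L L' : CochainComplex (SkewMod A G) ℤ} (f : K ⟶ K') (g : L ⟶ L') :
    (f ⊗ₘ g) ≫ (cplxComm K' L').hom = (cplxComm K L).hom ≫ (g ⊗ₘ f) := by
  have h₁ := mapBifunctorComparison_naturality (flipComparison A G) f g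
  have h₂ := mapBifunctorFlipIso_hom_naturality g f (tensorBifunctor A G) (ComplexShape.up ℤ)
  have h₃ := congrArg (fun t => t ≫ (mapBifunctorFlipIso L' K' (tensorBifunctor A G)
    (ComplexShape.up ℤ)).hom) h₁
  refine (Category.assoc _ _ _).symm.trans (h₃.trans ?_)
  exact (Category.assoc _ _ _).trans ((congrArg (fun t => mapBifunctorComparison
    (flipComparison A G) K L ≫ t) h₂).trans (Category.assoc _ _ _).symm)

/-! ### Tensor products and mapping cones, shifts and homotopies -/

/-- `mappingCone (φ ⊗ L) ≅ mappingCone φ ⊗ L`. -/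
def coneTensorIso {K K' : CochainComplex (SkewMod A G) ℤ} (φ : K ⟶ K')
    (L : CochainComplex (SkewMod A G) ℤ) :
    CochainComplex.mappingCone (φ ▷ L) ≅ CochainComplex.mappingCone φ ⊠ L :=
  bifunctorConeIso (tensorBifunctor A G) φ L

lemma inr_coneTensorIso {K K' : CochainComplex (SkewMod A G) ℤ} (φ : K ⟶ K')
    (L : CochainComplex (SkewMod A G) ℤ) :
    CochainComplex.mappingCone.inr (φ ▷ L) ≫ (coneTensorIso φ L).hom =
      CochainComplex.mappingCone.inr φ ▷ L :=
  CochainComplex.mappingCone.inr_desc _ _ _ (δ_bifunctorInl (tensorBifunctor A G) φ L)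

/-- `K⟦n⟧ ⊗ L ≅ (K ⊗ L)⟦n⟧`. -/
def shiftTensorIso (K L : CochainComplex (SkewMod A G) ℤ) (n : ℤ) :
    K⟦n⟧ ⊠ L ≅ (K ⊠ L)⟦n⟧ :=
  CochainComplex.mapBifunctorShift₁Iso K L (tensorBifunctor A G) n

/-- The tensor product with a module in degree zero is computed termwise. -/
def tensorSingleIso (K : CochainComplex (SkewMod A G) ℤ) (N : SkewMod A G) :
    (((tensorBifunctor A G).flip.obj N).mapHomologicalComplex (ComplexShape.up ℤ)).obj K ≅
      K ⊠ (single (SkewMod A G) (ComplexShape.up ℤ) 0).obj N :=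
  singleTensorIso (tensorBifunctor A G) K N

lemma isZero_tensor {K : CochainComplex (SkewMod A G) ℤ} (hK : IsZero K)
    (L : CochainComplex (SkewMod A G) ℤ) : IsZero (K ⊠ L) := by
  rw [IsZero.iff_id_eq_zero] at hK ⊢
  rw [← id_whiskerRight, hK, whiskerRight_eq]
  ext n : 1
  refine tot_hom_ext (M := K) (F := tensorBifunctor A G) fun i j h => ?_
  rw [ι_map, HomologicalComplex.zero_f, HomologicalComplex.zero_f, Functor.map_zero,
    NatTrans.app_zero, zero_comp]
  exact comp_zero.symm

end Symmetry

/-! ### Total complexes of bifunctors and homotopy equivalences -/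

section

open HomologicalComplex

variable {C₁ C₂ D : Type*} [Category C₁] [Category C₂] [Category D]
  [Preadditive C₁] [Preadditive C₂] [Preadditive D]
  (F : C₁ ⥤ C₂ ⥤ D) [F.Additive] [∀ X, (F.obj X).Additive]

lemma mapBifunctorMap_id (K : CochainComplex C₁ ℤ) (M : CochainComplex C₂ ℤ)
    [HasMapBifunctor K M F (ComplexShape.up ℤ)] :
    mapBifunctorMap (𝟙 K) (𝟙 M) F (ComplexShape.up ℤ) = 𝟙 _ := by
  ext n i j h
  simp

lemma mapBifunctorMap_comp_left {K L N : CochainComplex C₁ ℤ} (f : K ⟶ L) (g : L ⟶ N)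
    (M : CochainComplex C₂ ℤ) [HasMapBifunctor K M F (ComplexShape.up ℤ)]
    [HasMapBifunctor L M F (ComplexShape.up ℤ)] [HasMapBifunctor N M F (ComplexShape.up ℤ)] :
    mapBifunctorMap f (𝟙 M) F (ComplexShape.up ℤ) ≫ mapBifunctorMap g (𝟙 M) F (ComplexShape.up ℤ) =
      mapBifunctorMap (f ≫ g) (𝟙 M) F (ComplexShape.up ℤ) := by
  ext n i j h
  simp

/-- The functor induced by a bifunctor preserves homotopy equivalences. -/
def homotopyEquivTensor {K L : CochainComplex C₁ ℤ} (e : HomotopyEquiv K L)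
    (M : CochainComplex C₂ ℤ) [HasMapBifunctor K M F (ComplexShape.up ℤ)]
    [HasMapBifunctor L M F (ComplexShape.up ℤ)] :
    HomotopyEquiv (mapBifunctor K M F (ComplexShape.up ℤ))
      (mapBifunctor L M F (ComplexShape.up ℤ)) where
  hom := mapBifunctorMap e.hom (𝟙 M) _ _
  inv := mapBifunctorMap e.inv (𝟙 M) _ _
  homotopyHomInvId := (Homotopy.ofEq (mapBifunctorMap_comp_left F _ _ M)).trans
    ((mapBifunctorMapHomotopy₁ e.homotopyHomInvId (𝟙 M) _ _).trans
      (Homotopy.ofEq (mapBifunctorMap_id F K M)))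
  homotopyInvHomId := (Homotopy.ofEq (mapBifunctorMap_comp_left F _ _ M)).trans
    ((mapBifunctorMapHomotopy₁ e.homotopyInvHomId (𝟙 M) _ _).trans
      (Homotopy.ofEq (mapBifunctorMap_id F L M)))

end

/-! ### Complexes of `A`-projective modules -/

section RelProj

open HomologicalComplex MonoidalCategory

variable {A : Type u} {G : Type v} [CommRing A] [Group G] [MulSemiringAction G A]

/-- The tensor product of complexes of `AG`-modules. -/
local infixr:70 " ⊠ " => MonoidalCategoryStruct.tensorObj

variable (A G) in
/-- The tensor product commutes with forgetting the action of `G`. -/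
def toModComparison : BifunctorComparison (tensorBifunctor A G)
    (MonoidalCategory.curriedTensor (ModuleCat.{u} A)) (toMod A G) (toMod A G) (toMod A G) where
  iso X Y := (tensorEquiv X Y).symm.toModuleIso
  nat₁ _ _ := ModuleCat.hom_ext (TensorProduct.ext' fun _ _ => rfl)
  nat₂ _ _ _ _ := ModuleCat.hom_ext (TensorProduct.ext' fun _ _ => rfl)

variable (A G) in
/-- The functor on complexes forgetting the action of `G`. -/
abbrev toModCplx : CochainComplex (SkewMod A G) ℤ ⥤ CochainComplex (ModuleCat.{u} A) ℤ :=
  (toMod A G).mapHomologicalComplex (ComplexShape.up ℤ)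

/-- Bounded above complexes of `AG`-modules which are projective over `A`. -/
structure IsRelProj (K : CochainComplex (SkewMod A G) ℤ) : Prop where
  bdd : ∃ b : ℤ, K.IsStrictlyLE b
  proj : ∀ i, Module.Projective A ((toMod A G).obj (K.X i))

instance {C D : Type*} [Category C] [Category D] [HasZeroObject C] [HasZeroObject D]
    [Preadditive C] [Preadditive D] (F : C ⥤ D) [F.Additive] (K : CochainComplex C ℤ) (b : ℤ)
    [K.IsStrictlyLE b] :
    CochainComplex.IsStrictlyLE ((F.mapHomologicalComplex (ComplexShape.up ℤ)).obj K) b :=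
  (CochainComplex.isStrictlyLE_iff _ _).2 fun i hi =>
    F.map_isZero (K.isZero_of_isStrictlyLE b i hi)

instance {C D : Type*} [Category C] [Category D] [HasZeroObject C] [HasZeroObject D]
    [Preadditive C] [Preadditive D] (F : C ⥤ D) [F.Additive] (K : CochainComplex C ℤ) (b : ℤ)
    [K.IsStrictlyGE b] :
    CochainComplex.IsStrictlyGE ((F.mapHomologicalComplex (ComplexShape.up ℤ)).obj K) b :=
  (CochainComplex.isStrictlyGE_iff _ _).2 fun i hi =>
    F.map_isZero (K.isZero_of_isStrictlyGE b i hi)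

lemma isKProjective_of_module_projective {R : Type*} [Ring R] [Small.{u} R]
    (K : CochainComplex (ModuleCat.{u} R) ℤ) (hb : ∃ b : ℤ, K.IsStrictlyLE b) (hK : ∀ i, Module.Projective R (K.X i)) :
    K.IsKProjective := by
  obtain ⟨b, hb⟩ := hb
  have (i : ℤ) : Projective (K.X i) := by
    have := hK i
    exact (IsProjective.iff_projective (K.X i)).1 (hK i)
  exact CochainComplex.isKProjective_of_projective K b

lemma IsRelProj.isKProjective {K : CochainComplex (SkewMod A G) ℤ} (hK : IsRelProj K) :
    ((toModCplx A G).obj K).IsKProjective :=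
  isKProjective_of_module_projective _ (by
    obtain ⟨b, hb⟩ := hK.bdd
    exact ⟨b, inferInstance⟩) hK.proj

instance : (toMod A G).ReflectsIsomorphisms := inferInstance

lemma quasiIso_toModCplx_iff {K L : CochainComplex (SkewMod A G) ℤ} (φ : K ⟶ L) :
    QuasiIso ((toModCplx A G).map φ) ↔ QuasiIso φ :=
  quasiIso_map_iff_of_preservesHomology φ (toMod A G)

/-- A quasi-isomorphism between bounded above complexes of `A`-projective modules is a homotopy
equivalence over `A`. -/
lemma exists_homotopyEquiv {K L : CochainComplex (SkewMod A G) ℤ} (hK : IsRelProj K)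
    (hL : IsRelProj L) (φ : K ⟶ L) [QuasiIso φ] :
    ∃ e : HomotopyEquiv ((toModCplx A G).obj K) ((toModCplx A G).obj L),
      e.hom = (toModCplx A G).map φ := by
  have := hK.isKProjective
  have := hL.isKProjective
  exact (CochainComplex.IsKProjective.quasiIso_iff ((toModCplx A G).map φ)).1
    ((quasiIso_toModCplx_iff φ).2 inferInstance)

lemma quasiIso_of_arrow_iso {C : Type*} [Category C] [Abelian C] {K L K' L' : CochainComplex C ℤ}
    {φ : K ⟶ L} {ψ : K' ⟶ L'} (e₁ : K ≅ K') (e₂ : L ≅ L') (h : φ ≫ e₂.hom = e₁.hom ≫ ψ)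
    [QuasiIso ψ] : QuasiIso φ := by
  have : φ = e₁.hom ≫ ψ ≫ e₂.inv := by rw [← Category.assoc, ← h, Category.assoc,
    e₂.hom_inv_id, Category.comp_id]
  rw [this]
  infer_instance

/-- Over `A` the map `φ` is a homotopy equivalence, which stays one after tensoring with an
arbitrary complex, and quasi-isomorphisms are detected over `A`. Thus projectivity over `A`, not
over `AG`, suffices to compute derived tensor products. -/
lemma quasiIso_whiskerRight {K L : CochainComplex (SkewMod A G) ℤ} (hK : IsRelProj K)
    (hL : IsRelProj L) (φ : K ⟶ L) [QuasiIso φ] (M : CochainComplex (SkewMod A G) ℤ) :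
    QuasiIso (φ ▷ M) := by
  obtain ⟨e, he⟩ := exists_homotopyEquiv hK hL φ
  have h₁ : QuasiIso (homotopyEquivTensor (curriedTensor (ModuleCat.{u} A)) e ((toModCplx A G).obj M)).hom := inferInstance
  rw [← quasiIso_toModCplx_iff]
  have h₂ := mapBifunctorComparison_naturality (toModComparison A G) φ (𝟙 M)
  have h₃ : mapBifunctorMap ((toModCplx A G).map φ) ((toModCplx A G).map (𝟙 M))
      (curriedTensor (ModuleCat.{u} A)) (ComplexShape.up ℤ) =
      (homotopyEquivTensor (curriedTensor (ModuleCat.{u} A)) e ((toModCplx A G).obj M)).hom := by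
    rw [CategoryTheory.Functor.map_id, ← he]; rfl
  rw [h₃] at h₂
  refine quasiIso_of_arrow_iso (mapBifunctorComparisonIso (toModComparison A G) K M).symm
    (mapBifunctorComparisonIso (toModComparison A G) L M).symm
    (ψ := (homotopyEquivTensor (curriedTensor (ModuleCat.{u} A)) e ((toModCplx A G).obj M)).hom) ?_
  refine (Iso.eq_inv_comp _).2 ?_
  rw [← Category.assoc]
  exact (Iso.comp_inv_eq _).2 h₂.symm

/-! ### Tensor products with bounded complexes of `A`-projective modules -/

variable (A G) in
/-- The tensor product on the right commutes with forgetting the action. -/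
def tensorRightToModIso (N : SkewMod A G) : (tensorBifunctor A G).flip.obj N ⋙ toMod A G ≅
    toMod A G ⋙ MonoidalCategory.tensorRight ((toMod A G).obj N) :=
  NatIso.ofComponents (fun M => (tensorEquiv M N).toModuleIso) (fun _ =>
    ModuleCat.hom_ext (tensorMod_linearMap_ext fun _ _ => rfl))

/-- Exactness may be tested after forgetting the action, where it is flatness of `N`. -/
lemma tensorRight_exact (N : SkewMod A G) [Module.Flat A ((toMod A G).obj N)]
    (S : ShortComplex (SkewMod A G)) (hS : S.Exact) :
    (S.map ((tensorBifunctor A G).flip.obj N)).Exact := by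
  rw [← ShortComplex.exact_map_iff_of_faithful _ (toMod A G)]
  refine ShortComplex.exact_of_iso (S.mapNatIso (tensorRightToModIso A G N)).symm ?_
  exact Module.Flat.rTensor_shortComplex_exact _ (S.map (toMod A G)) (hS.map (toMod A G))

lemma acyclic_of_iso {C : Type*} [Category C] [Abelian C] {K L : CochainComplex C ℤ}
    (h : K.Acyclic) (e : K ≅ L) : L.Acyclic := fun i => (h i).of_iso e

lemma acyclic_tensor_single (N : SkewMod A G) [Module.Flat A ((toMod A G).obj N)]
    (Z : CochainComplex (SkewMod A G) ℤ) (hZ : Z.Acyclic) :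
    (Z ⊠ (single (SkewMod A G) (ComplexShape.up ℤ) 0).obj N).Acyclic :=
  acyclic_of_iso (K := (((tensorBifunctor A G).flip.obj N).mapHomologicalComplex
    (ComplexShape.up ℤ)).obj Z) (fun i => tensorRight_exact N (Z.sc i) (hZ i)) (tensorSingleIso Z N)

lemma acyclic_mappingCone {C : Type*} [Category C] [Abelian C] {K L : CochainComplex C ℤ}
    (φ : K ⟶ L) (hK : K.Acyclic) (hL : L.Acyclic) :
    (CochainComplex.mappingCone φ).Acyclic := by
  let _ := HasDerivedCategory.standard C
  rw [acyclic_mappingCone_iff, quasiIso_iff]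
  exact fun i => (quasiIsoAt_iff_exactAt' _ i (hL i)).2 (hK i)

lemma acyclic_shift {C : Type*} [Category C] [Abelian C] {K : CochainComplex C ℤ} (n : ℤ)
    (hK : K.Acyclic) : (K⟦n⟧).Acyclic := by
  let _ := HasDerivedCategory.standard C
  rw [← isZero_Q_iff] at hK ⊢
  exact ((shiftFunctor _ n).map_isZero hK).of_iso ((DerivedCategory.Q.commShiftIso n).app K)

/-- The tensor product of a bounded complex of `A`-projective modules with an acyclic complex is
acyclic. -/
lemma acyclic_tensor (W : CochainComplex (SkewMod A G) ℤ) (a b : ℤ) [W.IsStrictlyGE a]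
    [W.IsStrictlyLE b] (hW : ∀ i, Module.Projective A ((toMod A G).obj (W.X i)))
    (Z : CochainComplex (SkewMod A G) ℤ) (hZ : Z.Acyclic) : (W ⊠ Z).Acyclic := by
  let P : ObjectProperty (CochainComplex (SkewMod A G) ℤ) := fun W => (W ⊠ Z).Acyclic
  let 𝓐 : ObjectProperty (SkewMod A G) := fun N => Module.Projective A ((toMod A G).obj N)
  have : P.IsClosedUnderIsomorphisms := ⟨fun e h => acyclic_of_iso h (whiskerRightIso e Z)⟩
  have : 𝓐.IsClosedUnderIsomorphisms := ⟨fun e (h : Module.Projective _ _) =>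
    Module.Projective.of_equiv ((toMod A G).mapIso e).toLinearEquiv⟩
  -- Dévissage in `W`: shifts and cones commute with `- ⊗ Z`, and a single module is flat over `A`.
  refine bounded_induction P (fun K n hK => ?_) (fun φ hK hL => ?_) (fun K hK => ?_) 𝓐
    (fun M hM => ?_) (fun M (hM : Module.Projective _ _) => ?_) W a b hW
  · exact acyclic_of_iso (acyclic_shift n hK) (shiftTensorIso K Z n).symm
  · exact acyclic_of_iso (acyclic_mappingCone (φ ▷ Z) hK hL) (coneTensorIso φ Z)
  · exact acyclic_of_isZero _ (isZero_tensor hK Z)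
  · have : Subsingleton ((toMod A G).obj M) :=
      ModuleCat.subsingleton_of_isZero ((toMod A G).map_isZero hM)
    infer_instance
  · have : Module.Flat A ((toMod A G).obj M) := inferInstance
    exact acyclic_of_iso (acyclic_tensor_single M Z hZ) (cplxComm _ _)

end RelProj

/-! ### Finitely generated modules over the skew group ring -/

section FiniteModules

variable {A : Type u} {G : Type v} [CommRing A] [Group G] [MulSemiringAction G A]

lemma incl_mul (a : A) (r : SkewGroupRing A G) : incl A G a * r = a • r := by
  induction r using SkewMonoidAlgebra.induction_on with
  | zero => rw [mul_zero, smul_zero]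
  | single g b =>
    change SkewMonoidAlgebra.single 1 a * SkewMonoidAlgebra.single g b = _
    simp [SkewMonoidAlgebra.single_mul_single, SkewMonoidAlgebra.smul_single]
  | add r s hr hs => rw [mul_add, smul_add, hr, hs]

/-- Projective `AG`-modules are projective over `A`. -/
lemma projective_toMod (M : SkewMod A G) [h : Module.Projective (SkewGroupRing A G) M] :
    Module.Projective A ((toMod A G).obj M) := by
  obtain ⟨s, hs⟩ := Module.projective_def'.1 h
  -- Since `AG` is `A`-free on `G`, an `AG`-linear splitting of a free cover is a splitting off a
  -- free `A`-module.
  have : Module.Free A (SkewGroupRing A G) :=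
    Module.Free.of_basis (SkewMonoidAlgebra.basisSingleOne)
  have smul_eq (a : A) (x : M →₀ SkewGroupRing A G) : a • x = incl A G a • x := by
    ext1 m
    exact (incl_mul a (x m)).symm
  let i : (toMod A G).obj M →ₗ[A] (M →₀ SkewGroupRing A G) :=
    { toFun := fun x => s x
      map_add' := fun x y => s.map_add x y
      map_smul' := fun a x => (s.map_smul (incl A G a) x).trans (smul_eq a (s x)).symm }
  let p : (M →₀ SkewGroupRing A G) →ₗ[A] (toMod A G).obj M :=
    { toFun := fun x => Finsupp.linearCombination (SkewGroupRing A G) (id : M → M) x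
      map_add' := fun x y => map_add _ x y
      map_smul' := fun a x => (congrArg _ (smul_eq a x)).trans
        ((Finsupp.linearCombination (SkewGroupRing A G) (id : M → M)).map_smul (incl A G a) x) }
  exact Module.Projective.of_split i p (LinearMap.ext fun x => LinearMap.congr_fun hs x)

lemma finite_of_finite_toMod (M : SkewMod A G) [h : Module.Finite A ((toMod A G).obj M)] :
    Module.Finite (SkewGroupRing A G) M := by
  obtain ⟨s, hs⟩ := h
  let s' : Finset M := s
  let N : Submodule (SkewGroupRing A G) M := Submodule.span _ (s' : Set M)
  let N' : Submodule A ((toMod A G).obj M) :=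
    { carrier := (N : Set M)
      add_mem' := fun hx hy => N.add_mem hx hy
      zero_mem' := N.zero_mem
      smul_mem' := fun a x hx => N.smul_mem (incl A G a) hx }
  have key : Submodule.span A (s : Set ((toMod A G).obj M)) ≤ N' :=
    Submodule.span_le.2 (Submodule.subset_span : (s' : Set M) ⊆ N)
  rw [hs] at key
  have key' : ∀ x : M, x ∈ N := fun x => key (x := (x : (toMod A G).obj M)) Submodule.mem_top
  exact ⟨s', top_unique fun x _ => key' x⟩

variable [Finite G]

/-- The ring `AG` lies in `Type max u v`. For finite `G` it embeds into a finite power of `A`, so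
free modules of finite rank have models in the universe of `SkewMod A G`. -/
instance : Small.{u} (SkewGroupRing A G) := by
  have := Fintype.ofFinite G
  exact small_of_injective (β := Fin (Fintype.card G) → A)
    (f := fun r i => r.coeff ((Fintype.equivFin G).symm i)) fun r s h => by
      ext g
      have := congrFun h (Fintype.equivFin G g)
      simpa using this

/-- The finitely many `G`-translates of a set of `AG`-generators generate over `A`. -/
lemma finite_toMod_of_finite (M : SkewMod A G) [h : Module.Finite (SkewGroupRing A G) M] :
    Module.Finite A ((toMod A G).obj M) := by
  have := Fintype.ofFinite G
  classical
  obtain ⟨s, hs⟩ := h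
  let t : Finset ((toMod A G).obj M) :=
    (show Finset ((toMod A G).obj M) from s).biUnion fun x => Finset.univ.image fun g => act M g x
  let N : Submodule A ((toMod A G).obj M) := Submodule.span A (t : Set ((toMod A G).obj M))
  have smul_mem (r : SkewGroupRing A G) (y : M)
      (hy : ∀ g : G, act M g y ∈ N) : (show (toMod A G).obj M from r • y) ∈ N := by
    induction r using SkewMonoidAlgebra.induction_on with
    | zero => exact (congrArg (· ∈ N) (zero_smul (SkewGroupRing A G) y)).mpr N.zero_mem
    | single g a => exact (congrArg (· ∈ N) (single_smul_eq M g a y)).mpr (N.smul_mem a (hy g))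
    | add r t hr ht => exact (congrArg (· ∈ N) (add_smul r t y)).mpr (N.add_mem hr ht)
  -- The elements all of whose translates lie in `N` form an `AG`-submodule that contains the
  -- generators.
  let N' : Submodule (SkewGroupRing A G) M :=
    { carrier := {x | ∀ g : G, act M g x ∈ N}
      add_mem' := fun hx hy g => (congrArg (· ∈ N) (map_add (act M g) _ _)).mpr
        (N.add_mem (hx g) (hy g))
      zero_mem' := fun g => (congrArg (· ∈ N) (map_zero (act M g))).mpr N.zero_mem
      smul_mem' := fun r x hx g => (congrArg (· ∈ N)
        (mul_smul (SkewMonoidAlgebra.single g 1 : SkewGroupRing A G) r x)).mp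
        (smul_mem _ x hx) }
  have key : Submodule.span (SkewGroupRing A G) (s : Set M) ≤ N' :=
    Submodule.span_le.2 fun x hx g => Submodule.subset_span
      (Finset.mem_biUnion.2 ⟨x, hx, Finset.mem_image.2 ⟨g, Finset.mem_univ g, rfl⟩⟩)
  rw [hs] at key
  have key' : ∀ (x : M) (g : G), act M g x ∈ N := fun x => key (x := x) Submodule.mem_top
  exact ⟨t, top_unique fun x _ => (congrArg (· ∈ N) (DFunLike.congr_fun (map_one (act M)) x)).mp
    (key' x 1)⟩

/-- A surjection from a finitely generated projective module. -/
lemma exists_fg_cover (M : SkewMod A G) (hM : Module.Finite A ((toMod A G).obj M)) :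
    ∃ (P : SkewMod A G) (p : P ⟶ M), Module.Projective (SkewGroupRing A G) P ∧
      Module.Finite A ((toMod A G).obj P) ∧ Epi p := by
  have := finite_of_finite_toMod M
  obtain ⟨n, q, hq⟩ := Module.Finite.exists_fin' (SkewGroupRing A G) M
  let e : Shrink.{u} (Fin n → SkewGroupRing A G) ≃ₗ[SkewGroupRing A G] (Fin n → SkewGroupRing A G) :=
    Shrink.linearEquiv _ _
  let P : SkewMod A G := ModuleCat.of (SkewGroupRing A G) (Shrink.{u} (Fin n → SkewGroupRing A G))
  have h₁ : Module.Projective (SkewGroupRing A G) P := Module.Projective.of_equiv e.symm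
  have h₂ : Module.Finite (SkewGroupRing A G) P := Module.Finite.equiv e.symm
  refine ⟨P, ModuleCat.ofHom (q ∘ₗ e.toLinearMap), h₁, finite_toMod_of_finite P, ?_⟩
  rw [ModuleCat.epi_iff_surjective]
  exact hq.comp e.surjective

end FiniteModules

/-! ### Resolutions by finitely generated projective modules -/

section Splice

universe w₁ w₂

variable {C : Type w₁} [Category.{w₂} C] [Abelian C]

/-- Exactness at `Y` depends only on the image of the incoming map and the kernel of the outgoing
one. -/
lemma exact_epi_comp_mono {X Y Z X' Z' : C} {i : X ⟶ Y} {p : Y ⟶ Z} {w : i ≫ p = 0}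
    (h : (ShortComplex.mk i p w).Exact) (q : X' ⟶ X) [Epi q] (j : Z ⟶ Z') [Mono j]
    (w' : (q ≫ i) ≫ p ≫ j = 0) : (ShortComplex.mk (q ≫ i) (p ≫ j) w').Exact := by
  have w'' : (q ≫ i) ≫ p = 0 := by rw [Category.assoc, w, comp_zero]
  let φ : ShortComplex.mk (q ≫ i) p w'' ⟶ ShortComplex.mk i p w := { τ₁ := q, τ₂ := 𝟙 _, τ₃ := 𝟙 _ }
  let φ' : ShortComplex.mk (q ≫ i) p w'' ⟶ ShortComplex.mk (q ≫ i) (p ≫ j) w' :=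
    { τ₁ := 𝟙 _, τ₂ := 𝟙 _, τ₃ := j }
  have : Epi φ.τ₁ := ‹Epi q›
  have : IsIso φ.τ₂ := inferInstanceAs (IsIso (𝟙 _))
  have : Mono φ.τ₃ := inferInstanceAs (Mono (𝟙 _))
  have : Epi φ'.τ₁ := inferInstanceAs (Epi (𝟙 _))
  have : IsIso φ'.τ₂ := inferInstanceAs (IsIso (𝟙 _))
  have : Mono φ'.τ₃ := ‹Mono j›
  exact (ShortComplex.exact_iff_of_epi_of_isIso_of_mono φ').1
    ((ShortComplex.exact_iff_of_epi_of_isIso_of_mono φ).2 h)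

variable (M P : ℕ → C) (i : ∀ n, M (n + 1) ⟶ P n) (p : ∀ n, P n ⟶ M n)
    (w : ∀ n, i n ≫ p n = 0)

/-- The complex `… → P₂ → P₁ → P₀` obtained by splicing short exact sequences
`0 → Mₙ₊₁ → Pₙ → Mₙ → 0`. -/
def splice : ChainComplex C ℕ :=
  ChainComplex.of P (fun n => p (n + 1) ≫ i n)
    (fun n => by rw [Category.assoc, reassoc_of% (w (n + 1)), zero_comp, comp_zero])

lemma splice_d (n : ℕ) : (splice M P i p w).d (n + 1) n = p (n + 1) ≫ i n :=
  ChainComplex.of_d P (fun n => p (n + 1) ≫ i n) n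

variable (hS : ∀ n, (ShortComplex.mk _ _ (w n)).ShortExact)

include hS in
lemma exactAt_splice (n : ℕ) : (splice M P i p w).ExactAt (n + 1) := by
  rw [HomologicalComplex.exactAt_iff' _ (n + 1 + 1) (n + 1) n (by simp) (by simp)]
  have hi : Mono (i n) := (hS n).mono_f
  have hp : Epi (p (n + 2)) := (hS (n + 2)).epi_g
  have w' : (p (n + 2) ≫ i (n + 1)) ≫ p (n + 1) ≫ i n = 0 := by
    rw [Category.assoc, reassoc_of% (w (n + 1)), zero_comp, comp_zero]
  refine ShortComplex.exact_of_iso ?_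
    (exact_epi_comp_mono (hS (n + 1)).exact (p (n + 2)) (i n) w')
  exact ShortComplex.isoMk (Iso.refl _) (Iso.refl _) (Iso.refl _)
    ((Category.id_comp _).trans ((splice_d M P i p w (n + 1)).trans (Category.comp_id _).symm))
    ((Category.id_comp _).trans ((splice_d M P i p w n).trans (Category.comp_id _).symm))

/-- The projective resolution obtained by splicing short exact sequences. -/
def spliceResolution [∀ n, Projective (P n)] : ProjectiveResolution (M 0) where
  complex := splice M P i p w
  projective := fun n => inferInstanceAs (Projective (P n))
  π := (ChainComplex.toSingle₀Equiv _ _).symm ⟨p 0, by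
    rw [splice_d]
    exact (Category.assoc (p 1) (i 0) (p 0)).trans ((congrArg _ (w 0)).trans comp_zero)⟩
  quasiIso := ⟨fun n => by
    cases n
    · rw [ChainComplex.quasiIsoAt₀_iff, ShortComplex.quasiIso_iff_of_zeros']
      · have h1 : Epi (p 1) := (hS 1).epi_g
        have h0 : Epi (p 0) := (hS 0).epi_g
        refine (ShortComplex.exact_and_epi_g_iff_of_iso ?_).2
          ⟨exact_epi_comp_mono (hS 0).exact (p 1) (𝟙 _) ?_, ?_⟩
        · exact ShortComplex.isoMk (Iso.refl _) (Iso.refl _) (Iso.refl _)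
            ((Category.id_comp _).trans ((splice_d M P i p w 0).symm.trans
              (Category.comp_id _).symm))
            (by
              refine (Category.id_comp _).trans (Eq.trans ?_ (Category.comp_id _).symm)
              exact (Category.comp_id _).trans (ChainComplex.toSingle₀Equiv_symm_apply_f_zero
                (C := splice M P i p w) _ _).symm)
        · rw [Category.comp_id, Category.assoc, w, comp_zero]
        · exact epi_comp _ _
      all_goals rfl
    · rw [quasiIsoAt_iff_exactAt']
      · exact exactAt_splice M P i p w hS _
      · apply ChainComplex.exactAt_succ_single_obj⟩

end Splice

section FiniteResolution

variable {A : Type u} {G : Type v} [CommRing A] [Group G] [MulSemiringAction G A]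

/-- Bounded above complexes of projective `AG`-modules which are finitely generated. -/
structure IsFGProj (P : CochainComplex (SkewMod A G) ℤ) : Prop where
  proj : IsBoundedAboveProj P
  fg : ∀ i, Module.Finite A ((toMod A G).obj (P.X i))

lemma finite_of_iso {M N : SkewMod A G} (e : M ≅ N) (h : Module.Finite A ((toMod A G).obj M)) :
    Module.Finite A ((toMod A G).obj N) :=
  Module.Finite.equiv ((toMod A G).mapIso e).toLinearEquiv

lemma finite_of_isZero {M : SkewMod A G} (h : IsZero M) : Module.Finite A ((toMod A G).obj M) := by
  have := ModuleCat.subsingleton_of_isZero ((toMod A G).map_isZero h)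
  infer_instance

variable [IsNoetherianRing A] [Finite G]

/-- Noetherianity of `A` keeps the kernel of a finitely generated cover finitely generated, so that
the construction can be iterated. -/
lemma exists_syzygy (M : SkewMod A G) (hM : Module.Finite A ((toMod A G).obj M)) :
    ∃ (K P : SkewMod A G) (i : K ⟶ P) (p : P ⟶ M) (w : i ≫ p = 0),
      (ShortComplex.mk i p w).ShortExact ∧ Module.Projective (SkewGroupRing A G) P ∧
      Module.Finite A ((toMod A G).obj P) ∧ Module.Finite A ((toMod A G).obj K) := by
  obtain ⟨P, p, h₁, h₂, _⟩ := exists_fg_cover M hM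
  refine ⟨kernel p, P, kernel.ι p, p, kernel.condition p,
    { exact := ShortComplex.exact_kernel p, mono_f := inferInstance, epi_g := ‹Epi p› }, h₁, h₂, ?_⟩
  have : Mono ((toMod A G).map (kernel.ι p)) := inferInstance
  exact Module.Finite.of_injective ((toMod A G).map (kernel.ι p)).hom
    ((ModuleCat.mono_iff_injective _).1 this)

lemma exists_fg_resolution (M : SkewMod A G) (hM : Module.Finite A ((toMod A G).obj M)) :
    ∃ (P : CochainComplex (SkewMod A G) ℤ)
      (π : P ⟶ (CochainComplex.singleFunctor (SkewMod A G) 0).obj M), IsFGProj P ∧ QuasiIso π := by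
  let T := {M : SkewMod A G // Module.Finite A ((toMod A G).obj M)}
  have h (M : T) := exists_syzygy M.1 M.2
  choose K P i p w hS hP hfg hK using h
  let M' : ℕ → T := fun n => Nat.rec ⟨M, hM⟩ (fun _ N => ⟨K N, hK N⟩) n
  have : ∀ n, Projective (P (M' n)) := fun n =>
    (IsProjective.iff_projective (P (M' n))).1 (hP _)
  let R : ProjectiveResolution M := spliceResolution (fun n => (M' n).1) (fun n => P (M' n))
    (fun n => i (M' n)) (fun n => p (M' n)) (fun n => w (M' n)) (fun n => hS (M' n))
  refine ⟨R.cochainComplex, R.π', ⟨⟨⟨0, inferInstance⟩, fun n => ?_⟩, fun n => ?_⟩, inferInstance⟩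
  · have : Projective (R.cochainComplex.X n) := inferInstance
    exact (IsProjective.iff_projective (R.cochainComplex.X n)).2 this
  · by_cases hn : n ≤ 0
    · obtain ⟨k, rfl⟩ := Int.exists_eq_neg_ofNat hn
      exact finite_of_iso (R.cochainComplexXIso (-k) k).symm (hfg (M' k))
    · exact finite_of_isZero (CochainComplex.isZero_of_isStrictlyLE _ 0 _)

end FiniteResolution

/-! ### Complexes with finitely generated homology -/

section

open DerivedCategory Pretriangulated ZeroObject

variable {C : Type*} [Category C] [Abelian C] [HasDerivedCategory C]

/-- The middle term of a distinguished triangle is a mapping cone of a morphism of complexes, if the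
third term is represented by a `K`-projective complex. -/
lemma exists_mappingCone_iso (T : Triangle (DerivedCategory C)) (hT : T ∈ distTriang _)
    {K L : CochainComplex C ℤ} [K.IsKProjective] (e₁ : Q.obj L ≅ T.obj₁) (e₃ : Q.obj K ≅ T.obj₃) :
    ∃ φ : K⟦(-1 : ℤ)⟧ ⟶ L, Nonempty (Q.obj (CochainComplex.mappingCone φ) ≅ T.obj₂) := by
  let e₃' : Q.obj (K⟦(-1 : ℤ)⟧) ≅ T.obj₃⟦(-1 : ℤ)⟧ :=
    (Q.commShiftIso (-1 : ℤ)).app K ≪≫ (shiftFunctor _ (-1 : ℤ)).mapIso e₃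
  obtain ⟨φ, hφ⟩ := exists_Q_map_eq (e₃'.hom ≫ T.invRotate.mor₁ ≫ e₁.inv)
  obtain ⟨h, H⟩ := exists_cone_triangle φ
  refine ⟨φ, ⟨Triangle.π₃.mapIso (isoTriangleOfIso₁₂ _ _ H (inv_rot_of_distTriang _ hT) e₃' e₁ ?_)⟩⟩
  have : (e₃'.hom ≫ T.invRotate.mor₁ ≫ e₁.inv) ≫ e₁.hom = e₃'.hom ≫ T.invRotate.mor₁ :=
    (Category.assoc _ _ _).trans (congrArg _ ((Category.assoc _ _ _).trans
      ((congrArg _ e₁.inv_hom_id).trans (Category.comp_id _))))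
  exact (congrArg (· ≫ e₁.hom) hφ).trans this

/-- The objects of amplitude in `[a, b]` belong to an extension closed class if their homology
objects, placed in one degree, do. -/
lemma amplitude_induction (P : ObjectProperty (DerivedCategory C)) [P.IsClosedUnderIsomorphisms]
    (zero : ∀ X, IsZero X → P X)
    (shift : ∀ X (n : ℤ), P X → P (X⟦n⟧))
    (ext : ∀ T ∈ distTriang (DerivedCategory C), P T.obj₁ → P T.obj₃ → P T.obj₂)
    (𝓐 : ObjectProperty C) [𝓐.IsClosedUnderIsomorphisms]
    (sub : ∀ {M N : C} (f : M ⟶ N) [Mono f], 𝓐 N → 𝓐 M)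
    (quot : ∀ {M N : C} (f : M ⟶ N) [Epi f], 𝓐 M → 𝓐 N)
    (single : ∀ M, 𝓐 M → P (Q.obj ((CochainComplex.singleFunctor C 0).obj M)))
    (n : ℕ) (a b : ℤ) (hab : b + 1 = a + n) (X : DerivedCategory C) [hXa : X.IsGE a] [hXb : X.IsLE b]
    (hX : ∀ i, 𝓐 ((homologyFunctor C i).obj X)) : P X := by
  induction n generalizing a X with
  | zero =>
    refine zero X (TStructure.t.isZero X b a (by grind))
  | succ n ih =>
    -- The truncation triangle isolates the lowest degree `a` in `Y`, and `Z` has smaller amplitude.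
    obtain ⟨Y, Z, hY, hZ, f, g, h, hT⟩ := TStructure.t.exists_triangle X a (a + 1) rfl
    have hY' : Y.IsLE a := ⟨hY⟩
    have hZ' : Z.IsGE (a + 1) := ⟨hZ⟩
    -- By the long exact sequence the homology of `Y` is a subobject, and that of `Z` a quotient, of
    -- the homology of `X` in the relevant degrees.
    have hm (i : ℤ) (hi : i ≤ a) : Mono ((homologyFunctor C i).map f) :=
      (HomologySequence.mono_homologyMap_mor₁_iff _ hT (i - 1) i (by lia)).2
        ((Z.isZero_of_isGE (a + 1) (i - 1) (by lia)).eq_of_src _ _)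
    have he (i : ℤ) (hi : a < i) : Epi ((homologyFunctor C i).map g) :=
      (HomologySequence.epi_homologyMap_mor₂_iff _ hT i (i + 1) rfl).2
        ((Y.isZero_of_isLE a (i + 1) (by lia)).eq_of_tgt _ _)
    have : Y.IsGE a := (Y.isGE_iff a).2 fun i hi => by
      have := hm i hi.le
      exact (X.isZero_of_isGE a i hi).of_mono ((homologyFunctor C i).map f)
    have : Z.IsLE b := (Z.isLE_iff b).2 fun i hi => by
      have := he i (by lia)
      exact (X.isZero_of_isLE b i hi).of_epi ((homologyFunctor C i).map g)
    have hZ'' : P Z := ih (a + 1) (by lia) Z fun i => by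
      by_cases hi : a < i
      · have := he i hi
        exact quot ((homologyFunctor C i).map g) (hX i)
      -- The homology of `Z` vanishes here, so the zero map from it is mono and closure under
      -- subobjects gives `𝓐`.
      · have := (Z.isZero_of_isGE (a + 1) i (by lia)).mono
          (0 : _ ⟶ (homologyFunctor C i).obj X)
        exact sub (0 : _ ⟶ (homologyFunctor C i).obj X) (hX i)
    refine ext _ hT ?_ hZ''
    obtain ⟨M, ⟨e⟩⟩ := Y.exists_iso_singleFunctor_obj_of_isGE_of_isLE a
    have hM : 𝓐 M := 𝓐.prop_of_iso ((homologyFunctor C a).mapIso e ≪≫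
      (singleFunctorCompHomologyFunctorIso C a).app M) (by
        have := hm a le_rfl
        exact sub ((homologyFunctor C a).map f) (hX a))
    exact P.prop_of_iso (((singleFunctors C).shiftIso (-a) a 0 (by lia)).app M ≪≫ e.symm)
      (shift _ (-a) (single M hM))

end

/-! ### Closure of classes of complexes under cones and shifts -/

section

variable {A : Type u} {G : Type v} [CommRing A] [Group G] [MulSemiringAction G A]

/-- The terms of a mapping cone, as `A`-modules. -/
def mappingConeXIso {K L : CochainComplex (SkewMod A G) ℤ} (φ : K ⟶ L) (n : ℤ) :
    (toMod A G).obj ((CochainComplex.mappingCone φ).X n) ≅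
      ModuleCat.of A ((toMod A G).obj (K.X (n + 1)) × (toMod A G).obj (L.X n)) :=
  have : PreservesBinaryBiproduct (K.X (n + 1)) (L.X n) (toMod A G) :=
    preservesBinaryBiproduct_of_preservesBiproduct _ _ _
  (toMod A G).mapIso (HomologicalComplex.homotopyCofiber.XIsoBiprod φ n (n + 1) rfl) ≪≫
    (toMod A G).mapBiprod _ _ ≪≫ ModuleCat.biprodIsoProd _ _

lemma finite_mappingCone {K L : CochainComplex (SkewMod A G) ℤ} (φ : K ⟶ L)
    (hK : ∀ i, Module.Finite A ((toMod A G).obj (K.X i)))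
    (hL : ∀ i, Module.Finite A ((toMod A G).obj (L.X i))) (i : ℤ) :
    Module.Finite A ((toMod A G).obj ((CochainComplex.mappingCone φ).X i)) := by
  have := hK (i + 1)
  have := hL i
  exact Module.Finite.equiv (mappingConeXIso φ i).symm.toLinearEquiv

lemma projective_mappingCone {K L : CochainComplex (SkewMod A G) ℤ} (φ : K ⟶ L)
    (hK : ∀ i, Module.Projective A ((toMod A G).obj (K.X i)))
    (hL : ∀ i, Module.Projective A ((toMod A G).obj (L.X i))) (i : ℤ) :
    Module.Projective A ((toMod A G).obj ((CochainComplex.mappingCone φ).X i)) := by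
  have := hK (i + 1)
  have := hL i
  exact Module.Projective.of_equiv (mappingConeXIso φ i).symm.toLinearEquiv

lemma projective_mappingCone' {K L : CochainComplex (SkewMod A G) ℤ} (φ : K ⟶ L)
    (hK : ∀ i, Module.Projective (SkewGroupRing A G) (K.X i))
    (hL : ∀ i, Module.Projective (SkewGroupRing A G) (L.X i)) (i : ℤ) :
    Module.Projective (SkewGroupRing A G) ((CochainComplex.mappingCone φ).X i) := by
  have := hK (i + 1)
  have := hL i
  exact Module.Projective.of_equiv
    (HomologicalComplex.homotopyCofiber.XIsoBiprod φ i (i + 1) rfl ≪≫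
      ModuleCat.biprodIsoProd _ _).symm.toLinearEquiv

lemma isStrictlyLE_mappingCone {C : Type*} [Category C] [Preadditive C] [HasBinaryBiproducts C]
    [HasZeroObject C] {K L : CochainComplex C ℤ}
    (φ : K ⟶ L) (b : ℤ) (hK : K.IsStrictlyLE (b + 1)) (hL : L.IsStrictlyLE b) :
    (CochainComplex.mappingCone φ).IsStrictlyLE b :=
  (CochainComplex.isStrictlyLE_iff _ _).2 fun i hi =>
    IsZero.of_iso ((biprod_isZero_iff _ _).2
      ⟨K.isZero_of_isStrictlyLE (b + 1) (i + 1) (by lia), L.isZero_of_isStrictlyLE b i hi⟩)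
    (HomologicalComplex.homotopyCofiber.XIsoBiprod φ i (i + 1) rfl)

lemma isStrictlyGE_mappingCone {C : Type*} [Category C] [Preadditive C] [HasBinaryBiproducts C]
    [HasZeroObject C] {K L : CochainComplex C ℤ}
    (φ : K ⟶ L) (a : ℤ) (hK : K.IsStrictlyGE (a + 1)) (hL : L.IsStrictlyGE a) :
    (CochainComplex.mappingCone φ).IsStrictlyGE a :=
  (CochainComplex.isStrictlyGE_iff _ _).2 fun i hi =>
    IsZero.of_iso ((biprod_isZero_iff _ _).2
      ⟨K.isZero_of_isStrictlyGE (a + 1) (i + 1) (by lia), L.isZero_of_isStrictlyGE a i hi⟩)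
    (HomologicalComplex.homotopyCofiber.XIsoBiprod φ i (i + 1) rfl)

lemma exists_isStrictlyLE_mappingCone {C : Type*} [Category C] [Preadditive C]
    [HasBinaryBiproducts C] [HasZeroObject C] {K L : CochainComplex C ℤ}
    (φ : K ⟶ L) (hK : ∃ b : ℤ, K.IsStrictlyLE b) (hL : ∃ b : ℤ, L.IsStrictlyLE b) :
    ∃ b : ℤ, (CochainComplex.mappingCone φ).IsStrictlyLE b := by
  obtain ⟨b, hb⟩ := hK
  obtain ⟨c, hc⟩ := hL
  exact ⟨max b c, isStrictlyLE_mappingCone φ _ (K.isStrictlyLE_of_le b _ (by lia))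
    (L.isStrictlyLE_of_le c _ (by lia))⟩

lemma exists_isStrictlyLE_shift {C : Type*} [Category C] [Preadditive C] [HasZeroObject C]
    {K : CochainComplex C ℤ} (n : ℤ) (hK : ∃ b : ℤ, K.IsStrictlyLE b) :
    ∃ b : ℤ, (K⟦n⟧).IsStrictlyLE b := by
  obtain ⟨b, hb⟩ := hK
  exact ⟨b - n, K.isStrictlyLE_shift b n (b - n) (by lia)⟩

lemma IsBoundedAboveProj.mappingCone {K L : CochainComplex (SkewMod A G) ℤ} (φ : K ⟶ L)
    (hK : IsBoundedAboveProj K) (hL : IsBoundedAboveProj L) :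
    IsBoundedAboveProj (CochainComplex.mappingCone φ) :=
  ⟨exists_isStrictlyLE_mappingCone φ hK.1 hL.1, projective_mappingCone' φ hK.2 hL.2⟩

lemma IsBoundedAboveProj.shift {K : CochainComplex (SkewMod A G) ℤ} (n : ℤ)
    (hK : IsBoundedAboveProj K) : IsBoundedAboveProj (K⟦n⟧) :=
  ⟨exists_isStrictlyLE_shift n hK.1, fun i => hK.2 (i + n)⟩

lemma IsFGProj.mappingCone {K L : CochainComplex (SkewMod A G) ℤ} (φ : K ⟶ L)
    (hK : IsFGProj K) (hL : IsFGProj L) : IsFGProj (CochainComplex.mappingCone φ) :=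
  ⟨hK.proj.mappingCone φ hL.proj, finite_mappingCone φ hK.fg hL.fg⟩

lemma IsFGProj.shift {K : CochainComplex (SkewMod A G) ℤ} (n : ℤ) (hK : IsFGProj K) :
    IsFGProj (K⟦n⟧) :=
  ⟨hK.proj.shift n, fun i => hK.fg (i + n)⟩

lemma IsRelProj.mappingCone {K L : CochainComplex (SkewMod A G) ℤ} (φ : K ⟶ L)
    (hK : IsRelProj K) (hL : IsRelProj L) : IsRelProj (CochainComplex.mappingCone φ) :=
  ⟨exists_isStrictlyLE_mappingCone φ hK.1 hL.1, projective_mappingCone φ hK.2 hL.2⟩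

lemma IsRelProj.shift {K : CochainComplex (SkewMod A G) ℤ} (n : ℤ) (hK : IsRelProj K) :
    IsRelProj (K⟦n⟧) :=
  ⟨exists_isStrictlyLE_shift n hK.1, fun i => hK.2 (i + n)⟩

lemma IsBoundedAboveProj.isRelProj {K : CochainComplex (SkewMod A G) ℤ}
    (hK : IsBoundedAboveProj K) : IsRelProj K :=
  ⟨hK.1, fun i => by
    have := hK.2 i
    exact projective_toMod (K.X i)⟩

lemma IsBoundedAboveProj.isKProjective [Finite G] {K : CochainComplex (SkewMod A G) ℤ}
    (hK : IsBoundedAboveProj K) : K.IsKProjective :=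
  isKProjective_of_module_projective K hK.1 hK.2

end

/-! ### Resolving perfect objects by finitely generated projective modules -/

section

attribute [local instance] HasDerivedCategory.standard

variable {A : Type u} {G : Type v} [CommRing A] [Group G] [MulSemiringAction G A]

open DerivedCategory ZeroObject

/-- Forgetting the action is exact, so homology can be computed from the perfect complex `L` over
`A`, where it is a subquotient of finitely generated modules over a noetherian ring. -/
lemma homologyFunctor_finite_of_perf [IsNoetherianRing A] (X : DAG A G) (hX : perf A G X) :
    (∃ a b : ℤ, X.IsGE a ∧ X.IsLE b) ∧
      ∀ i, Module.Finite A ((toMod A G).obj ((homologyFunctor (SkewMod A G) i).obj X)) := by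
  obtain ⟨L, a, b, hLa, hLb, hL, ⟨e⟩⟩ := hX
  let K := Q.objPreimage X
  let eK : Q.obj K ≅ X := Q.objObjPreimageIso X
  let e' (i : ℤ) : (toMod A G).obj ((homologyFunctor (SkewMod A G) i).obj X) ≅ L.homology i :=
    (toMod A G).mapIso ((homologyFunctor (SkewMod A G) i).mapIso eK.symm ≪≫
      (homologyFunctorFactors (SkewMod A G) i).app K) ≪≫
    ((K.sc i).mapHomologyIso (toMod A G)).symm ≪≫
    ((homologyFunctorFactors (ModuleCat.{u} A) i).app ((toModCplx A G).obj K)).symm ≪≫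
    (homologyFunctor (ModuleCat.{u} A) i).mapIso
      (((toMod A G).mapDerivedCategoryFactors.app K).symm ≪≫ (toDMod A G).mapIso eK ≪≫ e) ≪≫
    (homologyFunctorFactors (ModuleCat.{u} A) i).app L
  have zero (i : ℤ) (hi : IsZero (L.X i)) : IsZero ((homologyFunctor (SkewMod A G) i).obj X) := by
    have h₁ : IsZero (L.homology i) := ShortComplex.isZero_homology_of_isZero_X₂ (L.sc i) hi
    have h₂ := h₁.of_iso (e' i)
    rw [IsZero.iff_id_eq_zero] at h₂ ⊢
    exact (toMod A G).map_injective (((toMod A G).map_id _).trans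
      (h₂.trans ((toMod A G).map_zero _ _).symm))
  refine ⟨⟨a, b, (isGE_iff _ _).2 fun i hi => zero i (L.isZero_of_isStrictlyGE a i hi),
    (isLE_iff _ _).2 fun i hi => zero i (L.isZero_of_isStrictlyLE b i hi)⟩, fun i => ?_⟩
  have := (hL i).1
  have h₁ : Module.Finite A (L.cycles i) :=
    Module.Finite.of_injective (L.iCycles i).hom ((ModuleCat.mono_iff_injective _).1 inferInstance)
  have h₂ : Module.Finite A (L.homology i) :=
    Module.Finite.of_surjective (L.homologyπ i).hom
      ((ModuleCat.epi_iff_surjective _).1 inferInstance)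
  exact Module.Finite.equiv (e' i).symm.toLinearEquiv

/-- The objects of `D(AG)` represented by bounded above complexes of finitely generated projective
`AG`-modules. -/
def fgProj (A : Type u) (G : Type v) [CommRing A] [Group G] [MulSemiringAction G A] :
    ObjectProperty (DAG A G) :=
  fun X => ∃ P, IsFGProj P ∧ Nonempty (Q.obj P ≅ X)

instance : (fgProj A G).IsClosedUnderIsomorphisms where
  of_iso := fun e ⟨P, hP, ⟨e'⟩⟩ => ⟨P, hP, ⟨e' ≪≫ e⟩⟩

/-- Dévissage on the amplitude reduces to a module in degree zero, which has a resolution.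
Extensions are realized by mapping cones, since complexes of projective modules bounded above are
`K`-projective. -/
lemma fgProj_of_finite_homology [IsNoetherianRing A] [Finite G] (X : DAG A G) (a b : ℤ)
    [ha : X.IsGE a] [hb : X.IsLE b]
    (hfg : ∀ i, Module.Finite A ((toMod A G).obj ((homologyFunctor (SkewMod A G) i).obj X))) :
    fgProj A G X := by
  let 𝓐 : ObjectProperty (SkewMod A G) := fun M => Module.Finite A ((toMod A G).obj M)
  have : 𝓐.IsClosedUnderIsomorphisms := ⟨fun e h => finite_of_iso e h⟩
  -- Enlarging the upper bound to at least `a` makes the number of degrees a natural number even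
  -- when `b < a`.
  have hb' : X.IsLE (max b a) := TStructure.t.isLE_of_le _ b _ (by lia)
  refine amplitude_induction (fgProj A G) (fun X hX => ⟨0, ?_,
    ⟨(Q.map_isZero (isZero_zero _)).iso hX⟩⟩) ?_ ?_ 𝓐 ?_ ?_ ?_
    (max b a + 1 - a).toNat a (max b a) (by lia) X hfg
  · have h0 (i : ℤ) : IsZero ((0 : CochainComplex (SkewMod A G) ℤ).X i) :=
      (HomologicalComplex.eval _ _ i).map_isZero (isZero_zero _)
    exact ⟨⟨⟨0, (CochainComplex.isStrictlyLE_iff _ _).2 fun i _ => h0 i⟩, fun i => by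
      have := ModuleCat.subsingleton_of_isZero (h0 i)
      infer_instance⟩, fun i => finite_of_isZero (h0 i)⟩
  · rintro X n ⟨P, hP, ⟨e⟩⟩
    exact ⟨_, hP.shift n, ⟨(Q.commShiftIso n).app P ≪≫ (shiftFunctor _ n).mapIso e⟩⟩
  · rintro T hT ⟨P₁, hP₁, ⟨e₁⟩⟩ ⟨P₃, hP₃, ⟨e₃⟩⟩
    have := hP₃.proj.isKProjective
    obtain ⟨φ, ⟨e⟩⟩ := exists_mappingCone_iso T hT e₁ e₃
    exact ⟨_, (hP₃.shift (-1)).mappingCone φ hP₁, ⟨e⟩⟩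
  · intro M N f _ (hN : Module.Finite A _)
    exact Module.Finite.of_injective ((toMod A G).map f).hom
      ((ModuleCat.mono_iff_injective _).1 inferInstance)
  · intro M N f _ (hM : Module.Finite A _)
    exact Module.Finite.of_surjective ((toMod A G).map f).hom
      ((ModuleCat.epi_iff_surjective _).1 inferInstance)
  · intro M hM
    obtain ⟨P, π, hP, _⟩ := exists_fg_resolution M hM
    have := (isIso_Q_map_iff_quasiIso _ π).2 ‹_›
    exact ⟨P, hP, ⟨asIso (Q.map π)⟩⟩

end

/-! ### Perfect complexes -/

section

variable {C : Type*} [Category C] [Abelian C] {K : CochainComplex C ℤ} {f : K ⟶ K}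
  (h : Homotopy f (𝟙 K))

include h

/-- Homotopic maps agree on homology, and there `f` induces zero. -/
lemma exactAt_of_homotopy (n : ℤ) (hf : f.f n = 0) : K.ExactAt n := by
  rw [HomologicalComplex.exactAt_iff_isZero_homology, IsZero.iff_id_eq_zero,
    ← HomologicalComplex.homologyMap_id, ← h.homologyMap_eq n,
    ← cancel_epi (K.homologyπ n), HomologicalComplex.homologyπ_naturality, comp_zero,
    ← cancel_mono (K.homologyι n)]
  simp [hf]

/-- If the identity of `K` is homotopic to a morphism which vanishes in degree `n - 1`, then the
quotient of `Kⁿ` by the boundaries is a direct summand. -/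
lemma exists_retract_opcycles (n : ℤ) (hf : f.f (n - 1) = 0) :
    Nonempty (Retract (K.opcycles n) (K.X n)) := by
  -- In degree `n - 1` the homotopy relation reads `0 = d h + h d + 1`; composing it with `d` leaves
  -- `d h d = -d`.
  have hd : K.d (n - 1) n ≫ h.hom n (n - 1) ≫ K.d (n - 1) n = - K.d (n - 1) n := by
    have := congrArg (· ≫ K.d (n - 1) n) (h.comm (n - 1))
    rw [dNext_eq h.hom (show (ComplexShape.up ℤ).Rel (n - 1) n by simp),
      prevD_eq h.hom (show (ComplexShape.up ℤ).Rel (n - 2) (n - 1) by simp; lia), hf] at this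
    simp only [zero_comp, Preadditive.add_comp, Category.assoc, HomologicalComplex.d_comp_d,
      comp_zero, add_zero, HomologicalComplex.id_f, Category.id_comp] at this
    exact eq_neg_of_add_eq_zero_left this.symm
  -- The map `1 + h d` kills boundaries by `hd` and is the identity modulo boundaries, so it
  -- descends to a section of the projection.
  refine ⟨⟨K.descOpcycles (𝟙 _ + h.hom n (n - 1) ≫ K.d (n - 1) n) (n - 1) (by simp) ?_,
    K.pOpcycles n, ?_⟩⟩
  · rw [Preadditive.comp_add, hd, Category.comp_id, add_neg_cancel]
  · rw [← cancel_epi (K.pOpcycles n), HomologicalComplex.p_descOpcycles_assoc]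
    simp

end

section

attribute [local instance] HasDerivedCategory.standard

variable {A : Type u} {G : Type v} [CommRing A] [Group G] [MulSemiringAction G A]

open DerivedCategory ZeroObject

/-- Bounded complexes of `AG`-modules which are finitely generated projective over `A`. -/
structure IsStrictPerf (L : CochainComplex (SkewMod A G) ℤ) : Prop where
  ge : ∃ a : ℤ, L.IsStrictlyGE a
  le : ∃ b : ℤ, L.IsStrictlyLE b
  fg : ∀ i, Module.Finite A ((toMod A G).obj (L.X i))
  proj : ∀ i, Module.Projective A ((toMod A G).obj (L.X i))

lemma IsStrictPerf.isRelProj {L : CochainComplex (SkewMod A G) ℤ} (hL : IsStrictPerf L) :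
    IsRelProj L := ⟨hL.le, hL.proj⟩

lemma IsStrictPerf.perf {L : CochainComplex (SkewMod A G) ℤ} (hL : IsStrictPerf L) :
    perf A G (Q.obj L) := by
  obtain ⟨a, ha⟩ := hL.ge
  obtain ⟨b, hb⟩ := hL.le
  exact ⟨(toModCplx A G).obj L, a, b, inferInstance, inferInstance,
    fun i => ⟨hL.fg i, hL.proj i⟩, ⟨(toMod A G).mapDerivedCategoryFactors.app L⟩⟩

lemma IsStrictPerf.mappingCone {K L : CochainComplex (SkewMod A G) ℤ} (φ : K ⟶ L)
    (hK : IsStrictPerf K) (hL : IsStrictPerf L) : IsStrictPerf (CochainComplex.mappingCone φ) := by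
  refine ⟨?_, exists_isStrictlyLE_mappingCone φ hK.le hL.le, finite_mappingCone φ hK.fg hL.fg,
    projective_mappingCone φ hK.proj hL.proj⟩
  obtain ⟨a, ha⟩ := hK.ge
  obtain ⟨b, hb⟩ := hL.ge
  exact ⟨min a b - 1, isStrictlyGE_mappingCone φ _ (K.isStrictlyGE_of_ge _ a (by lia))
    (L.isStrictlyGE_of_ge _ b (by lia))⟩

lemma IsStrictPerf.shift {K : CochainComplex (SkewMod A G) ℤ} (n : ℤ) (hK : IsStrictPerf K) :
    IsStrictPerf (K⟦n⟧) := by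
  obtain ⟨a, ha⟩ := hK.ge
  exact ⟨⟨a - n, K.isStrictlyGE_shift a n (a - n) (by lia)⟩, exists_isStrictlyLE_shift n hK.le,
    fun i => hK.fg (i + n), fun i => hK.proj (i + n)⟩

/-- A bounded above complex of finitely generated projective `AG`-modules which over `A` is a
retract of a bounded complex of projective modules has a bounded truncation with finitely generated
`A`-projective terms. -/
lemma IsFGProj.exists_isStrictPerf {P : CochainComplex (SkewMod A G) ℤ} (hP : IsFGProj P)
    (L : CochainComplex (ModuleCat.{u} A) ℤ) (a b : ℤ) [L.IsStrictlyGE a] [L.IsStrictlyLE b]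
    (hL : ∀ i, Module.Projective A (L.X i))
    (r : Retract (Q.obj ((toModCplx A G).obj P)) (Q.obj L)) :
    ∃ L' : CochainComplex (SkewMod A G) ℤ, IsStrictPerf L' ∧ Nonempty (Q.obj P ≅ Q.obj L') := by
  let K := (toModCplx A G).obj P
  have : K.IsKProjective := hP.proj.isRelProj.isKProjective
  have : L.IsKProjective := isKProjective_of_module_projective L ⟨b, inferInstance⟩ hL
  obtain ⟨i, hi⟩ := exists_Q_map_eq r.i
  obtain ⟨p, hp⟩ := exists_Q_map_eq r.r
  -- `K`-projectivity turns the retraction in the derived category into one up to homotopy. The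
  -- composite `i ≫ p` vanishes below `a`, because `L` does.
  obtain ⟨h⟩ : Nonempty (Homotopy (i ≫ p) (𝟙 K)) := homotopy_of_Q_map_eq (by
    rw [Functor.map_comp, hi, hp, CategoryTheory.Functor.map_id]
    exact r.retract)
  have hf (n : ℤ) (hn : n < a) : (i ≫ p).f n = 0 :=
    (congrArg (· ≫ p.f n) ((L.isZero_of_isStrictlyGE a n hn).eq_of_tgt (i.f n) 0)).trans zero_comp
  have hGE : P.IsGE a := (CochainComplex.isGE_iff _ _).2 fun n hn =>
    (ShortComplex.exact_map_iff_of_faithful (P.sc n) (toMod A G)).1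
      (exactAt_of_homotopy h n (hf n hn))
  obtain ⟨ρ⟩ := exists_retract_opcycles h a (hf (a - 1) (by lia))
  let e : K.opcycles a ≅ (toMod A G).obj ((P.truncGE a).X a) :=
    (P.sc a).mapOpcyclesIso (toMod A G) ≪≫ (toMod A G).mapIso (P.truncGEXIsoOpcycles a).symm
  -- Above `a` the truncation has the terms of `P`; in degree `a` it is a quotient by boundaries,
  -- which `ρ` exhibits as a direct summand over `A`.
  have key (i : ℤ) : IsZero ((P.truncGE a).X i) ∨
      ∃ j, Nonempty (Retract ((toMod A G).obj ((P.truncGE a).X i)) (K.X j)) := by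
    obtain hi | rfl | hi := lt_trichotomy i a
    · exact Or.inl ((P.truncGE a).isZero_of_isStrictlyGE a i hi)
    · exact Or.inr ⟨i, ⟨(Retract.ofIso e.symm).trans ρ⟩⟩
    · exact Or.inr ⟨i, ⟨Retract.ofIso ((toMod A G).mapIso (P.truncGEXIso a i hi))⟩⟩
  obtain ⟨c, hc⟩ := hP.proj.1
  refine ⟨P.truncGE a, ⟨⟨a, inferInstance⟩, ⟨c, inferInstance⟩, fun i => ?_, fun i => ?_⟩,
    ⟨asIso (Q.map (P.πTruncGE a))⟩⟩
  · obtain h0 | ⟨j, ⟨ρ⟩⟩ := key i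
    · exact finite_of_isZero h0
    · have : Module.Finite A (K.X j) := hP.fg j
      exact Module.Finite.of_surjective ρ.r.hom ((ModuleCat.epi_iff_surjective _).1 inferInstance)
  · obtain h0 | ⟨j, ⟨ρ⟩⟩ := key i
    · have := ModuleCat.subsingleton_of_isZero ((toMod A G).map_isZero h0)
      infer_instance
    · have : Module.Projective A (K.X j) := hP.proj.isRelProj.proj j
      exact Module.Projective.of_split ρ.i.hom ρ.r.hom (ModuleCat.hom_ext_iff.1 ρ.retract)

instance : (perf A G).IsClosedUnderIsomorphisms where
  of_iso := fun e ⟨L, a, b, ha, hb, hL, ⟨e'⟩⟩ =>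
    ⟨L, a, b, ha, hb, hL, ⟨(toDMod A G).mapIso e.symm ≪≫ e'⟩⟩

section

variable [IsNoetherianRing A] [Finite G]

/-- The form with a retract costs nothing extra: bounds, finiteness of homology and the homotopy
argument all pass to retracts. It also yields thickness of `perf`. -/
lemma exists_isStrictPerf_of_retract {X Y : DAG A G} (hY : perf A G Y) (r : Retract X Y) :
    ∃ L : CochainComplex (SkewMod A G) ℤ, IsStrictPerf L ∧ Nonempty (Q.obj L ≅ X) := by
  obtain ⟨⟨a, b, ha, hb⟩, hfg⟩ := homologyFunctor_finite_of_perf Y hY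
  let ρ (i : ℤ) := r.map (homologyFunctor (SkewMod A G) i)
  have ha' : X.IsGE a := (isGE_iff _ _).2 fun i hi =>
    (Y.isZero_of_isGE a i hi).of_mono (ρ i).i
  have hb' : X.IsLE b := (isLE_iff _ _).2 fun i hi =>
    (Y.isZero_of_isLE b i hi).of_mono (ρ i).i
  obtain ⟨P, hP, ⟨e⟩⟩ := fgProj_of_finite_homology X a b fun i => by
    have := hfg i
    exact Module.Finite.of_injective ((toMod A G).map (ρ i).i).hom
      ((ModuleCat.mono_iff_injective _).1 inferInstance)
  obtain ⟨L, c, d, hc, hd, hL, ⟨e'⟩⟩ := hY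
  obtain ⟨L', hL', ⟨e''⟩⟩ := hP.exists_isStrictPerf L c d (fun i => (hL i).2)
    (((Retract.ofIso ((toMod A G).mapDerivedCategoryFactors.app P).symm).trans
      ((Retract.ofIso e).trans r |>.map (toDMod A G))).trans (Retract.ofIso e'))
  exact ⟨L', hL', ⟨e''.symm ≪≫ e⟩⟩

lemma exists_isStrictPerf {X : DAG A G} (hX : perf A G X) :
    ∃ L : CochainComplex (SkewMod A G) ℤ, IsStrictPerf L ∧ Nonempty (Q.obj L ≅ X) :=
  exists_isStrictPerf_of_retract hX (Retract.refl X)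

lemma exists_fgProj {X : DAG A G} (hX : perf A G X) :
    ∃ P : CochainComplex (SkewMod A G) ℤ, IsFGProj P ∧ Nonempty (Q.obj P ≅ X) := by
  obtain ⟨⟨a, b, ha, hb⟩, hfg⟩ := homologyFunctor_finite_of_perf X hX
  exact fgProj_of_finite_homology X a b hfg

instance : (perf A G).IsStableUnderRetracts where
  of_retract r hY := by
    obtain ⟨L, hL, ⟨e⟩⟩ := exists_isStrictPerf_of_retract hY r
    exact (perf A G).prop_of_iso e hL.perf

lemma perf_shift {X : DAG A G} (n : ℤ) (hX : perf A G X) : perf A G (X⟦n⟧) := by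
  obtain ⟨L, hL, ⟨e⟩⟩ := exists_isStrictPerf hX
  exact (perf A G).prop_of_iso ((Q.commShiftIso n).app L ≪≫ (shiftFunctor _ n).mapIso e)
    (hL.shift n).perf

end

lemma perf_of_isZero {X : DAG A G} (hX : IsZero X) : perf A G X :=
  ⟨0, 0, 0, inferInstance, inferInstance, fun i => by
    have : Subsingleton ((0 : CochainComplex (ModuleCat.{u} A) ℤ).X i) :=
      ModuleCat.subsingleton_of_isZero ((HomologicalComplex.eval (ModuleCat.{u} A) (ComplexShape.up ℤ) i).map_isZero
        (isZero_zero _))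
    exact ⟨inferInstance, inferInstance⟩,
    ⟨((toDMod A G).map_isZero hX).iso (Q.map_isZero (isZero_zero _))⟩⟩

/-- Over `A` the third term is `K`-projective, so the middle term is the cone of a morphism between
bounded complexes of finitely generated projective modules. -/
lemma perf_ext (T : Pretriangulated.Triangle (DAG A G)) (hT : T ∈ distTriang _)
    (h₁ : perf A G T.obj₁) (h₃ : perf A G T.obj₃) : perf A G T.obj₂ := by
  obtain ⟨L, a, b, ha, hb, hL, ⟨e₁⟩⟩ := h₁
  obtain ⟨K, c, d, hc, hd, hK, ⟨e₃⟩⟩ := h₃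
  have := isKProjective_of_module_projective K ⟨d, hd⟩ fun i => (hK i).2
  obtain ⟨φ, ⟨e⟩⟩ := exists_mappingCone_iso _ ((toDMod A G).map_distinguished T hT) e₁.symm e₃.symm
  have hc' : (K⟦(-1 : ℤ)⟧).IsStrictlyGE (c + 1) := K.isStrictlyGE_shift c (-1) (c + 1) (by lia)
  have hd' : (K⟦(-1 : ℤ)⟧).IsStrictlyLE (d + 1) := K.isStrictlyLE_shift d (-1) (d + 1) (by lia)
  refine ⟨CochainComplex.mappingCone φ, min c a, max d b,
    isStrictlyGE_mappingCone φ _ (CochainComplex.isStrictlyGE_of_ge _ _ (c + 1) (by lia))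
      (L.isStrictlyGE_of_ge _ a (by lia)),
    isStrictlyLE_mappingCone φ _ (CochainComplex.isStrictlyLE_of_le _ (d + 1) _ (by lia))
      (L.isStrictlyLE_of_le b _ (by lia)), fun i => ?_, ⟨e.symm⟩⟩
  let ε := (HomologicalComplex.homotopyCofiber.XIsoBiprod φ i (i + 1) rfl ≪≫
      ModuleCat.biprodIsoProd _ _).symm.toLinearEquiv
  obtain ⟨_, _⟩ := hL i
  have : Module.Finite A ((K⟦(-1 : ℤ)⟧).X (i + 1)) := (hK (i + 1 + -1)).1
  have : Module.Projective A ((K⟦(-1 : ℤ)⟧).X (i + 1)) := (hK (i + 1 + -1)).2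
  exact ⟨Module.Finite.equiv ε, Module.Projective.of_equiv ε⟩

end

/-! ### Tensor products of perfect complexes -/

section

open HomologicalComplex MonoidalCategory DerivedCategory ZeroObject

attribute [local instance] HasDerivedCategory.standard

variable {A : Type u} {G : Type v} [CommRing A] [Group G] [MulSemiringAction G A]

local infixr:70 " ⊠ " => MonoidalCategoryStruct.tensorObj

lemma IsStrictPerf.of_iso {K L : CochainComplex (SkewMod A G) ℤ} (e : K ≅ L)
    (hK : IsStrictPerf K) : IsStrictPerf L := by
  obtain ⟨a, ha⟩ := hK.ge
  obtain ⟨b, hb⟩ := hK.le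
  let e' (i : ℤ) : K.X i ≅ L.X i := (HomologicalComplex.eval _ _ i).mapIso e
  refine ⟨⟨a, (CochainComplex.isStrictlyGE_iff _ _).2 fun i hi =>
      (K.isZero_of_isStrictlyGE a i hi).of_iso (e' i).symm⟩,
    ⟨b, (CochainComplex.isStrictlyLE_iff _ _).2 fun i hi =>
      (K.isZero_of_isStrictlyLE b i hi).of_iso (e' i).symm⟩,
    fun i => finite_of_iso (e' i) (hK.fg i), fun i => ?_⟩
  have := hK.proj i
  exact Module.Projective.of_equiv ((toMod A G).mapIso (e' i)).toLinearEquiv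

lemma projective_of_isZero {M : SkewMod A G} (h : IsZero M) :
    Module.Projective A ((toMod A G).obj M) := by
  have := ModuleCat.subsingleton_of_isZero ((toMod A G).map_isZero h)
  infer_instance

lemma IsStrictPerf.of_isZero {K : CochainComplex (SkewMod A G) ℤ} (hK : IsZero K) :
    IsStrictPerf K :=
  have h (i : ℤ) : IsZero (K.X i) := (HomologicalComplex.eval _ _ i).map_isZero hK
  ⟨⟨0, (CochainComplex.isStrictlyGE_iff _ _).2 fun i _ => h i⟩,
    ⟨0, (CochainComplex.isStrictlyLE_iff _ _).2 fun i _ => h i⟩, fun i => finite_of_isZero (h i),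
    fun i => projective_of_isZero (h i)⟩

/-- Dévissage in `K`. For a single module the tensor product is computed termwise on `L`, after
applying the symmetry. -/
lemma IsStrictPerf.tensor {K L : CochainComplex (SkewMod A G) ℤ} (hK : IsStrictPerf K)
    (hL : IsStrictPerf L) : IsStrictPerf (K ⊠ L) := by
  let P : ObjectProperty (CochainComplex (SkewMod A G) ℤ) := fun K => IsStrictPerf (K ⊠ L)
  let 𝓐 : ObjectProperty (SkewMod A G) := fun N =>
    Module.Finite A ((toMod A G).obj N) ∧ Module.Projective A ((toMod A G).obj N)
  have : P.IsClosedUnderIsomorphisms := ⟨fun e h => h.of_iso (whiskerRightIso e L)⟩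
  have : 𝓐.IsClosedUnderIsomorphisms := ⟨fun e ⟨h₁, _⟩ => ⟨finite_of_iso e h₁,
    Module.Projective.of_equiv ((toMod A G).mapIso e).toLinearEquiv⟩⟩
  obtain ⟨a, ha⟩ := hK.ge
  obtain ⟨b, hb⟩ := hK.le
  refine bounded_induction P (fun K n h => (h.shift n).of_iso (shiftTensorIso K L n).symm)
    (fun φ h h' => (h.mappingCone (φ ▷ L) h').of_iso (coneTensorIso φ L))
    (fun K hK => .of_isZero (isZero_tensor hK L)) 𝓐
    (fun M hM => ⟨finite_of_isZero hM, projective_of_isZero hM⟩) ?_ K a b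
    (fun i => ⟨hK.fg i, hK.proj i⟩)
  rintro M ⟨_, _⟩
  refine IsStrictPerf.of_iso (tensorSingleIso L M ≪≫ cplxComm _ _) ?_
  obtain ⟨a, ha⟩ := hL.ge
  obtain ⟨b, hb⟩ := hL.le
  refine ⟨⟨a, inferInstance⟩, ⟨b, inferInstance⟩, fun i => ?_, fun i => ?_⟩
  · have := hL.fg i
    exact Module.Finite.equiv (tensorEquiv (L.X i) M).symm
  · have := hL.proj i
    exact Module.Projective.of_equiv (tensorEquiv (L.X i) M).symm

lemma nonempty_iso_of_quasiIso {C : Type*} [Category C] [Abelian C] [HasDerivedCategory C]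
    {K L : CochainComplex C ℤ} (φ : K ⟶ L) (hφ : QuasiIso φ) :
    Nonempty (Q.obj K ≅ Q.obj L) := by
  have := (isIso_Q_map_iff_quasiIso _ φ).2 hφ
  exact ⟨asIso (Q.map φ)⟩

lemma exists_quasiIso_of_iso {C : Type*} [Category C] [Abelian C] [HasDerivedCategory C]
    {K L : CochainComplex C ℤ} [K.IsKProjective] (e : Q.obj K ≅ Q.obj L) :
    ∃ φ : K ⟶ L, QuasiIso φ := by
  obtain ⟨φ, hφ⟩ := exists_Q_map_eq e.hom
  exact ⟨φ, (isIso_Q_map_iff_quasiIso _ φ).1 (hφ ▸ inferInstance)⟩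

section

variable [Finite G]

lemma nonempty_whiskerRight_iso {P K : CochainComplex (SkewMod A G) ℤ} (hP : IsBoundedAboveProj P)
    (hK : IsRelProj K) (e : Q.obj P ≅ Q.obj K) (L : CochainComplex (SkewMod A G) ℤ) :
    Nonempty (Q.obj (P ⊠ L) ≅ Q.obj (K ⊠ L)) := by
  have := hP.isKProjective
  obtain ⟨φ, _⟩ := exists_quasiIso_of_iso e
  exact nonempty_iso_of_quasiIso _ (quasiIso_whiskerRight hP.isRelProj hK φ L)

lemma nonempty_tensor_iso {P P' K K' : CochainComplex (SkewMod A G) ℤ}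
    (hP : IsBoundedAboveProj P) (hP' : IsBoundedAboveProj P') (hK : IsRelProj K) (hK' : IsRelProj K')
    (e : Q.obj P ≅ Q.obj K) (e' : Q.obj P' ≅ Q.obj K') :
    Nonempty (Q.obj (P ⊠ P') ≅ Q.obj (K ⊠ K')) := by
  obtain ⟨i⟩ := nonempty_whiskerRight_iso hP hK e P'
  obtain ⟨j⟩ := nonempty_whiskerRight_iso hP' hK' e' K
  exact ⟨i ≪≫ Q.mapIso (cplxComm K P') ≪≫ j ≪≫ Q.mapIso (cplxComm K' K)⟩

variable [IsNoetherianRing A]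

/-- Strictly perfect complexes may replace the projective resolutions in the definition of the
tensor product, by `quasiIso_whiskerRight` in each variable. -/
lemma isTensor_iff {X Y Z : DAG A G} {K K' : CochainComplex (SkewMod A G) ℤ} (hK : IsStrictPerf K)
    (hK' : IsStrictPerf K') (e : Q.obj K ≅ X) (e' : Q.obj K' ≅ Y) :
    IsTensor X Y Z ↔ Nonempty (Q.obj (K ⊠ K') ≅ Z) := by
  constructor
  · rintro ⟨P, P', hP, hP', ⟨i⟩, ⟨i'⟩, ⟨j⟩⟩
    obtain ⟨k⟩ := nonempty_tensor_iso hP hP' hK.isRelProj hK'.isRelProj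
      (i ≪≫ e.symm) (i' ≪≫ e'.symm)
    exact ⟨k.symm ≪≫ j⟩
  · rintro ⟨j⟩
    obtain ⟨P, hP, ⟨i⟩⟩ := exists_fgProj hK.perf
    obtain ⟨P', hP', ⟨i'⟩⟩ := exists_fgProj hK'.perf
    obtain ⟨k⟩ := nonempty_tensor_iso hP.proj hP'.proj hK.isRelProj hK'.isRelProj i i'
    exact ⟨P, P', hP.proj, hP'.proj, ⟨i ≪≫ e⟩, ⟨i' ≪≫ e'⟩, ⟨k ≪≫ j⟩⟩

lemma isTensor_Q {K K' : CochainComplex (SkewMod A G) ℤ} (hK : IsStrictPerf K)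
    (hK' : IsStrictPerf K') : IsTensor (Q.obj K) (Q.obj K') (Q.obj (K ⊠ K')) :=
  (isTensor_iff hK hK' (Iso.refl _) (Iso.refl _)).2 ⟨Iso.refl _⟩

end

/-! ### Base change of perfect complexes -/

variable {B : Type u} [CommRing B] [MulSemiringAction G B] (f : A →+*[G] B)

/-- The underlying `B`-module of the base change. -/
def baseChangeEquiv (M : SkewMod A G) :
    (toMod B G).obj ((baseChange f).obj M) ≃ₗ[B] baseChangeUnder f M :=
  ofSemilinearEquiv (baseChangeUnder f M) (baseChangeAct f M) (baseChangeAct_smul f M)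

/-- Base change commutes with forgetting the action of `G`. -/
def baseChangeToModIso :
    baseChange (G := G) f ⋙ toMod B G ≅ toMod A G ⋙ ModuleCat.extendScalars f.toRingHom :=
  NatIso.ofComponents (fun M => (baseChangeEquiv f M).toModuleIso) (fun φ => by
    ext z
    rfl)

instance : (ModuleCat.extendScalars.{u, u, u} f.toRingHom).Additive :=
  (ModuleCat.extendRestrictScalarsAdj.{u, u, u} f.toRingHom).left_adjoint_additive

/-- The base change functor on complexes. -/
abbrev baseChangeFunctor : CochainComplex (SkewMod A G) ℤ ⥤ CochainComplex (SkewMod B G) ℤ :=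
  (baseChange f).mapHomologicalComplex (ComplexShape.up ℤ)

/-- Base change of complexes commutes with forgetting the action of `G`. -/
def baseChangeCplxToModIso (K : CochainComplex (SkewMod A G) ℤ) :
    (toModCplx B G).obj ((baseChangeFunctor f).obj K) ≅
      ((ModuleCat.extendScalars f.toRingHom).mapHomologicalComplex (ComplexShape.up ℤ)).obj
        ((toModCplx A G).obj K) :=
  HomologicalComplex.Hom.isoOfComponents (fun n => (baseChangeToModIso f).app (K.X n))
    (fun i j _ => ((baseChangeToModIso f).hom.naturality (K.d i j)).symm)

lemma baseChangeCplxToModIso_naturality {K L : CochainComplex (SkewMod A G) ℤ} (φ : K ⟶ L) :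
    (toModCplx B G).map ((baseChangeFunctor f).map φ) ≫ (baseChangeCplxToModIso f L).hom =
      (baseChangeCplxToModIso f K).hom ≫
        ((ModuleCat.extendScalars f.toRingHom).mapHomologicalComplex (ComplexShape.up ℤ)).map
          ((toModCplx A G).map φ) :=
  HomologicalComplex.hom_ext _ _ fun n => (baseChangeToModIso f).hom.naturality (φ.f n)

lemma finite_baseChange (M : SkewMod A G) (hM : Module.Finite A ((toMod A G).obj M)) :
    Module.Finite B ((toMod B G).obj ((baseChange f).obj M)) := by
  let _ : Algebra A B := f.toRingHom.toAlgebra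
  have : Module.Finite B (baseChangeUnder f M) :=
    Module.Finite.base_change A B ((toMod A G).obj M)
  exact Module.Finite.equiv (baseChangeEquiv f M).symm

lemma projective_baseChange (M : SkewMod A G) (hM : Module.Projective A ((toMod A G).obj M)) :
    Module.Projective B ((toMod B G).obj ((baseChange f).obj M)) := by
  let _ : Algebra A B := f.toRingHom.toAlgebra
  have : Module.Projective B (baseChangeUnder f M) :=
    (inferInstance : Module.Projective B (B ⊗[A] ((toMod A G).obj M)))
  exact Module.Projective.of_equiv (baseChangeEquiv f M).symm

lemma IsStrictPerf.baseChange {K : CochainComplex (SkewMod A G) ℤ} (hK : IsStrictPerf K) :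
    IsStrictPerf ((baseChangeFunctor f).obj K) := by
  obtain ⟨a, ha⟩ := hK.ge
  obtain ⟨b, hb⟩ := hK.le
  exact ⟨⟨a, inferInstance⟩, ⟨b, inferInstance⟩, fun i => finite_baseChange f _ (hK.fg i),
    fun i => projective_baseChange f _ (hK.proj i)⟩

/-- As for tensor products: a homotopy equivalence over `A` gives one over `B`, and that detects
quasi-isomorphisms of complexes of `BG`-modules. -/
lemma quasiIso_baseChange {K L : CochainComplex (SkewMod A G) ℤ} (hK : IsRelProj K)
    (hL : IsRelProj L) (φ : K ⟶ L) [QuasiIso φ] : QuasiIso ((baseChangeFunctor f).map φ) := by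
  obtain ⟨e, he⟩ := exists_homotopyEquiv hK hL φ
  rw [← quasiIso_toModCplx_iff]
  have : QuasiIso ((ModuleCat.extendScalars f.toRingHom).mapHomotopyEquiv e).hom := inferInstance
  have h : (toModCplx B G).map ((baseChangeFunctor f).map φ) ≫ (baseChangeCplxToModIso f L).hom =
      (baseChangeCplxToModIso f K).hom ≫
        ((ModuleCat.extendScalars f.toRingHom).mapHomotopyEquiv e).hom :=
    (baseChangeCplxToModIso_naturality f φ).trans (congrArg ((baseChangeCplxToModIso f K).hom ≫ ·)
      (congrArg ((ModuleCat.extendScalars f.toRingHom).mapHomologicalComplex _).map he.symm))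
  exact quasiIso_of_arrow_iso _ _ h

lemma isBaseChange_iff [Finite G] [IsNoetherianRing A] {X : DAG A G} {Y : DAG B G}
    {K : CochainComplex (SkewMod A G) ℤ} (hK : IsStrictPerf K) (e : Q.obj K ≅ X) :
    IsBaseChange f X Y ↔ Nonempty (Q.obj ((baseChangeFunctor f).obj K) ≅ Y) := by
  have key {P : CochainComplex (SkewMod A G) ℤ} (hP : IsBoundedAboveProj P) (i : Q.obj P ≅ X) :
      Nonempty (Q.obj (baseChangeCplx f P) ≅ Q.obj ((baseChangeFunctor f).obj K)) := by
    have := hP.isKProjective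
    obtain ⟨φ, _⟩ := exists_quasiIso_of_iso (i ≪≫ e.symm)
    exact nonempty_iso_of_quasiIso _ (quasiIso_baseChange f hP.isRelProj hK.isRelProj φ)
  constructor
  · rintro ⟨P, hP, ⟨i⟩, ⟨j⟩⟩
    obtain ⟨k⟩ := key hP i
    exact ⟨k.symm ≪≫ j⟩
  · rintro ⟨j⟩
    obtain ⟨P, hP, ⟨i⟩⟩ := exists_fgProj hK.perf
    obtain ⟨k⟩ := key hP.proj (i ≪≫ e)
    exact ⟨P, hP.proj, ⟨i ≪≫ e⟩, ⟨k ≪≫ j⟩⟩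

end

/-! ### Inverse images of thick subcategories -/

section

open HomologicalComplex MonoidalCategory DerivedCategory ZeroObject

attribute [local instance] HasDerivedCategory.standard

variable {A : Type u} {G : Type v} [CommRing A] [Group G] [MulSemiringAction G A]

local infixr:70 " ⊠ " => MonoidalCategoryStruct.tensorObj

/-- Functors on complexes which can be derived on bounded above complexes of `A`-projective
`AG`-modules. -/
structure IsDerivable {C : Type*} [Category C] [Abelian C]
    (Γ : CochainComplex (SkewMod A G) ℤ ⥤ CochainComplex C ℤ) : Prop where
  zero : ∀ {K}, IsZero K → IsZero (Γ.obj K)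
  shift : ∀ (K) (n : ℤ), Nonempty (Γ.obj (K⟦n⟧) ≅ (Γ.obj K)⟦n⟧)
  cone : ∀ {K L} (φ : K ⟶ L),
    Nonempty (Γ.obj (CochainComplex.mappingCone φ) ≅ CochainComplex.mappingCone (Γ.map φ))
  quasiIso : ∀ {K L} (φ : K ⟶ L), IsRelProj K → IsRelProj L → QuasiIso φ → QuasiIso (Γ.map φ)

lemma isDerivable_tensorRight (L : CochainComplex (SkewMod A G) ℤ) :
    IsDerivable (MonoidalCategory.tensorRight L) where
  zero hK := isZero_tensor hK L
  shift K n := ⟨shiftTensorIso K L n⟩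
  cone φ := ⟨(coneTensorIso φ L).symm⟩
  quasiIso φ hK hL _ := quasiIso_whiskerRight hK hL φ L

lemma isDerivable_baseChange {B : Type u} [CommRing B] [MulSemiringAction G B] (f : A →+*[G] B) :
    IsDerivable (baseChangeFunctor (G := G) f) where
  zero hK := (baseChangeFunctor f).map_isZero hK
  shift K n := ⟨((baseChangeFunctor f).commShiftIso n).app K⟩
  cone φ := ⟨CochainComplex.mappingCone.mapHomologicalComplexIso φ (baseChange f)⟩
  quasiIso φ hK hL _ := quasiIso_baseChange f hK hL φ

section

variable {C : Type*} [Category C] [Abelian C] [HasDerivedCategory C]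
  {Γ : CochainComplex (SkewMod A G) ℤ ⥤ CochainComplex C ℤ}

/-- The inverse image of a class of objects under the derived functor of `Γ`. -/
def derivedInverseImage (Γ : CochainComplex (SkewMod A G) ℤ ⥤ CochainComplex C ℤ)
    (𝓘 : ObjectProperty (DerivedCategory C)) : ObjectProperty (DAG A G) := fun X =>
  perf A G X ∧ ∃ K, IsRelProj K ∧ Nonempty (Q.obj K ≅ X) ∧ 𝓘 (Q.obj (Γ.obj K))

variable [IsNoetherianRing A] [Finite G] (hΓ : IsDerivable Γ) (𝓘 : ObjectProperty (DerivedCategory C))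

include hΓ

/-- Both representatives receive quasi-isomorphisms from a common projective resolution, and `Γ`
preserves these. -/
lemma IsDerivable.nonempty_iso {X : DAG A G} (hX : perf A G X)
    {K L : CochainComplex (SkewMod A G) ℤ} (hK : IsRelProj K) (hL : IsRelProj L)
    (e : Q.obj K ≅ X) (e' : Q.obj L ≅ X) : Nonempty (Q.obj (Γ.obj K) ≅ Q.obj (Γ.obj L)) := by
  obtain ⟨P, hP, ⟨i⟩⟩ := exists_fgProj hX
  have := hP.proj.isKProjective
  obtain ⟨φ, hφ⟩ := exists_quasiIso_of_iso (i ≪≫ e.symm)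
  obtain ⟨ψ, hψ⟩ := exists_quasiIso_of_iso (i ≪≫ e'.symm)
  obtain ⟨j⟩ := nonempty_iso_of_quasiIso _ (hΓ.quasiIso φ hP.proj.isRelProj hK hφ)
  obtain ⟨j'⟩ := nonempty_iso_of_quasiIso _ (hΓ.quasiIso ψ hP.proj.isRelProj hL hψ)
  exact ⟨j.symm ≪≫ j'⟩

lemma IsDerivable.inverseImage_iff [𝓘.IsClosedUnderIsomorphisms] {X : DAG A G} (hX : perf A G X)
    {K : CochainComplex (SkewMod A G) ℤ} (hK : IsRelProj K) (e : Q.obj K ≅ X) :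
    derivedInverseImage Γ 𝓘 X ↔ 𝓘 (Q.obj (Γ.obj K)) := by
  refine ⟨fun ⟨_, L, hL, ⟨e'⟩, h⟩ => ?_, fun h => ⟨hX, K, hK, ⟨e⟩, h⟩⟩
  obtain ⟨j⟩ := hΓ.nonempty_iso hX hK hL e e'
  exact 𝓘.prop_of_iso j.symm h

omit [IsNoetherianRing A] [Finite G] hΓ in
instance : (derivedInverseImage Γ 𝓘).IsClosedUnderIsomorphisms where
  of_iso := fun e ⟨hX, K, hK, ⟨e'⟩, h⟩ => ⟨(perf A G).prop_of_iso e hX, K, hK, ⟨e' ≪≫ e⟩, h⟩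

lemma IsDerivable.isTriangulated [𝓘.IsClosedUnderIsomorphisms] [𝓘.IsTriangulated] :
    (derivedInverseImage Γ 𝓘).IsTriangulated := by
  refine isTriangulated_of _ (fun X hX => ?_) (fun X n hX => ?_) fun T hT h₁ h₃ => ?_
  · have h0 : IsZero (0 : CochainComplex (SkewMod A G) ℤ) := isZero_zero _
    refine ⟨perf_of_isZero hX, 0, (IsStrictPerf.of_isZero h0).isRelProj,
      ⟨(Q.map_isZero h0).iso hX⟩, ?_⟩
    obtain ⟨Z, hZ, h⟩ := 𝓘.exists_prop_of_containsZero
    exact 𝓘.prop_of_iso (hZ.iso (Q.map_isZero (hΓ.zero h0))) h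
  · obtain ⟨hX', K, hK, ⟨e⟩, h⟩ := hX
    obtain ⟨j⟩ := hΓ.shift K n
    exact ⟨perf_shift n hX', _, hK.shift n,
      ⟨(Q.commShiftIso n).app K ≪≫ (shiftFunctor _ n).mapIso e⟩,
      𝓘.prop_of_iso ((Q.commShiftIso n).symm.app _ ≪≫ Q.mapIso j.symm) (𝓘.le_shift n _ h)⟩
  · obtain ⟨h₁', K₁, hK₁, ⟨e₁⟩, h₁⟩ := h₁
    obtain ⟨P, hP, ⟨e₃⟩⟩ := exists_fgProj h₃.1
    have h₃' := h₃.1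
    replace h₃ := (hΓ.inverseImage_iff 𝓘 h₃.1 hP.proj.isRelProj e₃).1 h₃
    have := hP.proj.isKProjective
    -- The third term is now represented by a `K`-projective complex, so the extension is the cone
    -- of an actual morphism of complexes, to which `Γ` applies.
    obtain ⟨φ, ⟨e⟩⟩ := exists_mappingCone_iso T hT e₁ e₃
    refine ⟨perf_ext T hT h₁' h₃', _,
      (hP.proj.isRelProj.shift (-1)).mappingCone φ hK₁, ⟨e⟩, ?_⟩
    obtain ⟨j⟩ := hΓ.cone φ
    obtain ⟨j'⟩ := hΓ.shift P (-1)
    obtain ⟨t, ht⟩ := exists_cone_triangle (Γ.map φ)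
    refine 𝓘.prop_of_iso (Q.mapIso j.symm) (𝓘.ext_of_isTriangulatedClosed₃ _ ht ?_ h₁)
    exact 𝓘.prop_of_iso ((Q.commShiftIso (-1 : ℤ)).symm.app _ ≪≫ Q.mapIso j'.symm)
      (𝓘.le_shift (-1 : ℤ) _ h₃)

lemma IsDerivable.isStableUnderRetracts [𝓘.IsClosedUnderIsomorphisms] [𝓘.IsStableUnderRetracts] :
    (derivedInverseImage Γ 𝓘).IsStableUnderRetracts where
  of_retract {X Y} r hY := by
    have hX : perf A G X := (perf A G).prop_of_retract r hY.1
    obtain ⟨P, hP, ⟨e⟩⟩ := exists_fgProj hX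
    obtain ⟨P', hP', ⟨e'⟩⟩ := exists_fgProj hY.1
    have := hP.proj.isKProjective
    have := hP'.proj.isKProjective
    rw [hΓ.inverseImage_iff 𝓘 hX hP.proj.isRelProj e]
    rw [hΓ.inverseImage_iff 𝓘 hY.1 hP'.proj.isRelProj e'] at hY
    obtain ⟨i, hi⟩ := exists_Q_map_eq (e.hom ≫ r.i ≫ e'.inv)
    obtain ⟨p, hp⟩ := exists_Q_map_eq (e'.hom ≫ r.r ≫ e.inv)
    have h : Q.map (i ≫ p) = 𝟙 _ := by simp [hi, hp]
    have : QuasiIso (i ≫ p) := (isIso_Q_map_iff_quasiIso _ _).1 (h ▸ inferInstance)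
    have := (isIso_Q_map_iff_quasiIso _ _).2
      (hΓ.quasiIso (i ≫ p) hP.proj.isRelProj hP.proj.isRelProj this)
    -- The lift `i ≫ p` is only a quasi-isomorphism and `Γ` need not respect homotopies, so the
    -- retraction is corrected by the inverse of the image of `i ≫ p`.
    refine 𝓘.prop_of_retract ⟨Q.map (Γ.map i), Q.map (Γ.map p) ≫ inv (Q.map (Γ.map (i ≫ p))), ?_⟩ hY
    rw [← Category.assoc, ← Functor.map_comp, ← Functor.map_comp, IsIso.hom_inv_id]

end

end

/-! ### Base change and tensor products -/

section

variable {A : Type u} {G : Type v} [CommRing A] [Group G] [MulSemiringAction G A]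
  {B : Type u} [CommRing B] [MulSemiringAction G B] (f : A →+*[G] B)

/-- The elementary tensor `b ⊗ m`, as an element of the underlying `B`-module of `B ⊗ M`. -/
def bcTens {M : SkewMod A G} (b : B) (m : (toMod A G).obj M) :
    (toMod B G).obj ((baseChange f).obj M) :=
  (baseChangeEquiv f M).symm (baseChangeTmul f M b m)

lemma bcTens_add {M : SkewMod A G} (b : B) (m m' : (toMod A G).obj M) :
    bcTens f b (m + m') = bcTens f b m + bcTens f b m' :=
  TensorProduct.tmul_add (M := restr f) (N := (toMod A G).obj M) b m m'

lemma act_bcTens {M : SkewMod A G} (g : G) (b : B) (m : (toMod A G).obj M) :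
    act ((baseChange f).obj M) g (bcTens f b m) = bcTens f (g • b) (act M g m) :=
  act_ofSemilinear _ _ _ g (bcTens f b m)

lemma smul_bcTens {M : SkewMod A G} (b b' : B) (m : (toMod A G).obj M) :
    b • bcTens f b' m = bcTens f (b * b') m :=
  ((baseChangeEquiv f M).symm.map_smul b (baseChangeTmul f M b' m)).symm

lemma bcTens_smul {M : SkewMod A G} (a : A) (b : B) (m : (toMod A G).obj M) :
    bcTens f b (a • m) = bcTens f (f a * b) m :=
  (TensorProduct.smul_tmul (R := A) (M := restr f) (N := (toMod A G).obj M) a b m).symm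

lemma bcTens_induction {M : SkewMod A G} {p : (toMod B G).obj ((baseChange f).obj M) → Prop}
    (zero : p 0) (tens : ∀ b m, p (bcTens f b m)) (add : ∀ x y, p x → p y → p (x + y)) (z) : p z :=
  TensorProduct.induction_on (R := A) (M := restr f) (N := (toMod A G).obj M)
    (motive := p) z zero tens add

lemma bcTens_tens_induction {M N : SkewMod A G}
    {p : (toMod B G).obj (tensorMod ((baseChange f).obj M) ((baseChange f).obj N)) → Prop}
    (zero : p 0) (tens : ∀ b m b' n, p (tens (bcTens f b m) (bcTens f b' n)))
    (add : ∀ x y, p x → p y → p (x + y)) (z) : p z := by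
  induction z using tensorMod_induction with
  | zero => exact zero
  | add x y hx hy => exact add x y hx hy
  | tens x y =>
    induction x using bcTens_induction with
    | zero => rw [zero_tens]; exact zero
    | add x x' hx hx' => rw [add_tens]; exact add _ _ hx hx'
    | tens b m =>
      induction y using bcTens_induction with
      | zero => rw [tens_zero]; exact zero
      | add y y' hy hy' => rw [tens_add]; exact add _ _ hy hy'
      | tens b' n => exact tens b m b' n

/-- The `B`-linear equivalence `(B ⊗ M) ⊗ (B ⊗ N) ≃ B ⊗ (M ⊗ N)`. -/
def baseChangeTensorEquiv (M N : SkewMod A G) :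
    (toMod B G).obj (tensorMod ((baseChange f).obj M) ((baseChange f).obj N)) ≃ₗ[B]
      (toMod B G).obj ((baseChange f).obj (tensorMod M N)) :=
  letI : Algebra A B := f.toRingHom.toAlgebra
  let e₁ : (toMod B G).obj ((baseChange f).obj M) ≃ₗ[B] B ⊗[A] (toMod A G).obj M :=
    baseChangeEquiv f M
  let e₂ : (toMod B G).obj ((baseChange f).obj N) ≃ₗ[B] B ⊗[A] (toMod A G).obj N :=
    baseChangeEquiv f N
  let e₃ : (toMod B G).obj ((baseChange f).obj (tensorMod M N)) ≃ₗ[B]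
      B ⊗[A] (toMod A G).obj (tensorMod M N) := baseChangeEquiv f (tensorMod M N)
  tensorEquiv _ _ ≪≫ₗ TensorProduct.congr e₁ e₂ ≪≫ₗ
    (TensorProduct.AlgebraTensorModule.distribBaseChange A B
      ((toMod A G).obj M) ((toMod A G).obj N)).symm ≪≫ₗ
    (TensorProduct.AlgebraTensorModule.congr (LinearEquiv.refl B B) (tensorEquiv M N).symm) ≪≫ₗ
    e₃.symm

lemma baseChangeTensorEquiv_tens {M N : SkewMod A G} (b b' : B) (m : (toMod A G).obj M)
    (n : (toMod A G).obj N) :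
    baseChangeTensorEquiv f M N (tens (bcTens f b m) (bcTens f b' n)) =
      bcTens f (b * b') (tens m n) := by
  rw [mul_comm]
  rfl

lemma bcTens_tens_hom_ext {M N : SkewMod A G} {L : SkewMod B G}
    {φ ψ : tensorMod ((baseChange f).obj M) ((baseChange f).obj N) ⟶ L}
    (h : ∀ b m b' n, (toMod B G).map φ (tens (bcTens f b m) (bcTens f b' n)) =
      (toMod B G).map ψ (tens (bcTens f b m) (bcTens f b' n))) : φ = ψ := by
  apply (toMod B G).map_injective
  ext z
  induction z using bcTens_tens_induction with
  | zero => rw [map_zero, map_zero]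
  | add x y hx hy => rw [map_add, map_add, hx, hy]
  | tens b m b' n => exact h b m b' n

/-- The isomorphism `(B ⊗ M) ⊗ (B ⊗ N) ≅ B ⊗ (M ⊗ N)` of `BG`-modules. -/
def baseChangeTensorIso (M N : SkewMod A G) :
    tensorMod ((baseChange f).obj M) ((baseChange f).obj N) ≅ (baseChange f).obj (tensorMod M N) :=
  isoOfEquivariant (baseChangeTensorEquiv f M N) (fun g z => by
    induction z using bcTens_tens_induction with
    | zero => simp only [map_zero]
    | add x y hx hy => simp only [map_add, hx, hy]
    | tens b m b' n =>
      rw [act_tens, act_bcTens, act_bcTens, baseChangeTensorEquiv_tens, baseChangeTensorEquiv_tens,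
        act_bcTens, act_tens, smul_mul'])

lemma baseChangeTensorIso_tens {M N : SkewMod A G} (b b' : B) (m : (toMod A G).obj M)
    (n : (toMod A G).obj N) :
    (toMod B G).map (baseChangeTensorIso f M N).hom (tens (bcTens f b m) (bcTens f b' n)) =
      bcTens f (b * b') (tens m n) :=
  baseChangeTensorEquiv_tens f b b' m n

variable (G) in
/-- Base change is monoidal. -/
def baseChangeComparison : BifunctorComparison (tensorBifunctor A G) (tensorBifunctor B G)
    (baseChange f) (baseChange f) (baseChange f) where
  iso M N := baseChangeTensorIso f M N
  nat₁ φ N := bcTens_tens_hom_ext f fun b m b' n =>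
    (baseChangeTensorIso_tens f b b' ((toMod A G).map φ m) n).trans
      (congrArg ((toMod B G).map ((baseChange f).map (tensorMap φ (𝟙 N))))
        (baseChangeTensorIso_tens f b b' m n)).symm
  nat₂ M _ _ φ := bcTens_tens_hom_ext f fun b m b' n =>
    (baseChangeTensorIso_tens f b b' m ((toMod A G).map φ n)).trans
      (congrArg ((toMod B G).map ((baseChange f).map (tensorMap (𝟙 M) φ)))
        (baseChangeTensorIso_tens f b b' m n)).symm

/-- Base change commutes with colimits of shape `J`. -/
lemma baseChange_preservesColimitsOfShape (J : Type) :
    PreservesColimitsOfShape (Discrete J) (baseChange (G := G) f) := by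
  have : PreservesColimitsOfShape (Discrete J) (toMod A G ⋙ ModuleCat.extendScalars f.toRingHom) :=
    have : PreservesColimitsOfShape (Discrete J) (ModuleCat.extendScalars.{u, u, u} f.toRingHom) :=
      ((ModuleCat.extendRestrictScalarsAdj.{u, u, u} f.toRingHom).leftAdjoint_preservesColimits
        ).preservesColimitsOfShape
    inferInstance
  have : PreservesColimitsOfShape (Discrete J) (baseChange (G := G) f ⋙ toMod B G) :=
    preservesColimitsOfShape_of_natIso (baseChangeToModIso f).symm
  exact preservesColimitsOfShape_of_comp_toMod _ _

lemma bcTens_hom_ext {M : SkewMod A G} {L : SkewMod B G}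
    {φ ψ : (baseChange f).obj M ⟶ L}
    (h : ∀ b m, (toMod B G).map φ (bcTens f b m) = (toMod B G).map ψ (bcTens f b m)) : φ = ψ := by
  apply (toMod B G).map_injective
  ext z
  induction z using bcTens_induction with
  | zero => rw [map_zero, map_zero]
  | add x y hx hy => rw [map_add, map_add, hx, hy]
  | tens b m => exact h b m

/-- The `B`-linear equivalence `B ⊗ A ≃ B`. -/
def baseChangeUnitEquiv :
    (toMod B G).obj ((baseChange f).obj (unitMod A G)) ≃ₗ[B] (toMod B G).obj (unitMod B G) :=
  letI : Algebra A B := f.toRingHom.toAlgebra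
  let e₁ : (toMod A G).obj (unitMod A G) ≃ₗ[A] A := unitEquiv
  let e₂ : (toMod B G).obj (unitMod B G) ≃ₗ[B] B := unitEquiv
  let e₃ : (toMod B G).obj ((baseChange f).obj (unitMod A G)) ≃ₗ[B]
    B ⊗[A] (toMod A G).obj (unitMod A G) := baseChangeEquiv f _
  e₃ ≪≫ₗ (TensorProduct.AlgebraTensorModule.congr (LinearEquiv.refl B B) e₁) ≪≫ₗ
    TensorProduct.AlgebraTensorModule.rid A B B ≪≫ₗ e₂.symm

lemma baseChangeUnitEquiv_tens (b : B) (a : (toMod A G).obj (unitMod A G)) :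
    unitEquiv (baseChangeUnitEquiv f (bcTens f b a)) = f (unitEquiv a) * b := rfl

/-- The base change of the unit object is the unit object. -/
def baseChangeUnitIso : (baseChange f).obj (unitMod A G) ≅ unitMod B G :=
  isoOfEquivariant (baseChangeUnitEquiv f) (fun g z => by
    induction z using bcTens_induction with
    | zero => simp only [map_zero]
    | add x y hx hy => simp only [map_add, hx, hy]
    | tens b m =>
      apply unitEquiv.injective
      rw [act_bcTens, act_unit, baseChangeUnitEquiv_tens, baseChangeUnitEquiv_tens, act_unit,
        map_smul, smul_mul'])

end

section

open HomologicalComplex MonoidalCategory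

variable {A : Type u} {G : Type v} [CommRing A] [Group G] [MulSemiringAction G A]
  {B : Type u} [CommRing B] [MulSemiringAction G B] (f : A →+*[G] B)

local infixr:70 " ⊠ " => MonoidalCategoryStruct.tensorObj

/-- Base change of complexes is monoidal. -/
def baseChangeTensorCplxIso (K L : CochainComplex (SkewMod A G) ℤ) :
    (baseChangeFunctor f).obj K ⊠ (baseChangeFunctor f).obj L ≅ (baseChangeFunctor f).obj (K ⊠ L) :=
  have := baseChange_preservesColimitsOfShape (G := G) f
  mapBifunctorComparisonIso (baseChangeComparison G f) K L

end

/-! ### The map induced by a base change on spectra -/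

section

open HomologicalComplex MonoidalCategory DerivedCategory ZeroObject

attribute [local instance] HasDerivedCategory.standard

local infixr:70 " ⊠ " => MonoidalCategoryStruct.tensorObj

lemma nonempty_mappingCone_iso {C : Type*} [Category C] [Abelian C] [HasDerivedCategory C]
    {K L K' L' : CochainComplex C ℤ} {φ : K ⟶ L} {ψ : K' ⟶ L'}
    (e : Arrow.mk (Q.map φ) ≅ Arrow.mk (Q.map ψ)) :
    Nonempty (Q.obj (CochainComplex.mappingCone φ) ≅ Q.obj (CochainComplex.mappingCone ψ)) := by
  obtain ⟨h, H⟩ := exists_cone_triangle φ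
  obtain ⟨h', H'⟩ := exists_cone_triangle ψ
  obtain ⟨e', -⟩ := Pretriangulated.exists_iso_of_arrow_iso _ _ H H' e
  exact ⟨Pretriangulated.Triangle.π₃.mapIso e'⟩

variable {A : Type u} {G : Type v} [CommRing A] [Group G] [MulSemiringAction G A]

lemma isStrictPerf_single (M : SkewMod A G) (h₁ : Module.Finite A ((toMod A G).obj M))
    (h₂ : Module.Projective A ((toMod A G).obj M)) :
    IsStrictPerf ((single (SkewMod A G) (ComplexShape.up ℤ) 0).obj M) := by
  have key (i : ℤ) : IsZero (((single (SkewMod A G) (ComplexShape.up ℤ) 0).obj M).X i) ∨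
      Nonempty (M ≅ ((single (SkewMod A G) (ComplexShape.up ℤ) 0).obj M).X i) := by
    by_cases hi : i = 0
    · subst hi
      exact Or.inr ⟨(singleObjXSelf (ComplexShape.up ℤ) 0 M).symm⟩
    · exact Or.inl (isZero_single_obj_X _ _ _ _ hi)
  refine ⟨⟨0, inferInstanceAs
      (((CochainComplex.singleFunctor (SkewMod A G) 0).obj M).IsStrictlyGE 0)⟩,
    ⟨0, inferInstanceAs (((CochainComplex.singleFunctor (SkewMod A G) 0).obj M).IsStrictlyLE 0)⟩,
    fun i => ?_, fun i => ?_⟩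
  · obtain h | ⟨⟨e⟩⟩ := key i
    · exact finite_of_isZero h
    · exact finite_of_iso e h₁
  · obtain h | ⟨⟨e⟩⟩ := key i
    · exact projective_of_isZero h
    · exact Module.Projective.of_equiv ((toMod A G).mapIso e).toLinearEquiv

variable (A G) in
lemma isStrictPerf_unit : IsStrictPerf (𝟙_ (CochainComplex (SkewMod A G) ℤ)) :=
  isStrictPerf_single (unitMod A G) (Module.Finite.equiv (unitEquiv (A := A) (G := G)).symm)
    (Module.Projective.of_equiv (unitEquiv (A := A) (G := G)).symm)

lemma perf_coneInv (a : Inv A G) : perf A G (coneInv a) :=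
  ((isStrictPerf_unit A G).mappingCone _ (isStrictPerf_unit A G)).perf

section

variable [IsNoetherianRing A] [Finite G] (P : Spc A G)

instance : P.carrier.IsTriangulated := P.isTriangulated

instance : P.carrier.IsStableUnderRetracts := P.thick

lemma Spc.tensor_mem {K L : CochainComplex (SkewMod A G) ℤ} (hK : IsStrictPerf K)
    (hL : IsStrictPerf L) (h : P.carrier (Q.obj K)) : P.carrier (Q.obj (K ⊠ L)) :=
  P.ideal _ _ _ h hL.perf (isTensor_Q hK hL)

lemma Spc.mem_or_mem {K L : CochainComplex (SkewMod A G) ℤ} (hK : IsStrictPerf K)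
    (hL : IsStrictPerf L) (h : P.carrier (Q.obj (K ⊠ L))) :
    P.carrier (Q.obj K) ∨ P.carrier (Q.obj L) :=
  P.prime _ _ _ hK.perf hL.perf (isTensor_Q hK hL) h

/-- An ideal containing the unit contains every perfect object, contrary to properness. -/
lemma Spc.unit_notMem : ¬ P.carrier (Q.obj (𝟙_ (CochainComplex (SkewMod A G) ℤ))) := fun h => by
  obtain ⟨X, hX, hX'⟩ := P.proper
  obtain ⟨L, hL, ⟨e⟩⟩ := exists_isStrictPerf hX
  exact hX' (P.carrier.prop_of_iso (Q.mapIso (λ_ L) ≪≫ e) (P.tensor_mem (isStrictPerf_unit A G) hL h))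

end

variable {B : Type u} [CommRing B] [MulSemiringAction G B] (f : A →+*[G] B)

/-- The base change of the unit complex is the unit complex. -/
def baseChangeUnitCplxIso : (baseChangeFunctor f).obj (𝟙_ (CochainComplex (SkewMod A G) ℤ)) ≅
    𝟙_ (CochainComplex (SkewMod B G) ℤ) :=
  (singleMapHomologicalComplex (baseChange f) (ComplexShape.up ℤ) 0).app (unitMod A G) ≪≫
    (single (SkewMod B G) (ComplexShape.up ℤ) 0).mapIso (baseChangeUnitIso f)

lemma baseChange_mulUnit (a : Inv A G) :
    (baseChange f).map (mulUnit a) ≫ (baseChangeUnitIso f).hom =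
      (baseChangeUnitIso f).hom ≫ mulUnit (invMap f a) :=
  bcTens_hom_ext f fun b m => by
    apply unitEquiv.injective
    change f ((a : A) * unitEquiv m) * b = f (a : A) * (f (unitEquiv m) * b)
    rw [map_mul, mul_assoc]

lemma baseChange_single_mulUnit (a : Inv A G) :
    (baseChangeFunctor f).map ((single (SkewMod A G) (ComplexShape.up ℤ) 0).map (mulUnit a)) ≫
      (baseChangeUnitCplxIso f).hom =
    (baseChangeUnitCplxIso f).hom ≫
      (single (SkewMod B G) (ComplexShape.up ℤ) 0).map (mulUnit (invMap f a)) := by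
  refine ((Category.assoc _ _ _).symm.trans (congrArg (· ≫ _)
    ((singleMapHomologicalComplex (baseChange f) (ComplexShape.up ℤ) 0).hom.naturality
      (mulUnit a)))).trans ((Category.assoc _ _ _).trans (Eq.trans (congrArg (_ ≫ ·) ?_)
        (Category.assoc _ _ _).symm))
  exact ((single (SkewMod B G) (ComplexShape.up ℤ) 0).map_comp _ _).symm.trans
    ((congrArg (single (SkewMod B G) (ComplexShape.up ℤ) 0).map (baseChange_mulUnit f a)).trans
      ((single (SkewMod B G) (ComplexShape.up ℤ) 0).map_comp _ _))

/-- This makes `comap` compatible with the maps to the spectra of invariants. -/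
lemma isBaseChange_coneInv [IsNoetherianRing A] [Finite G] (a : Inv A G) :
    IsBaseChange f (coneInv a) (coneInv (invMap f a)) := by
  refine (isBaseChange_iff f ((isStrictPerf_unit A G).mappingCone _ (isStrictPerf_unit A G))
    (Iso.refl _)).2 ?_
  obtain ⟨e⟩ := (isDerivable_baseChange f).cone
    ((single (SkewMod A G) (ComplexShape.up ℤ) 0).map (mulUnit a))
  obtain ⟨e'⟩ := nonempty_mappingCone_iso (Q.mapArrow.mapIso
    (Arrow.isoMk (f := Arrow.mk ((baseChangeFunctor f).map
      ((single (SkewMod A G) (ComplexShape.up ℤ) 0).map (mulUnit a))))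
      (g := Arrow.mk ((single (SkewMod B G) (ComplexShape.up ℤ) 0).map (mulUnit (invMap f a))))
      (baseChangeUnitCplxIso f) (baseChangeUnitCplxIso f)
      (baseChange_single_mulUnit f a).symm))
  exact ⟨Q.mapIso e ≪≫ e'⟩

section

variable [IsNoetherianRing A] [Finite G] [IsNoetherianRing B]

/-- The inverse image of a prime thick tensor ideal under base change. -/
def Spc.comap (P : Spc B G) : Spc A G where
  carrier := derivedInverseImage (baseChangeFunctor f) P.carrier
  le_perf := fun _ h => h.1
  isTriangulated := (isDerivable_baseChange f).isTriangulated P.carrier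
  thick := (isDerivable_baseChange f).isStableUnderRetracts P.carrier
  ideal X Y Z hX hY hZ := by
    obtain ⟨K, hK, ⟨e⟩⟩ := exists_isStrictPerf hX.1
    obtain ⟨L, hL, ⟨e'⟩⟩ := exists_isStrictPerf hY
    obtain ⟨i⟩ := (isTensor_iff hK hL e e').1 hZ
    rw [(isDerivable_baseChange f).inverseImage_iff _ hX.1 hK.isRelProj e] at hX
    exact ⟨(perf A G).prop_of_iso i (hK.tensor hL).perf, _, (hK.tensor hL).isRelProj, ⟨i⟩,
      P.carrier.prop_of_iso (Q.mapIso (baseChangeTensorCplxIso f K L))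
        (P.tensor_mem (hK.baseChange f) (hL.baseChange f) hX)⟩
  proper := ⟨_, (isStrictPerf_unit A G).perf, fun h => P.unit_notMem
    (P.carrier.prop_of_iso (Q.mapIso (baseChangeUnitCplxIso f))
      (((isDerivable_baseChange f).inverseImage_iff _ (isStrictPerf_unit A G).perf
        (isStrictPerf_unit A G).isRelProj (Iso.refl _)).1 h))⟩
  prime X Y Z hX hY hZ h := by
    obtain ⟨K, hK, ⟨e⟩⟩ := exists_isStrictPerf hX
    obtain ⟨L, hL, ⟨e'⟩⟩ := exists_isStrictPerf hY
    obtain ⟨i⟩ := (isTensor_iff hK hL e e').1 hZ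
    rw [(isDerivable_baseChange f).inverseImage_iff _ h.1 (hK.tensor hL).isRelProj i] at h
    rw [(isDerivable_baseChange f).inverseImage_iff _ hX hK.isRelProj e,
      (isDerivable_baseChange f).inverseImage_iff _ hY hL.isRelProj e']
    exact P.mem_or_mem (hK.baseChange f) (hL.baseChange f)
      (P.carrier.prop_of_iso (Q.mapIso (baseChangeTensorCplxIso f K L)).symm h)

lemma Spc.isPreimage_comap (P : Spc B G) : IsPreimage f P (P.comap f) := fun X Y hX hY => by
  obtain ⟨K, hK, ⟨e⟩⟩ := exists_isStrictPerf hX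
  obtain ⟨i⟩ := (isBaseChange_iff f hK e).1 hY
  exact ((isDerivable_baseChange f).inverseImage_iff _ hX hK.isRelProj e).trans
    ⟨P.carrier.prop_of_iso i, P.carrier.prop_of_iso i.symm⟩

/-- The preimage of the basic open set of `X` is the basic open set of the base change of `X`. -/
lemma Spc.continuous_comap : Continuous (Spc.comap (G := G) f) := by
  refine continuous_generateFrom_iff.2 ?_
  rintro _ ⟨X, hX, rfl⟩
  obtain ⟨K, hK, ⟨e⟩⟩ := exists_isStrictPerf hX
  refine TopologicalSpace.isOpen_generateFrom_of_mem
    ⟨Q.obj ((baseChangeFunctor f).obj K), (hK.baseChange f).perf, ?_⟩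
  ext P
  exact (isDerivable_baseChange f).inverseImage_iff _ hX hK.isRelProj e

lemma Spc.rhoBar_comap (P : Spc B G) : rhoBar (P.comap f) = invMap f ⁻¹' rhoBar P := by
  ext a
  exact not_congr (P.isPreimage_comap f _ _ (perf_coneInv a) (isBaseChange_coneInv f a))

end

end

/-! ### The reduced fiber -/

section ReducedFiberProperties

open scoped Pointwise

variable {A : Type u} {G : Type v} [CommRing A] [Group G] [MulSemiringAction G A]
  (q : PrimeSpectrum (Inv A G))

instance : Algebra.IsInvariant (Inv A G) A G :=
  ⟨fun b hb => ⟨⟨b, hb⟩, rfl⟩⟩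

instance : IsReduced (ReducedFiber q) :=
  (Ideal.isRadical_iff_quotient_reduced _).1 (Ideal.radical_isRadical (⊥ : Ideal (FiberRing q)))

/-- The fiber ring is essentially of finite type over `A`, as a residue field is over its base. -/
instance [IsNoetherianRing A] : IsNoetherianRing (ReducedFiber q) :=
  have : IsNoetherianRing (FiberRing q) := Algebra.EssFiniteType.isNoetherianRing A _
  inferInstanceAs (IsNoetherianRing (FiberRing q ⧸ nilradical (FiberRing q)))

/-- `A` is integral over its invariants, so some prime of `A` lies over `𝔮`. -/
instance [Finite G] : Nontrivial (ReducedFiber q) := by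
  have : Algebra.IsIntegral (Inv A G) A := Algebra.IsInvariant.isIntegral (Inv A G) A G
  have h : Nontrivial (q.asIdeal.ResidueField ⊗[Inv A G] A) := by
    rw [PrimeSpectrum.nontrivial_iff_mem_rangeComap]
    exact (algebraMap_isIntegral_iff.2 this).comap_surjective Subtype.val_injective q
  have : Nontrivial (FiberRing q) := (Algebra.TensorProduct.comm (Inv A G) _ _).symm.nontrivial
  exact Ideal.Quotient.nontrivial_iff.2 (fun h => by
    have h1 : (1 : FiberRing q) ∈ nilradical (FiberRing q) := h ▸ Submodule.mem_top
    exact not_isNilpotent_one h1)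

lemma tmul_algebraMap (a : A) (r : Inv A G) :
    (a ⊗ₜ[Inv A G] algebraMap (Inv A G) q.asIdeal.ResidueField r : FiberRing q) =
      (a * (r : A)) ⊗ₜ[Inv A G] 1 := by
  rw [Algebra.algebraMap_eq_smul_one, ← TensorProduct.smul_tmul, mul_comm]
  rfl

lemma psi_eq_zero {r : Inv A G} (hr : r ∈ q.asIdeal) : psi q (r : A) = 0 := by
  have := tmul_algebraMap q (1 : A) r
  rw [Ideal.algebraMap_residueField_eq_zero.2 hr, TensorProduct.tmul_zero, one_mul] at this
  exact (congrArg (Ideal.Quotient.mk (nilradical (FiberRing q))) this.symm).trans (map_zero _)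

lemma isUnit_psi {s : Inv A G} (hs : s ∉ q.asIdeal) : IsUnit (psi q (s : A)) := by
  have h : IsUnit (algebraMap (Inv A G) q.asIdeal.ResidueField s) :=
    isUnit_iff_ne_zero.2 fun h => hs (Ideal.algebraMap_residueField_eq_zero.1 h)
  have := h.map (Algebra.TensorProduct.includeRight (R := Inv A G) (A := A))
  have := this.map (Ideal.Quotient.mk (nilradical (FiberRing q)))
  rw [Algebra.TensorProduct.includeRight_apply, tmul_algebraMap, one_mul] at this
  exact this

lemma invMap_psi_eq_zero_iff [Finite G] (r : Inv A G) : invMap (psi q) r = 0 ↔ r ∈ q.asIdeal := by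
  refine ⟨fun h => ?_, fun h => Subtype.ext (psi_eq_zero q h)⟩
  by_contra hr
  exact (isUnit_psi q hr).ne_zero (congrArg Subtype.val h)

/-- The residue field is the fraction field of `A^G/𝔮`, so denominators from `A^G ∖ 𝔮` suffice, and
sums have common ones. Hence the reduced fiber is a localization of a quotient of `A`. -/
lemma exists_psi_mul_eq (b : ReducedFiber q) :
    ∃ (s : Inv A G) (_ : s ∉ q.asIdeal) (a : A), psi q (s : A) * b = psi q a := by
  obtain ⟨z, rfl⟩ := Ideal.Quotient.mk_surjective b
  suffices ∃ (s : Inv A G) (_ : s ∉ q.asIdeal) (a : A),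
      ((s : A) ⊗ₜ[Inv A G] 1 : FiberRing q) * z = a ⊗ₜ 1 by
    obtain ⟨s, hs, a, h⟩ := this
    exact ⟨s, hs, a, congrArg (Ideal.Quotient.mk (nilradical (FiberRing q))) h⟩
  induction z using TensorProduct.induction_on with
  | zero =>
    exact ⟨1, fun h => q.isPrime.ne_top ((Ideal.eq_top_iff_one _).2 h), 0, by
      rw [mul_zero, TensorProduct.zero_tmul]⟩
  | tmul x y =>
    obtain ⟨⟨r, s⟩, h⟩ := IsLocalization.surj (nonZeroDivisors (Inv A G ⧸ q.asIdeal)) y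
    obtain ⟨r, rfl⟩ := Ideal.Quotient.mk_surjective r
    obtain ⟨s, hs⟩ := s
    obtain ⟨s, rfl⟩ := Ideal.Quotient.mk_surjective s
    refine ⟨s, fun h => nonZeroDivisors.ne_zero hs (Ideal.Quotient.eq_zero_iff_mem.2 h), x * r, ?_⟩
    have h' : y * algebraMap (Inv A G) q.asIdeal.ResidueField s = algebraMap _ _ r := h
    rw [← tmul_algebraMap, ← h', ← one_mul (s : A), ← tmul_algebraMap,
      Algebra.TensorProduct.tmul_mul_tmul, one_mul, mul_comm y]
  | add x y hx hy =>
    obtain ⟨s, hs, a, h⟩ := hx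
    obtain ⟨s', hs', a', h'⟩ := hy
    refine ⟨s * s', q.isPrime.mul_notMem hs hs', s' * a + s * a', ?_⟩
    have e (a b : A) : ((a * b) ⊗ₜ[Inv A G] 1 : FiberRing q) = a ⊗ₜ 1 * b ⊗ₜ 1 := by
      rw [Algebra.TensorProduct.tmul_mul_tmul, one_mul]
    rw [Subring.coe_mul, TensorProduct.add_tmul, e, e, e, ← h, ← h']
    ring

/-- Up to denominators outside `𝔮`, the kernel of `A → A ⊗ k(𝔮)` is `𝔮A`, and the kernel of `psi q`
is its radical. Noetherianity makes the exponent and the denominator uniform. -/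
lemma exists_mul_mem_of_psi_eq_zero [IsNoetherianRing A] :
    ∃ (n : ℕ) (s : Inv A G) (_ : s ∉ q.asIdeal),
      ∀ a ∈ RingHom.ker (psi q).toRingHom ^ n,
        (s : A) * a ∈ q.asIdeal.map (algebraMap (Inv A G) A) := by
  classical
  let J := q.asIdeal.map (algebraMap (Inv A G) A)
  -- The localization `D` of `A/𝔮A` receives a map from the fiber ring, so an element that dies in
  -- the fiber dies in `D`, that is, after multiplication by some `s ∉ 𝔮`.
  let S := q.asIdeal.primeCompl.map (algebraMap (Inv A G) (A ⧸ J))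
  let D := Localization S
  let ι : (A ⧸ J) →+* D := algebraMap _ _
  have key (a : A) (ha : (a ⊗ₜ[Inv A G] 1 : FiberRing q) = 0) :
      ∃ (s : Inv A G) (_ : s ∉ q.asIdeal), (s : A) * a ∈ J := by
    let α : Inv A G →ₐ[Inv A G] D := Algebra.ofId _ _
    have hα (r : Inv A G) : α r = ι (algebraMap (Inv A G) (A ⧸ J) r) := rfl
    let κ : q.asIdeal.ResidueField →ₐ[Inv A G] D := Ideal.ResidueField.liftₐ q.asIdeal α
      (fun r hr => by
        have : algebraMap (Inv A G) (A ⧸ J) r = 0 :=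
          Ideal.Quotient.eq_zero_iff_mem.2 (Ideal.mem_map_of_mem _ hr)
        exact (hα r).trans (by rw [this, map_zero]))
      (fun r hr => IsLocalization.map_units D
        (⟨_, Submonoid.mem_map_of_mem _ hr⟩ : S))
    let Φ : FiberRing q →ₐ[Inv A G] D := Algebra.TensorProduct.lift
      ((IsScalarTower.toAlgHom (Inv A G) (A ⧸ J) D).comp (Ideal.Quotient.mkₐ _ J)) κ
      (fun _ _ => Commute.all _ _)
    have h0 : ι (Ideal.Quotient.mk J a) = 0 := by
      have := congrArg Φ ha
      rw [map_zero, Algebra.TensorProduct.lift_tmul, map_one, mul_one] at this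
      exact this
    obtain ⟨⟨_, s, hs, rfl⟩, h⟩ := (IsLocalization.map_eq_zero_iff S D _).1 h0
    exact ⟨s, hs, Ideal.Quotient.eq_zero_iff_mem.1 h⟩
  let K : Ideal A := RingHom.ker (algebraMap A (FiberRing q))
  -- An element killed by `psi q` is nilpotent in the fiber ring, so it has a power in `K`.
  obtain ⟨n, hn⟩ := Ideal.exists_pow_le_of_le_radical_of_fg
    (I := RingHom.ker (psi q).toRingHom) (J := K) (fun a ha => by
      obtain ⟨n, hn⟩ := Ideal.Quotient.eq_zero_iff_mem.1 ha
      exact ⟨n, ((map_pow (algebraMap A (FiberRing q)) a n).trans hn :)⟩)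
    (IsNoetherian.noetherian _)
  obtain ⟨T, hT⟩ := IsNoetherian.noetherian K
  have hT' : ∀ a ∈ T, ∃ (s : Inv A G) (_ : s ∉ q.asIdeal), (s : A) * a ∈ J := fun a ha =>
    key a (show a ∈ K from hT ▸ Submodule.subset_span ha)
  choose! s hs hsJ using hT'
  refine ⟨n, ∏ a ∈ T, s a, fun h => ?_, fun a ha => ?_⟩
  · obtain ⟨a, ha, h⟩ := (Ideal.IsPrime.prod_mem_iff (hp := q.isPrime)).1 h
    exact hs a ha h
  · have : K ≤ Submodule.comap (LinearMap.mulLeft A ((∏ a ∈ T, s a : Inv A G) : A)) J := by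
      rw [← hT, Submodule.span_le]
      intro a ha
      change ((∏ a ∈ T, s a : Inv A G) : A) * a ∈ J
      rw [← Finset.prod_erase_mul _ _ ha, Subring.coe_mul, mul_assoc]
      exact J.mul_mem_left _ (hsJ a ha)
    exact this (hn ha)

lemma under_comap_psi [Finite G] (P : Ideal (ReducedFiber q)) [P.IsPrime] :
    (P.comap (psi q).toRingHom).under (Inv A G) = q.asIdeal := by
  ext r
  refine ⟨fun h => ?_, fun h => ?_⟩
  · by_contra hr
    exact Ideal.IsPrime.ne_top ‹_› (P.eq_top_of_isUnit_mem h (isUnit_psi q hr))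
  · exact Ideal.mem_comap.2 ((congrArg (· ∈ P) (psi_eq_zero q h)).mpr P.zero_mem)

/-- A finite group acts transitively on the primes of `A` over a given prime of the invariants. -/
lemma exists_comap_psi_eq_smul [Finite G] (P P' : Ideal (ReducedFiber q)) [P.IsPrime]
    [P'.IsPrime] :
    ∃ g : G, P'.comap (psi q).toRingHom = g • P.comap (psi q).toRingHom :=
  Algebra.IsInvariant.exists_smul_of_under_eq (Inv A G) A G _ _
    ((under_comap_psi q P).trans (under_comap_psi q P').symm)

/-- Every element becomes the image of an element of `A` after multiplication by an invariant unit,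
so inclusions between primes may be checked on their contractions to `A`. -/
lemma mem_of_comap_psi_le (P P' : Ideal (ReducedFiber q)) [P'.IsPrime]
    {g : G} (h : ∀ a, psi q a ∈ P → psi q (g • a) ∈ P') {b : ReducedFiber q} (hb : b ∈ P) :
    g • b ∈ P' := by
  obtain ⟨s, hs, a, e⟩ := exists_psi_mul_eq q b
  have h1 := h a (e ▸ P.mul_mem_left _ hb)
  rw [map_smul, ← e, smul_mul', ← map_smul, s.2 g] at h1
  exact (‹P'.IsPrime›.mem_or_mem h1).resolve_left
    fun h => ‹P'.IsPrime›.ne_top (P'.eq_top_of_isUnit_mem h (isUnit_psi q hs))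

/-- A non-unit lies in a maximal ideal; being invariant it lies in all primes by transitivity, so it
is nilpotent and thus zero in a reduced ring. The inverse of an invariant unit is invariant because
inverses are unique. -/
lemma isUnit_of_invariant [Finite G] {b : Inv (ReducedFiber q) G} (hb : b ≠ 0) : IsUnit b := by
  have hu : IsUnit (b : ReducedFiber q) := by
    by_contra hu
    obtain ⟨M, hM, hbM⟩ := exists_max_ideal_of_mem_nonunits hu
    refine hb (Subtype.ext ?_)
    have : (b : ReducedFiber q) ∈ nilradical (ReducedFiber q) := by
      rw [mem_nilradical, nilpotent_iff_mem_prime]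
      intro P hP
      obtain ⟨g, hg⟩ := exists_comap_psi_eq_smul q M P
      rw [← b.2 g]
      refine mem_of_comap_psi_le q M P (fun a ha => ?_) hbM
      have : g • a ∈ P.comap (psi q).toRingHom := hg ▸ Ideal.smul_mem_pointwise_smul _ _ _ ha
      exact this
    rwa [nilradical_eq_zero] at this
  obtain ⟨⟨x, y, hxy, hyx⟩, rfl : x = b⟩ := hu
  refine ⟨⟨b, ⟨y, fun g => ?_⟩, Subtype.ext hxy, Subtype.ext hyx⟩, rfl⟩
  have h : (b : ReducedFiber q) * (g • y) = 1 := by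
    rw [← b.2 g, ← smul_mul', hxy, smul_one]
  calc g • y = y * b * (g • y) := by rw [hyx, one_mul]
    _ = y := by rw [mul_assoc, h, mul_one]

/-- Conjugate contractions leave no room for strict inclusions of primes, so the dimension is zero;
a reduced Artinian ring is semisimple. The use of this is that all modules over the reduced fiber
are flat. -/
instance [Finite G] [IsNoetherianRing A] : IsSemisimpleRing (ReducedFiber q) := by
  have : Ring.KrullDimLE 0 (ReducedFiber q) := by
    refine Ring.KrullDimLE.mk₀ fun P hP => ?_
    obtain ⟨M, hM, hPM⟩ := P.exists_le_maximal hP.ne_top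
    suffices M ≤ P from le_antisymm hPM this ▸ hM
    obtain ⟨g, hg⟩ := exists_comap_psi_eq_smul q P M
    have h1 : P.comap (psi q).toRingHom ≤ g • P.comap (psi q).toRingHom :=
      hg ▸ Ideal.comap_mono hPM
    -- As `g` has finite order, an ideal contained in its translate by `g` equals it.
    have h2 := smul_eq_of_le_smul h1
    intro b hb
    rw [← one_smul G b]
    refine mem_of_comap_psi_le q M P (fun a ha => ?_) hb
    rw [one_smul]
    have : a ∈ P.comap (psi q).toRingHom := by
      rw [← h2, ← hg]
      exact ha
    exact this
  have : IsArtinianRing (ReducedFiber q) :=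
    isArtinianRing_iff_isNoetherianRing_krullDimLE_zero.2 ⟨inferInstance, inferInstance⟩
  exact IsArtinianRing.isSemisimpleRing_of_isReduced _

end ReducedFiberProperties

/-! ### Augmented complexes and the objects they annihilate -/

section

open HomologicalComplex MonoidalCategory DerivedCategory ZeroObject

attribute [local instance] HasDerivedCategory.standard

variable {A : Type u} {G : Type v} [CommRing A] [Group G] [MulSemiringAction G A]

local infixr:70 " ⊠ " => MonoidalCategoryStruct.tensorObj

lemma IsStrictPerf.acyclic_tensor {W : CochainComplex (SkewMod A G) ℤ} (hW : IsStrictPerf W)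
    {Z : CochainComplex (SkewMod A G) ℤ} (hZ : Z.Acyclic) : (W ⊠ Z).Acyclic := by
  obtain ⟨a, ha⟩ := hW.ge
  obtain ⟨b, hb⟩ := hW.le
  exact EquivPerf.acyclic_tensor W a b hW.proj Z hZ

/-- Here `K` and `L` are arbitrary. This lets tensoring with a strictly perfect complex descend to
all of `D(AG)`, which is needed for modules that are neither finitely generated nor projective over
`A`. -/
lemma IsStrictPerf.quasiIso_whisker {W : CochainComplex (SkewMod A G) ℤ} (hW : IsStrictPerf W)
    {K L : CochainComplex (SkewMod A G) ℤ} (φ : K ⟶ L) [h : QuasiIso φ] : QuasiIso (φ ▷ W) := by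
  rw [← acyclic_mappingCone_iff] at h ⊢
  exact acyclic_of_iso (hW.acyclic_tensor h) (cplxComm _ _ ≪≫ (coneTensorIso φ W).symm)

lemma IsStrictPerf.quasiIso_whiskerLeft {W : CochainComplex (SkewMod A G) ℤ} (hW : IsStrictPerf W)
    {K L : CochainComplex (SkewMod A G) ℤ} (φ : K ⟶ L) [h : QuasiIso φ] : QuasiIso (W ◁ φ) := by
  have := hW.quasiIso_whisker φ
  refine quasiIso_of_arrow_iso (cplxComm W K) (cplxComm W L) (ψ := φ ▷ W) ?_
  rw [← tensorHom_id, ← id_tensorHom]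
  exact cplxComm_naturality (𝟙 W) φ

/-- `F` factors through the derived category, where `φ` and the zero morphism have the same image.
Comparing the two avoids proving that the factorization is additive. -/
lemma map_eq_zero_of_Q_map_eq_zero {C E : Type*} [Category C] [Abelian C] [HasDerivedCategory C]
    [Category E] [HasZeroMorphisms E] (F : CochainComplex C ℤ ⥤ E) [F.PreservesZeroMorphisms]
    (hF : ∀ ⦃K L : CochainComplex C ℤ⦄ (φ : K ⟶ L), QuasiIso φ → IsIso (F.map φ))
    {K L : CochainComplex C ℤ} {φ : K ⟶ L} (h : Q.map φ = 0) : F.map φ = 0 := by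
  have hF' : (HomologicalComplex.quasiIso C (ComplexShape.up ℤ)).IsInvertedBy F := hF
  let e := Localization.fac F hF' Q
  have h₁ := e.hom.naturality φ
  have h₂ := e.hom.naturality (0 : K ⟶ L)
  rw [Functor.comp_map, Functor.map_zero] at h₂
  rw [Functor.comp_map, h, h₂, F.map_zero, comp_zero] at h₁
  rw [← cancel_epi (e.hom.app K), comp_zero]
  exact h₁.symm

lemma IsStrictPerf.Q_map_whiskerRight_eq_zero {L : CochainComplex (SkewMod A G) ℤ}
    (hL : IsStrictPerf L) {K K' : CochainComplex (SkewMod A G) ℤ} {φ : K ⟶ K'}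
    (h : Q.map φ = 0) : Q.map (φ ▷ L) = 0 := by
  have : (MonoidalCategory.tensorRight L ⋙ Q).PreservesZeroMorphisms := ⟨fun X Y => by
    have : (0 : X ⟶ Y) ▷ L = 0 := by
      rw [whiskerRight_eq]
      ext n : 1
      refine tot_hom_ext (F := tensorBifunctor A G) fun i j h => ?_
      rw [ι_map, HomologicalComplex.zero_f, HomologicalComplex.zero_f, Functor.map_zero,
        NatTrans.app_zero, zero_comp]
      exact comp_zero.symm
    exact (congrArg Q.map this).trans (Q.map_zero _ _)⟩
  exact map_eq_zero_of_Q_map_eq_zero (MonoidalCategory.tensorRight L ⋙ Q) (fun X Y ψ hψ =>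
    (isIso_Q_map_iff_quasiIso _ (ψ ▷ L)).2 (hL.quasiIso_whisker ψ)) h

variable (A G) in
/-- A bounded complex of `AG`-modules, finitely generated projective over `A`, with a morphism to
the unit object. -/
structure Aug where
  /-- The complex. -/
  W : CochainComplex (SkewMod A G) ℤ
  isStrictPerf : IsStrictPerf W
  /-- The augmentation. -/
  ξ : W ⟶ 𝟙_ (CochainComplex (SkewMod A G) ℤ)

namespace Aug

variable (w w₁ w₂ : Aug A G)

/-- The morphism `W ⊗ K ⟶ K` induced by the augmentation. -/
def aug (K : CochainComplex (SkewMod A G) ℤ) : w.W ⊠ K ⟶ K := w.ξ ▷ K ≫ (λ_ K).hom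

lemma aug_naturality {K K' : CochainComplex (SkewMod A G) ℤ} (φ : K ⟶ K') :
    w.W ◁ φ ≫ w.aug K' = w.aug K ≫ φ := by
  rw [aug, aug, whisker_exchange_assoc, leftUnitor_naturality, Category.assoc]

/-- The tensor product of two augmented complexes. -/
def mul : Aug A G where
  W := w₁.W ⊠ w₂.W
  isStrictPerf := w₁.isStrictPerf.tensor w₂.isStrictPerf
  ξ := (w₁.ξ ⊗ₘ w₂.ξ) ≫ (λ_ _).hom

lemma mul_ξ : (w₁.mul w₂).ξ = w₁.aug w₂.W ≫ w₂.ξ := by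
  change (w₁.ξ ⊗ₘ w₂.ξ) ≫ (λ_ _).hom = (w₁.ξ ▷ w₂.W ≫ (λ_ _).hom) ≫ w₂.ξ
  rw [MonoidalCategory.tensorHom_def, Category.assoc, leftUnitor_naturality, Category.assoc]

/-- The product acts by first contracting `W₁` and then `W₂`; this underlies annihilation in two
steps. -/
lemma aug_mul (K : CochainComplex (SkewMod A G) ℤ) :
    (w₁.mul w₂).aug K = (α_ w₁.W w₂.W K).hom ≫ w₁.aug (w₂.W ⊠ K) ≫ w₂.aug K := by
  rw [aug, mul_ξ, aug, aug, aug]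
  change (((w₁.ξ ▷ w₂.W ≫ (λ_ w₂.W).hom) ≫ w₂.ξ) ▷ K) ≫ _ = _
  simp only [comp_whiskerRight, Category.assoc, whiskerRight_tensor, leftUnitor_whiskerRight,
    Iso.hom_inv_id_assoc]

lemma aug_tensor (K L : CochainComplex (SkewMod A G) ℤ) :
    w.aug (K ⊠ L) = (α_ w.W K L).inv ≫ w.aug K ▷ L := by
  rw [aug, aug]
  simp only [comp_whiskerRight, whiskerRight_tensor, leftUnitor_whiskerRight, Category.assoc]

/-- The tensor product with `W`, as a functor on `D(AG)`. -/
def functor : DAG A G ⥤ DAG A G :=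
  Localization.lift (W := HomologicalComplex.quasiIso (SkewMod A G) (ComplexShape.up ℤ))
    (MonoidalCategory.tensorLeft w.W ⋙ Q) (fun _ _ φ hφ =>
      have : QuasiIso φ := hφ
      (isIso_Q_map_iff_quasiIso _ (w.W ◁ φ)).2 (w.isStrictPerf.quasiIso_whiskerLeft φ)) Q

instance : Localization.Lifting Q (HomologicalComplex.quasiIso (SkewMod A G) (ComplexShape.up ℤ))
    (MonoidalCategory.tensorLeft w.W ⋙ Q) w.functor :=
  Localization.liftingLift _ _ _

/-- The functor `w.functor` is computed by the tensor product of complexes. -/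
def functorIso (K : CochainComplex (SkewMod A G) ℤ) :
    w.functor.obj (Q.obj K) ≅ Q.obj (w.W ⊠ K) :=
  (Localization.Lifting.iso Q (HomologicalComplex.quasiIso (SkewMod A G) (ComplexShape.up ℤ))
    (MonoidalCategory.tensorLeft w.W ⋙ Q) w.functor).app K

/-- The natural transformation `W ⊗ Z ⟶ Z` on `D(AG)`. -/
def τ : w.functor ⟶ 𝟭 (DAG A G) :=
  Localization.liftNatTrans Q (HomologicalComplex.quasiIso (SkewMod A G) (ComplexShape.up ℤ))
    (MonoidalCategory.tensorLeft w.W ⋙ Q) Q _ _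
    { app := fun K => Q.map (w.aug K)
      naturality := fun K L φ => by
        refine (Q.map_comp _ _).symm.trans (Eq.trans ?_ (Q.map_comp _ _))
        exact congrArg Q.map (w.aug_naturality φ) }

lemma τ_app_Q (K : CochainComplex (SkewMod A G) ℤ) :
    w.τ.app (Q.obj K) = (w.functorIso K).hom ≫ Q.map (w.aug K) := by
  refine (Localization.liftNatTrans_app _ _ _ _ _ _ _ K).trans (congrArg _ ?_)
  exact Category.comp_id _

lemma τ_app_Q_eq_zero_iff (K : CochainComplex (SkewMod A G) ℤ) :
    w.τ.app (Q.obj K) = 0 ↔ Q.map (w.aug K) = 0 := by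
  rw [τ_app_Q, Preadditive.IsIso.comp_left_eq_zero]

lemma τ_app_Q_eq_zero_iff' (K : CochainComplex (SkewMod A G) ℤ) :
    w.τ.app (Q.obj K) = 0 ↔ Q.map (w.ξ ▷ K) = 0 := by
  rw [τ_app_Q_eq_zero_iff, aug, Functor.map_comp, Preadditive.IsIso.comp_right_eq_zero]

/-- The composite in the hypothesis is, up to isomorphism, the augmentation of the product on `Z`;
`Z` is first replaced by a complex so that `aug_mul` applies. -/
lemma τ_mul_eq_zero {Z : DAG A G} (h : w₁.τ.app (w₂.functor.obj Z) ≫ w₂.τ.app Z = 0) :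
    (w₁.mul w₂).τ.app Z = 0 := by
  obtain ⟨K, ⟨e⟩⟩ : ∃ K, Nonempty (Q.obj K ≅ Z) :=
    ⟨_, ⟨Q.objObjPreimageIso Z⟩⟩
  have h' : w₁.τ.app (w₂.functor.obj (Q.obj K)) ≫ w₂.τ.app (Q.obj K) = 0 := by
    rw [← cancel_mono e.hom, zero_comp, Category.assoc]
    have h₁ := w₂.τ.naturality e.hom
    have h₂ := w₁.τ.naturality (w₂.functor.map e.hom)
    rw [Functor.id_map] at h₁ h₂
    rw [← h₁, ← reassoc_of% h₂, h, comp_zero]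
  have h₀ := w₁.τ.naturality (w₂.functorIso K).hom
  rw [Functor.id_map] at h₀
  rw [τ_app_Q, ← reassoc_of% h₀, Preadditive.IsIso.comp_left_eq_zero, τ_app_Q, Category.assoc,
    Preadditive.IsIso.comp_left_eq_zero] at h'
  have : (w₁.mul w₂).τ.app (Q.obj K) = 0 := by
    rw [τ_app_Q_eq_zero_iff, aug_mul]
    exact (Q.map_comp _ _).trans ((congrArg _ ((Q.map_comp _ _).trans h')).trans comp_zero)
  have h₃ := (w₁.mul w₂).τ.naturality e.hom
  rw [this] at h₃
  rw [← cancel_epi ((w₁.mul w₂).functor.map e.hom), comp_zero, h₃]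
  exact zero_comp

end Aug

/-- A class of augmented complexes closed under tensor products. -/
structure IsMultiplicative (𝓢 : Aug A G → Prop) : Prop where
  nonempty : ∃ w, 𝓢 w
  mul : ∀ {w₁ w₂}, 𝓢 w₁ → 𝓢 w₂ → 𝓢 (w₁.mul w₂)

/-- The objects of `D(AG)` which are annihilated by an augmented complex in `𝓢`. -/
def annihilated (𝓢 : Aug A G → Prop) : ObjectProperty (DAG A G) := fun Z =>
  ∃ w, 𝓢 w ∧ w.τ.app Z = 0

section

variable {𝓢 : Aug A G → Prop}

instance : (annihilated 𝓢).IsStableUnderRetracts where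
  of_retract {X Y} r := fun ⟨w, hw, h⟩ => ⟨w, hw, by
    have h' := w.τ.naturality r.i
    rw [h, comp_zero, Functor.id_map] at h'
    rw [← Category.comp_id (w.τ.app X)]
    change w.τ.app X ≫ 𝟙 X = 0
    rw [← r.retract, ← Category.assoc]
    exact (congrArg (· ≫ r.r) h'.symm).trans zero_comp⟩

instance : (annihilated 𝓢).IsClosedUnderIsomorphisms where
  of_iso e h := (annihilated 𝓢).prop_of_retract ⟨e.inv, e.hom, e.inv_hom_id⟩ h

lemma annihilated_tensor {K L : CochainComplex (SkewMod A G) ℤ} (hL : IsStrictPerf L)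
    (h : annihilated 𝓢 (Q.obj K)) : annihilated 𝓢 (Q.obj (K ⊠ L)) := by
  obtain ⟨w, hw, h⟩ := h
  refine ⟨w, hw, ?_⟩
  rw [Aug.τ_app_Q_eq_zero_iff] at h ⊢
  rw [Aug.aug_tensor, Functor.map_comp, hL.Q_map_whiskerRight_eq_zero h, comp_zero]

/-- By naturality `W₃ ⊗ X₂ ⟶ X₂` becomes zero in `X₃`, so it factors through `X₁`; there `W₁` kills
it. The product of the two annihilates `X₂`. -/
lemma IsMultiplicative.ext_annihilated (h𝓢 : IsMultiplicative 𝓢)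
    (T : Pretriangulated.Triangle (DAG A G)) (hT : T ∈ Pretriangulated.distinguishedTriangles)
    (h₁ : annihilated 𝓢 T.obj₁) (h₃ : annihilated 𝓢 T.obj₃) : annihilated 𝓢 T.obj₂ := by
  obtain ⟨w₁, hw₁, h₁⟩ := h₁
  obtain ⟨w₃, hw₃, h₃⟩ := h₃
  refine ⟨_, h𝓢.mul hw₁ hw₃, Aug.τ_mul_eq_zero _ _ ?_⟩
  have hn := w₃.τ.naturality T.mor₂
  rw [h₃, comp_zero] at hn
  obtain ⟨t, ht⟩ := Pretriangulated.Triangle.coyoneda_exact₂ T hT (w₃.τ.app T.obj₂) hn.symm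
  have hn' := w₁.τ.naturality t
  rw [h₁, comp_zero] at hn'
  rw [ht]
  exact (Category.assoc _ _ _).symm.trans ((congrArg (· ≫ T.mor₁) hn'.symm).trans zero_comp)

/-- `K ⊗ 1⟦n⟧ ≅ K⟦n⟧`. -/
def tensorShiftUnitIso (K : CochainComplex (SkewMod A G) ℤ) (n : ℤ) :
    K ⊠ ((𝟙_ (CochainComplex (SkewMod A G) ℤ))⟦n⟧) ≅ K⟦n⟧ :=
  cplxComm _ _ ≪≫ shiftTensorIso (𝟙_ (CochainComplex (SkewMod A G) ℤ)) K n ≪≫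
    (shiftFunctor (CochainComplex (SkewMod A G) ℤ) n).mapIso (λ_ K)

/-- Shifting is tensoring with the shifted unit, which is strictly perfect. -/
lemma annihilated_shift {X : DAG A G} (n : ℤ) (h : annihilated 𝓢 X) : annihilated 𝓢 (X⟦n⟧) := by
  obtain ⟨K, ⟨e⟩⟩ : ∃ K, Nonempty (Q.obj K ≅ X) := ⟨_, ⟨Q.objObjPreimageIso X⟩⟩
  have h₁ := annihilated_tensor ((isStrictPerf_unit A G).shift n)
    ((annihilated 𝓢).prop_of_iso e.symm h)
  have h₂ := (annihilated 𝓢).prop_of_iso (Q.mapIso (tensorShiftUnitIso K n)) h₁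
  have h₃ := (annihilated 𝓢).prop_of_iso ((Q.commShiftIso n).app K) h₂
  exact (annihilated 𝓢).prop_of_iso ((shiftFunctor (DAG A G) n).mapIso e) h₃

lemma IsMultiplicative.isTriangulated (h𝓢 : IsMultiplicative 𝓢) :
    (annihilated 𝓢).IsTriangulated :=
  isTriangulated_of _ (fun _ hX => by
    obtain ⟨w, hw⟩ := h𝓢.nonempty
    exact ⟨w, hw, hX.eq_of_tgt _ _⟩) (fun _ n => annihilated_shift n) h𝓢.ext_annihilated

end

end

/-! ### Multiplicative classes of augmented complexes -/

section

open HomologicalComplex MonoidalCategory DerivedCategory ZeroObject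

attribute [local instance] HasDerivedCategory.standard

variable {A : Type u} {G : Type v} [CommRing A] [Group G] [MulSemiringAction G A]

local infixr:70 " ⊠ " => MonoidalCategoryStruct.tensorObj

section

variable [IsNoetherianRing A] [Finite G] (P : Spc A G)

/-- The augmented complexes whose augmentation has its cone in `𝒫`. -/
def Spc.augClass (w : Aug A G) : Prop := P.carrier.trW (Q.map w.ξ)

variable {P} in
lemma Spc.augClass.trW_aug {w : Aug A G} (hw : P.augClass w)
    {X : CochainComplex (SkewMod A G) ℤ} (hX : IsStrictPerf X) :
    P.carrier.trW (Q.map (w.aug X)) := by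
  have h : P.carrier.trW (Q.map (w.ξ ▷ X)) := by
    rw [trW_Q_map_iff]
    refine P.carrier.prop_of_iso (Q.mapIso (coneTensorIso w.ξ X).symm) ?_
    exact P.tensor_mem (w.isStrictPerf.mappingCone _ (isStrictPerf_unit A G)) hX
      ((trW_Q_map_iff _ _).1 hw)
  rw [Aug.aug, Functor.map_comp]
  exact P.carrier.trW.comp_mem _ _ h (P.carrier.trW_of_isIso _)

/-- The product augmentation is `w₁.aug w₂.W` followed by `w₂.ξ`, and both have their cones in `𝒫`.
-/
lemma Spc.isMultiplicative_augClass : IsMultiplicative P.augClass where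
  nonempty := ⟨⟨_, isStrictPerf_unit A G, 𝟙 _⟩, by
    have h := P.carrier.trW_of_isIso (Q.map (𝟙 (𝟙_ (CochainComplex (SkewMod A G) ℤ))))
    exact h⟩
  mul {w₁ w₂} h₁ h₂ := by
    have h : P.carrier.trW (Q.map (w₁.aug w₂.W ≫ w₂.ξ)) := by
      rw [Functor.map_comp]
      exact P.carrier.trW.comp_mem _ _ (h₁.trW_aug w₂.isStrictPerf) h₂
    have key {X Y : CochainComplex (SkewMod A G) ℤ} {φ ψ : X ⟶ Y} (e : φ = ψ)
        (h : P.carrier.trW (Q.map ψ)) : P.carrier.trW (Q.map φ) := e ▸ h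
    exact key (Aug.mul_ξ w₁ w₂) h

end

variable {B : Type u} [CommRing B] [MulSemiringAction G B] (f : A →+*[G] B)

lemma baseChangeTensorCplxIso_naturality {K K' L L' : CochainComplex (SkewMod A G) ℤ}
    (φ : K ⟶ K') (ψ : L ⟶ L') :
    ((baseChangeFunctor f).map φ ⊗ₘ (baseChangeFunctor f).map ψ) ≫
        (baseChangeTensorCplxIso f K' L').hom =
      (baseChangeTensorCplxIso f K L).hom ≫ (baseChangeFunctor f).map (φ ⊗ₘ ψ) :=
  have := baseChange_preservesColimitsOfShape (G := G) f
  mapBifunctorComparison_naturality (baseChangeComparison G f) φ ψ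

/-- The augmented complexes over `B` which come from a class of augmented complexes over `A`. -/
def baseChangeAug (𝓢 : Aug A G → Prop) (w' : Aug B G) : Prop :=
  ∃ w, 𝓢 w ∧ ∃ (i : w'.W ≅ (baseChangeFunctor f).obj w.W)
    (j : (baseChangeFunctor f).obj (𝟙_ (CochainComplex (SkewMod A G) ℤ)) ≅ 𝟙_ _),
    w'.ξ = i.hom ≫ (baseChangeFunctor f).map w.ξ ≫ j.hom

/-- The base change of an augmented complex. -/
def Aug.baseChange (w : Aug A G) : Aug B G where
  W := (baseChangeFunctor f).obj w.W
  isStrictPerf := w.isStrictPerf.baseChange f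
  ξ := (baseChangeFunctor f).map w.ξ ≫ (baseChangeUnitCplxIso f).hom

variable {𝓢 : Aug A G → Prop}

lemma baseChangeAug_baseChange {w : Aug A G} (hw : 𝓢 w) : baseChangeAug f 𝓢 (w.baseChange f) :=
  ⟨w, hw, Iso.refl _, baseChangeUnitCplxIso f, (Category.id_comp _).symm⟩

/-- This is the rewriting in `IsMultiplicative.baseChangeAug`, isolated in an arbitrary monoidal
category. Only naturality of the tensor comparison enters. -/
lemma tensorHom_comp_leftUnitor {C : Type*} [Category C] [MonoidalCategory C]
    {X₁ X₂ Y₁ Y₂ U V M N : C} {ξ₁ : Y₁ ⟶ U} {ξ₂ : Y₂ ⟶ U} {μ : Y₁ ⊗ Y₂ ⟶ N} {x : N ⟶ M}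
    (ν : U ⊗ U ≅ M) (l : M ≅ V) (h : (ξ₁ ⊗ₘ ξ₂) ≫ ν.hom = μ ≫ x) (i₁ : X₁ ⟶ Y₁) (i₂ : X₂ ⟶ Y₂)
    (j₁ j₂ : U ⟶ 𝟙_ C) :
    ((i₁ ≫ ξ₁ ≫ j₁) ⊗ₘ (i₂ ≫ ξ₂ ≫ j₂)) ≫ (λ_ (𝟙_ C)).hom =
      ((i₁ ⊗ₘ i₂) ≫ μ) ≫ (x ≫ l.hom) ≫ l.inv ≫ ν.inv ≫ (j₁ ⊗ₘ j₂) ≫ (λ_ (𝟙_ C)).hom := by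
  rw [← tensorHom_comp_tensorHom, ← tensorHom_comp_tensorHom]
  simp only [Category.assoc, Iso.hom_inv_id_assoc]
  rw [← reassoc_of% h, Iso.hom_inv_id_assoc]

/-- In `baseChangeAug` the comparison `j` of the units is an arbitrary isomorphism, so no coherence
between the unit and tensor comparisons of base change has to be verified. -/
lemma IsMultiplicative.baseChangeAug (h𝓢 : IsMultiplicative 𝓢) :
    IsMultiplicative (baseChangeAug f 𝓢) where
  nonempty := by
    obtain ⟨w, hw⟩ := h𝓢.nonempty
    exact ⟨_, baseChangeAug_baseChange f hw⟩
  mul {w₁' w₂'} := by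
    rintro ⟨w₁, hw₁, i₁, j₁, h₁⟩ ⟨w₂, hw₂, i₂, j₂, h₂⟩
    let u := 𝟙_ (CochainComplex (SkewMod A G) ℤ)
    refine ⟨w₁.mul w₂, h𝓢.mul hw₁ hw₂,
      (i₁ ⊗ᵢ i₂) ≪≫ baseChangeTensorCplxIso f w₁.W w₂.W,
      (baseChangeFunctor f).mapIso (λ_ u).symm ≪≫ (baseChangeTensorCplxIso f u u).symm ≪≫
        (j₁ ⊗ᵢ j₂) ≪≫ λ_ _, ?_⟩
    change (w₁'.ξ ⊗ₘ w₂'.ξ) ≫ (λ_ _).hom = _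
    rw [h₁, h₂]
    refine (tensorHom_comp_leftUnitor (baseChangeTensorCplxIso f u u)
      ((baseChangeFunctor f).mapIso (λ_ u))
      (baseChangeTensorCplxIso_naturality f w₁.ξ w₂.ξ) i₁.hom i₂.hom j₁.hom j₂.hom).trans ?_
    have e : (baseChangeFunctor f).map (w₁.ξ ⊗ₘ w₂.ξ) ≫ (baseChangeFunctor f).map (λ_ u).hom =
        (baseChangeFunctor f).map (w₁.mul w₂).ξ := ((baseChangeFunctor f).map_comp _ _).symm
    exact congrArg (fun t => _ ≫ t ≫ _) e

end

/-! ### Duals of modules over the skew group ring -/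

section

open MonoidalCategory

variable {A : Type u} {G : Type v} [CommRing A] [Group G] [MulSemiringAction G A]

/-- The action `(g f)(x) = g f(g⁻¹ x)` on the dual of an `AG`-module. -/
def dualAct (M : SkewMod A G) : G →* AddMonoid.End (Module.Dual A ((toMod A G).obj M)) where
  toFun g :=
    { toFun := fun f =>
        { toFun := fun x => g • f (act M g⁻¹ x)
          map_add' := fun x y => by rw [map_add, map_add, smul_add]
          map_smul' := fun a x => by
            rw [act_smul, map_smul, smul_eq_mul, smul_mul', smul_inv_smul, RingHom.id_apply,
              smul_eq_mul] }
      map_zero' := LinearMap.ext fun x => smul_zero g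
      map_add' := fun f f' => LinearMap.ext fun x => smul_add g _ _ }
  map_one' := AddMonoidHom.ext fun f => LinearMap.ext fun x => by
    change (1 : G) • f (act M 1⁻¹ x) = f x
    rw [one_smul, inv_one, map_one]
    rfl
  map_mul' g h := AddMonoidHom.ext fun f => LinearMap.ext fun x => by
    change (g * h) • f (act M (g * h)⁻¹ x) = g • h • f (act M h⁻¹ (act M g⁻¹ x))
    rw [mul_smul, mul_inv_rev, map_mul]
    rfl

/-- The dual `Hom_A(M, A)` of an `AG`-module `M`. -/
def dualMod (M : SkewMod A G) : SkewMod A G :=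
  ofSemilinear (ModuleCat.of A (Module.Dual A ((toMod A G).obj M))) (dualAct M)
    (fun g a f => LinearMap.ext fun x => smul_mul' g a (f (act M g⁻¹ x)))

/-- The underlying `A`-module of `dualMod M`. -/
def dualEquiv (M : SkewMod A G) :
    (toMod A G).obj (dualMod M) ≃ₗ[A] Module.Dual A ((toMod A G).obj M) :=
  ofSemilinearEquiv (ModuleCat.of A (Module.Dual A ((toMod A G).obj M))) _ _

lemma dualEquiv_act {M : SkewMod A G} (g : G) (f : (toMod A G).obj (dualMod M))
    (x : (toMod A G).obj M) :
    dualEquiv M (act (dualMod M) g f) x = g • dualEquiv M f (act M g⁻¹ x) :=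
  congrArg (fun t : Module.Dual A ((toMod A G).obj M) => t x)
    (act_ofSemilinear (ModuleCat.of A (Module.Dual A ((toMod A G).obj M))) (dualAct M) _ g f)

/-- The transpose of a homomorphism of `AG`-modules. -/
def dualMap {M N : SkewMod A G} (φ : M ⟶ N) : dualMod N ⟶ dualMod M :=
  homOfEquivariant ((dualEquiv M).symm.toLinearMap ∘ₗ
    Module.Dual.transpose ((toMod A G).map φ).hom ∘ₗ (dualEquiv N).toLinearMap) (fun g f => by
      apply (dualEquiv M).injective
      refine LinearMap.ext fun x => ?_
      rw [dualEquiv_act]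
      refine (dualEquiv_act g f _).trans ?_
      exact congrArg (fun t => g • dualEquiv N f t) (map_act φ g⁻¹ x).symm)

lemma dualEquiv_dualMap {M N : SkewMod A G} (φ : M ⟶ N) (f : (toMod A G).obj (dualMod N))
    (x : (toMod A G).obj M) :
    dualEquiv M ((toMod A G).map (dualMap φ) f) x = dualEquiv N f ((toMod A G).map φ x) :=
  rfl

lemma dualMod_hom_ext {M N : SkewMod A G} {φ ψ : N ⟶ dualMod M}
    (h : ∀ n x, dualEquiv M ((toMod A G).map φ n) x = dualEquiv M ((toMod A G).map ψ n) x) :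
    φ = ψ := by
  apply (toMod A G).map_injective
  ext n
  exact (dualEquiv M).injective (LinearMap.ext (h n))

lemma dualMap_id (M : SkewMod A G) : dualMap (𝟙 M) = 𝟙 _ := rfl

lemma dualMap_comp {M N L : SkewMod A G} (φ : M ⟶ N) (ψ : N ⟶ L) :
    dualMap (φ ≫ ψ) = dualMap ψ ≫ dualMap φ := rfl

lemma dualMap_zero (M N : SkewMod A G) : dualMap (0 : M ⟶ N) = 0 :=
  dualMod_hom_ext fun n _ => map_zero (dualEquiv N n)

/-- The evaluation `M^∨ ⊗ M ⟶ A`. -/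
def evMod (M : SkewMod A G) : tensorMod (dualMod M) M ⟶ unitMod A G :=
  homOfEquivariant (unitEquiv.symm.toLinearMap ∘ₗ TensorProduct.lift (dualEquiv M).toLinearMap ∘ₗ
    (tensorEquiv (dualMod M) M).toLinearMap) (fun g z => by
      apply unitEquiv.injective
      rw [act_unit]
      induction z using tensorMod_induction with
      | zero => simp only [map_zero, smul_zero]
      | tens f x =>
        rw [act_tens]
        change dualEquiv M (act (dualMod M) g f) (act M g x) = g • dualEquiv M f x
        rw [dualEquiv_act]
        have : act M g⁻¹ (act M g x) = act M (g⁻¹ * g) x := by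
          rw [map_mul]
          rfl
        rw [this, inv_mul_cancel, map_one]
        rfl
      | add x y hx hy => simp only [map_add, hx, hy, smul_add])

lemma evMod_dinatural {M N : SkewMod A G} (φ : M ⟶ N) :
    dualMap φ ▷ M ≫ evMod M = dualMod N ◁ φ ≫ evMod N :=
  tensorMod_hom_ext fun f x => (unitEquiv (A := A) (G := G)).injective (dualEquiv_dualMap φ f x)

/-- The contraction `N ⊗ M^∨ ⟶ Hom_A(M, N)`. -/
def contract (M N : SkewMod A G) : (toMod A G).obj (tensorMod N (dualMod M)) →ₗ[A]
    (toMod A G).obj M →ₗ[A] (toMod A G).obj N :=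
  dualTensorHom A _ _ ∘ₗ (TensorProduct.comm A _ _).toLinearMap ∘ₗ
    TensorProduct.map LinearMap.id (dualEquiv M).toLinearMap ∘ₗ
      (tensorEquiv N (dualMod M)).toLinearMap

lemma contract_tens {M N : SkewMod A G} (n : (toMod A G).obj N)
    (f : (toMod A G).obj (dualMod M)) (x : (toMod A G).obj M) :
    contract M N (tens n f) x = dualEquiv M f x • n :=
  rfl

lemma contract_bijective (M N : SkewMod A G) [Module.Finite A ((toMod A G).obj M)]
    [Module.Projective A ((toMod A G).obj M)] : Function.Bijective (contract M N) :=
  dualTensorHom_bijective.comp ((TensorProduct.comm A _ _).bijective.comp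
    ((TensorProduct.congr (LinearEquiv.refl A _) (dualEquiv M)).bijective.comp
      (tensorEquiv N (dualMod M)).bijective))

lemma contract_act {M N : SkewMod A G} (g : G) (z : (toMod A G).obj (tensorMod N (dualMod M)))
    (x : (toMod A G).obj M) :
    contract M N (act _ g z) x = act N g (contract M N z (act M g⁻¹ x)) := by
  induction z using tensorMod_induction with
  | zero => simp only [map_zero, LinearMap.zero_apply]
  | tens n f => rw [act_tens, contract_tens, contract_tens, dualEquiv_act, act_smul]
  | add y z hy hz => simp only [map_add, LinearMap.add_apply, hy, hz]

lemma contract_whiskerRight {M N N' : SkewMod A G} (φ : N ⟶ N')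
    (z : (toMod A G).obj (tensorMod N (dualMod M))) :
    contract M N' ((toMod A G).map (φ ▷ dualMod M) z) =
      ((toMod A G).map φ).hom ∘ₗ contract M N z := by
  refine LinearMap.ext fun x => ?_
  induction z using tensorMod_induction with
  | zero => simp only [map_zero, LinearMap.zero_apply, LinearMap.comp_zero]
  | tens n f => exact (((toMod A G).map φ).hom.map_smul (dualEquiv M f x) n).symm
  | add y z hy hz =>
    simp only [map_add, LinearMap.add_apply, hy, hz, LinearMap.comp_apply]

lemma contract_whiskerLeft {M M' N : SkewMod A G} (φ : M ⟶ M')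
    (z : (toMod A G).obj (tensorMod N (dualMod M'))) :
    contract M N ((toMod A G).map (N ◁ dualMap φ) z) =
      contract M' N z ∘ₗ ((toMod A G).map φ).hom := by
  refine LinearMap.ext fun x => ?_
  induction z using tensorMod_induction with
  | zero => simp only [map_zero, LinearMap.zero_apply, LinearMap.zero_comp]
  | tens n f => rfl
  | add y z hy hz =>
    simp only [map_add, LinearMap.add_apply, hy, hz, LinearMap.comp_apply]

section

variable (M : SkewMod A G) [Module.Finite A ((toMod A G).obj M)]
  [Module.Projective A ((toMod A G).obj M)]

/-- The canonical element of `M ⊗ M^∨`. -/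
def coevElement : (toMod A G).obj (tensorMod M (dualMod M)) :=
  (LinearEquiv.ofBijective _ (contract_bijective M M)).symm LinearMap.id

lemma contract_coevElement : contract M M (coevElement M) = LinearMap.id :=
  (LinearEquiv.ofBijective _ (contract_bijective M M)).apply_symm_apply LinearMap.id

/-- The element corresponds to the identity of `M`, which is fixed under conjugation by `g`. -/
lemma act_coevElement (g : G) : act _ g (coevElement M) = coevElement M := by
  apply (contract_bijective M M).1
  refine LinearMap.ext fun x => ?_
  rw [contract_act, contract_coevElement]
  change act M g (act M g⁻¹ x) = x
  have : act M g (act M g⁻¹ x) = act M (g * g⁻¹) x := by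
    rw [map_mul]
    rfl
  rw [this, mul_inv_cancel, map_one]
  rfl

/-- The coevaluation `A ⟶ M ⊗ M^∨`. -/
def coevMod : unitMod A G ⟶ tensorMod M (dualMod M) :=
  homOfEquivariant (LinearMap.toSpanSingleton A _ (coevElement M) ∘ₗ unitEquiv.toLinearMap)
    (fun g x => by
      change unitEquiv (act (unitMod A G) g x) • coevElement M =
        act _ g (unitEquiv x • coevElement M)
      rw [act_unit, act_smul, act_coevElement])

-- Under `contract`, both composites correspond to `φ` as an element of `Hom_A(M, N)`.
variable {M} in
lemma coevMod_dinatural {N : SkewMod A G} [Module.Finite A ((toMod A G).obj N)]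
    [Module.Projective A ((toMod A G).obj N)] (φ : M ⟶ N) :
    coevMod M ≫ φ ▷ dualMod M = coevMod N ≫ N ◁ dualMap φ := by
  apply (toMod A G).map_injective
  ext x
  have h : (toMod A G).map (φ ▷ dualMod M) (coevElement M) =
      (toMod A G).map (N ◁ dualMap φ) (coevElement N) := by
    apply (contract_bijective M N).1
    rw [contract_whiskerRight, contract_whiskerLeft, contract_coevElement, contract_coevElement]
    rfl
  refine ((((toMod A G).map (φ ▷ dualMod M)).hom.map_smul (unitEquiv x) (coevElement M)).trans
    ?_).trans (((toMod A G).map (N ◁ dualMap φ)).hom.map_smul (unitEquiv x) (coevElement N)).symm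
  exact congrArg (unitEquiv x • ·) h

lemma coevMod_evMod :
    coevMod M ▷ M ≫ (α_ M (dualMod M) M).hom ≫ M ◁ evMod M ≫ (ρ_ M).hom = (λ_ M).hom := by
  refine tensorMod_hom_ext fun a x => ?_
  have key (z : (toMod A G).obj (tensorMod M (dualMod M))) :
      (toMod A G).map ((α_ M (dualMod M) M).hom ≫ M ◁ evMod M ≫ (ρ_ M).hom) (tens z x) =
        contract M M z x := by
    induction z using tensorMod_induction with
    | zero => rw [zero_tens, map_zero, map_zero, LinearMap.zero_apply]
    | tens m f => rfl
    | add y z hy hz => rw [add_tens, map_add, map_add, hy, hz, LinearMap.add_apply]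
  refine (key (unitEquiv a • coevElement M)).trans ?_
  rw [map_smul, contract_coevElement]
  rfl

end

lemma dualMod_finite (M : SkewMod A G) [Module.Finite A ((toMod A G).obj M)]
    [Module.Projective A ((toMod A G).obj M)] : Module.Finite A ((toMod A G).obj (dualMod M)) :=
  Module.Finite.equiv (dualEquiv M).symm

lemma dualMod_projective (M : SkewMod A G) [Module.Finite A ((toMod A G).obj M)]
    [Module.Projective A ((toMod A G).obj M)] :
    Module.Projective A ((toMod A G).obj (dualMod M)) :=
  Module.Projective.of_equiv (dualEquiv M).symm

end

/-! ### Summands of tensor products of complexes -/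

section

open HomologicalComplex MonoidalCategory ZeroObject

variable {A : Type u} {G : Type v} [CommRing A] [Group G] [MulSemiringAction G A]

local infixr:70 " ⊠ " => MonoidalCategoryStruct.tensorObj

instance : MonoidalPreadditive (SkewMod A G) where
  whiskerLeft_zero {X Y Z} := Functor.map_zero ((tensorBifunctor A G).obj X) Y Z
  zero_whiskerRight {X Y Z} := Functor.map_zero ((tensorBifunctor A G).flip.obj X) Y Z
  whiskerLeft_add {X _ _} _ _ := Functor.map_add ((tensorBifunctor A G).obj X)
  add_whiskerRight {X _ _} _ _ := Functor.map_add ((tensorBifunctor A G).flip.obj X)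

lemma units_smul_whiskerRight {M N : SkewMod A G} (e : ℤˣ) (φ : M ⟶ N) (P : SkewMod A G) :
    (e • φ) ▷ P = e • φ ▷ P := by
  obtain rfl | rfl := Int.units_eq_one_or e
  · rw [one_smul, one_smul]
  · rw [Units.neg_smul, one_smul, Units.neg_smul, one_smul]
    exact Functor.map_neg ((tensorBifunctor A G).flip.obj P)

lemma whiskerLeft_units_smul {M N : SkewMod A G} (e : ℤˣ) (φ : M ⟶ N) (P : SkewMod A G) :
    P ◁ (e • φ) = e • P ◁ φ := by
  obtain rfl | rfl := Int.units_eq_one_or e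
  · rw [one_smul, one_smul]
  · rw [Units.neg_smul, one_smul, Units.neg_smul, one_smul]
    exact Functor.map_neg ((tensorBifunctor A G).obj P)

section

variable (K L M : CochainComplex (SkewMod A G) ℤ)

/-- The inclusion of a summand of a tensor product of complexes. -/
def inTensor (i j n : ℤ) (h : i + j = n) : K.X i ⊗ L.X j ⟶ (K ⊠ L).X n :=
  ιMapBifunctor K L (tensorBifunctor A G) (ComplexShape.up ℤ) i j n h

variable {K L} in
lemma tensor_X_hom_ext {n : ℤ} {N : SkewMod A G} {f g : (K ⊠ L).X n ⟶ N}
    (h : ∀ i j (h : i + j = n), inTensor K L i j n h ≫ f = inTensor K L i j n h ≫ g) : f = g :=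
  tot_hom_ext (F := tensorBifunctor A G) h

lemma inTensor_d (i j n m i' j' : ℤ) (h : i + j = n) (hm : n + 1 = m) (hi : i + 1 = i')
    (hj : j + 1 = j') :
    inTensor K L i j n h ≫ (K ⊠ L).d n m =
      K.d i i' ▷ L.X j ≫ inTensor K L i' j m (by omega) +
        i.negOnePow • (K.X i ◁ L.d j j' ≫ inTensor K L i j' m (by omega)) :=
  ι_d (tensorBifunctor A G) L K i j n m i' j' h hm hi hj

variable {K} in
lemma inTensor_whiskerRight {K' : CochainComplex (SkewMod A G) ℤ} (φ : K ⟶ K') (i j n : ℤ)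
    (h : i + j = n) :
    inTensor K L i j n h ≫ (φ ▷ L).f n = φ.f i ▷ L.X j ≫ inTensor K' L i j n h :=
  ι_map (tensorBifunctor A G) L φ i j n h

variable {L} in
lemma inTensor_whiskerLeft {L' : CochainComplex (SkewMod A G) ℤ} (φ : L ⟶ L') (i j n : ℤ)
    (h : i + j = n) :
    inTensor K L i j n h ≫ (K ◁ φ).f n = K.X i ◁ φ.f j ≫ inTensor K L' i j n h := by
  have := ι_mapBifunctorMap (𝟙 K) φ (tensorBifunctor A G) (ComplexShape.up ℤ) i j n h
  rw [HomologicalComplex.id_f, CategoryTheory.Functor.map_id, NatTrans.id_app,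
    Category.id_comp] at this
  exact this

lemma inTensor_associator (i j k n : ℤ) (h : i + j + k = n) (i₁ j₁ : ℤ) (hi : i + j = i₁)
    (hj : j + k = j₁) :
    inTensor K L i j i₁ hi ▷ M.X k ≫ inTensor (K ⊠ L) M i₁ k n (by omega) ≫
        (α_ K L M).hom.f n =
      (α_ _ _ _).hom ≫ K.X i ◁ inTensor L M j k j₁ hj ≫
        inTensor K (L ⊠ M) i j₁ n (by omega) := by
  subst hi hj
  have := ι_mapBifunctorAssociatorX_hom (curriedAssociatorNatIso (SkewMod A G)) K L M
    (ComplexShape.up ℤ) (ComplexShape.up ℤ) (ComplexShape.up ℤ) i j k n h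
  rw [mapBifunctor₁₂.ι_eq _ _ _ _ _ _ _ _ _ _ (i + j) _ rfl (by exact h),
    mapBifunctor₂₃.ι_eq _ _ _ _ _ _ _ _ _ _ _ (j + k) _ rfl (by dsimp; omega)] at this
  exact (Category.assoc _ _ _).symm.trans this

lemma leftUnitor_inv_f (n : ℤ) : (λ_ L).inv.f n =
    (λ_ (L.X n)).inv ≫ (singleObjXSelf (ComplexShape.up ℤ) 0 (𝟙_ (SkewMod A G))).inv ▷ L.X n ≫
      inTensor (𝟙_ (CochainComplex (SkewMod A G) ℤ)) L 0 n n (zero_add n) :=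
  leftUnitor'_inv L n

lemma inTensor_rightUnitor_hom (n : ℤ) :
    L.X n ◁ (singleObjXSelf (ComplexShape.up ℤ) 0 (𝟙_ (SkewMod A G))).inv ≫
      inTensor L (𝟙_ (CochainComplex (SkewMod A G) ℤ)) n 0 n (add_zero n) ≫ (ρ_ L).hom.f n = (ρ_ (L.X n)).hom := by
  have h : (ρ_ L).inv.f n = (ρ_ (L.X n)).inv ≫
      L.X n ◁ (singleObjXSelf (ComplexShape.up ℤ) 0 (𝟙_ (SkewMod A G))).inv ≫
      inTensor L (𝟙_ (CochainComplex (SkewMod A G) ℤ)) n 0 n (add_zero n) := rightUnitor'_inv L n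
  have h' : (ρ_ L).inv.f n ≫ (ρ_ L).hom.f n = 𝟙 _ := by
    rw [← HomologicalComplex.comp_f, Iso.inv_hom_id, HomologicalComplex.id_f]
  rw [h, Category.assoc, Category.assoc] at h'
  rw [← cancel_epi (ρ_ (L.X n)).inv, Iso.inv_hom_id]
  exact h'

end

/-! ### Duals of bounded complexes -/

variable (L : CochainComplex (SkewMod A G) ℤ)

/-- The dual `Hom_A(L, A)` of a complex of `AG`-modules. -/
def dualCplx : CochainComplex (SkewMod A G) ℤ where
  X i := dualMod (L.X (-i))
  -- This sign makes the evaluation vanish on boundaries: it is opposite to the sign `(-1)^i` of the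
  -- second partial differential of the tensor product.
  d i j := (i + 1).negOnePow • dualMap (L.d (-j) (-i))
  shape i j h := by
    rw [L.shape _ _ (fun h' : -j + 1 = -i => h (by change i + 1 = j; omega)), dualMap_zero,
      smul_zero]
  d_comp_d' i j k _ _ := by
    rw [Linear.units_smul_comp, Linear.comp_units_smul, ← dualMap_comp, L.d_comp_d, dualMap_zero,
      smul_zero, smul_zero]

/-- The transpose of an isomorphism. -/
def dualMapIso {M N : SkewMod A G} (e : M ≅ N) : dualMod N ≅ dualMod M where
  hom := dualMap e.hom
  inv := dualMap e.inv
  hom_inv_id := by rw [← dualMap_comp, Iso.inv_hom_id, dualMap_id]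
  inv_hom_id := by rw [← dualMap_comp, Iso.hom_inv_id, dualMap_id]

/-- The module in degree `i` of the dual complex is the dual of `L^j` for `i + j = 0`. -/
def dualCplxX (i j : ℤ) (h : i + j = 0) : (dualCplx L).X i ≅ dualMod (L.X j) :=
  dualMapIso (L.XIsoOfEq (show j = -i by omega))

lemma dualCplx_d (i j i' j' : ℤ) (h : i + j = 0) (h' : i' + j' = 0) :
    (dualCplx L).d i i' ≫ (dualCplxX L i' j' h').hom =
      (i + 1).negOnePow • ((dualCplxX L i j h).hom ≫ dualMap (L.d j' j)) := by
  obtain rfl : j = -i := by omega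
  obtain rfl : j' = -i' := by omega
  change ((i + 1).negOnePow • dualMap (L.d (-i') (-i))) ≫ dualMap (𝟙 _) =
    (i + 1).negOnePow • (dualMap (𝟙 _) ≫ dualMap (L.d (-i') (-i)))
  rw [dualMap_id, dualMap_id, Category.comp_id, Category.id_comp]

lemma isZero_dualMod {M : SkewMod A G} (hM : IsZero M) : IsZero (dualMod M) := by
  rw [IsZero.iff_id_eq_zero] at hM ⊢
  rw [← dualMap_id, hM, dualMap_zero]

/-- The component `(L^∨)^i ⊗ L^j ⟶ A` of the evaluation. -/
def evComponent (i j : ℤ) (h : i + j = 0) : (dualCplx L).X i ⊗ L.X j ⟶ 𝟙_ (SkewMod A G) :=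
  (dualCplxX L i j h).hom ▷ L.X j ≫ evMod (L.X j)

/-- The evaluation in degree zero. -/
def evZero : (dualCplx L ⊠ L).X 0 ⟶ 𝟙_ (SkewMod A G) :=
  totDesc (tensorBifunctor A G) L (dualCplx L) fun i j h => evComponent L i j h

lemma inTensor_evZero (i j : ℤ) (h : i + j = 0) :
    inTensor (dualCplx L) L i j 0 h ≫ evZero L = evComponent L i j h :=
  ι_totDesc (tensorBifunctor A G) L (dualCplx L) _ i j h

lemma evComponent_d (i j i' j' : ℤ) (h : i + j + 1 = 0) (hi : i + 1 = i') (hj : j + 1 = j') :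
    (dualCplx L).d i i' ▷ L.X j ≫ evComponent L i' j (by omega) =
      (i + 1).negOnePow • ((dualCplx L).X i ◁ L.d j j' ≫ evComponent L i j' (by omega)) := by
  have e := dualCplx_d L i j' i' j (by omega) (by omega)
  rw [evComponent, evComponent, whisker_exchange_assoc, ← evMod_dinatural, ← comp_whiskerRight_assoc,
    ← comp_whiskerRight_assoc, e]
  rw [units_smul_whiskerRight, Linear.units_smul_comp]

lemma d_evZero (n : ℤ) (hn : n + 1 = 0) : (dualCplx L ⊠ L).d n 0 ≫ evZero L = 0 := by
  refine tensor_X_hom_ext fun i j h => ?_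
  rw [← Category.assoc, inTensor_d _ _ i j n 0 (i + 1) (j + 1) h hn rfl rfl, Preadditive.add_comp,
    Linear.units_smul_comp, Category.assoc, Category.assoc, inTensor_evZero, inTensor_evZero,
    evComponent_d L i j (i + 1) (j + 1) (by omega) rfl rfl, Int.negOnePow_succ, Units.neg_smul,
    neg_add_cancel, comp_zero]

/-- The evaluation `L^∨ ⊗ L ⟶ A`. -/
def evCplx : dualCplx L ⊠ L ⟶ 𝟙_ (CochainComplex (SkewMod A G) ℤ) :=
  mkHomToSingle (evZero L) (fun n hn => d_evZero L n hn)

lemma evCplx_f_zero :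
    (evCplx L).f 0 = evZero L ≫ (singleObjXSelf (ComplexShape.up ℤ) 0 (𝟙_ (SkewMod A G))).inv :=
  mkHomToSingle_f _ _

section

variable [∀ i, Module.Finite A ((toMod A G).obj (L.X i))]
  [∀ i, Module.Projective A ((toMod A G).obj (L.X i))]

/-- The component `A ⟶ L^i ⊗ (L^∨)^j` of the coevaluation. -/
def coevComponent (i j : ℤ) (h : j + i = 0) : 𝟙_ (SkewMod A G) ⟶ L.X i ⊗ (dualCplx L).X j :=
  coevMod (L.X i) ≫ L.X i ◁ (dualCplxX L j i h).inv

lemma coevComponent_d (i j i' j' : ℤ) (h : j + i = 1) (hi : i' + 1 = i) (hj : j' + 1 = j) :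
    coevComponent L i' j (by omega) ≫ L.d i' i ▷ (dualCplx L).X j =
      (j' + 1).negOnePow • (coevComponent L i j' (by omega) ≫ L.X i ◁ (dualCplx L).d j' j) := by
  have e := dualCplx_d L j' i j i' (by omega) (by omega)
  rw [← Iso.eq_comp_inv, Linear.units_smul_comp, Category.assoc] at e
  rw [coevComponent, Category.assoc, whisker_exchange, ← Category.assoc, coevMod_dinatural,
    coevComponent, Category.assoc, Category.assoc, ← whiskerLeft_comp, ← whiskerLeft_comp, e]
  rw [Linear.comp_units_smul, whiskerLeft_units_smul, Linear.comp_units_smul, smul_smul,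
    Int.units_mul_self, one_smul, Iso.inv_hom_id_assoc]

/-- The coevaluation in degree zero, for a complex concentrated in degrees in `[a, a + n)`. -/
def coevZero (a : ℤ) (n : ℕ) : 𝟙_ (SkewMod A G) ⟶ (L ⊠ dualCplx L).X 0 :=
  ∑ k ∈ Finset.range n, coevComponent L (a + k) (-(a + k)) (by omega) ≫
    inTensor L (dualCplx L) (a + k) (-(a + k)) 0 (by omega)

/-- The boundary of the `k`-th summand is `β (k + 1) - β k`, so the sum telescopes, and the two end
terms vanish because `L` is zero in degrees `a - 1` and `a + n`. -/
lemma coevZero_d {a : ℤ} {n : ℕ} (h₁ : IsZero (L.X (a - 1))) (h₂ : IsZero (L.X (a + n))) :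
    coevZero L a n ≫ (L ⊠ dualCplx L).d 0 1 = 0 := by
  let β (k : ℕ) : 𝟙_ (SkewMod A G) ⟶ (L ⊠ dualCplx L).X 1 :=
    coevComponent L (a - 1 + k) (-(a - 1 + k)) (by omega) ≫
      L.d (a - 1 + k) (a + k) ▷ (dualCplx L).X (-(a - 1 + k)) ≫
        inTensor L (dualCplx L) (a + k) (-(a - 1 + k)) 1 (by omega)
  have hβ (k : ℕ) : (coevComponent L (a + k) (-(a + k)) (by omega) ≫
      inTensor L (dualCplx L) (a + k) (-(a + k)) 0 (by omega)) ≫ (L ⊠ dualCplx L).d 0 1 =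
        β (k + 1) - β k := by
    have e : β (k + 1) = coevComponent L (a + k) (-(a + k)) (by omega) ≫
      L.d (a + k) (a + k + 1) ▷ (dualCplx L).X (-(a + k)) ≫
        inTensor L (dualCplx L) (a + k + 1) (-(a + k)) 1 (by omega) := by
      have key (x y z : ℤ) (hx : x = a + k) (hy : y = a + k + 1) (hz : z = -x) :
        coevComponent L x z (by omega) ≫ L.d x y ▷ (dualCplx L).X z ≫
          inTensor L (dualCplx L) y z 1 (by omega) =
        coevComponent L (a + k) (-(a + k)) (by omega) ≫
          L.d (a + k) (a + k + 1) ▷ (dualCplx L).X (-(a + k)) ≫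
          inTensor L (dualCplx L) (a + k + 1) (-(a + k)) 1 (by omega) := by
        subst hx hy hz
        rfl
      exact key (a - 1 + (k + 1 : ℕ)) (a + (k + 1 : ℕ)) _ (by omega) (by omega) rfl
    rw [Category.assoc, inTensor_d L (dualCplx L) (a + k) (-(a + k)) 0 1 (a + k + 1)
      (-(a - 1 + k)) (by omega) (by omega) rfl (by omega), Preadditive.comp_add,
      Linear.comp_units_smul, ← e, sub_eq_add_neg (β (k + 1))]
    have e' := coevComponent_d L (a + k) (-(a - 1 + k)) (a - 1 + k) (-(a + k)) (by omega) (by omega)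
      (by omega)
    have e'' : β k = -((a + k).negOnePow • (coevComponent L (a + k) (-(a + k)) (by omega) ≫
        L.X (a + k) ◁ (dualCplx L).d (-(a + k)) (-(a - 1 + k)) ≫
          inTensor L (dualCplx L) (a + k) (-(a - 1 + k)) 1 (by omega))) := by
      refine (Category.assoc _ _ _).symm.trans ((congrArg (· ≫ _) e').trans ?_)
      rw [Int.negOnePow_succ, Int.negOnePow_neg, Units.neg_smul, Preadditive.neg_comp,
        Linear.units_smul_comp, Category.assoc]
    rw [e'', neg_neg]
  rw [coevZero, Preadditive.sum_comp, Finset.sum_congr rfl fun k _ => hβ k, Finset.sum_range_sub]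
  have hz {M N P : SkewMod A G} (h : IsZero M) (φ : P ⟶ M ⊠ N) : φ = 0 := by
    have : IsZero (M ⊠ N) := ((tensorBifunctor A G).flip.obj N).map_isZero h
    exact this.eq_of_tgt _ _
  have e₀ : β 0 = 0 := by
    have h₁' : IsZero (L.X (a - 1 + (0 : ℕ))) := by simpa using h₁
    exact (congrArg (· ≫ _) (hz h₁' (coevComponent L _ _ (by omega)))).trans zero_comp
  have e₁ : β n = 0 := by
    refine (Category.assoc _ _ _).symm.trans ?_
    exact (congrArg (· ≫ _) (hz h₂ _)).trans zero_comp
  rw [e₀, e₁, sub_zero]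

/-- The coevaluation `A ⟶ L ⊗ L^∨`, for a complex concentrated in degrees in `[a, a + n)`. -/
def coevCplx {a : ℤ} {n : ℕ} (h₁ : IsZero (L.X (a - 1))) (h₂ : IsZero (L.X (a + n))) :
    𝟙_ (CochainComplex (SkewMod A G) ℤ) ⟶ L ⊠ dualCplx L :=
  mkHomFromSingle (coevZero L a n) (fun m hm => by
    obtain rfl : m = 1 := by
      change (0 : ℤ) + 1 = m at hm
      omega
    exact coevZero_d L h₁ h₂)

lemma coevCplx_f_zero {a : ℤ} {n : ℕ} (h₁ : IsZero (L.X (a - 1))) (h₂ : IsZero (L.X (a + n))) :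
    (coevCplx L h₁ h₂).f 0 =
      (singleObjXSelf (ComplexShape.up ℤ) 0 (𝟙_ (SkewMod A G))).hom ≫ coevZero L a n :=
  mkHomFromSingle_f _ _

lemma coevComponent_evComponent (i j : ℤ) (h : j + i = 0) :
    coevComponent L i j h ▷ L.X i ≫ (α_ _ _ _).hom ≫ L.X i ◁ evComponent L j i h ≫
      (ρ_ (L.X i)).hom = (λ_ (L.X i)).hom := by
  rw [coevComponent, evComponent, comp_whiskerRight, Category.assoc,
    associator_naturality_middle_assoc, ← whiskerLeft_comp_assoc, ← comp_whiskerRight_assoc,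
    Iso.inv_hom_id, id_whiskerRight, Category.id_comp, coevMod_evMod]

/-- The unit complex is concentrated in degree zero, which forces `p = 0` and hence `i = m`; the
remaining summand is the triangle identity for modules. -/
lemma coevComponent_evCplx (i j m p : ℤ) (h : j + i = 0) (hp : j + m = p) :
    coevComponent L i j h ▷ L.X m ≫ (α_ _ _ _).hom ≫
        L.X i ◁ (inTensor (dualCplx L) L j m p hp ≫ (evCplx L).f p) ≫
        inTensor L (𝟙_ (CochainComplex (SkewMod A G) ℤ)) i p m (by omega) ≫ (ρ_ L).hom.f m =
      if i = m then (λ_ (L.X m)).hom else 0 := by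
  split_ifs with hi
  · subst hi
    obtain rfl : p = 0 := by omega
    rw [evCplx_f_zero, ← Category.assoc (inTensor _ _ _ _ _ _), inTensor_evZero,
      MonoidalCategory.whiskerLeft_comp, Category.assoc, inTensor_rightUnitor_hom,
      coevComponent_evComponent]
  · have hz : (evCplx L).f p = 0 :=
      (isZero_single_obj_X (ComplexShape.up ℤ) 0 (𝟙_ (SkewMod A G)) p (by omega)).eq_of_tgt _ _
    rw [hz, comp_zero, MonoidalPreadditive.whiskerLeft_zero, zero_comp, comp_zero, comp_zero]

/-- In each degree exactly one summand of the coevaluation contributes. This single triangle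
identity suffices: it recovers `L` from `L ⊗ L^∨ ⊗ L`. -/
lemma coevCplx_evCplx {a : ℤ} {n : ℕ} (h₁ : IsZero (L.X (a - 1))) (h₂ : IsZero (L.X (a + n)))
    (h : ∀ i, i < a ∨ a + n ≤ i → IsZero (L.X i)) :
    coevCplx L h₁ h₂ ▷ L ≫ (α_ L (dualCplx L) L).hom ≫ L ◁ evCplx L ≫ (ρ_ L).hom =
      (λ_ L).hom := by
  rw [← cancel_epi (λ_ L).inv, Iso.inv_hom_id]
  ext m : 1
  by_cases hm : m < a ∨ a + n ≤ m
  · exact (h m hm).eq_of_src _ _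
  have key (k : ℕ) : (coevComponent L (a + k) (-(a + k)) (by omega) ≫
      inTensor L (dualCplx L) (a + k) (-(a + k)) 0 (by omega)) ▷ L.X m ≫
      inTensor (L ⊠ dualCplx L) L 0 m m (zero_add m) ≫ (α_ L (dualCplx L) L).hom.f m ≫
        (L ◁ evCplx L).f m ≫ (ρ_ L).hom.f m = if a + k = m then (λ_ (L.X m)).hom else 0 := by
    have e₁ := inTensor_associator L (dualCplx L) L (a + k) (-(a + k)) m m (by omega) 0 (m - (a + k))
      (by omega) (by omega)
    have e₂ := inTensor_whiskerLeft L (evCplx L) (a + k) (m - (a + k)) m (by omega)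
    rw [comp_whiskerRight, Category.assoc, reassoc_of% e₁, reassoc_of% e₂,
      ← whiskerLeft_comp_assoc]
    exact coevComponent_evCplx L _ _ m _ _ _
  have e₀ := inTensor_whiskerRight L (coevCplx L h₁ h₂) 0 m m (zero_add m)
  have e₁ : (singleObjXSelf (ComplexShape.up ℤ) 0 (𝟙_ (SkewMod A G))).inv ≫
      (coevCplx L h₁ h₂).f 0 = coevZero L a n := by
    rw [coevCplx_f_zero, Iso.inv_hom_id_assoc]
  have e₂ : (λ_ (L.X m)).inv ≫ coevZero L a n ▷ L.X m ≫
      inTensor (L ⊠ dualCplx L) L 0 m m (zero_add m) ≫ (α_ L (dualCplx L) L).hom.f m ≫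
        (L ◁ evCplx L).f m ≫ (ρ_ L).hom.f m = 𝟙 _ := by
    rw [coevZero, sum_whiskerRight, Preadditive.sum_comp,
      Finset.sum_congr rfl fun k _ => key k]
    have : ∑ k ∈ Finset.range n, (if a + (k : ℤ) = m then (λ_ (L.X m)).hom else 0) =
        (λ_ (L.X m)).hom := by
      rw [Finset.sum_eq_single (m - a).toNat, if_pos (by omega)]
      · intro k _ hk
        rw [if_neg (by omega)]
      · intro hk
        rw [Finset.mem_range] at hk
        omega
    rw [this, Iso.inv_hom_id]
  have e₃ : (λ_ L).inv.f m ≫ (coevCplx L h₁ h₂ ▷ L).f m = (λ_ (L.X m)).inv ≫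
      coevZero L a n ▷ L.X m ≫ inTensor (L ⊠ dualCplx L) L 0 m m (zero_add m) := by
    rw [leftUnitor_inv_f, Category.assoc, Category.assoc, e₀, ← comp_whiskerRight_assoc, e₁]
  simp only [HomologicalComplex.comp_f, HomologicalComplex.id_f]
  rw [reassoc_of% e₃, e₂]

end

variable {L}

lemma IsStrictPerf.dual (hL : IsStrictPerf L) : IsStrictPerf (dualCplx L) where
  ge := by
    obtain ⟨b, hb⟩ := hL.le
    exact ⟨-b, (CochainComplex.isStrictlyGE_iff _ _).2 fun i hi =>
      isZero_dualMod (L.isZero_of_isStrictlyLE b (-i) (by omega))⟩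
  le := by
    obtain ⟨a, ha⟩ := hL.ge
    exact ⟨-a, (CochainComplex.isStrictlyLE_iff _ _).2 fun i hi =>
      isZero_dualMod (L.isZero_of_isStrictlyGE a (-i) (by omega))⟩
  fg i := by
    have := hL.fg (-i)
    have := hL.proj (-i)
    exact dualMod_finite (L.X (-i))
  proj i := by
    have := hL.fg (-i)
    have := hL.proj (-i)
    exact dualMod_projective (L.X (-i))

open DerivedCategory

attribute [local instance] HasDerivedCategory.standard

/-- `L` is annihilated by an augmented complex whose augmentation has a cone isomorphic to
`L ⊗ L^∨`. -/
lemma IsStrictPerf.exists_aug (hL : IsStrictPerf L) (𝓘 : ObjectProperty (DAG A G))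
    (h : 𝓘 (Q.obj (L ⊠ dualCplx L))) :
    ∃ w : Aug A G, 𝓘.trW (Q.map w.ξ) ∧ w.τ.app (Q.obj L) = 0 := by
  obtain ⟨a, ha⟩ := hL.ge
  obtain ⟨b, hb⟩ := hL.le
  have := hL.fg
  have := hL.proj
  let n : ℕ := (b + 1 - a).toNat
  have hz (i : ℤ) (hi : i < a ∨ a + n ≤ i) : IsZero (L.X i) := by
    obtain hi | hi := hi
    · exact L.isZero_of_isStrictlyGE a i hi
    · exact L.isZero_of_isStrictlyLE b i (by omega)
  let c := coevCplx L (hz (a - 1) (by omega)) (hz (a + n) (by omega))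
  have hT := mappingCocone_triangle_distinguished c
  -- The cocone of the coevaluation, whose map to the unit has cone `L ⊗ L^∨`.
  let w : Aug A G := ⟨CochainComplex.mappingCocone c,
    ((isStrictPerf_unit A G).mappingCone c (hL.tensor hL.dual)).shift (-1),
    CochainComplex.mappingCocone.fst c⟩
  refine ⟨w, ObjectProperty.trW.mk 𝓘 hT h, (w.τ_app_Q_eq_zero_iff' L).2 ?_⟩
  -- Two consecutive maps in a triangle compose to zero; by the triangle identity the action of `w`
  -- on `L` factors through this composite tensored with `L`.
  have h₁ : Q.map (w.ξ ≫ c) = 0 :=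
    (Q.map_comp _ _).trans (Pretriangulated.comp_distTriang_mor_zero₁₂ _ hT)
  have h₂ := hL.Q_map_whiskerRight_eq_zero h₁
  have h₃ := coevCplx_evCplx L (hz (a - 1) (by omega)) (hz (a + n) (by omega)) hz
  rw [← cancel_mono (Q.map (λ_ L).hom), zero_comp, ← Functor.map_comp, ← h₃,
    ← Category.assoc, ← comp_whiskerRight]
  exact (Q.map_comp _ _).trans ((congrArg (· ≫ _) h₂).trans zero_comp)

end

/-! ### Restriction of scalars -/

section

variable {A : Type u} {G : Type v} [CommRing A] [Group G] [MulSemiringAction G A]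
  {B : Type u} [CommRing B] [MulSemiringAction G B] (f : A →+*[G] B)

/-- The ring homomorphism `AG → BG` induced by `f`. -/
def skewMap : SkewGroupRing A G →+* SkewGroupRing B G :=
  SkewMonoidAlgebra.liftNCRingHom ((incl B G).comp f.toRingHom)
    { toFun := fun g => SkewMonoidAlgebra.single g 1
      map_one' := rfl
      map_mul' := fun g h => by simp [SkewMonoidAlgebra.single_mul_single] } (by
    intro a g
    change SkewMonoidAlgebra.single 1 (f (g • a)) * SkewMonoidAlgebra.single g 1 =
      (SkewMonoidAlgebra.single g 1 * SkewMonoidAlgebra.single 1 (f a) : SkewGroupRing B G)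
    simp [SkewMonoidAlgebra.single_mul_single])

lemma skewMap_single (g : G) (a : A) :
    skewMap f (SkewMonoidAlgebra.single g a) = SkewMonoidAlgebra.single g (f a) := by
  simp only [skewMap, SkewMonoidAlgebra.liftNCRingHom, RingHom.coe_mk, MonoidHom.coe_mk,
    OneHom.coe_mk]
  refine (SkewMonoidAlgebra.liftNC_single _ _ g a).trans ?_
  change (SkewMonoidAlgebra.single 1 (f a) * SkewMonoidAlgebra.single g 1 : SkewGroupRing B G) = _
  simp [SkewMonoidAlgebra.single_mul_single]

variable (G) in
/-- The restriction of a `BG`-module to `AG`. -/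
abbrev resFunctor : SkewMod B G ⥤ SkewMod A G := ModuleCat.restrictScalars (skewMap f)

instance : PreservesFiniteLimits (resFunctor G f) :=
  ⟨fun _ _ _ => ⟨inferInstance⟩⟩

instance : PreservesFiniteColimits (resFunctor G f) :=
  ⟨fun _ _ _ => ⟨inferInstance⟩⟩

/-- An element of a `BG`-module, as an element of its restriction. -/
def toRes (N : SkewMod B G) : (toMod B G).obj N ≃+ (toMod A G).obj ((resFunctor G f).obj N) :=
  AddEquiv.refl N

variable {N : SkewMod B G}

lemma toRes_smul (a : A) (n : (toMod B G).obj N) : toRes f N (f a • n) = a • toRes f N n := by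
  change (SkewMonoidAlgebra.single 1 (f a) : SkewGroupRing B G) • (n : N) =
    skewMap f (SkewMonoidAlgebra.single 1 a) • (n : N)
  rw [skewMap_single]

lemma toRes_act (g : G) (n : (toMod B G).obj N) :
    toRes f N (act N g n) = act ((resFunctor G f).obj N) g (toRes f N n) := by
  change (SkewMonoidAlgebra.single g 1 : SkewGroupRing B G) • (n : N) =
    skewMap f (SkewMonoidAlgebra.single g 1) • (n : N)
  rw [skewMap_single, map_one]

lemma bcTens_pair_induction {M : SkewMod A G}
    {p : (toMod B G).obj (tensorMod ((baseChange f).obj M) N) → Prop}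
    (zero : p 0) (tens : ∀ b m n, p (tens (bcTens f b m) n))
    (add : ∀ x y, p x → p y → p (x + y)) (z) : p z := by
  induction z using tensorMod_induction with
  | zero => exact zero
  | add x y hx hy => exact add x y hx hy
  | tens x n =>
    induction x using bcTens_induction with
    | zero => rw [zero_tens]; exact zero
    | add x x' hx hx' => rw [add_tens]; exact add _ _ hx hx'
    | tens b m => exact tens b m n

lemma smul_tens' {M N : SkewMod A G} (a : A) (m : (toMod A G).obj M) (n : (toMod A G).obj N) :
    a • tens m n = tens (a • m) n :=
  ((tensorEquiv M N).symm.map_smul a (m ⊗ₜ[A] n)).symm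

/-- The additive equivalence `(B ⊗ M) ⊗ N ≃ M ⊗ N`. -/
def projEquivAux (M : SkewMod A G) (N : SkewMod B G) :
    (toMod B G).obj (tensorMod ((baseChange f).obj M) N) ≃+
      (toMod A G).obj (tensorMod M ((resFunctor G f).obj N)) :=
  letI : Algebra A B := f.toRingHom.toAlgebra
  letI : Module A ((toMod B G).obj N) := Module.compHom _ f.toRingHom
  haveI : IsScalarTower A B ((toMod B G).obj N) :=
    IsScalarTower.of_algebraMap_smul fun _ _ => rfl
  let e₁ : (toMod B G).obj ((baseChange f).obj M) ≃ₗ[B] B ⊗[A] (toMod A G).obj M :=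
    baseChangeEquiv f M
  let e₂ : (toMod B G).obj N ≃ₗ[A] (toMod A G).obj ((resFunctor G f).obj N) :=
    { toRes f N with map_smul' := fun a n => toRes_smul f a n }
  ((tensorEquiv _ _ ≪≫ₗ TensorProduct.congr e₁ (LinearEquiv.refl B _) ≪≫ₗ
    TensorProduct.comm B _ _ ≪≫ₗ
    TensorProduct.AlgebraTensorModule.cancelBaseChange A B B ((toMod B G).obj N)
      ((toMod A G).obj M)).toAddEquiv.trans
    (TensorProduct.comm A _ _ ≪≫ₗ TensorProduct.congr (LinearEquiv.refl A _) e₂ ≪≫ₗ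
      (tensorEquiv _ _).symm).toAddEquiv)

lemma projEquivAux_tens {M : SkewMod A G} (b : B) (m : (toMod A G).obj M)
    (n : (toMod B G).obj N) :
    projEquivAux f M N (tens (bcTens f b m) n) = tens m (toRes f N (b • n)) :=
  rfl

/-- The projection formula `(B ⊗ M) ⊗ N ≅ M ⊗ N`. -/
def projIso (M : SkewMod A G) (N : SkewMod B G) :
    (resFunctor G f).obj (tensorMod ((baseChange f).obj M) N) ≅
      tensorMod M ((resFunctor G f).obj N) :=
  isoOfEquivariant
    { (toRes f _).symm.trans (projEquivAux f M N) with
      map_smul' := fun a x => by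
        obtain ⟨x, rfl⟩ := (toRes f _).surjective x
        rw [← toRes_smul]
        change projEquivAux f M N (f a • x) = a • projEquivAux f M N x
        induction x using bcTens_pair_induction with
        | zero => simp only [map_zero, smul_zero]
        | add x y hx hy => simp only [map_add, smul_add, hx, hy]
        | tens b m n =>
          have h₁ : f a • tens (bcTens f b m) n = tens (bcTens f b m) (f a • n) := by
            rw [smul_tens', smul_tens]
          have h₂ (y) : a • tens m y =
              (tens m (a • y) : (toMod A G).obj (tensorMod M ((resFunctor G f).obj N))) := by
            rw [smul_tens', smul_tens]
          rw [h₁, projEquivAux_tens, projEquivAux_tens, h₂, smul_comm, toRes_smul] }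
    (fun g x => by
      obtain ⟨x, rfl⟩ := (toRes f _).surjective x
      rw [← toRes_act]
      change projEquivAux f M N (act _ g x) = act _ g (projEquivAux f M N x)
      induction x using bcTens_pair_induction with
      | zero => simp only [map_zero]
      | add x y hx hy => simp only [map_add, hx, hy]
      | tens b m n =>
        rw [act_tens, act_bcTens, projEquivAux_tens, projEquivAux_tens, act_tens, ← act_smul,
          toRes_act])

/-- The projection formula, as an isomorphism of functors. -/
def projNatIso (N : SkewMod B G) :
    baseChange f ⋙ (tensorBifunctor B G).flip.obj N ⋙ resFunctor G f ≅
      (tensorBifunctor A G).flip.obj ((resFunctor G f).obj N) :=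
  NatIso.ofComponents (fun M => projIso f M N) (fun {M M'} φ => by
    apply (toMod A G).map_injective
    ext x
    obtain ⟨x, rfl⟩ := (toRes f _).surjective x
    induction x using bcTens_pair_induction with
    | zero => exact (LinearMap.map_zero _).trans (LinearMap.map_zero _).symm
    | add x y hx hy =>
      exact (LinearMap.map_add _ _ _).trans
        ((congrArg₂ (· + ·) hx hy).trans (LinearMap.map_add _ _ _).symm)
    | tens b m n => rfl)

end

/-! ### Annihilated objects and base change -/

section

open HomologicalComplex MonoidalCategory DerivedCategory ZeroObject

attribute [local instance] HasDerivedCategory.standard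

variable {A : Type u} {G : Type v} [CommRing A] [Group G] [MulSemiringAction G A]
  {B : Type u} [CommRing B] [MulSemiringAction G B] (f : A →+*[G] B)

local infixr:70 " ⊠ " => MonoidalCategoryStruct.tensorObj

/-- After composing with a projective resolution of `K`, vanishing in the derived category becomes a
null homotopy, which base change preserves. No condition on `K'` is needed. -/
lemma Q_map_baseChange_eq_zero [Finite G] [IsNoetherianRing A]
    {K K' : CochainComplex (SkewMod A G) ℤ} (hK : IsStrictPerf K) {φ : K ⟶ K'}
    (h : Q.map φ = 0) : Q.map ((baseChangeFunctor f).map φ) = 0 := by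
  obtain ⟨P, hP, ⟨e⟩⟩ := exists_fgProj hK.perf
  have := hP.proj.isKProjective
  obtain ⟨s, hs⟩ := exists_quasiIso_of_iso e
  obtain ⟨t⟩ := homotopy_of_Q_map_eq (φ := s ≫ φ) (ψ := 0) (by
    rw [Functor.map_comp, h, comp_zero, Functor.map_zero])
  have h₁ : Q.map ((baseChangeFunctor f).map (s ≫ φ)) = Q.map ((baseChangeFunctor f).map 0) :=
    DerivedCategory.Q_map_eq_of_homotopy _ ((baseChange f).mapHomotopy t)
  have := quasiIso_baseChange f hP.proj.isRelProj hK.isRelProj s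
  have := (isIso_Q_map_iff_quasiIso _ ((baseChangeFunctor f).map s)).2 this
  rw [Functor.map_zero, Functor.map_zero, Functor.map_comp, Functor.map_comp,
    Preadditive.IsIso.comp_left_eq_zero] at h₁
  exact h₁

lemma Q_map_baseChange_whiskerRight_eq_zero_iff {K K' : CochainComplex (SkewMod A G) ℤ}
    (φ : K ⟶ K') (L : CochainComplex (SkewMod A G) ℤ) :
    Q.map ((baseChangeFunctor f).map φ ▷ (baseChangeFunctor f).obj L) = 0 ↔
      Q.map ((baseChangeFunctor f).map (φ ▷ L)) = 0 := by
  have h := baseChangeTensorCplxIso_naturality f φ (𝟙 L)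
  rw [CategoryTheory.Functor.map_id, tensorHom_id, tensorHom_id] at h
  rw [← Preadditive.IsIso.comp_right_eq_zero _ (Q.map (baseChangeTensorCplxIso f K' L).hom),
    ← Functor.map_comp, h, Functor.map_comp, Preadditive.IsIso.comp_left_eq_zero]

/-- Removes the unit and tensor comparisons, so that annihilation over `B` is expressed by the base
change of a morphism over `A`. -/
lemma annihilated_baseChangeAug_iff {𝓢 : Aug A G → Prop} (L : CochainComplex (SkewMod A G) ℤ) :
    annihilated (baseChangeAug f 𝓢) (Q.obj ((baseChangeFunctor f).obj L)) ↔
      ∃ w, 𝓢 w ∧ Q.map ((baseChangeFunctor f).map (w.ξ ▷ L)) = 0 := by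
  constructor
  · rintro ⟨w', ⟨w, hw, i, j, hw'⟩, h⟩
    refine ⟨w, hw, ?_⟩
    rw [Aug.τ_app_Q_eq_zero_iff', hw', comp_whiskerRight, comp_whiskerRight, Functor.map_comp,
      Functor.map_comp, Preadditive.IsIso.comp_left_eq_zero,
      Preadditive.IsIso.comp_right_eq_zero] at h
    exact (Q_map_baseChange_whiskerRight_eq_zero_iff f w.ξ L).1 h
  · rintro ⟨w, hw, h⟩
    refine ⟨w.baseChange f, baseChangeAug_baseChange f hw, ?_⟩
    rw [Aug.τ_app_Q_eq_zero_iff']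
    change Q.map (((baseChangeFunctor f).map w.ξ ≫ (baseChangeUnitCplxIso f).hom) ▷ _) = 0
    rw [comp_whiskerRight, Functor.map_comp,
      (Q_map_baseChange_whiskerRight_eq_zero_iff f w.ξ L).2 h, zero_comp]

/-- The easy half of the comparison: duality gives an annihilator of `L` over `A`, which is then
base changed. -/
lemma Spc.annihilated_baseChange [Finite G] [IsNoetherianRing A] (P : Spc A G)
    {L : CochainComplex (SkewMod A G) ℤ} (hL : IsStrictPerf L) (h : P.carrier (Q.obj L)) :
    annihilated (baseChangeAug f P.augClass) (Q.obj ((baseChangeFunctor f).obj L)) := by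
  obtain ⟨w, hw, h'⟩ := hL.exists_aug P.carrier (P.tensor_mem hL hL.dual h)
  rw [Aug.τ_app_Q_eq_zero_iff'] at h'
  exact (annihilated_baseChangeAug_iff f L).2
    ⟨w, hw, Q_map_baseChange_eq_zero f (w.isStrictPerf.tensor hL) h'⟩

lemma tensorSingleIso_naturality {K K' : CochainComplex (SkewMod A G) ℤ} (φ : K ⟶ K')
    (N : SkewMod A G) :
    (tensorSingleIso K N).hom ≫ φ ▷ (single (SkewMod A G) (ComplexShape.up ℤ) 0).obj N =
      (((tensorBifunctor A G).flip.obj N).mapHomologicalComplex (ComplexShape.up ℤ)).map φ ≫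
        (tensorSingleIso K' N).hom := by
  have h := singleTensorIso_naturality (tensorBifunctor A G) (N := N) φ (𝟙 N)
  rw [CategoryTheory.Functor.map_id, CategoryTheory.Functor.map_id] at h
  refine h.trans (congrArg _ ?_)
  ext n : 1
  exact Category.id_comp _

/-- The functor `K ↦ K ⊗ N` from complexes of `BG`-modules to `D(AG)`. -/
abbrev tensorResFunctor (N : SkewMod B G) : CochainComplex (SkewMod B G) ℤ ⥤ DAG A G :=
  ((tensorBifunctor B G).flip.obj N ⋙ resFunctor G f).mapHomologicalComplex (ComplexShape.up ℤ) ⋙ Q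

/-- By the projection formula, `- ⊗_A N` is base change followed by `- ⊗_B N` and restriction. The
last two functors are exact since `N` is flat over `B`, so they preserve vanishing in the derived
category. -/
lemma Q_map_whiskerRight_res_eq_zero (N : SkewMod B G) [Module.Flat B ((toMod B G).obj N)]
    {K K' : CochainComplex (SkewMod A G) ℤ} {φ : K ⟶ K'}
    (h : Q.map ((baseChangeFunctor f).map φ) = 0) :
    Q.map (φ ▷ (single (SkewMod A G) (ComplexShape.up ℤ) 0).obj ((resFunctor G f).obj N)) = 0 := by
  let Γ := (tensorBifunctor B G).flip.obj N ⋙ resFunctor G f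
  have : Γ.PreservesHomology := Functor.preservesHomology_of_map_exact _ fun S hS =>
    (tensorRight_exact N S hS).map (resFunctor G f)
  have h₁ : (tensorResFunctor f N).map ((baseChangeFunctor f).map φ) = 0 :=
    map_eq_zero_of_Q_map_eq_zero (tensorResFunctor f N) (fun K L ψ hψ =>
      (isIso_Q_map_iff_quasiIso _ ((Γ.mapHomologicalComplex (ComplexShape.up ℤ)).map ψ)).2
        inferInstance) h
  let T := ((tensorBifunctor A G).flip.obj ((resFunctor G f).obj N)).mapHomologicalComplex
    (ComplexShape.up ℤ)
  let e := NatIso.mapHomologicalComplex (projNatIso f N) (ComplexShape.up ℤ)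
  have h₂ : Q.map (e.hom.app K) ≫ Q.map (T.map φ) = 0 := by
    refine (Q.map_comp _ _).symm.trans ((congrArg Q.map (e.hom.naturality φ)).symm.trans ?_)
    exact (Q.map_comp _ _).trans ((congrArg (· ≫ Q.map (e.hom.app K')) h₁).trans zero_comp)
  rw [Preadditive.IsIso.comp_left_eq_zero] at h₂
  rw [← Preadditive.IsIso.comp_left_eq_zero (Q.map (tensorSingleIso K _).hom), ← Functor.map_comp,
    tensorSingleIso_naturality, Functor.map_comp]
  exact (congrArg (· ≫ _) h₂).trans zero_comp

/-- An object annihilated after base change is annihilated after tensoring with any module which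
comes from a flat module. -/
lemma annihilated_tensor_res {𝓢 : Aug A G → Prop} {L : CochainComplex (SkewMod A G) ℤ}
    (h : annihilated (baseChangeAug f 𝓢) (Q.obj ((baseChangeFunctor f).obj L)))
    (N : SkewMod B G) [Module.Flat B ((toMod B G).obj N)] :
    annihilated 𝓢
      (Q.obj (L ⊠ (single (SkewMod A G) (ComplexShape.up ℤ) 0).obj ((resFunctor G f).obj N))) := by
  obtain ⟨w, hw, h⟩ := (annihilated_baseChangeAug_iff f L).1 h
  refine ⟨w, hw, ?_⟩
  have h := Q_map_whiskerRight_res_eq_zero f N h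
  rw [Aug.τ_app_Q_eq_zero_iff', whiskerRight_tensor, Functor.map_comp, Functor.map_comp, h,
    zero_comp, comp_zero]

end

/-! ### Modules on which the complement of a prime ideal of invariants acts invertibly -/

section

variable {A : Type u} {G : Type v} [CommRing A] [Group G] [MulSemiringAction G A]

/-- Multiplication by an invariant element on an `AG`-module. -/
def mulMod (a : Inv A G) (M : SkewMod A G) : M ⟶ M :=
  homOfEquivariant ((a : A) • LinearMap.id) (fun g x => by
    change (a : A) • act M g x = act M g ((a : A) • x)
    rw [act_smul, a.2 g])

lemma mulMod_naturality (a : Inv A G) {M N : SkewMod A G} (φ : M ⟶ N) :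
    mulMod a M ≫ φ = φ ≫ mulMod a N := by
  apply (toMod A G).map_injective
  ext x
  exact ((toMod A G).map φ).hom.map_smul (a : A) x

variable (q : PrimeSpectrum (Inv A G))

/-- The invariant elements outside `𝔮` act invertibly on `M`. -/
def IsLocalMod (M : SkewMod A G) : Prop := ∀ s : Inv A G, s ∉ q.asIdeal → IsIso (mulMod s M)

variable {q} {M N : SkewMod A G}

lemma IsLocalMod.bijective (hM : IsLocalMod q M) {s : Inv A G} (hs : s ∉ q.asIdeal) :
    Function.Bijective (fun x : (toMod A G).obj M => (s : A) • x) :=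
  have := hM s hs
  ConcreteCategory.bijective_of_isIso ((toMod A G).map (mulMod s M))

lemma isLocalMod_of_bijective (h : ∀ s : Inv A G, s ∉ q.asIdeal →
    Function.Bijective (fun x : (toMod A G).obj M => (s : A) • x)) : IsLocalMod q M :=
  fun s hs => by
    have : IsIso ((toMod A G).map (mulMod s M)) :=
      (ConcreteCategory.isIso_iff_bijective _).2 (h s hs)
    exact isIso_of_reflects_iso _ (toMod A G)

/-- Multiplication on `J` is mono because `J` embeds in `N`, and epi because `J` is a quotient of
`M`. -/
lemma IsLocalMod.image (hM : IsLocalMod q M) (hN : IsLocalMod q N) {J : SkewMod A G} (p : M ⟶ J)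
    [Epi p] (i : J ⟶ N) [Mono i] : IsLocalMod q J := fun s hs => by
  have := hM s hs
  have := hN s hs
  have : Mono (mulMod s J) := mono_of_mono_fac (mulMod_naturality s i)
  have : Epi (mulMod s J) := epi_of_epi_fac (mulMod_naturality s p).symm
  exact isIso_of_mono_of_epi _

lemma IsLocalMod.kernel (hM : IsLocalMod q M) (hN : IsLocalMod q N) (φ : M ⟶ N) :
    IsLocalMod q (kernel φ) := fun s hs => by
  have := hM s hs
  have := hN s hs
  have h : mulMod s (Limits.kernel φ) =
      (kernel.mapIso φ φ (asIso (mulMod s M)) (asIso (mulMod s N))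
        (mulMod_naturality s φ).symm).hom := by
    rw [← cancel_mono (kernel.ι φ)]
    exact (mulMod_naturality s (kernel.ι φ)).trans (kernel.lift_ι _ _ _).symm
  rw [h]
  infer_instance

lemma IsLocalMod.cokernel (hM : IsLocalMod q M) (hN : IsLocalMod q N) (φ : M ⟶ N) :
    IsLocalMod q (cokernel φ) := fun s hs => by
  have := hM s hs
  have := hN s hs
  have h : mulMod s (Limits.cokernel φ) =
      (cokernel.mapIso φ φ (asIso (mulMod s M)) (asIso (mulMod s N))
        (mulMod_naturality s φ).symm).hom := by
    rw [← cancel_epi (cokernel.π φ)]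
    exact (mulMod_naturality s (cokernel.π φ)).symm.trans (cokernel.π_desc _ _ _).symm
  rw [h]
  infer_instance

lemma mulMod_eq_zero_of_mono {a : Inv A G} (h : mulMod a N = 0) (i : M ⟶ N) [Mono i] :
    mulMod a M = 0 := by
  rw [← cancel_mono i, mulMod_naturality, h, comp_zero, zero_comp]

lemma mulMod_eq_zero_of_epi {a : Inv A G} (h : mulMod a M = 0) (p : M ⟶ N) [Epi p] :
    mulMod a N = 0 := by
  rw [← cancel_epi p, ← mulMod_naturality, h, comp_zero, zero_comp]

end

/-! ### The unit of base change on local modules -/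

section

variable {A : Type u} {G : Type v} [CommRing A] [Group G] [MulSemiringAction G A]
  {B : Type u} [CommRing B] [MulSemiringAction G B] (f : A →+*[G] B)

lemma bcTens_smul_one {M : SkewMod A G} (a : A) (b : B) (m : (toMod A G).obj M) :
    bcTens f b (a • m) = f a • bcTens f b m := by
  rw [bcTens_smul, smul_bcTens]

/-- The unit `M ⟶ B ⊗ M` of the adjunction between base change and restriction. -/
def unitHom (M : SkewMod A G) : M ⟶ (resFunctor G f).obj ((baseChange f).obj M) :=
  homOfEquivariant
    { toFun := fun m => toRes f _ (bcTens f 1 m)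
      map_add' := fun m m' => by rw [bcTens_add, map_add]
      map_smul' := fun a m => by
        rw [bcTens_smul_one, toRes_smul, RingHom.id_apply] }
    (fun g m => by
      change toRes f _ (bcTens f 1 (act M g m)) = act _ g (toRes f _ (bcTens f 1 m))
      rw [← toRes_act, act_bcTens, smul_one])

lemma isLocalMod_res {q : PrimeSpectrum (Inv A G)}
    (hq : ∀ s : Inv A G, s ∉ q.asIdeal → IsUnit (f (s : A))) (N : SkewMod B G) :
    IsLocalMod q ((resFunctor G f).obj N) :=
  isLocalMod_of_bijective fun s hs => by
    have h : (fun x => (s : A) • x) = toRes f N ∘ (fun n => f (s : A) • n) ∘ (toRes f N).symm := by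
      ext x
      obtain ⟨n, rfl⟩ := (toRes f N).surjective x
      change _ = toRes f N (f (s : A) • (toRes f N).symm (toRes f N n))
      rw [AddEquiv.symm_apply_apply, toRes_smul]
    rw [h]
    obtain ⟨t, ht⟩ := hq s hs
    refine (toRes f N).bijective.comp (Function.Bijective.comp ?_ (toRes f N).symm.bijective)
    rw [← ht]
    exact MulAction.bijective t

end

section

variable {A V : Type*} [CommRing A] [AddCommGroup V] [Module A V]

lemma bijective_smul_quotient {M : Type*} [AddCommGroup M] [Module A M] {s : A}
    (hs : Function.Bijective (fun x : M => s • x)) (I : Ideal A) :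
    Function.Bijective (fun x : M ⧸ (I • ⊤ : Submodule A M) => s • x) := by
  let e : M ≃ₗ[A] M := LinearEquiv.ofBijective (s • LinearMap.id) hs
  have h : (I • ⊤ : Submodule A M).map e.toLinearMap = I • ⊤ := by
    rw [Submodule.map_smul'', Submodule.map_top, LinearMap.range_eq_top.2 e.surjective]
  convert (Submodule.Quotient.equiv (I • ⊤ : Submodule A M) (I • ⊤) e h).bijective using 1
  ext x
  obtain ⟨x, rfl⟩ := Submodule.Quotient.mk_surjective _ x
  rfl

/-- If `B` is a localization of `A ⧸ ker` at a set `T` which acts invertibly on `M`, then an element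
of `M` which vanishes in `B ⊗ M` lies in `ker • M`. -/
lemma mem_ker_smul_of_tmul_eq_zero {B : Type*} [CommRing B] [Algebra A B] (T : Submonoid A)
    (hT : ∀ t ∈ T, IsUnit (algebraMap A B t))
    (hB : ∀ b : B, ∃ t ∈ T, ∃ a, algebraMap A B t * b = algebraMap A B a)
    {M : Type*} [AddCommGroup M] [Module A M]
    (hM : ∀ t ∈ T, Function.Bijective (fun x : M => t • x)) {m : M}
    (hm : (1 : B) ⊗ₜ[A] m = 0) : m ∈ (RingHom.ker (algebraMap A B) • ⊤ : Submodule A M) := by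
  let I := RingHom.ker (algebraMap A B)
  let V := M ⧸ (I • ⊤ : Submodule A M)
  let l : (A ⧸ I) →ₗ[A] B := (Ideal.Quotient.liftₐ I (Algebra.ofId A B) (fun a ha => ha)).toLinearMap
  have hl (a : A) : l (Ideal.Quotient.mk I a) = algebraMap A B a := rfl
  have hinj : Function.Injective l := by
    refine (injective_iff_map_eq_zero l).2 fun x hx => ?_
    obtain ⟨a, rfl⟩ := Ideal.Quotient.mk_surjective x
    exact Ideal.Quotient.eq_zero_iff_mem.2 hx
  -- The hypotheses say that `B` is the localization of `A ⧸ I` at `T` as an `A`-module.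
  have : IsLocalizedModule T l :=
    { map_units := fun t => by
        rw [Module.End.isUnit_iff]
        obtain ⟨u, hu⟩ := hT t t.2
        convert MulAction.bijective (β := B) u using 1
        ext b
        rw [Module.algebraMap_end_apply, Units.smul_def, hu, Algebra.smul_def, smul_eq_mul]
      surj := fun b => by
        obtain ⟨t, ht, a, h⟩ := hB b
        refine ⟨(Ideal.Quotient.mk I a, ⟨t, ht⟩), ?_⟩
        rw [hl, ← h, ← Algebra.smul_def]
        rfl
      exists_of_eq := fun h => ⟨1, by rw [hinj h]⟩ }
  -- The quotient map `M → V` is to be extended along `M → B ⊗ M`. The assignment `1 ↦ (M → V)` on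
  -- `A ⧸ I` extends to `B`, because `T` acts invertibly on `V`.
  let g₀ : A →ₗ[A] (M →ₗ[A] V) := LinearMap.toSpanSingleton A _ (Submodule.mkQ _)
  let g : (A ⧸ I) →ₗ[A] (M →ₗ[A] V) := Submodule.liftQ I g₀ (fun a ha => by
    ext x
    exact (Submodule.Quotient.mk_eq_zero _).2 (Submodule.smul_mem_smul ha trivial))
  have hg : ∀ t : T, IsUnit (algebraMap A (Module.End A (M →ₗ[A] V)) t) := fun t => by
    rw [Module.End.isUnit_iff]
    let e : V ≃ₗ[A] V := LinearEquiv.ofBijective ((t : A) • LinearMap.id)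
      (bijective_smul_quotient (hM t t.2) I)
    exact (LinearEquiv.congrRight (M := M) e).bijective
  let G := IsLocalizedModule.lift T l g hg
  have hG : G 1 = Submodule.mkQ _ := by
    have : l (Ideal.Quotient.mk I 1) = 1 := map_one (algebraMap A B)
    rw [← this, IsLocalizedModule.lift_apply]
    exact one_smul A _
  have := congrArg (TensorProduct.lift G) hm
  rw [TensorProduct.lift.tmul, hG, map_zero] at this
  exact (Submodule.Quotient.mk_eq_zero _).1 this

end

section

variable {A : Type u} {G : Type v} [CommRing A] [Group G] [MulSemiringAction G A]
  {q : PrimeSpectrum (Inv A G)} {M : SkewMod A G}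

/-- Given `b ⊗ m`, write `s b = a` with `s ∉ 𝔮` and `m = s m'`; then `b ⊗ m = 1 ⊗ a m'`. -/
lemma IsLocalMod.epi_unitHom (hM : IsLocalMod q M) : Epi (unitHom (psi q) M) := by
  have : Function.Surjective ((toMod A G).map (unitHom (psi q) M)) := fun x => by
    obtain ⟨x, rfl⟩ := (toRes (psi q) _).surjective x
    induction x using bcTens_induction with
    | zero => exact ⟨0, map_zero _⟩
    | add x y hx hy =>
      obtain ⟨x', hx⟩ := hx
      obtain ⟨y', hy⟩ := hy
      exact ⟨x' + y', (map_add _ _ _).trans ((congrArg₂ (· + ·) hx hy).trans (map_add _ _ _).symm)⟩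
    | tens b m =>
      obtain ⟨s, hs, a, h⟩ := exists_psi_mul_eq q b
      obtain ⟨m', rfl⟩ := (hM.bijective hs).2 m
      refine ⟨a • m', congrArg (toRes (psi q) _) ?_⟩
      change bcTens (psi q) 1 (a • m') = bcTens (psi q) b ((s : A) • m')
      rw [bcTens_smul, bcTens_smul, h, mul_one]
  have : Epi ((toMod A G).map (unitHom (psi q) M)) := (ModuleCat.epi_iff_surjective _).2 this
  exact (toMod A G).epi_of_epi_map this

lemma IsLocalMod.mem_of_unitHom_eq_zero (hM : IsLocalMod q M) {m : (toMod A G).obj M}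
    (hm : (toMod A G).map (unitHom (psi q) M) m = 0) :
    m ∈ (RingHom.ker (psi q).toRingHom • ⊤ : Submodule A ((toMod A G).obj M)) := by
  let _ : Algebra A (ReducedFiber q) := (psi q).toRingHom.toAlgebra
  refine mem_ker_smul_of_tmul_eq_zero (B := ReducedFiber q)
    (q.asIdeal.primeCompl.map (Inv A G).subtype) ?_ (fun b => ?_) ?_ hm
  · rintro _ ⟨s, hs, rfl⟩
    exact isUnit_psi q hs
  · obtain ⟨s, hs, a, h⟩ := exists_psi_mul_eq q b
    exact ⟨s, ⟨s, hs, rfl⟩, a, h⟩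
  · rintro _ ⟨s, hs, rfl⟩
    exact hM.bijective hs

end

/-! ### Multiplication by invariant elements on complexes -/

section

open HomologicalComplex MonoidalCategory DerivedCategory ZeroObject

attribute [local instance] HasDerivedCategory.standard

lemma flat_of_isSemisimpleRing (R M : Type*) [CommRing R] [IsSemisimpleRing R] [AddCommGroup M]
    [Module R M] : Module.Flat R M :=
  have := Module.projective_of_isSemisimpleRing R M
  inferInstance

lemma shortExact_kernel {C : Type*} [Category C] [Abelian C] {X Y : C} (f : X ⟶ Y) [Epi f] :
    (ShortComplex.mk (kernel.ι f) f (kernel.condition f)).ShortExact where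
  exact := ShortComplex.exact_of_f_is_kernel _ (kernelIsKernel f)

lemma shortExact_cokernel {C : Type*} [Category C] [Abelian C] {X Y : C} (f : X ⟶ Y) [Mono f] :
    (ShortComplex.mk f (cokernel.π f) (cokernel.condition f)).ShortExact where
  exact := ShortComplex.exact_of_g_is_cokernel _ (cokernelIsCokernel f)

/-- The kernel of the unit lies in `ker(psi q) • M`, so one power fewer of `ker(psi q)` is needed to
kill it. This drives the induction in `annihilated_of_pow`. -/
lemma IsLocalMod.smul_eq_zero_of_comp_unitHom {A : Type u} {G : Type v} [CommRing A] [Group G]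
    [MulSemiringAction G A] {q : PrimeSpectrum (Inv A G)} {K M : SkewMod A G}
    (hM : IsLocalMod q M) (i : K ⟶ M) [Mono i] (hi : i ≫ unitHom (psi q) M = 0) {n : ℕ}
    (hn : ∀ a ∈ RingHom.ker (psi q).toRingHom ^ (n + 1), ∀ x : (toMod A G).obj M, a • x = 0)
    {a : A} (ha : a ∈ RingHom.ker (psi q).toRingHom ^ n) (x : (toMod A G).obj K) : a • x = 0 := by
  have hinj : Function.Injective ((toMod A G).map i) :=
    (ModuleCat.mono_iff_injective _).1 inferInstance
  apply hinj
  rw [map_zero]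
  refine (((toMod A G).map i).hom.map_smul a x).trans ?_
  have hx : (toMod A G).map i x ∈
      (RingHom.ker (psi q).toRingHom • ⊤ : Submodule A ((toMod A G).obj M)) :=
    hM.mem_of_unitHom_eq_zero (ConcreteCategory.congr_hom hi x)
  have h : ∀ y ∈ (RingHom.ker (psi q).toRingHom • ⊤ : Submodule A ((toMod A G).obj M)),
      a • y = 0 := fun y hy => by
    induction hy using Submodule.smul_induction_on' with
    | smul r hr z _ =>
      rw [← mul_smul]
      exact hn _ (by rw [pow_succ]; exact Ideal.mul_mem_mul ha hr) z
    | add y _ z _ hy hz => rw [smul_add, hy, hz, add_zero]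
  exact h _ hx

variable {A : Type u} {G : Type v} [CommRing A] [Group G] [MulSemiringAction G A]

local infixr:70 " ⊠ " => MonoidalCategoryStruct.tensorObj

/-- Multiplication by an invariant element on a complex of `AG`-modules. -/
def mulCplx (a : Inv A G) (K : CochainComplex (SkewMod A G) ℤ) : K ⟶ K where
  f i := mulMod a (K.X i)
  comm' _ _ _ := mulMod_naturality a _

variable (A G) in
/-- The functor from `AG`-modules to complexes concentrated in degree zero. -/
abbrev singleCplx : SkewMod A G ⥤ CochainComplex (SkewMod A G) ℤ :=
  single (SkewMod A G) (ComplexShape.up ℤ) 0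

lemma mulCplx_single (a : Inv A G) (M : SkewMod A G) :
    mulCplx a ((singleCplx A G).obj M) = (singleCplx A G).map (mulMod a M) := by
  apply from_single_hom_ext
  rw [single_map_f_self, ← Category.assoc, Iso.eq_comp_inv]
  exact mulMod_naturality a _

lemma mulMod_tensor (a : Inv A G) (M N : SkewMod A G) : mulMod a (M ⊠ N) = mulMod a M ▷ N :=
  (toMod A G).map_injective (ModuleCat.hom_ext (tensorMod_linearMap_ext fun m n =>
    smul_tens' (a : A) m n))

lemma mulCplx_tensor (a : Inv A G) (K L : CochainComplex (SkewMod A G) ℤ) :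
    mulCplx a (K ⊠ L) = mulCplx a K ▷ L := by
  ext n : 1
  refine tensor_X_hom_ext fun i j h => ?_
  rw [inTensor_whiskerRight]
  refine (mulMod_naturality a _).symm.trans (congrArg (· ≫ _) ?_)
  exact mulMod_tensor a (K.X i) (L.X j)

lemma leftUnitor_inv_mulUnit (a : Inv A G) (M : SkewMod A G) :
    (λ_ M).inv ≫ mulUnit a ▷ M = mulMod a M ≫ (λ_ M).inv := by
  rw [Iso.inv_comp_eq, ← Category.assoc, Iso.eq_comp_inv]
  exact tensorMod_hom_ext fun x m =>
    mul_smul (a : A) (unitEquiv (A := A) (G := G) x) (m : (toMod A G).obj M)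

lemma mulUnit_whiskerRight (a : Inv A G) (K : CochainComplex (SkewMod A G) ℤ) :
    (singleCplx A G).map (mulUnit a) ▷ K ≫ (λ_ K).hom = (λ_ K).hom ≫ mulCplx a K := by
  rw [← Iso.inv_comp_eq, ← Category.assoc, ← Iso.eq_comp_inv]
  ext n : 1
  rw [comp_f, comp_f, leftUnitor_inv_f]
  simp only [Category.assoc]
  rw [inTensor_whiskerRight]
  have h : (singleObjXSelf (ComplexShape.up ℤ) 0 (𝟙_ (SkewMod A G))).inv ≫
      ((singleCplx A G).map (mulUnit a)).f 0 =
        mulUnit a ≫ (singleObjXSelf (ComplexShape.up ℤ) 0 (𝟙_ (SkewMod A G))).inv := by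
    rw [single_map_f_self]
    exact Iso.inv_hom_id_assoc _ _
  have h' := congrArg (· ▷ K.X n) h
  rw [comp_whiskerRight, comp_whiskerRight] at h'
  rw [reassoc_of% h', reassoc_of% (leftUnitor_inv_mulUnit a (K.X n))]
  rfl

/-- The cone of an invariant element on the unit object. -/
abbrev unitCone (a : Inv A G) : CochainComplex (SkewMod A G) ℤ :=
  CochainComplex.mappingCone ((singleCplx A G).map (mulUnit a))

lemma isStrictPerf_unitCone (a : Inv A G) : IsStrictPerf (unitCone a) :=
  (isStrictPerf_unit A G).mappingCone _ (isStrictPerf_unit A G)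

/-- The cone of multiplication by `a` on `K` is `unitCone a ⊗ K`. -/
lemma trW_mulCplx_iff (P : ObjectProperty (DAG A G)) [P.IsClosedUnderIsomorphisms] (a : Inv A G)
    (K : CochainComplex (SkewMod A G) ℤ) :
    P.trW (Q.map (mulCplx a K)) ↔ P (Q.obj (unitCone a ⊠ K)) := by
  have e : Arrow.mk (Q.map ((singleCplx A G).map (mulUnit a) ▷ K)) ≅ Arrow.mk (Q.map (mulCplx a K)) :=
    Arrow.isoMk (Q.mapIso (λ_ K)) (Q.mapIso (λ_ K)) (by
      refine (Q.map_comp _ _).symm.trans (Eq.trans ?_ (Q.map_comp _ _))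
      exact congrArg Q.map (mulUnit_whiskerRight a K).symm)
  rw [← P.trW.arrow_mk_iso_iff e, trW_Q_map_iff]
  exact P.prop_iff_of_iso (Q.mapIso (coneTensorIso _ K))

/-- The cone of `S.f` is quasi-isomorphic to `S.X₃`, and tensoring with a strictly perfect complex
preserves this for arbitrary modules. -/
lemma exists_triangle_of_shortExact {L : CochainComplex (SkewMod A G) ℤ} (hL : IsStrictPerf L)
    (S : ShortComplex (SkewMod A G)) (hS : S.ShortExact) :
    ∃ h, Pretriangulated.Triangle.mk (Q.map ((singleCplx A G).map S.f ▷ L))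
      (Q.map ((singleCplx A G).map S.g ▷ L)) h ∈ Pretriangulated.distinguishedTriangles := by
  let S' := S.map (singleCplx A G)
  have hS' : S'.ShortExact := hS.map_of_exact _
  have := CochainComplex.mappingCone.quasiIso_descShortComplex hS'
  have := hL.quasiIso_whisker (CochainComplex.mappingCone.descShortComplex S')
  have := (isIso_Q_map_iff_quasiIso _
    (CochainComplex.mappingCone.descShortComplex S' ▷ L)).2 this
  obtain ⟨t, ht⟩ := exists_cone_triangle (S'.f ▷ L)
  let e : Q.obj (CochainComplex.mappingCone (S'.f ▷ L)) ≅ Q.obj (S'.X₃ ⊠ L) :=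
    Q.mapIso (coneTensorIso S'.f L) ≪≫
      asIso (Q.map (CochainComplex.mappingCone.descShortComplex S' ▷ L))
  have he : Q.map (CochainComplex.mappingCone.inr (S'.f ▷ L)) ≫ e.hom = Q.map (S'.g ▷ L) := by
    refine (congrArg (_ ≫ ·) (Q.map_comp _ _).symm).trans ((Q.map_comp _ _).symm.trans
      (congrArg Q.map ?_))
    rw [← Category.assoc, inr_coneTensorIso, ← comp_whiskerRight,
      CochainComplex.mappingCone.inr_descShortComplex]
  refine ⟨e.inv ≫ t, Pretriangulated.isomorphic_distinguished _ ht _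
    (Pretriangulated.Triangle.isoMk _ _ (Iso.refl _) (Iso.refl _) e.symm ?_ ?_ ?_)⟩
  · exact (Category.comp_id _).trans (Category.id_comp _).symm
  · change Q.map (S'.g ▷ L) ≫ e.inv = 𝟙 _ ≫ _
    rw [← he, Category.assoc, Iso.hom_inv_id, Category.comp_id]
    exact (Category.id_comp _).symm
  · change (e.inv ≫ t) ≫ (shiftFunctor _ (1 : ℤ)).map (𝟙 _) = e.inv ≫ t
    rw [CategoryTheory.Functor.map_id]
    exact Category.comp_id _

/-! ### Objects annihilated after tensoring with local modules -/

section

variable {𝓢 : Aug A G → Prop} (h𝓢 : IsMultiplicative 𝓢) {L : CochainComplex (SkewMod A G) ℤ}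
  (hL : IsStrictPerf L)

include h𝓢

lemma IsMultiplicative.annihilated_of_isZero {X : DAG A G} (hX : IsZero X) : annihilated 𝓢 X := by
  obtain ⟨w, hw⟩ := h𝓢.nonempty
  exact ⟨w, hw, hX.eq_of_tgt _ _⟩

include hL

lemma IsMultiplicative.annihilated_of_epi {M N : SkewMod A G} (f : M ⟶ N) [Epi f]
    (h₁ : annihilated 𝓢 (Q.obj ((singleCplx A G).obj (kernel f) ⊠ L)))
    (h₃ : annihilated 𝓢 (Q.obj ((singleCplx A G).obj N ⊠ L))) :
    annihilated 𝓢 (Q.obj ((singleCplx A G).obj M ⊠ L)) := by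
  obtain ⟨t, ht⟩ := exists_triangle_of_shortExact hL _ (shortExact_kernel f)
  exact h𝓢.ext_annihilated _ ht h₁ h₃

section

variable [IsNoetherianRing A] [Finite G] {q : PrimeSpectrum (Inv A G)}

/-- Induction along `0 → K → M → B ⊗ M → 0`. The quotient is restricted from `B`, over which every
module is flat, so `annihilated_tensor_res` applies; the kernel `K` is again local and is killed by
the next lower power. -/
lemma IsMultiplicative.annihilated_of_pow
    (h : annihilated (EquivPerf.baseChangeAug (psi q) 𝓢) (Q.obj ((baseChangeFunctor (psi q)).obj L))) (n : ℕ)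
    (M : SkewMod A G) (hM : IsLocalMod q M)
    (hn : ∀ a ∈ RingHom.ker (psi q).toRingHom ^ n, ∀ x : (toMod A G).obj M, a • x = 0) :
    annihilated 𝓢 (Q.obj ((singleCplx A G).obj M ⊠ L)) := by
  induction n generalizing M with
  | zero =>
    have : Subsingleton M := ⟨fun x y => by
      have h1 (x : (toMod A G).obj M) : x = 0 := by
        rw [← one_smul A x]
        exact hn 1 (by rw [pow_zero, Ideal.one_eq_top]; trivial) x
      exact (h1 x).trans (h1 y).symm⟩
    have hM : IsZero M := ModuleCat.isZero_of_subsingleton M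
    exact h𝓢.annihilated_of_isZero
      (Q.map_isZero (isZero_tensor ((singleCplx A G).map_isZero hM) L))
  | succ n ih =>
    have := hM.epi_unitHom
    have hN := isLocalMod_res (psi q) (fun s hs => isUnit_psi q hs) ((baseChange (psi q)).obj M)
    have : Module.Flat (ReducedFiber q)
        ((toMod (ReducedFiber q) G).obj ((baseChange (psi q)).obj M)) :=
      flat_of_isSemisimpleRing _ _
    have h₃ := (annihilated 𝓢).prop_of_iso (Q.mapIso (cplxComm _ _))
      (annihilated_tensor_res (psi q) h ((baseChange (psi q)).obj M))
    have h₁ := ih _ (hM.kernel hN (unitHom (psi q) M)) fun a ha x =>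
      hM.smul_eq_zero_of_comp_unitHom (kernel.ι _) (kernel.condition _) hn ha x
    exact h𝓢.annihilated_of_epi hL (unitHom (psi q) M) h₁ h₃

/-- Some `s ∉ 𝔮` multiplies a power of `ker(psi q)` into `𝔮A`. As `s` acts injectively on `M`, that
power already kills `M`. -/
lemma IsMultiplicative.annihilated_of_local
    (h : annihilated (EquivPerf.baseChangeAug (psi q) 𝓢) (Q.obj ((baseChangeFunctor (psi q)).obj L)))
    (M : SkewMod A G) (hM : IsLocalMod q M)
    (hq : ∀ a ∈ q.asIdeal, ∀ x : (toMod A G).obj M, (a : A) • x = 0) :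
    annihilated 𝓢 (Q.obj ((singleCplx A G).obj M ⊠ L)) := by
  obtain ⟨n, s, hs, hn⟩ := exists_mul_mem_of_psi_eq_zero q
  refine h𝓢.annihilated_of_pow hL h n M hM fun a ha x => (hM.bijective hs).1 ?_
  change (s : A) • a • x = (s : A) • 0
  rw [smul_zero, ← mul_smul]
  have : q.asIdeal.map (algebraMap (Inv A G) A) ≤ Module.annihilator A ((toMod A G).obj M) :=
    Ideal.map_le_iff_le_comap.2 fun r hr => Module.mem_annihilator.2 (hq r hr)
  exact Module.mem_annihilator.1 (this (hn a ha)) x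

end

variable {q : PrimeSpectrum (Inv A G)}

/-- Multiplication by `a` factors as `M ↠ J ↪ M`, and the kernel and cokernel of these maps are
killed by `a`. So on `M ⊗ L` it is invertible modulo annihilated objects, which means that its cone
is annihilated. Passing from `L` to `unitCone a ⊗ L` thus removes the condition that `a` kills `M`.
-/
lemma IsMultiplicative.annihilated_unitCone (a : Inv A G) (T : Set (Inv A G))
    (h : ∀ M : SkewMod A G, IsLocalMod q M → mulMod a M = 0 → (∀ t ∈ T, mulMod t M = 0) →
      annihilated 𝓢 (Q.obj ((singleCplx A G).obj M ⊠ L)))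
    (M : SkewMod A G) (hM : IsLocalMod q M) (hT : ∀ t ∈ T, mulMod t M = 0) :
    annihilated 𝓢 (Q.obj ((singleCplx A G).obj M ⊠ (unitCone a ⊠ L))) := by
  have := h𝓢.isTriangulated
  obtain ⟨J, p, _, i, _, hpi⟩ : ∃ (J : SkewMod A G) (p : M ⟶ J) (_ : Epi p) (i : J ⟶ M)
      (_ : Mono i), p ≫ i = mulMod a M :=
    ⟨_, factorThruImage (mulMod a M), inferInstance, image.ι _, inferInstance, image.fac _⟩
  have hJ : IsLocalMod q J := hM.image hM p i
  have h₁ : (annihilated 𝓢).trW (Q.map ((singleCplx A G).map p ▷ L)) := by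
    obtain ⟨t, ht⟩ := exists_triangle_of_shortExact hL _ (shortExact_kernel p)
    refine ObjectProperty.trW.mk' _ ht (h _ (hM.kernel hJ p) ?_ fun t ht =>
      mulMod_eq_zero_of_mono (hT t ht) (kernel.ι p))
    rw [← cancel_mono (kernel.ι p), zero_comp, mulMod_naturality]
    rw [← hpi, kernel.condition_assoc, zero_comp]
  have h₂ : (annihilated 𝓢).trW (Q.map ((singleCplx A G).map i ▷ L)) := by
    obtain ⟨t, ht⟩ := exists_triangle_of_shortExact hL _ (shortExact_cokernel i)
    refine ObjectProperty.trW.mk _ ht (h _ (hJ.cokernel hM i) ?_ fun t ht =>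
      mulMod_eq_zero_of_epi (hT t ht) (cokernel.π i))
    rw [← cancel_epi (cokernel.π i), comp_zero, ← mulMod_naturality]
    rw [← hpi, Category.assoc, cokernel.condition, comp_zero]
  have h₃ := (annihilated 𝓢).trW.comp_mem _ _ h₁ h₂
  have e : Q.map ((singleCplx A G).map p ▷ L) ≫ Q.map ((singleCplx A G).map i ▷ L) =
      Q.map (mulCplx a ((singleCplx A G).obj M ⊠ L)) := by
    rw [← Functor.map_comp, ← comp_whiskerRight, ← Functor.map_comp, hpi, mulCplx_tensor,
      mulCplx_single]
  rw [e, trW_mulCplx_iff] at h₃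
  exact (annihilated 𝓢).prop_of_iso (Q.mapIso ((α_ _ _ _).symm ≪≫
    whiskerRightIso (cplxComm _ _) L ≪≫ α_ _ _ _)) h₃

end

end

/-! ### Localization at a prime ideal of invariants -/

section

open MonoidalCategory

variable {A : Type u} {G : Type v} [CommRing A] [Group G] [MulSemiringAction G A]
  (q : PrimeSpectrum (Inv A G))

local infixr:70 " ⊠ " => MonoidalCategoryStruct.tensorObj

/-- The invariant elements outside `𝔮`. -/
abbrev primeComplInv : Submonoid A := q.asIdeal.primeCompl.map (Inv A G).subtype

/-- The action of `g` on the localization of `A` at `𝔮`. -/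
def locRingHom (g : G) : Localization (primeComplInv q) →+* Localization (primeComplInv q) :=
  IsLocalization.map (M := primeComplInv q) (T := primeComplInv q) _
    (MulSemiringAction.toRingHom G A g) (by
      rintro _ ⟨s, hs, rfl⟩
      exact ⟨s, hs, (s.2 g).symm⟩)

lemma locRingHom_mk' (g : G) (a : A) (t : primeComplInv q) :
    locRingHom q g (IsLocalization.mk' _ a t) = IsLocalization.mk' _ (g • a) t := by
  refine (IsLocalization.map_mk' _ _ _).trans (congrArg _ (Subtype.ext ?_))
  obtain ⟨_, s, hs, rfl⟩ := t
  exact s.2 g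

lemma locRingHom_algebraMap (g : G) (a : A) :
    locRingHom q g (algebraMap A _ a) = algebraMap A _ (g • a) :=
  IsLocalization.map_eq _ a

/-- The localization of `A` at `𝔮`, as an `AG`-module. -/
def locMod : SkewMod A G :=
  ofSemilinear (ModuleCat.of A (Localization (primeComplInv q)))
    { toFun := fun g => (locRingHom q g).toAddMonoidHom
      map_one' := by
        ext x
        obtain ⟨a, t, rfl⟩ := IsLocalization.exists_mk'_eq (primeComplInv q) x
        exact (locRingHom_mk' q 1 a t).trans (by rw [one_smul]; rfl)
      map_mul' := fun g h => by
        ext x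
        obtain ⟨a, t, rfl⟩ := IsLocalization.exists_mk'_eq (primeComplInv q) x
        refine (locRingHom_mk' q (g * h) a t).trans (Eq.symm ?_)
        refine (congrArg (locRingHom q g) (locRingHom_mk' q h a t)).trans ?_
        rw [locRingHom_mk', mul_smul] }
    (fun g a x => by
      change locRingHom q g (a • (x : Localization (primeComplInv q))) =
        (g • a) • locRingHom q g (x : Localization (primeComplInv q))
      rw [Algebra.smul_def, Algebra.smul_def, map_mul]
      exact congrArg (· * _) (IsLocalization.map_eq _ a))

/-- The underlying `A`-module of `locMod q`. -/
def locEquiv : (toMod A G).obj (locMod q) ≃ₗ[A] Localization (primeComplInv q) :=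
  ofSemilinearEquiv (ModuleCat.of A (Localization (primeComplInv q))) _ _

lemma act_locMod (g : G) (x : (toMod A G).obj (locMod q)) :
    locEquiv q (act (locMod q) g x) = locRingHom q g (locEquiv q x) :=
  act_ofSemilinear _ _ _ g x

lemma isLocalMod_locMod : IsLocalMod q (locMod q) := isLocalMod_of_bijective fun s hs => by
  have h : (fun x => (s : A) • x) = (locEquiv q).symm ∘
      (fun x => algebraMap A (Localization (primeComplInv q)) s • x) ∘ locEquiv q := by
    ext x
    change _ = (locEquiv q).symm (algebraMap A (Localization (primeComplInv q)) s • locEquiv q x)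
    rw [algebraMap_smul, map_smul, LinearEquiv.symm_apply_apply]
  obtain ⟨t, ht⟩ := IsLocalization.map_units (Localization (primeComplInv q))
    (⟨s, s, hs, rfl⟩ : primeComplInv q)
  rw [h]
  refine (locEquiv q).symm.bijective.comp (Function.Bijective.comp ?_ (locEquiv q).bijective)
  rw [← ht]
  exact MulAction.bijective t

/-- The unit `A ⟶ A_𝔮`. -/
def unitLoc : unitMod A G ⟶ locMod q :=
  homOfEquivariant ((locEquiv q).symm.toLinearMap ∘ₗ
    Algebra.linearMap A (Localization (primeComplInv q)) ∘ₗ (unitEquiv (A := A) (G := G)).toLinearMap)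
    (fun g x => by
      apply (locEquiv q).injective
      rw [act_locMod]
      change algebraMap A _ (unitEquiv (act (unitMod A G) g x)) =
        locRingHom q g (algebraMap A _ (unitEquiv x))
      rw [act_unit]
      exact (locRingHom_algebraMap q g _).symm)

/-- The natural transformation `M ⟶ M ⊗ A_𝔮`. -/
def locNat : 𝟭 (SkewMod A G) ⟶ (tensorBifunctor A G).flip.obj (locMod q) where
  app M := (ρ_ M).inv ≫ M ◁ unitLoc q
  naturality M N φ := by
    have h : φ ≫ (ρ_ N).inv ≫ N ◁ unitLoc q = ((ρ_ M).inv ≫ M ◁ unitLoc q) ≫ φ ▷ locMod q := by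
      rw [rightUnitor_inv_naturality_assoc, Category.assoc]
      exact congrArg _ (whisker_exchange φ (unitLoc q)).symm
    exact h

lemma isLocalizedModule_locNat (M : SkewMod A G) :
    IsLocalizedModule (primeComplInv q) ((toMod A G).map ((locNat q).app M)).hom := by
  let R := Localization (primeComplInv q)
  let E : R ⊗[A] (toMod A G).obj M ≃ₗ[A] (toMod A G).obj (tensorMod M (locMod q)) :=
    TensorProduct.comm A _ _ ≪≫ₗ TensorProduct.congr (LinearEquiv.refl A _) (locEquiv q).symm ≪≫ₗ
      (tensorEquiv _ _).symm
  have := (isLocalizedModule_iff_isBaseChange (primeComplInv q) R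
    (TensorProduct.mk A R ((toMod A G).obj M) 1)).2 (TensorProduct.isBaseChange A _ R)
  have h := IsLocalizedModule.of_linearEquiv (primeComplInv q)
    (TensorProduct.mk A R ((toMod A G).obj M) 1) E
  have e : E.toLinearMap ∘ₗ TensorProduct.mk A R ((toMod A G).obj M) 1 =
      ((toMod A G).map ((locNat q).app M)).hom := by
    ext m
    have h1 : (1 : R) = algebraMap A R 1 := (map_one _).symm
    change tens m ((locEquiv q).symm (1 : R)) = tens m ((locEquiv q).symm (algebraMap A R 1))
    rw [h1]
  exact e ▸ h

end

/-! ### Lifting homotopies from a localization -/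

section

open HomologicalComplex MonoidalCategory

variable {A : Type u} {G : Type v} [CommRing A] [Group G] [MulSemiringAction G A]
  {q : PrimeSpectrum (Inv A G)}

lemma exists_common_notMem (q : PrimeSpectrum (Inv A G)) {ι : Type*} (p : ι → Inv A G → Prop)
    (hmul : ∀ i s t, p i s → p i (s * t)) (F : Finset ι)
    (h : ∀ i ∈ F, ∃ s ∉ q.asIdeal, p i s) : ∃ s ∉ q.asIdeal, ∀ i ∈ F, p i s := by
  classical
  induction F using Finset.induction_on with
  | empty => exact ⟨1, q.asIdeal.one_notMem, fun i hi => absurd hi (Finset.notMem_empty i)⟩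
  | insert j F hj ih =>
    obtain ⟨s, hs, hs'⟩ := h j (Finset.mem_insert_self j F)
    obtain ⟨t, ht, ht'⟩ := ih fun i hi => h i (Finset.mem_insert_of_mem hi)
    refine ⟨s * t, q.asIdeal.primeCompl.mul_mem hs ht, fun i hi => ?_⟩
    obtain rfl | hi := Finset.mem_insert.1 hi
    · exact hmul _ _ _ hs'
    · rw [mul_comm]
      exact hmul _ _ _ (ht' i hi)

lemma exists_forall_mem {R M : Type*} [Ring R] [AddCommGroup M] [Module R M] [Module.Finite R M]
    (N : Inv A G → Submodule R M) (hN : ∀ s t, N s ≤ N (s * t))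
    (h : ∀ x, ∃ s ∉ q.asIdeal, x ∈ N s) : ∃ s ∉ q.asIdeal, ∀ x, x ∈ N s := by
  obtain ⟨F, hF⟩ := Module.Finite.fg_top (R := R) (M := M)
  obtain ⟨s, hs, hs'⟩ := exists_common_notMem q (fun x s => x ∈ N s) (fun x s t hx => hN s t hx) F
    (fun x _ => h x)
  refine ⟨s, hs, fun x => ?_⟩
  have : Submodule.span R (F : Set M) ≤ N s := Submodule.span_le.2 hs'
  exact this (hF ▸ trivial)

lemma mulMod_mul (s t : Inv A G) (M : SkewMod A G) :
    mulMod (s * t) M = mulMod s M ≫ mulMod t M := by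
  apply (toMod A G).map_injective
  ext x
  change ((s : A) * t) • x = (t : A) • (s : A) • x
  rw [mul_comm, mul_smul]

section

variable {P X X' : SkewMod A G} [Module.Finite A ((toMod A G).obj P)] (c : X ⟶ X')
  (hc : IsLocalizedModule (primeComplInv q) ((toMod A G).map c).hom)

include hc

lemma exists_mulMod_comp_eq_zero (g : P ⟶ X) (hg : g ≫ c = 0) :
    ∃ s ∉ q.asIdeal, mulMod s P ≫ g = 0 := by
  obtain ⟨s, hs, h⟩ := exists_forall_mem (q := q)
    (fun s => LinearMap.ker ((toMod A G).map (mulMod s P ≫ g)).hom) (fun s t x hx => by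
      rw [LinearMap.mem_ker] at hx ⊢
      rw [mul_comm, mulMod_mul, Category.assoc, Functor.map_comp]
      change ((toMod A G).map (mulMod s P ≫ g)).hom ((t : A) • x) = 0
      rw [map_smul, hx, smul_zero]) (fun x => by
      have hx : ((toMod A G).map c).hom (((toMod A G).map g).hom x) = ((toMod A G).map c).hom 0 := by
        rw [map_zero]
        exact ConcreteCategory.congr_hom hg x
      obtain ⟨⟨_, s, hs, rfl⟩, h⟩ := IsLocalizedModule.exists_of_eq (S := primeComplInv q) hx
      refine ⟨s, hs, ?_⟩
      rw [LinearMap.mem_ker]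
      rw [smul_zero] at h
      exact (((toMod A G).map g).hom.map_smul (s : A) x).trans h)
  refine ⟨s, hs, ?_⟩
  apply (toMod A G).map_injective
  ext x
  exact (h x).trans rfl

/-- A common denominator for finitely many generators moves `g` into the image of `c`; projectivity
over `AG` then lifts it. -/
lemma exists_lift_of_isLocalizedModule [Module.Projective (SkewGroupRing A G) P] (g : P ⟶ X') :
    ∃ s ∉ q.asIdeal, ∃ g', g' ≫ c = mulMod s P ≫ g := by
  obtain ⟨s, hs, h⟩ := exists_forall_mem (q := q)
    (fun s => (LinearMap.range ((toMod A G).map c).hom).comap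
      ((toMod A G).map (mulMod s P ≫ g)).hom) (fun s t x hx => by
      rw [Submodule.mem_comap] at hx ⊢
      rw [mul_comm, mulMod_mul, Category.assoc, Functor.map_comp]
      change ((toMod A G).map (mulMod s P ≫ g)).hom ((t : A) • x) ∈ _
      rw [map_smul]
      exact Submodule.smul_mem _ _ hx) (fun x => by
      obtain ⟨⟨y, ⟨_, s, hs, rfl⟩⟩, h⟩ :=
        IsLocalizedModule.surj (primeComplInv q) ((toMod A G).map c).hom (((toMod A G).map g).hom x)
      refine ⟨s, hs, y, ?_⟩
      rw [← h]
      exact (((toMod A G).map g).hom.map_smul (s : A) x).symm)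
  refine ⟨s, hs, ?_⟩
  obtain ⟨k, hk⟩ := Module.projective_lifting_property c.hom.rangeRestrict
    ((mulMod s P ≫ g).hom.codRestrict (LinearMap.range c.hom) h) c.hom.surjective_rangeRestrict
  refine ⟨ModuleCat.ofHom k, ?_⟩
  ext x
  exact congrArg Subtype.val (LinearMap.congr_fun hk x)

end

lemma mulCplx_f (s : Inv A G) (K : CochainComplex (SkewMod A G) ℤ) (i : ℤ) :
    (mulCplx s K).f i = mulMod s (K.X i) := rfl

open CochainComplex.HomComplex in
/-- A morphism which becomes null-homotopic after localization is null-homotopic up to invariant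
elements outside `𝔮`. -/
lemma exists_homotopy_of_isLocalizedModule {P X X' : CochainComplex (SkewMod A G) ℤ}
    (hfg : ∀ i, Module.Finite A ((toMod A G).obj (P.X i)))
    (hP : ∀ i, Module.Projective (SkewGroupRing A G) (P.X i)) (c : X ⟶ X')
    (hc : ∀ i, IsLocalizedModule (primeComplInv q) ((toMod A G).map (c.f i)).hom)
    (a b : ℤ) (hX : ∀ i, i ∉ Finset.Icc a b → IsZero (X.X i))
    (hX' : ∀ i, i ∉ Finset.Icc a b → IsZero (X'.X i)) (g : P ⟶ X) (h : Homotopy (g ≫ c) 0) :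
    ∃ s ∉ q.asIdeal, ∃ t ∉ q.asIdeal, Nonempty (Homotopy (g ≫ mulCplx s X ≫ mulCplx t X) 0) := by
  obtain ⟨z, hz⟩ := Cochain.equivHomotopy _ _ h
  rw [Cochain.ofHom_zero, add_zero] at hz
  -- Clearing denominators in the components of `z`. The complex `P` may be unbounded below, but
  -- only targets in degrees `[a, b]` matter, so one `s` serves for all.
  obtain ⟨s, hs, hs'⟩ := exists_common_notMem q (fun (j : ℤ) s => ∀ i (hi : i + (-1) = j),
    ∃ k : P.X i ⟶ X.X j, k ≫ c.f j = mulMod s _ ≫ z.v i j hi) (fun j s t hj i hi => by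
      obtain ⟨k, hk⟩ := hj i hi
      refine ⟨mulMod t _ ≫ k, ?_⟩
      rw [mul_comm, mulMod_mul, Category.assoc, Category.assoc, hk]) (Finset.Icc a b)
    (fun j _ => by
      obtain ⟨s, hs, k, hk⟩ := exists_lift_of_isLocalizedModule (c.f j) (hc j)
        (z.v (j + 1) j (by omega))
      refine ⟨s, hs, fun i hi => ?_⟩
      obtain rfl : i = j + 1 := by omega
      exact ⟨k, hk⟩)
  replace hs' : ∀ i j (hi : i + (-1) = j),
      ∃ k : P.X i ⟶ X.X j, k ≫ c.f j = mulMod s _ ≫ z.v i j hi := fun i j hi => by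
    by_cases hj : j ∈ Finset.Icc a b
    · exact hs' j hj i hi
    · exact ⟨0, (hX' j hj).eq_of_tgt _ _⟩
  choose k hk using hs'
  let y : Cochain P X (-1) := Cochain.mk fun i j hi => k i j hi
  have hy (i j : ℤ) (hi : i + (-1) = j) : y.v i j hi ≫ c.f j = mulMod s _ ≫ z.v i j hi := hk i j hi
  -- The failure of the lifted cochain `y` to be a homotopy from `s g` to zero. It vanishes after
  -- localization, so some `t ∉ 𝔮` kills it, and `t y` is a homotopy for `s t g`.
  let D (i : ℤ) : P.X i ⟶ X.X i := mulMod s _ ≫ g.f i - (δ (-1) 0 y).v i i (add_zero i)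
  have hD (i : ℤ) : D i ≫ c.f i = 0 := by
    have h₁ := Cochain.congr_v hz i i (add_zero i)
    rw [Cochain.ofHom_v, comp_f, δ_v (-1) 0 (by omega) z i i _ (i - 1) (i + 1) rfl rfl] at h₁
    rw [Preadditive.sub_comp, Category.assoc, h₁,
      δ_v (-1) 0 (by omega) y i i _ (i - 1) (i + 1) rfl rfl]
    simp only [Int.negOnePow_zero, one_smul, Preadditive.add_comp, Category.assoc,
      Preadditive.comp_add]
    rw [hy, ← c.comm, ← Category.assoc (y.v _ _ _), hy, ← reassoc_of% (mulMod_naturality s (P.d i (i + 1)))]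
    simp
  obtain ⟨t, ht, ht'⟩ := exists_common_notMem q (fun (i : ℤ) t => mulMod t (P.X i) ≫ D i = 0)
    (fun i s t hi => by rw [mul_comm, mulMod_mul, Category.assoc, hi, comp_zero]) (Finset.Icc a b)
    (fun i _ => exists_mulMod_comp_eq_zero (c.f i) (hc i) (D i) (hD i))
  replace ht' (i : ℤ) : mulMod t (P.X i) ≫ D i = 0 := by
    by_cases hi : i ∈ Finset.Icc a b
    · exact ht' i hi
    · exact (hX i hi).eq_of_tgt _ _
  refine ⟨s, hs, t, ht, ⟨(Cochain.equivHomotopy _ _).symm ⟨y.comp (Cochain.ofHom (mulCplx t X))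
    (add_zero (-1)), ?_⟩⟩⟩
  rw [Cochain.ofHom_zero, add_zero, δ_comp_ofHom]
  ext i : 1
  have h₂ := ht' i
  rw [mulMod_naturality, Preadditive.sub_comp, sub_eq_zero] at h₂
  rw [Cochain.ofHom_v, comp_f, comp_f, Cochain.comp_zero_cochain_v, Cochain.ofHom_v, mulCplx_f,
    mulCplx_f, ← h₂, mulMod_naturality s (g.f i), Category.assoc]

end

/-! ### Detecting membership in a prime ideal on the reduced fiber -/

section

open HomologicalComplex MonoidalCategory DerivedCategory ZeroObject

attribute [local instance] HasDerivedCategory.standard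

variable {A : Type u} {G : Type v} [CommRing A] [Group G] [MulSemiringAction G A]
  {q : PrimeSpectrum (Inv A G)}

local infixr:70 " ⊠ " => MonoidalCategoryStruct.tensorObj

variable (q) in
/-- The localization morphism `X ⟶ X ⊗ A_𝔮` of complexes. -/
def locCplx (X : CochainComplex (SkewMod A G) ℤ) :
    X ⟶ (((tensorBifunctor A G).flip.obj (locMod q)).mapHomologicalComplex (ComplexShape.up ℤ)).obj X where
  f i := (locNat q).app (X.X i)
  comm' i j _ := ((locNat q).naturality (X.d i j)).symm

lemma locCplx_naturality {X Y : CochainComplex (SkewMod A G) ℤ} (φ : X ⟶ Y) :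
    φ ≫ locCplx q Y = locCplx q X ≫ (((tensorBifunctor A G).flip.obj
      (locMod q)).mapHomologicalComplex (ComplexShape.up ℤ)).map φ := by
  ext i : 1
  exact (locNat q).naturality (φ.f i)

/-- In a triangle on a zero morphism `X ⟶ Y`, the identity of `Y` factors through the cone, so `Y`
is a retract of it. -/
lemma prop_of_trW_zero {C : Type*} [Category C] [Preadditive C] [HasZeroObject C] [HasShift C ℤ]
    [∀ n : ℤ, (shiftFunctor C n).Additive] [Pretriangulated C] (P : ObjectProperty C)
    [P.IsStableUnderRetracts] {X Y : C} (h : P.trW (0 : X ⟶ Y)) : P Y := by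
  obtain ⟨Z, g, t, ht, hZ⟩ := h
  obtain ⟨r, hr⟩ := Pretriangulated.Triangle.yoneda_exact₂ _ ht (𝟙 Y) zero_comp
  exact P.prop_of_retract ⟨g, r, hr.symm⟩ hZ

variable {P : Spc A G}

lemma Spc.carrier_coneInv (hq : rhoBar P = (q.asIdeal : Set (Inv A G))) {s : Inv A G}
    (hs : s ∉ q.asIdeal) : P.carrier (Q.obj (unitCone s)) := by
  by_contra h
  have : s ∈ rhoBar P := h
  rw [hq] at this
  exact hs this

variable [IsNoetherianRing A] [Finite G]

lemma Spc.trW_mulCplx (hq : rhoBar P = (q.asIdeal : Set (Inv A G))) {s : Inv A G}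
    (hs : s ∉ q.asIdeal) {X : CochainComplex (SkewMod A G) ℤ} (hX : IsStrictPerf X) :
    P.carrier.trW (Q.map (mulCplx s X)) :=
  (trW_mulCplx_iff _ s X).2
    (P.tensor_mem (isStrictPerf_unitCone s) hX (P.carrier_coneInv hq hs))

/-- The vanishing of `W ⊗ X ⟶ X` over `A_𝔮` descends to `A` up to factors `s, t ∉ 𝔮`. All maps in
the resulting zero composite have cones in `𝒫`, so `prop_of_trW_zero` applies. -/
lemma Spc.carrier_of_annihilated_locMod (hq : rhoBar P = (q.asIdeal : Set (Inv A G)))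
    {X : CochainComplex (SkewMod A G) ℤ} (hX : IsStrictPerf X)
    (h : annihilated P.augClass (Q.obj ((singleCplx A G).obj (locMod q) ⊠ X))) :
    P.carrier (Q.obj X) := by
  obtain ⟨w, hw, h⟩ := (annihilated P.augClass).prop_of_iso (Q.mapIso (cplxComm _ _)) h
  let T := ((tensorBifunctor A G).flip.obj (locMod q)).mapHomologicalComplex (ComplexShape.up ℤ)
  have h₁ : Q.map (T.map (w.aug X)) = 0 := by
    rw [Aug.τ_app_Q_eq_zero_iff, Aug.aug_tensor, Functor.map_comp,
      Preadditive.IsIso.comp_left_eq_zero, ← Preadditive.IsIso.comp_left_eq_zero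
      (Q.map (tensorSingleIso _ (locMod q)).hom), ← Functor.map_comp, tensorSingleIso_naturality,
      Functor.map_comp, Preadditive.IsIso.comp_right_eq_zero] at h
    exact h
  -- A resolution by finitely generated projective modules turns the vanishing into a null homotopy,
  -- and its finite generation allows denominators to be cleared.
  obtain ⟨K, hK, ⟨e⟩⟩ := exists_fgProj (w.isStrictPerf.tensor hX).perf
  have := hK.proj.isKProjective
  obtain ⟨σ, hσ⟩ := exists_quasiIso_of_iso e
  have h₂ : Q.map ((σ ≫ w.aug X) ≫ locCplx q X) = Q.map 0 := by
    rw [locCplx_naturality, Functor.map_comp, Functor.map_comp, Functor.map_comp, h₁, comp_zero,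
      comp_zero, Functor.map_zero]
  obtain ⟨η⟩ := homotopy_of_Q_map_eq h₂
  obtain ⟨a, ha⟩ := hX.ge
  obtain ⟨b, hb⟩ := hX.le
  have hX₀ (i : ℤ) (hi : i ∉ Finset.Icc a b) : IsZero (X.X i) := by
    rw [Finset.mem_Icc, not_and_or] at hi
    obtain hi | hi := hi
    · exact X.isZero_of_isStrictlyGE a i (by omega)
    · exact X.isZero_of_isStrictlyLE b i (by omega)
  obtain ⟨s, hs, t, ht, ⟨θ⟩⟩ := exists_homotopy_of_isLocalizedModule hK.fg hK.proj.2 (locCplx q X)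
    (fun i => isLocalizedModule_locNat q (X.X i)) a b hX₀
    (fun i hi => ((tensorBifunctor A G).flip.obj (locMod q)).map_isZero (hX₀ i hi)) _ η
  have h₃ := DerivedCategory.Q_map_eq_of_homotopy _ θ
  rw [Functor.map_zero, Functor.map_comp, Functor.map_comp, Functor.map_comp] at h₃
  have := P.isTriangulated
  have := P.thick
  have := (isIso_Q_map_iff_quasiIso _ σ).2 hσ
  refine prop_of_trW_zero P.carrier (X := Q.obj K) (h₃ ▸ ?_)
  exact P.carrier.trW.comp_mem _ _ (P.carrier.trW.comp_mem _ _ (P.carrier.trW_of_isIso _)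
    (hw.trW_aug hX)) (P.carrier.trW.comp_mem _ _ (Spc.trW_mulCplx hq hs hX)
    (Spc.trW_mulCplx hq ht hX))

/-- `L'` is the tensor product of `L` with the cones of the elements of `T`. Each cone removes one
annihilation condition on `M`, and lies outside `𝒫` since `t ∈ 𝔮`, so primality leads back from `L'`
to `L`. -/
lemma Spc.exists_koszul (hq : rhoBar P = (q.asIdeal : Set (Inv A G))) (T : Finset (Inv A G))
    (hT : ∀ t ∈ T, t ∈ q.asIdeal) {L : CochainComplex (SkewMod A G) ℤ} (hL : IsStrictPerf L)
    (h : ∀ M : SkewMod A G, IsLocalMod q M → (∀ t ∈ T, mulMod t M = 0) →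
      annihilated P.augClass (Q.obj ((singleCplx A G).obj M ⊠ L))) :
    ∃ L', IsStrictPerf L' ∧ (P.carrier (Q.obj L') → P.carrier (Q.obj L)) ∧
      ∀ M : SkewMod A G, IsLocalMod q M →
        annihilated P.augClass (Q.obj ((singleCplx A G).obj M ⊠ L')) := by
  classical
  induction T using Finset.induction_on generalizing L with
  | empty => exact ⟨L, hL, id, fun M hM => h M hM fun t ht => absurd ht (Finset.notMem_empty t)⟩
  | insert a T ha ih =>
    obtain ⟨L', hL', hL'L, h'⟩ := ih (fun t ht => hT t (Finset.mem_insert_of_mem ht))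
      ((isStrictPerf_unitCone a).tensor hL) (fun M hM hM' =>
        P.isMultiplicative_augClass.annihilated_unitCone hL a T (fun N hN hNa hNT =>
          h N hN fun t ht => by
            obtain rfl | ht := Finset.mem_insert.1 ht
            · exact hNa
            · exact hNT t ht) M hM hM')
    refine ⟨L', hL', fun hP => ?_, h'⟩
    refine (P.mem_or_mem (isStrictPerf_unitCone a) hL (hL'L hP)).resolve_left ?_
    have : a ∈ rhoBar P := by
      rw [hq]
      exact hT a (Finset.mem_insert_self a T)
    exact this

/-- An object lies in the prime ideal `𝒫` over `𝔮` if its base change to the reduced fiber is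
annihilated. -/
lemma Spc.carrier_of_annihilated (hq : rhoBar P = (q.asIdeal : Set (Inv A G)))
    {L : CochainComplex (SkewMod A G) ℤ} (hL : IsStrictPerf L)
    (h : annihilated (baseChangeAug (psi q) P.augClass)
      (Q.obj ((baseChangeFunctor (psi q)).obj L))) : P.carrier (Q.obj L) := by
  classical
  have hfg : (q.asIdeal.map (algebraMap (Inv A G) A)).FG := IsNoetherian.noetherian _
  -- The generators of `𝔮A` are chosen among the images of elements of `𝔮`. The ring `A^G` itself is
  -- not assumed noetherian.
  obtain ⟨T', hT', hT⟩ := (Submodule.fg_span_iff_fg_span_finset_subset _).1 hfg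
  obtain ⟨T, hTq, rfl⟩ := Finset.subset_set_image_iff.1 hT'
  obtain ⟨L', hL', hL'L, h'⟩ := Spc.exists_koszul hq T (fun t ht => hTq ht) hL (fun M hM hM' =>
    P.isMultiplicative_augClass.annihilated_of_local hL h M hM fun r hr x => by
      have hle : q.asIdeal.map (algebraMap (Inv A G) A) ≤
          Module.annihilator A ((toMod A G).obj M) := by
        refine hT.le.trans (Submodule.span_le.2 fun y hy => ?_)
        obtain ⟨t, ht, rfl⟩ := Finset.mem_image.1 hy
        exact Module.mem_annihilator.2 fun z =>
          ConcreteCategory.congr_hom ((toMod A G).congr_map (hM' t ht)) z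
      exact Module.mem_annihilator.1 (hle (Ideal.mem_map_of_mem _ hr)) x)
  exact hL'L (Spc.carrier_of_annihilated_locMod hq hL' (h' _ (isLocalMod_locMod q)))

end

/-! ### Existence of prime ideals with given inverse image -/

section

open HomologicalComplex MonoidalCategory DerivedCategory ZeroObject

attribute [local instance] HasDerivedCategory.standard

variable {A : Type u} {G : Type v} [CommRing A] [Group G] [MulSemiringAction G A]

local infixr:70 " ⊠ " => MonoidalCategoryStruct.tensorObj

/-- Thick tensor ideals of `D^b(AG)_{A-perf}`. -/
structure IsThickIdeal (𝓘 : ObjectProperty (DAG A G)) : Prop where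
  le_perf : 𝓘 ≤ perf A G
  isTriangulated : 𝓘.IsTriangulated
  thick : 𝓘.IsStableUnderRetracts
  tensor : ∀ {K L : CochainComplex (SkewMod A G) ℤ}, IsStrictPerf K → IsStrictPerf L →
    𝓘 (Q.obj K) → 𝓘 (Q.obj (K ⊠ L))

lemma IsThickIdeal.sUnion {c : Set (ObjectProperty (DAG A G))} (hc : ∀ 𝓘 ∈ c, IsThickIdeal 𝓘)
    (hc' : IsChain (· ≤ ·) c) (hne : c.Nonempty) : IsThickIdeal fun X => ∃ 𝓘 ∈ c, 𝓘 X := by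
  have thick : ObjectProperty.IsStableUnderRetracts (C := DAG A G) fun X => ∃ 𝓘 ∈ c, 𝓘 X :=
    ⟨fun r ⟨𝓘, h𝓘, hX⟩ =>
      have := (hc 𝓘 h𝓘).thick
      ⟨𝓘, h𝓘, 𝓘.prop_of_retract r hX⟩⟩
  refine ⟨fun X ⟨𝓘, h𝓘, hX⟩ => (hc 𝓘 h𝓘).le_perf X hX, ?_, thick,
    fun hK hL ⟨𝓘, h𝓘, h⟩ => ⟨𝓘, h𝓘, (hc 𝓘 h𝓘).tensor hK hL h⟩⟩
  · have := thick
    refine isTriangulated_of _ (fun X hX => ?_) (fun X n ⟨𝓘, h𝓘, hX⟩ => ?_)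
      fun T hT ⟨𝓘₁, h𝓘₁, h₁⟩ ⟨𝓘₃, h𝓘₃, h₃⟩ => ?_
    · obtain ⟨𝓘, h𝓘⟩ := hne
      have := (hc 𝓘 h𝓘).isTriangulated
      have := (hc 𝓘 h𝓘).thick
      obtain ⟨Z, hZ, h⟩ := 𝓘.exists_prop_of_containsZero
      exact ⟨𝓘, h𝓘, 𝓘.prop_of_iso (hZ.iso hX) h⟩
    · have := (hc 𝓘 h𝓘).isTriangulated
      exact ⟨𝓘, h𝓘, 𝓘.le_shift n _ hX⟩
    · obtain ⟨𝓘, h𝓘, h₁, h₃⟩ : ∃ 𝓘 ∈ c, 𝓘 T.obj₁ ∧ 𝓘 T.obj₃ := by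
        obtain h | h := hc'.total h𝓘₁ h𝓘₃
        · exact ⟨𝓘₃, h𝓘₃, h _ h₁, h₃⟩
        · exact ⟨𝓘₁, h𝓘₁, h₁, h _ h₃⟩
      have := (hc 𝓘 h𝓘).isTriangulated
      have := (hc 𝓘 h𝓘).thick
      exact ⟨𝓘, h𝓘, 𝓘.ext_of_isTriangulatedClosed₂ T hT h₁ h₃⟩

variable [IsNoetherianRing A] [Finite G]

lemma isThickIdeal_annihilated {𝓢 : Aug A G → Prop} (h𝓢 : IsMultiplicative 𝓢) :
    IsThickIdeal (perf A G ⊓ annihilated 𝓢) where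
  le_perf := inf_le_left
  isTriangulated :=
    have := h𝓢.isTriangulated
    isTriangulated_of _ (fun _ hX => ⟨perf_of_isZero hX, h𝓢.annihilated_of_isZero hX⟩)
      (fun _ n hX => ⟨perf_shift n hX.1, annihilated_shift n hX.2⟩)
      fun T hT h₁ h₃ => ⟨perf_ext T hT h₁.1 h₃.1, h𝓢.ext_annihilated T hT h₁.2 h₃.2⟩
  thick := ⟨fun r h => ⟨(perf A G).prop_of_retract r h.1, (annihilated 𝓢).prop_of_retract r h.2⟩⟩
  tensor hK hL h := ⟨(hK.tensor hL).perf, annihilated_tensor hL h.2⟩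

namespace IsThickIdeal

variable {𝓘 : ObjectProperty (DAG A G)} (h𝓘 : IsThickIdeal 𝓘) {L : CochainComplex (SkewMod A G) ℤ}

include h𝓘 in
lemma colon_iff {K : CochainComplex (SkewMod A G) ℤ} (hK : IsStrictPerf K) :
    derivedInverseImage (MonoidalCategory.tensorRight L) 𝓘 (Q.obj K) ↔ 𝓘 (Q.obj (K ⊠ L)) :=
  have := h𝓘.thick
  (isDerivable_tensorRight L).inverseImage_iff 𝓘 hK.perf hK.isRelProj (Iso.refl _)

-- The colon ideal is a derived inverse image under `- ⊗ L`, so it inherits thickness and triangles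
-- from `IsDerivable`.
include h𝓘 in
lemma colon (hL : IsStrictPerf L) :
    IsThickIdeal (derivedInverseImage (MonoidalCategory.tensorRight L) 𝓘) where
  le_perf := fun _ h => h.1
  isTriangulated :=
    have := h𝓘.thick
    have := h𝓘.isTriangulated
    (isDerivable_tensorRight L).isTriangulated 𝓘
  thick :=
    have := h𝓘.thick
    (isDerivable_tensorRight L).isStableUnderRetracts 𝓘
  tensor {K K'} hK hK' h := by
    have := h𝓘.thick
    rw [h𝓘.colon_iff hK] at h
    rw [h𝓘.colon_iff (hK.tensor hK')]
    exact 𝓘.prop_of_iso (Q.mapIso (α_ K L K' ≪≫ whiskerLeftIso K (cplxComm L K') ≪≫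
      (α_ K K' L).symm)) (h𝓘.tensor (hK.tensor hL) hK' h)

include h𝓘 in
lemma le_colon (hL : IsStrictPerf L) :
    𝓘 ≤ derivedInverseImage (MonoidalCategory.tensorRight L) 𝓘 := fun X hX => by
  have := h𝓘.thick
  obtain ⟨K, hK, ⟨e⟩⟩ := exists_isStrictPerf (h𝓘.le_perf X hX)
  exact ((isDerivable_tensorRight L).inverseImage_iff 𝓘 (h𝓘.le_perf X hX) hK.isRelProj e).2
    (h𝓘.tensor hK hL (𝓘.prop_of_iso e.symm hX))

/-- The prime ideal with given objects. -/
def toSpc (h𝓘 : IsThickIdeal 𝓘) (hu : ¬ 𝓘 (Q.obj (𝟙_ (CochainComplex (SkewMod A G) ℤ))))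
    (hprime : ∀ K L : CochainComplex (SkewMod A G) ℤ, IsStrictPerf K → IsStrictPerf L →
      𝓘 (Q.obj (K ⊠ L)) → 𝓘 (Q.obj K) ∨ 𝓘 (Q.obj L)) : Spc A G where
  carrier := 𝓘
  le_perf := h𝓘.le_perf
  isTriangulated := h𝓘.isTriangulated
  thick := h𝓘.thick
  ideal X Y Z hX hY hZ := by
    have := h𝓘.thick
    obtain ⟨K, hK, ⟨e⟩⟩ := exists_isStrictPerf (h𝓘.le_perf X hX)
    obtain ⟨L, hL, ⟨e'⟩⟩ := exists_isStrictPerf hY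
    obtain ⟨i⟩ := (isTensor_iff hK hL e e').1 hZ
    exact 𝓘.prop_of_iso i (h𝓘.tensor hK hL (𝓘.prop_of_iso e.symm hX))
  proper := ⟨_, (isStrictPerf_unit A G).perf, hu⟩
  prime X Y Z hX hY hZ h := by
    have := h𝓘.thick
    obtain ⟨K, hK, ⟨e⟩⟩ := exists_isStrictPerf hX
    obtain ⟨L, hL, ⟨e'⟩⟩ := exists_isStrictPerf hY
    obtain ⟨i⟩ := (isTensor_iff hK hL e e').1 hZ
    exact (hprime K L hK hL (𝓘.prop_of_iso i.symm h)).imp (𝓘.prop_of_iso e) (𝓘.prop_of_iso e')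

end IsThickIdeal

lemma Spc.ext {P P' : Spc A G} (h : ∀ L : CochainComplex (SkewMod A G) ℤ, IsStrictPerf L →
    (P.carrier (Q.obj L) ↔ P'.carrier (Q.obj L))) : P = P' := by
  have : P.carrier = P'.carrier := by
    ext X
    by_cases hX : perf A G X
    · obtain ⟨L, hL, ⟨e⟩⟩ := exists_isStrictPerf hX
      exact ⟨fun hP => P'.carrier.prop_of_iso e ((h L hL).1 (P.carrier.prop_of_iso e.symm hP)),
        fun hP => P.carrier.prop_of_iso e ((h L hL).2 (P'.carrier.prop_of_iso e.symm hP))⟩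
    · exact iff_of_false (fun hP => hX (P.le_perf X hP)) fun hP => hX (P'.le_perf X hP)
  cases P
  cases P'
  obtain rfl := this
  rfl

variable {B : Type u} [CommRing B] [MulSemiringAction G B] [IsNoetherianRing B] (f : A →+*[G] B)

lemma Spc.comap_carrier_iff (P : Spc B G) {L : CochainComplex (SkewMod A G) ℤ}
    (hL : IsStrictPerf L) :
    (P.comap f).carrier (Q.obj L) ↔ P.carrier (Q.obj ((baseChangeFunctor f).obj L)) :=
  (isDerivable_baseChange f).inverseImage_iff P.carrier hL.perf hL.isRelProj (Iso.refl _)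

/-- A prime ideal is an inverse image under base change if there is a thick tensor ideal with this
inverse image. -/
lemma Spc.exists_comap_eq (P : Spc A G) {𝓝 : ObjectProperty (DAG B G)} (h𝓝 : IsThickIdeal 𝓝)
    (h : ∀ L : CochainComplex (SkewMod A G) ℤ, IsStrictPerf L →
      (𝓝 (Q.obj ((baseChangeFunctor f).obj L)) ↔ P.carrier (Q.obj L))) :
    ∃ P' : Spc B G, P'.comap f = P := by
  -- Thick ideals whose inverse image lies in `𝒫`, ordered by inclusion; a maximal one above `𝓝`
  -- will be prime.
  let Z : Set (ObjectProperty (DAG B G)) := {𝓘 | IsThickIdeal 𝓘 ∧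
    ∀ L : CochainComplex (SkewMod A G) ℤ, IsStrictPerf L →
      𝓘 (Q.obj ((baseChangeFunctor f).obj L)) → P.carrier (Q.obj L)}
  obtain ⟨𝓘, h𝓝𝓘, h𝓘⟩ := zorn_le_nonempty₀ Z (fun c hcZ hc 𝓘 h𝓘 =>
    ⟨fun X => ∃ 𝓘 ∈ c, 𝓘 X, ⟨IsThickIdeal.sUnion (fun 𝓘 h𝓘 => (hcZ h𝓘).1) hc ⟨𝓘, h𝓘⟩,
      fun L hL ⟨𝓘, h𝓘, h⟩ => (hcZ h𝓘).2 L hL h⟩, fun 𝓘 h𝓘 X hX => ⟨𝓘, h𝓘, hX⟩⟩) 𝓝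
    ⟨h𝓝, fun L hL => (h L hL).1⟩
  have hT := h𝓘.prop.1
  have := hT.thick
  -- If `K ∉ 𝓘`, the colon ideal `(𝓘 : L)` is strictly larger than `𝓘`, so by maximality it contains
  -- some `f_* M` with `M ∉ 𝒫`.
  have key (L : CochainComplex (SkewMod B G) ℤ) (hL : IsStrictPerf L)
      (K : CochainComplex (SkewMod B G) ℤ) (hK : IsStrictPerf K) (h₁ : 𝓘 (Q.obj (K ⊠ L)))
      (h₂ : ¬ 𝓘 (Q.obj K)) : ∃ M : CochainComplex (SkewMod A G) ℤ, IsStrictPerf M ∧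
        𝓘 (Q.obj ((baseChangeFunctor f).obj M ⊠ L)) ∧ ¬ P.carrier (Q.obj M) := by
    by_contra! hcon
    refine h₂ (h𝓘.le_of_ge ⟨hT.colon hL, fun M hM h => hcon M hM ?_⟩ (hT.le_colon hL) _
      ((hT.colon_iff hK).2 h₁))
    exact (hT.colon_iff (hM.baseChange f)).1 h
  let P' := hT.toSpc (fun hu => P.unit_notMem (h𝓘.prop.2 _ (isStrictPerf_unit A G)
    (𝓘.prop_of_iso (Q.mapIso (baseChangeUnitCplxIso f).symm) hu))) (fun K L hK hL hKL => by
      by_contra! hcon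
      obtain ⟨M, hM, h₁, h₂⟩ := key L hL K hK hKL hcon.1
      -- A second application with `f_* M` in place of `L` puts `f_* (N ⊗ M)` in `𝓘` with `N, M ∉
      -- 𝒫`, against primality of `𝒫`.
      obtain ⟨N, hN, h₃, h₄⟩ := key _ (hM.baseChange f) L hL
        (𝓘.prop_of_iso (Q.mapIso (cplxComm _ _)) h₁) hcon.2
      have := h𝓘.prop.2 _ (hN.tensor hM)
        (𝓘.prop_of_iso (Q.mapIso (baseChangeTensorCplxIso f N M)) h₃)
      exact (P.mem_or_mem hN hM this).elim h₄ h₂)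
  refine ⟨P', Spc.ext fun L hL => ?_⟩
  rw [Spc.comap_carrier_iff f P' hL]
  exact ⟨h𝓘.prop.2 L hL, fun hP => h𝓝𝓘 _ ((h L hL).2 hP)⟩

/-- Every prime ideal over `𝔮` is the inverse image of a prime ideal over the reduced fiber. -/
lemma Spc.exists_comap_psi_eq {q : PrimeSpectrum (Inv A G)} (P : Spc A G)
    (hq : rhoBar P = (q.asIdeal : Set (Inv A G))) :
    ∃ P' : Spc (ReducedFiber q) G, P'.comap (psi q) = P :=
  P.exists_comap_eq (psi q)
    (isThickIdeal_annihilated (P.isMultiplicative_augClass.baseChangeAug (psi q))) fun _ hL =>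
      ⟨fun h => Spc.carrier_of_annihilated hq hL h.2,
        fun h => ⟨(hL.baseChange (psi q)).perf, P.annihilated_baseChange (psi q) hL h⟩⟩

end

/-! ### The base change map of the reduced fiber -/

section

open HomologicalComplex MonoidalCategory DerivedCategory ZeroObject

attribute [local instance] HasDerivedCategory.standard

variable {A : Type u} {G : Type v} [CommRing A] [Group G] [MulSemiringAction G A]
  [IsNoetherianRing A] [Finite G]

local infixr:70 " ⊠ " => MonoidalCategoryStruct.tensorObj

/-- The cone of the zero endomorphism contains the unit as a retract. -/
lemma Spc.zero_mem_rhoBar (P : Spc A G) : 0 ∈ rhoBar P := fun h => by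
  have h₁ : P.carrier.trW (Q.map (mulCplx 0 (𝟙_ (CochainComplex (SkewMod A G) ℤ)))) :=
    (trW_mulCplx_iff _ _ _).2 (P.tensor_mem (isStrictPerf_unitCone 0) (isStrictPerf_unit A G) h)
  have h₂ : mulCplx 0 (𝟙_ (CochainComplex (SkewMod A G) ℤ)) = 0 := by
    ext i : 1
    apply (toMod A G).map_injective
    ext x
    exact zero_smul A x
  rw [h₂, Functor.map_zero] at h₁
  have := P.thick
  exact P.unit_notMem (prop_of_trW_zero P.carrier h₁)

omit [IsNoetherianRing A] [Finite G] in
lemma Spc.notMem_rhoBar_of_isUnit (P : Spc A G) {a : Inv A G} (ha : IsUnit a) : a ∉ rhoBar P := by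
  obtain ⟨b, hb⟩ := ha.exists_right_inv
  have hb' : (a : A) * b = 1 := congrArg Subtype.val hb
  have h (c d : Inv A G) (hcd : (c : A) * d = 1) : mulUnit d ≫ mulUnit c = 𝟙 (unitMod A G) := by
    ext x
    have key (x : A) : (c : A) * (d * x) = x := by rw [← mul_assoc, hcd, one_mul]
    exact key x
  have : IsIso (mulUnit a) := ⟨mulUnit b, h b a (by rw [mul_comm, hb']), h a b hb'⟩
  refine not_not.2 ((trW_Q_map_iff P.carrier ((singleCplx A G).map (mulUnit a))).1 ?_)
  exact P.carrier.trW_of_isIso _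

lemma rhoBar_reducedFiber (q : PrimeSpectrum (Inv A G)) (P : Spc (ReducedFiber q) G) :
    rhoBar P = {0} := by
  ext b
  refine ⟨fun hb => ?_, fun hb => ?_⟩
  · by_contra hb'
    exact P.notMem_rhoBar_of_isUnit (isUnit_of_invariant q hb') hb
  · rw [Set.mem_singleton_iff.1 hb]
    exact P.zero_mem_rhoBar

lemma rhoBar_comap_psi (q : PrimeSpectrum (Inv A G)) (P : Spc (ReducedFiber q) G) :
    rhoBar (P.comap (psi q)) = (q.asIdeal : Set (Inv A G)) := by
  ext r
  rw [Spc.rhoBar_comap, rhoBar_reducedFiber]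
  exact invMap_psi_eq_zero_iff q r

end

end EquivPerf

end

/-- For a finite group `G` acting on a noetherian commutative ring `A` and `𝔮 ∈ Spec(A^G)`, the base
change map of `ψ_𝔮 : A → A(𝔮)` is surjective; in other words, `Spc` of `A(𝔮)` surjects onto the
fiber over `𝔮`. -/
theorem mainTheorem6 {A : Type u} {G : Type v} [CommRing A] [IsNoetherianRing A] [Group G]
    [Finite G] [MulSemiringAction G A] (q : PrimeSpectrum (EquivPerf.Inv A G)) :
    EquivPerf.SpcSurj (EquivPerf.psi q) ∧
      ∃ j : EquivPerf.Spc (EquivPerf.ReducedFiber q) G → EquivPerf.SpcFiber q,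
        Continuous j ∧ (∀ P, EquivPerf.IsPreimage (EquivPerf.psi q) P (j P).1) ∧
        Function.Surjective j := by
  have hcont := EquivPerf.Spc.continuous_comap (G := G) (EquivPerf.psi q)
  have hpre := fun P => EquivPerf.Spc.isPreimage_comap (EquivPerf.psi q) P
  have hrho := EquivPerf.rhoBar_comap_psi q
  -- The invariants of the reduced fiber form a field, so their spectrum is the single point `⊥`,
  -- which lies over `𝔮`. The fiber product is therefore the fiber over `𝔮`.
  have hprime : (⊥ : Ideal (EquivPerf.Inv (EquivPerf.ReducedFiber q) G)).IsPrime :=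
    { ne_top' := (Ideal.ne_top_iff_one _).2 fun h => one_ne_zero (Ideal.mem_bot.1 h)
      mem_or_mem' := fun {x y} h => by
        by_contra! hcon
        have hx := EquivPerf.isUnit_of_invariant q (fun hx => hcon.1 (Ideal.mem_bot.2 hx))
        exact hcon.2 (Ideal.mem_bot.2 ((hx.mul_right_eq_zero).1 (Ideal.mem_bot.1 h))) }
  have hq : ∀ x : PrimeSpectrum (EquivPerf.Inv (EquivPerf.ReducedFiber q) G), x = ⟨⊥, hprime⟩ :=
    fun x => PrimeSpectrum.ext ((eq_bot_iff).2 fun b hb => by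
      by_contra hb'
      exact x.2.ne_top (Ideal.eq_top_of_isUnit_mem _ hb
        (EquivPerf.isUnit_of_invariant q fun h => hb' (Ideal.mem_bot.2 h))))
  have hker : ((PrimeSpectrum.comap (EquivPerf.invMap (EquivPerf.psi q)) ⟨⊥, hprime⟩).asIdeal :
      Set (EquivPerf.Inv A G)) = q.asIdeal := by
    ext r
    exact EquivPerf.invMap_psi_eq_zero_iff q r
  refine ⟨⟨fun P => ⟨(P.comap (EquivPerf.psi q), ⟨⊥, hprime⟩), (hrho P).trans hker.symm⟩,
    (hcont.prodMk continuous_const).subtype_mk _, fun P => ⟨hpre P, ?_⟩, ?_⟩,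
    fun P => ⟨P.comap (EquivPerf.psi q), hrho P⟩, hcont.subtype_mk _, hpre, ?_⟩
  · rw [EquivPerf.rhoBar_reducedFiber]
    rfl
  · rintro ⟨⟨Q, x⟩, hx⟩
    obtain rfl := hq x
    obtain ⟨P, rfl⟩ := Q.exists_comap_psi_eq (hx.trans hker)
    exact ⟨P, rfl⟩
  · rintro ⟨Q, hQ⟩
    obtain ⟨P, rfl⟩ := Q.exists_comap_psi_eq hQ
    exact ⟨P, rfl⟩
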